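/- **Notation.** Let $d\ge 2$. For a Schwartz function $f$ on $\mathbb R^d$ let $\hat f(\xi)=\int e^{-2\pi i\xi\cdot x}f(x)\,dx$, and write $\langle x\rangle=(1+|x|^2)^{1/2}$. Fix smooth $\chi,\varphi:\mathbb R^d\to\mathbb R$ with $\chi(\xi)+\sum_{n\ge0}\varphi(2^{-n}\xi)=1$, $\operatorname{supp}\chi\subseteq\{|\xi|\le 4/3\}$, $\chi=1$ on $\{|\xi|\le 3/4\}$ and $\operatorname{supp}\varphi\subseteq\{3/4\le|\xi|\le 8/3\}$; put $\varphi_{-1}=\chi$, $\varphi_n=\varphi(2^{-n}\cdot)$ for $n\ge0$, and $\Delta_nf=\mathcal F^{-1}(\varphi_n\hat f)$ for $f\in\mathcal S'(\mathbb R^d)$. For $r,a\in\mathbb R$, $p,q\in[1,\infty]$ and $\lambda>0$ let $B^r_{p,q}(\langle x\rangle^{a},\lambda)$ be the space of all $f\in\mathcal S'(\mathbb R^d)$ with $$\|f\|_{B^r_{p,q}(\langle x\rangle^a,\lambda)}=\Big\|\big(2^{nr}\,\|\langle\lambda x\rangle^{a}\,\Delta_nf\|_{L^p(\mathbb R^d)}\big)_{n\ge-1}\Big\|_{\ell^q}<\infty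 ,$$ and let $H^r(\langle x\rangle^a)=B^r_{2,2}(\langle x\rangle^a,1)$. For $k>0$, $\gamma\in\mathbb R^d$ and real $\tau\neq0$ let $r_{k,\gamma}=(k^2+|\gamma|^2)^{1/2}$ and $m_{k,\gamma,\tau}(\xi)=|\xi|^2-k^2-|\gamma|^2+2i\gamma\cdot\xi-i\tau$. For Schwartz functions $f$ let $\mathcal H_{k,\gamma,\tau}f=\mathcal F^{-1}(\hat f/m_{k,\gamma,\tau})$, that is, $\langle\mathcal H_{k,\gamma,\tau}f,g\rangle=\int \hat f\,\overline{\hat g}\,/m_{k,\gamma,\tau}\,d\xi$ for all $g\in\mathcal S(\mathbb R^d)$. For all $\rho\in\mathbb R$, $s\in[0,2]$ and $a>1/2$, and all sufficiently small $|\tau|$, $\mathcal H_{k,\gamma,\tau}$ extends to a bounded operator from $H^{\rho}(\langle x\rangle^{a})$ to $H^{\rho+s}(\langle x\rangle^{-a})$, and these operators converge in operator norm as $\tau\to0^{+}$ and as $\tau\to0^-$. The limits are denoted $\mathcal H^{+}_{k,\gamma}$ and $\mathcal H^-_{k,\gamma}$; they do not depend on $\rho,s,a$ and are defined on $\bigcup_{\rho\in\mathbb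 R,\,a>1/2}H^\rho(\langle x\rangle^a)$. **Theorem.** Let $\alpha\in[0,d/2)$, $p_1,p_2,q\in[1,\infty]$ and $r\in\mathbb R$ with $1/p_2-1/p_1=\alpha/d$, and let $\eta>(d+1)/2-\alpha$. There is a constant $C>0$, depending only on $d,\eta,p_1,p_2,q,r$ and the pair $(\chi,\varphi)$, such that for all $\lambda\in(0,1)$, $k>0$, $\gamma\in\mathbb R^d$ and both signs $\pm$, the operator $\mathcal H^{\pm}_{k,\gamma}$ extends to a bounded linear operator from $B^{r-2+\alpha}_{p_2,q}(\langle x\rangle^{\eta},\lambda)$ to $B^{r}_{p_1,q}(\langle x\rangle^{-\eta},\lambda)$, with $$\|\mathcal H^{\pm}_{k,\gamma}f\|_{B^{r}_{p_1,q}(\langle x\rangle^{-\eta},\lambda)}\le C\,\lambda^{-\eta}\max\{r_{k,\gamma}^{\eta},\,r_{k,\gamma}^{-2}\}\,\|f\|_{B^{r-2+\alpha}_{p_2,q}(\langle x\rangle^{\eta},\lambda)}$$ for all $f\in B^{r-2+\alpha}_{p_2,q}(\langle x\rangle^{\eta},\lambda)$. -/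

import Mathlib

open MeasureTheory Filter Topology FourierTransform
open scoped ENNReal NNReal SchwartzMap ContDiff

noncomputable section

/-! ### Rescaled weighted Besov spaces on `ℝ^d` -/

/-- A dyadic (Littlewood-Paley) partition pair: smooth functions with
`χ(ξ) + ∑_{n ≥ 0} φ(2^{-n} ξ) = 1`, `supp χ ⊆ {|ξ| ≤ 4/3}`, `χ = 1` on `{|ξ| ≤ 3/4}` and
`supp φ ⊆ {3/4 ≤ |ξ| ≤ 8/3}`. The supports of `φ(2^{-i} ·)` and `φ(2^{-j} ·)` for `|i - j| ≥ 2`,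
and those of `χ` and `φ(2^{-i} ·)` for `i ≥ 1`, are then automatically disjoint. -/
structure IsDyadicPair {d : ℕ} (χ φ : EuclideanSpace ℝ (Fin d) → ℝ) : Prop where
  smooth_low : ContDiff ℝ ∞ χ
  smooth_high : ContDiff ℝ ∞ φ
  sum_eq_one : ∀ ξ, HasSum (fun n : ℕ => φ ((2 : ℝ) ^ (-(n : ℝ)) • ξ)) (1 - χ ξ)
  supp_low : tsupport χ ⊆ {ξ | ‖ξ‖ ≤ 4 / 3}
  low_eq_one : ∀ ξ, ‖ξ‖ ≤ 3 / 4 → χ ξ = 1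
  supp_high : tsupport φ ⊆ {ξ | 3 / 4 ≤ ‖ξ‖ ∧ ‖ξ‖ ≤ 8 / 3}

/-- The frequency cut-offs. The natural number `m` stands for the dyadic index `m - 1 ≥ -1`:
`m = 0` gives `φ_{-1} = χ` and `m = n + 1` gives `φ_n = φ(2^{-n} ·)`. -/
def dyadicCutoff {d : ℕ} (χ φ : EuclideanSpace ℝ (Fin d) → ℝ) :
    ℕ → EuclideanSpace ℝ (Fin d) → ℝ
  | 0 => χ
  | n + 1 => fun ξ => φ ((2 : ℝ) ^ (-(n : ℝ)) • ξ)

/-- The Littlewood-Paley block `Δ_{m-1} f = 𝓕⁻¹ (φ_{m-1} 𝓕 f)` of a tempered distribution. -/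
def dyadicBlock {d : ℕ} (χ φ : EuclideanSpace ℝ (Fin d) → ℝ) (m : ℕ)
    (f : 𝓢'(EuclideanSpace ℝ (Fin d), ℂ)) : 𝓢'(EuclideanSpace ℝ (Fin d), ℂ) :=
  TemperedDistribution.fourierMultiplierCLM ℂ (fun ξ => (dyadicCutoff χ φ m ξ : ℂ)) f

/-- The tempered distribution `u` is given by integration against the measurable function `g`. -/
def IsRepresentedBy {d : ℕ} (u : 𝓢'(EuclideanSpace ℝ (Fin d), ℂ))
    (g : EuclideanSpace ℝ (Fin d) → ℂ) : Prop :=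
  AEStronglyMeasurable g volume ∧
    ∀ θ : 𝓢(EuclideanSpace ℝ (Fin d), ℂ),
      Integrable (fun x => θ x * g x) volume ∧ u θ = ∫ x, θ x * g x

/-- The norm of `u` in the weighted space `L^p(w)`, that is, `‖w g‖_{L^p}` if `u` is the function
`g`, and `∞` if `u` is not a function. -/
def weightedLpNorm {d : ℕ} (p : ℝ≥0∞) (w : EuclideanSpace ℝ (Fin d) → ℝ)
    (u : 𝓢'(EuclideanSpace ℝ (Fin d), ℂ)) : ℝ≥0∞ :=
  ⨅ (g : EuclideanSpace ℝ (Fin d) → ℂ) (_ : IsRepresentedBy u g),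
    eLpNorm (fun x => (w x : ℂ) * g x) p volume

/-- The rescaled weight `x ↦ ⟨lam x⟩ ^ a`, where `⟨x⟩ = (1 + |x|^2)^{1/2}`. -/
def bracketWeight {d : ℕ} (a lam : ℝ) (x : EuclideanSpace ℝ (Fin d)) : ℝ :=
  Real.sqrt (1 + ‖lam • x‖ ^ 2) ^ a

/-- The norm of `B^r_{p,q}(⟨x⟩^a, lam)`; a tempered distribution belongs to this space if and only
if the norm is finite. -/
def besovNorm {d : ℕ} (χ φ : EuclideanSpace ℝ (Fin d) → ℝ) (r : ℝ) (p q : ℝ≥0∞) (a lam : ℝ)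
    (f : 𝓢'(EuclideanSpace ℝ (Fin d), ℂ)) : ℝ≥0∞ :=
  if q = ⊤ then
    ⨆ m : ℕ, ENNReal.ofReal (2 ^ (((m : ℝ) - 1) * r)) *
      weightedLpNorm p (bracketWeight a lam) (dyadicBlock χ φ m f)
  else
    (∑' m : ℕ, (ENNReal.ofReal (2 ^ (((m : ℝ) - 1) * r)) *
      weightedLpNorm p (bracketWeight a lam) (dyadicBlock χ φ m f)) ^ q.toReal) ^ (1 / q.toReal)

/-- The norm of the weighted Sobolev space `H^r(⟨x⟩^a) = B^r_{2,2}(⟨x⟩^a)`. -/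
def sobolevNorm {d : ℕ} (χ φ : EuclideanSpace ℝ (Fin d) → ℝ) (r a : ℝ)
    (f : 𝓢'(EuclideanSpace ℝ (Fin d), ℂ)) : ℝ≥0∞ :=
  besovNorm χ φ r 2 2 a 1 f

/-! ### Faddeev-type operators -/

/-- `r_{k,γ} = (k^2 + |γ|^2)^{1/2}`. -/
def faddeevRadius {d : ℕ} (k : ℝ) (γ : EuclideanSpace ℝ (Fin d)) : ℝ :=
  Real.sqrt (k ^ 2 + ‖γ‖ ^ 2)

/-- The symbol `m_{k,γ,τ}(ξ) = |ξ|^2 - k^2 - |γ|^2 + 2 i γ·ξ - i τ`. -/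
def faddeevSymbol {d : ℕ} (k : ℝ) (γ : EuclideanSpace ℝ (Fin d)) (τ : ℝ)
    (ξ : EuclideanSpace ℝ (Fin d)) : ℂ :=
  ((‖ξ‖ ^ 2 - k ^ 2 - ‖γ‖ ^ 2 : ℝ) : ℂ) + 2 * Complex.I * ((inner ℝ γ ξ : ℝ) : ℂ)
    - Complex.I * (τ : ℂ)

/-- `u = 𝓕⁻¹ (𝓕 f / m_{k,γ,τ})` for a Schwartz function `f`: for every Schwartz function `g`,
`⟨u, g⟩ = ∫ (𝓕 f)(ξ) (𝓕⁻¹ g)(ξ) / m_{k,γ,τ}(ξ) dξ`, with an absolutely convergent integral.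
The pairing is the bilinear one; inserting the complex conjugate of `g` in place of `g` gives
the integral of `(𝓕 f)(ξ)` times the conjugate of `(𝓕 g)(ξ)`, divided by `m_{k,γ,τ}(ξ)`. -/
def IsMultiplierValue {d : ℕ} (k : ℝ) (γ : EuclideanSpace ℝ (Fin d)) (τ : ℝ)
    (f : 𝓢(EuclideanSpace ℝ (Fin d), ℂ)) (u : 𝓢'(EuclideanSpace ℝ (Fin d), ℂ)) : Prop :=
  ∀ g : 𝓢(EuclideanSpace ℝ (Fin d), ℂ),
    Integrable (fun ξ => (𝓕 f) ξ * (𝓕⁻ g) ξ / faddeevSymbol k γ τ ξ) volume ∧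
      u g = ∫ ξ, (𝓕 f) ξ * (𝓕⁻ g) ξ / faddeevSymbol k γ τ ξ

/-- `T` is the regularized operator `𝓗_{k,γ,τ}` as a bounded linear operator from
`H^ρ(⟨x⟩^a)` to `H^{ρ+s}(⟨x⟩^{-a})`: its domain is `H^ρ(⟨x⟩^a)`, it is bounded between these
spaces, and on Schwartz functions it is the Fourier multiplier with symbol `1 / m_{k,γ,τ}`. -/
structure IsRegularizedFaddeev {d : ℕ} (χ φ : EuclideanSpace ℝ (Fin d) → ℝ) (k : ℝ)
    (γ : EuclideanSpace ℝ (Fin d)) (τ ρ s a : ℝ)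
    (T : 𝓢'(EuclideanSpace ℝ (Fin d), ℂ) →ₗ.[ℂ] 𝓢'(EuclideanSpace ℝ (Fin d), ℂ)) : Prop where
  mem_domain_iff : ∀ f, f ∈ T.domain ↔ sobolevNorm χ φ ρ a f < (⊤ : ℝ≥0∞)
  bounded : ∃ M : ℝ≥0, ∀ f : T.domain,
    sobolevNorm χ φ (ρ + s) (-a) (T f) ≤
      M * sobolevNorm χ φ ρ a (f : 𝓢'(EuclideanSpace ℝ (Fin d), ℂ))
  eq_multiplier : ∀ (g : 𝓢(EuclideanSpace ℝ (Fin d), ℂ)) (f : T.domain),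
    (f : 𝓢'(EuclideanSpace ℝ (Fin d), ℂ)) = SchwartzMap.toTemperedDistributionCLM _ _ volume g →
      IsMultiplierValue k γ τ g (T f)

/-- `H` is the Faddeev-type operator obtained from `𝓗_{k,γ,τ}` as `τ → 0` along the filter `l`
(`𝓝[>] 0` for the outgoing operator `𝓗⁺_{k,γ}`, `𝓝[<] 0` for the incoming one `𝓗⁻_{k,γ}`).
It is defined on all the spaces `H^ρ(⟨x⟩^a)`, `ρ ∈ ℝ`, `a > 1/2`, and, for all `ρ ∈ ℝ`,
`s ∈ [0,2]` and `a > 1/2`, it is bounded from `H^ρ(⟨x⟩^a)` to `H^{ρ+s}(⟨x⟩^{-a})` and is the limit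
of `𝓗_{k,γ,τ}` in the operator norm between these two spaces. -/
structure IsFaddeevOperator {d : ℕ} (χ φ : EuclideanSpace ℝ (Fin d) → ℝ) (l : Filter ℝ) (k : ℝ)
    (γ : EuclideanSpace ℝ (Fin d))
    (H : 𝓢'(EuclideanSpace ℝ (Fin d), ℂ) →ₗ.[ℂ] 𝓢'(EuclideanSpace ℝ (Fin d), ℂ)) : Prop where
  mem_domain_iff : ∀ f, f ∈ H.domain ↔ ∃ ρ a : ℝ, 1 / 2 < a ∧ sobolevNorm χ φ ρ a f < (⊤ : ℝ≥0∞)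
  bounded : ∀ ρ s a : ℝ, 0 ≤ s → s ≤ 2 → 1 / 2 < a → ∃ M : ℝ≥0, ∀ f : H.domain,
    sobolevNorm χ φ ρ a (f : 𝓢'(EuclideanSpace ℝ (Fin d), ℂ)) < (⊤ : ℝ≥0∞) →
      sobolevNorm χ φ (ρ + s) (-a) (H f) ≤
        M * sobolevNorm χ φ ρ a (f : 𝓢'(EuclideanSpace ℝ (Fin d), ℂ))
  norm_limit : ∀ ρ s a : ℝ, 0 ≤ s → s ≤ 2 → 1 / 2 < a → ∀ ε : ℝ≥0, 0 < ε → ∀ᶠ τ in l,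
    ∃ T : 𝓢'(EuclideanSpace ℝ (Fin d), ℂ) →ₗ.[ℂ] 𝓢'(EuclideanSpace ℝ (Fin d), ℂ),
      IsRegularizedFaddeev χ φ k γ τ ρ s a T ∧
        ∀ (f : T.domain) (f' : H.domain),
          (f : 𝓢'(EuclideanSpace ℝ (Fin d), ℂ)) = (f' : 𝓢'(EuclideanSpace ℝ (Fin d), ℂ)) →
          sobolevNorm χ φ (ρ + s) (-a) (T f - H f')
            ≤ ε * sobolevNorm χ φ ρ a (f : 𝓢'(EuclideanSpace ℝ (Fin d), ℂ))

end

/-! Write `R = r_{k,γ}`. On a Littlewood-Paley block the operator is convolution of the neighbouring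
blocks of the argument with one kernel, the inverse Fourier transform of `φ_n / m_{k,γ,±0}`. By
Peetre's inequality `⟨λx⟩^{-η} ≤ 2^{η/2} ⟨λ(x-y)⟩^{-η} ⟨λy⟩^η`, so Young's inequality with `1/s = 1
- α/d` can put the decaying weight on the kernel. The theorem is thereby reduced to one family of
kernel bounds: the `L^s(⟨λx⟩^{-η})` norm of the `n`-th kernel is at most `C λ^{-η} max(R^η, R^{-2})
2^{-n(2-α)}` (`exists_wNorm_limitKernel_dyadic_le`).

Dilation by `2^n` brings the frequencies to size one and replaces `R` by `R / 2^n`. If that ratio is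
small or large, the symbol stays away from zero on the annulus, and the kernel decays rapidly,
uniformly in the parameters, by compactness. If the ratio is comparable to one, the kernel is
singular and is only controlled in `L²(⟨x⟩^{-a})` with `a > 1/2`. Hölder's inequality embeds that
space into `L^s(⟨x⟩^{-η})` because `η > (d+1)/2 - α` (`exponentEmbedding`), and passing from the
weight `⟨2^{-n}λx⟩` to `⟨x⟩` costs a multiple of `(2^n/λ)^η`, which is comparable to `(R/λ)^η`. For
the lowest block and small `R`, the identity `χ = χ(2·) + φ(2·)` and scaling give a recursion `N(R)
≤ 4 N(2R) + O(1)`, whence the factor `R^{-2}`.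

The `L²` bound is a limiting absorption principle, uniform in `τ` and in all `(k,γ)` of given
radius. With `q = |ξ|² + R² + iτ` one has `1/m = ∑_j (2ξ_j/q) (ξ_j + iγ_j)/m - 1/q`. The factors
with `1/q` are smooth and harmless. Since `ξ_j + iγ_j` is half of `∂_j m`, on each line parallel to
the `j`-th axis `(ξ_j + iγ_j)/m` is half the sum of two Cauchy kernels `1/(t-z)`. Each of these, for
non-real `z`, is the Fourier transform of a function bounded by `2π`, whatever `z` is. The pairing
is therefore bounded through `L¹` norms in one variable, and these are controlled by Cauchy-Schwarz
with a weight of exponent `a > 1/2` and by Plancherel in the other variables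
(`enorm_integral_fourier_mul_div_symbol_le`, `exists_pairing_bound`,
`exists_wNorm_symbolKernel_le`).

The limits in `τ` are first taken pointwise for the kernels. For `γ ≠ 0` the functions `1/m` are
bounded in `L^{5/4}` on balls, uniformly in `τ`, which gives Hölder continuity at `τ = 0`. For `γ =
0` an integration by parts replaces `1/m` by `log m`, which has one-sided limits. Uniform bounds for
a smaller weight exponent then upgrade pointwise convergence to convergence in norm
(`tendsto_wNorm_symbolKernel_sub`, `eventually_wNorm_conv_sub_le`).

On distributions a single formula, `faddeevFun`, is used: a smooth multiplier at high frequencies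
plus a convolution at low ones. The limiting operator on the Sobolev spaces and its extension to the
Besov space are restrictions of the same formula, so they agree wherever both are defined. -/

noncomputable section

namespace Faddeev

variable {d : ℕ}

/-! ### Convolutions and weighted norms -/

/-- The Euclidean space `ℝ^d`. -/
abbrev Eu (d : ℕ) := EuclideanSpace ℝ (Fin d)


/-- Convolution of two complex functions. -/
def conv (K g : Eu d → ℂ) (x : Eu d) : ℂ := ∫ y, K (x - y) * g y

/-- Convolution of two functions with values in `[0, ∞]`. -/
def econv (k h : Eu d → ℝ≥0∞) (x : Eu d) : ℝ≥0∞ := ∫⁻ y, k (x - y) * h y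

/-- The weighted norm `‖⟨lam x⟩ ^ a g‖_{L^p}`. -/
def wNorm (p : ℝ≥0∞) (a lam : ℝ) (g : Eu d → ℂ) : ℝ≥0∞ :=
  eLpNorm (fun x => (bracketWeight a lam x : ℂ) * g x) p volume

/-! ### Brackets -/

theorem one_le_bracket (lam : ℝ) (x : Eu d) : 1 ≤ Real.sqrt (1 + ‖lam • x‖ ^ 2) := by
  rw [Real.one_le_sqrt]
  nlinarith [sq_nonneg ‖lam • x‖]

theorem bracketWeight_pos (a lam : ℝ) (x : Eu d) : 0 < bracketWeight a lam x :=
  Real.rpow_pos_of_pos (lt_of_lt_of_le one_pos (one_le_bracket lam x)) a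

theorem bracketWeight_add (a b lam : ℝ) (x : Eu d) :
    bracketWeight (a + b) lam x = bracketWeight a lam x * bracketWeight b lam x :=
  Real.rpow_add (lt_of_lt_of_le one_pos (one_le_bracket lam x)) a b

theorem bracketWeight_zero (lam : ℝ) (x : Eu d) : bracketWeight 0 lam x = 1 :=
  Real.rpow_zero _

theorem bracketWeight_neg_mul (a lam : ℝ) (x : Eu d) :
    bracketWeight (-a) lam x * bracketWeight a lam x = 1 := by
  rw [← bracketWeight_add, neg_add_cancel, bracketWeight_zero]

theorem bracketWeight_neg_eq_inv (a lam : ℝ) (x : Eu d) :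
    bracketWeight (-a) lam x = (bracketWeight a lam x)⁻¹ :=
  eq_inv_of_mul_eq_one_left (bracketWeight_neg_mul a lam x)

theorem bracketWeight_neg_apply (a lam : ℝ) (x : Eu d) :
    bracketWeight a lam (-x) = bracketWeight a lam x := by
  simp [bracketWeight]

theorem bracketWeight_mono {a b : ℝ} (h : a ≤ b) (lam : ℝ) (x : Eu d) :
    bracketWeight a lam x ≤ bracketWeight b lam x :=
  Real.rpow_le_rpow_of_exponent_le (one_le_bracket lam x) h

theorem bracketWeight_le_one {a : ℝ} (h : a ≤ 0) (lam : ℝ) (x : Eu d) :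
    bracketWeight a lam x ≤ 1 := by
  simpa [bracketWeight_zero] using bracketWeight_mono h lam x

theorem bracketWeight_mono_lam {a l₁ l₂ : ℝ} (ha : 0 ≤ a) (h : |l₁| ≤ |l₂|) (x : Eu d) :
    bracketWeight a l₁ x ≤ bracketWeight a l₂ x := by
  unfold bracketWeight
  refine Real.rpow_le_rpow (Real.sqrt_nonneg _) (Real.sqrt_le_sqrt ?_) ha
  rw [norm_smul, norm_smul, Real.norm_eq_abs, Real.norm_eq_abs]
  gcongr

theorem continuous_bracketWeight (a lam : ℝ) :
    Continuous (bracketWeight a lam : Eu d → ℝ) := by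
  unfold bracketWeight
  refine Continuous.rpow_const (by fun_prop) fun x => Or.inl ?_
  exact (lt_of_lt_of_le one_pos (one_le_bracket lam x)).ne'

theorem bracket_add_le (lam : ℝ) (x y : Eu d) :
    Real.sqrt (1 + ‖lam • (x + y)‖ ^ 2) ≤
      Real.sqrt 2 * Real.sqrt (1 + ‖lam • x‖ ^ 2) * Real.sqrt (1 + ‖lam • y‖ ^ 2) := by
  rw [← Real.sqrt_mul (by norm_num), ← Real.sqrt_mul (by positivity)]
  apply Real.sqrt_le_sqrt
  have h : ‖lam • (x + y)‖ ≤ ‖lam • x‖ + ‖lam • y‖ := by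
    rw [smul_add]; exact norm_add_le _ _
  have h1 := norm_nonneg (lam • (x + y))
  have h2 := norm_nonneg (lam • x)
  have h3 := norm_nonneg (lam • y)
  have h4 : ‖lam • (x + y)‖ ^ 2 ≤ (‖lam • x‖ + ‖lam • y‖) ^ 2 := by gcongr
  nlinarith [sq_nonneg (‖lam • x‖ - ‖lam • y‖), sq_nonneg (‖lam • x‖ * ‖lam • y‖)]

/-- Peetre's inequality. -/
theorem bracketWeight_add_le {a : ℝ} (ha : 0 ≤ a) (lam : ℝ) (x y : Eu d) :
    bracketWeight a lam (x + y) ≤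
      Real.sqrt 2 ^ a * bracketWeight a lam x * bracketWeight a lam y := by
  unfold bracketWeight
  rw [← Real.mul_rpow (by positivity) (by positivity),
    ← Real.mul_rpow (by positivity) (by positivity)]
  exact Real.rpow_le_rpow (by positivity) (bracket_add_le lam x y) ha

/-- For negative `a` this is Peetre's inequality for `y = -(x - y) + x`, inverted. The sign of `a`
does not matter once the kernel carries the growing weight `|a|`. -/
theorem bracketWeight_le_sub_mul (a lam : ℝ) (x y : Eu d) :
    bracketWeight a lam x ≤
      Real.sqrt 2 ^ |a| * bracketWeight |a| lam (x - y) * bracketWeight a lam y := by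
  rcases le_total 0 a with ha | ha
  · rw [abs_of_nonneg ha]
    simpa using bracketWeight_add_le ha lam (x - y) y
  · obtain ⟨b, rfl⟩ : ∃ b, a = -b := ⟨-a, by ring⟩
    have hb : 0 ≤ b := by linarith
    rw [abs_neg, abs_of_nonneg hb, bracketWeight_neg_eq_inv, bracketWeight_neg_eq_inv,
      ← div_eq_mul_inv, le_div_iff₀ (bracketWeight_pos _ _ _), inv_mul_le_iff₀
      (bracketWeight_pos _ _ _)]
    have := bracketWeight_add_le hb lam (-(x - y)) x
    rw [bracketWeight_neg_apply] at this
    have e : -(x - y) + x = y := by abel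
    rw [e] at this
    linarith

/-- Peetre's inequality for `x + (-y)`, inverted. Here it is the kernel variable `x - y` that gets
the decaying weight, which is what admits kernels that are not integrable. -/
theorem bracketWeight_neg_le_sub_mul {a : ℝ} (ha : 0 ≤ a) (lam : ℝ) (x y : Eu d) :
    bracketWeight (-a) lam x ≤
      Real.sqrt 2 ^ a * bracketWeight (-a) lam (x - y) * bracketWeight a lam y := by
  have h := bracketWeight_add_le ha lam x (-y)
  rw [← sub_eq_add_neg, bracketWeight_neg_apply] at h
  rw [bracketWeight_neg_eq_inv, bracketWeight_neg_eq_inv,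
    mul_right_comm, ← div_eq_mul_inv, le_div_iff₀ (bracketWeight_pos _ _ _),
    inv_mul_le_iff₀ (bracketWeight_pos _ _ _)]
  linarith

/-! ### Young's inequality -/

theorem econv_eq_swap (k h : Eu d → ℝ≥0∞) (x : Eu d) :
    econv k h x = ∫⁻ y, k y * h (x - y) := by
  unfold econv
  rw [← lintegral_sub_left_eq_self _ x]
  simp

theorem lintegral_sub_left_fun (k : Eu d → ℝ≥0∞) (x : Eu d) :
    ∫⁻ y, k (x - y) = ∫⁻ y, k y := lintegral_sub_left_eq_self _ x

theorem aemeasurable_sub_left {k : Eu d → ℝ≥0∞} (hk : AEMeasurable k) (x : Eu d) :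
    AEMeasurable (fun y => k (x - y)) :=
  hk.comp_quasiMeasurePreserving
    (quasiMeasurePreserving_sub_left_of_right_invariant volume x)

theorem aemeasurable_econv_integrand {k h : Eu d → ℝ≥0∞} (hk : AEMeasurable k)
    (hh : AEMeasurable h) :
    AEMeasurable (fun p : Eu d × Eu d => k (p.1 - p.2) * h p.2) (volume.prod volume) :=
  (hk.comp_quasiMeasurePreserving (quasiMeasurePreserving_sub volume volume)).mul
    hh.comp_snd

theorem aemeasurable_econv {k h : Eu d → ℝ≥0∞} (hk : AEMeasurable k) (hh : AEMeasurable h) :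
    AEMeasurable (econv k h) :=
  (aemeasurable_econv_integrand hk hh).lintegral_prod_right'

theorem holder_three {α : Type*} [MeasurableSpace α] {μ : Measure α} {f g h : α → ℝ≥0∞}
    (hf : AEMeasurable f μ) (hg : AEMeasurable g μ) (hh : AEMeasurable h μ) {a b c : ℝ}
    (ha : 0 ≤ a) (hb : 0 ≤ b) (hc : 0 ≤ c) (habc : a + b + c = 1) :
    ∫⁻ x, f x ^ a * g x ^ b * h x ^ c ∂μ ≤
      (∫⁻ x, f x ∂μ) ^ a * (∫⁻ x, g x ∂μ) ^ b * (∫⁻ x, h x ∂μ) ^ c := by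
  have := ENNReal.lintegral_prod_norm_pow_le (μ := μ) (Finset.univ : Finset (Fin 3))
    (f := ![f, g, h]) (p := ![a, b, c]) ?_ ?_ ?_
  · simpa [Fin.prod_univ_three] using this
  · intro i _; fin_cases i <;> simpa
  · simpa [Fin.sum_univ_three]
  · intro i _; fin_cases i <;> simpa

/-- Hölder's inequality for functions with values in `[0, ∞]`. -/
theorem lintegral_mul_le_eLpNorm_mul_eLpNorm {α : Type*} [MeasurableSpace α] {μ : Measure α}
    {p q : ℝ≥0∞} (hpq : p.HolderConjugate q) {f g : α → ℝ≥0∞} (hf : AEMeasurable f μ)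
    (hg : AEMeasurable g μ) : ∫⁻ x, f x * g x ∂μ ≤ eLpNorm f p μ * eLpNorm g q μ := by
  have top_case : ∀ f g : α → ℝ≥0∞, AEMeasurable f μ →
      ∫⁻ x, f x * g x ∂μ ≤ eLpNorm f 1 μ * eLpNorm g ⊤ μ := by
    intro f g hf
    rw [eLpNorm_one_eq_lintegral_enorm, eLpNorm_exponent_top]
    simp only [enorm_eq_self]
    rw [← lintegral_mul_const'' _ hf]
    refine lintegral_mono_ae ?_
    filter_upwards [enorm_ae_le_eLpNormEssSup g μ] with x hx
    gcongr
    simpa using hx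
  have h1 := ENNReal.HolderConjugate.inv_add_inv_eq_one p q
  by_cases hp : p = ⊤
  · subst hp
    have : q = 1 := by simpa using h1
    subst this
    rw [mul_comm (eLpNorm f ⊤ μ)]
    simpa only [mul_comm] using top_case g f hg
  by_cases hq : q = ⊤
  · subst hq
    have : p = 1 := by simpa using h1
    subst this
    exact top_case f g hf
  have hp1 : 1 ≤ p := (ENNReal.inv_le_one.1 (h1 ▸ le_self_add))
  have hq1 : 1 ≤ q := (ENNReal.inv_le_one.1 (h1 ▸ le_add_self))
  have hp0 : p ≠ 0 := (lt_of_lt_of_le one_pos hp1).ne'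
  have hq0 : q ≠ 0 := (lt_of_lt_of_le one_pos hq1).ne'
  have hc : p.toReal.HolderConjugate q.toReal := by
    rw [Real.holderConjugate_iff]
    have h2 := congrArg ENNReal.toReal h1
    rw [ENNReal.toReal_add (by simpa using hp0) (by simpa using hq0)] at h2
    simp only [ENNReal.toReal_inv, ENNReal.toReal_one] at h2
    refine ⟨?_, h2⟩
    have h3 : 0 < q.toReal⁻¹ := inv_pos.2 (ENNReal.toReal_pos hq0 hq)
    have h4 : p.toReal⁻¹ < 1 := by linarith
    exact (inv_lt_one₀ (ENNReal.toReal_pos hp0 hp)).1 h4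
  rw [eLpNorm_eq_lintegral_rpow_enorm_toReal hp0 hp, eLpNorm_eq_lintegral_rpow_enorm_toReal hq0 hq]
  simpa using ENNReal.lintegral_mul_le_Lp_mul_Lq μ hc hf hg

/-- Young's inequality for convolutions. -/
theorem eLpNorm_econv_le {k h : Eu d → ℝ≥0∞} (hk : AEMeasurable k) (hh : AEMeasurable h)
    {s p r : ℝ≥0∞} (hs : 1 ≤ s) (hp : 1 ≤ p) (hspr : s⁻¹ + p⁻¹ = 1 + r⁻¹) :
    eLpNorm (econv k h) r volume ≤ eLpNorm k s volume * eLpNorm h p volume := by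
  by_cases hr : r = ⊤
  · subst hr
    simp only [ENNReal.inv_top, add_zero] at hspr
    have hsp : s.HolderConjugate p := ⟨by simpa using hspr⟩
    rw [eLpNorm_exponent_top]
    refine essSup_le_of_ae_le _ (Eventually.of_forall fun x => ?_)
    simp only [enorm_eq_self]
    have h1 := lintegral_mul_le_eLpNorm_mul_eLpNorm (μ := volume) hsp
      (aemeasurable_sub_left hk x) hh
    refine h1.trans (le_of_eq ?_)
    congr 1
    exact eLpNorm_comp_measurePreserving (f := fun y => x - y) hk.aestronglyMeasurable
      (Measure.measurePreserving_sub_left volume x)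
  have hr' : r⁻¹ ≠ 0 := by simpa using hr
  have hs1 : s⁻¹ ≤ 1 := by simpa using hs
  have hp1 : p⁻¹ ≤ 1 := by simpa using hp
  have hst : s ≠ ⊤ := by
    rintro rfl
    simp only [ENNReal.inv_top, zero_add] at hspr
    have : (1 : ℝ≥0∞) < 1 + r⁻¹ := ENNReal.lt_add_right (by simp) hr'
    exact absurd (hspr ▸ hp1) (not_le.2 this)
  have hpt : p ≠ ⊤ := by
    rintro rfl
    simp only [ENNReal.inv_top, add_zero] at hspr
    have : (1 : ℝ≥0∞) < 1 + r⁻¹ := ENNReal.lt_add_right (by simp) hr'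
    exact absurd (hspr ▸ hs1) (not_le.2 this)
  have hr0 : r ≠ 0 := by
    rintro rfl
    have : s⁻¹ + p⁻¹ < ⊤ := ENNReal.add_lt_top.2
      ⟨lt_of_le_of_lt hs1 (by simp), lt_of_le_of_lt hp1 (by simp)⟩
    rw [hspr] at this
    simp at this
  have hs0 : s ≠ 0 := (lt_of_lt_of_le one_pos hs).ne'
  have hp0 : p ≠ 0 := (lt_of_lt_of_le one_pos hp).ne'
  obtain ⟨S, rfl⟩ : ∃ S : ℝ≥0, s = S := ⟨s.toNNReal, (ENNReal.coe_toNNReal hst).symm⟩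
  obtain ⟨P, rfl⟩ : ∃ P : ℝ≥0, p = P := ⟨p.toNNReal, (ENNReal.coe_toNNReal hpt).symm⟩
  obtain ⟨Q, rfl⟩ : ∃ Q : ℝ≥0, r = Q := ⟨r.toNNReal, (ENNReal.coe_toNNReal hr).symm⟩
  have hS : (1 : ℝ) ≤ S := by exact_mod_cast hs
  have hP : (1 : ℝ) ≤ P := by exact_mod_cast hp
  have hQ : (0 : ℝ) < Q := by
    have : Q ≠ 0 := by simpa using hr0
    exact_mod_cast pos_iff_ne_zero.2 this
  have hS0 : (0 : ℝ) < S := by linarith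
  have hP0 : (0 : ℝ) < P := by linarith
  have hrel : (S : ℝ)⁻¹ + (P : ℝ)⁻¹ = 1 + (Q : ℝ)⁻¹ := by
    have h2 := congrArg ENNReal.toReal hspr
    rw [ENNReal.toReal_add (by simpa using hs0) (by simpa using hp0),
      ENNReal.toReal_add (by simp) (by simpa using hr0)] at h2
    simpa [ENNReal.toReal_inv] using h2
  rw [eLpNorm_eq_lintegral_rpow_enorm_toReal hr0 (by simp),
    eLpNorm_eq_lintegral_rpow_enorm_toReal hs0 (by simp),
    eLpNorm_eq_lintegral_rpow_enorm_toReal hp0 (by simp)]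
  simp only [enorm_eq_self, ENNReal.coe_toReal, one_div]
  set A := ∫⁻ x, k x ^ (S : ℝ) with hA
  set B := ∫⁻ x, h x ^ (P : ℝ) with hB
  have hSi : (S : ℝ)⁻¹ ≤ 1 := inv_le_one_of_one_le₀ hS
  have hPi : (P : ℝ)⁻¹ ≤ 1 := inv_le_one_of_one_le₀ hP
  have hQi : 0 < (Q : ℝ)⁻¹ := inv_pos.2 hQ
  -- The integrand is split as `(k^S h^P)^{1/Q} (k^S)^{1/S-1/Q} (h^P)^{1/P-1/Q}`; the Young relation
  -- says exactly that these three exponents sum to `1`, and makes them nonnegative.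
  have key : ∀ x, econv k h x ≤ (∫⁻ y, k (x - y) ^ (S : ℝ) * h y ^ (P : ℝ)) ^ (Q : ℝ)⁻¹ *
      A ^ ((S : ℝ)⁻¹ - (Q : ℝ)⁻¹) * B ^ ((P : ℝ)⁻¹ - (Q : ℝ)⁻¹) := by
    intro x
    have hkx := aemeasurable_sub_left hk x
    have h3 := holder_three (μ := volume) ((hkx.pow_const (S : ℝ)).mul (hh.pow_const (P : ℝ)))
      (hkx.pow_const (S : ℝ)) (hh.pow_const (P : ℝ)) (a := (Q : ℝ)⁻¹)
      (b := (S : ℝ)⁻¹ - (Q : ℝ)⁻¹) (c := (P : ℝ)⁻¹ - (Q : ℝ)⁻¹) hQi.le (by linarith)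
      (by linarith) (by linarith)
    rw [lintegral_sub_left_fun (fun y => k y ^ (S : ℝ)) x] at h3
    refine le_trans (le_of_eq ?_) h3
    unfold econv
    congr 1
    ext y
    simp only [Pi.mul_apply]
    rw [ENNReal.mul_rpow_of_nonneg _ _ hQi.le]
    simp only [← ENNReal.rpow_mul]
    have e1 : k (x - y) = k (x - y) ^ ((S : ℝ) * (Q : ℝ)⁻¹) *
        k (x - y) ^ ((S : ℝ) * ((S : ℝ)⁻¹ - (Q : ℝ)⁻¹)) := by
      rw [← ENNReal.rpow_add_of_nonneg _ _ (by positivity)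
        (mul_nonneg hS0.le (by linarith)), ← mul_add, add_sub_cancel,
        mul_inv_cancel₀ hS0.ne', ENNReal.rpow_one]
    have e2 : h y = h y ^ ((P : ℝ) * (Q : ℝ)⁻¹) *
        h y ^ ((P : ℝ) * ((P : ℝ)⁻¹ - (Q : ℝ)⁻¹)) := by
      rw [← ENNReal.rpow_add_of_nonneg _ _ (by positivity)
        (mul_nonneg hP0.le (by linarith)), ← mul_add, add_sub_cancel,
        mul_inv_cancel₀ hP0.ne', ENNReal.rpow_one]
    conv_lhs => rw [e1, e2]
    ring
  have hI : ∫⁻ x, ∫⁻ y, k (x - y) ^ (S : ℝ) * h y ^ (P : ℝ) = A * B := by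
    rw [lintegral_lintegral_swap (aemeasurable_econv_integrand (hk.pow_const _) (hh.pow_const _))]
    have : ∀ y, ∫⁻ x, k (x - y) ^ (S : ℝ) * h y ^ (P : ℝ) = A * h y ^ (P : ℝ) := by
      intro y
      have hm : AEMeasurable (fun x => k (x - y) ^ (S : ℝ)) :=
        (hk.pow_const (S : ℝ)).comp_quasiMeasurePreserving
          (measurePreserving_sub_right volume y).quasiMeasurePreserving
      rw [lintegral_mul_const'' _ hm]
      congr 1
      exact lintegral_sub_right_eq_self (fun x => k x ^ (S : ℝ)) y
    simp_rw [this]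
    rw [lintegral_const_mul'' _ (hh.pow_const _)]
  calc (∫⁻ x, econv k h x ^ (Q : ℝ)) ^ (Q : ℝ)⁻¹
      ≤ (∫⁻ x, (∫⁻ y, k (x - y) ^ (S : ℝ) * h y ^ (P : ℝ)) *
          (A ^ ((S : ℝ)⁻¹ - (Q : ℝ)⁻¹) * B ^ ((P : ℝ)⁻¹ - (Q : ℝ)⁻¹)) ^ (Q : ℝ)) ^ (Q : ℝ)⁻¹ := by
        gcongr with x
        refine (ENNReal.rpow_le_rpow (key x) hQ.le).trans (le_of_eq ?_)
        rw [mul_assoc, ENNReal.mul_rpow_of_nonneg _ _ hQ.le, ← ENNReal.rpow_mul,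
          inv_mul_cancel₀ hQ.ne', ENNReal.rpow_one]
    _ = (A * B) ^ (Q : ℝ)⁻¹ * (A ^ ((S : ℝ)⁻¹ - (Q : ℝ)⁻¹) * B ^ ((P : ℝ)⁻¹ - (Q : ℝ)⁻¹)) := by
        have hm : AEMeasurable (fun x => ∫⁻ y, k (x - y) ^ (S : ℝ) * h y ^ (P : ℝ)) :=
          aemeasurable_econv (hk.pow_const _) (hh.pow_const _)
        rw [lintegral_mul_const'' _ hm, hI,
          ENNReal.mul_rpow_of_nonneg _ _ hQi.le, ← ENNReal.rpow_mul, mul_inv_cancel₀ hQ.ne',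
          ENNReal.rpow_one]
    _ = A ^ (S : ℝ)⁻¹ * B ^ (P : ℝ)⁻¹ := by
        rw [ENNReal.mul_rpow_of_nonneg _ _ hQi.le]
        have e1 : A ^ (S : ℝ)⁻¹ = A ^ (Q : ℝ)⁻¹ * A ^ ((S : ℝ)⁻¹ - (Q : ℝ)⁻¹) := by
          rw [← ENNReal.rpow_add_of_nonneg _ _ hQi.le (by linarith), add_sub_cancel]
        have e2 : B ^ (P : ℝ)⁻¹ = B ^ (Q : ℝ)⁻¹ * B ^ ((P : ℝ)⁻¹ - (Q : ℝ)⁻¹) := by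
          rw [← ENNReal.rpow_add_of_nonneg _ _ hQi.le (by linarith), add_sub_cancel]
        rw [e1, e2]
        ring

/-- Young's inequality for convolutions with weights. -/
theorem eLpNorm_mul_econv_le {k h : Eu d → ℝ≥0∞} (hk : AEMeasurable k) (hh : AEMeasurable h)
    {s p r : ℝ≥0∞} (hs : 1 ≤ s) (hp : 1 ≤ p) (hspr : s⁻¹ + p⁻¹ = 1 + r⁻¹)
    {u v w : Eu d → ℝ} (hv : Continuous v) (hw : Continuous w) (hv0 : ∀ x, 0 < v x)
    {C : ℝ} (hC : 0 ≤ C) (huvw : ∀ x y, u x ≤ C * v (x - y) * w y) :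
    eLpNorm (fun x => ENNReal.ofReal (u x) * econv k h x) r volume ≤
      ENNReal.ofReal C * (eLpNorm (fun x => ENNReal.ofReal (v x) * k x) s volume *
        eLpNorm (fun x => ENNReal.ofReal (w x) * h x) p volume) := by
  have hvk : AEMeasurable (fun x => ENNReal.ofReal (v x) * k x) :=
    hv.measurable.ennreal_ofReal.aemeasurable.mul hk
  have hwh : AEMeasurable (fun x => ENNReal.ofReal (w x) * h x) :=
    hw.measurable.ennreal_ofReal.aemeasurable.mul hh
  have h1 : eLpNorm (fun x => ENNReal.ofReal (u x) * econv k h x) r volume ≤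
      eLpNorm (fun x => ENNReal.ofReal C * econv (fun x => ENNReal.ofReal (v x) * k x)
        (fun x => ENNReal.ofReal (w x) * h x) x) r volume := by
    refine eLpNorm_mono_enorm fun x => ?_
    simp only [enorm_eq_self]
    unfold econv
    rw [← lintegral_const_mul' _ _ (by simp), ← lintegral_const_mul' _ _ (by simp)]
    refine lintegral_mono fun y => ?_
    calc ENNReal.ofReal (u x) * (k (x - y) * h y)
        ≤ ENNReal.ofReal (C * v (x - y) * w y) * (k (x - y) * h y) := by
          gcongr; exact huvw x y
      _ = _ := by
          rw [ENNReal.ofReal_mul (mul_nonneg hC (hv0 _).le), ENNReal.ofReal_mul hC]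
          ring
  refine h1.trans ?_
  have h2 : eLpNorm (fun x => ENNReal.ofReal C * econv (fun x => ENNReal.ofReal (v x) * k x)
        (fun x => ENNReal.ofReal (w x) * h x) x) r volume ≤ ENNReal.ofReal C *
        eLpNorm (econv (fun x => ENNReal.ofReal (v x) * k x)
        (fun x => ENNReal.ofReal (w x) * h x)) r volume := by
    have := eLpNorm_le_nnreal_smul_eLpNorm_of_ae_le_mul' (c := C.toNNReal) (p := r) (μ := volume)
      (f := fun x => ENNReal.ofReal C * econv (fun x => ENNReal.ofReal (v x) * k x)
        (fun x => ENNReal.ofReal (w x) * h x) x) (g := econv (fun x => ENNReal.ofReal (v x) * k x)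
        (fun x => ENNReal.ofReal (w x) * h x)) (Eventually.of_forall fun x => by
          simp [ENNReal.ofReal])
    simpa [ENNReal.smul_def, ENNReal.ofReal] using this
  refine h2.trans ?_
  gcongr
  exact eLpNorm_econv_le hvk hwh hs hp hspr

theorem enorm_conv_le (K g : Eu d → ℂ) (x : Eu d) :
    ‖conv K g x‖ₑ ≤ econv (fun z => ‖K z‖ₑ) (fun z => ‖g z‖ₑ) x := by
  refine (enorm_integral_le_lintegral_enorm _).trans (le_of_eq ?_)
  simp [econv, enorm_mul]

theorem wNorm_eq (p : ℝ≥0∞) (a lam : ℝ) (g : Eu d → ℂ) :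
    wNorm p a lam g =
      eLpNorm (fun x => ENNReal.ofReal (bracketWeight a lam x) * ‖g x‖ₑ) p volume := by
  unfold wNorm
  refine eLpNorm_congr_enorm_ae (Eventually.of_forall fun x => ?_)
  simp only [enorm_mul, enorm_eq_self]
  congr 1
  rw [← ofReal_norm, Complex.norm_real, Real.norm_of_nonneg (bracketWeight_pos _ _ _).le]

theorem wNorm_conv_le_econv (p : ℝ≥0∞) (a lam : ℝ) (K g : Eu d → ℂ) :
    wNorm p a lam (conv K g) ≤ eLpNorm (fun x => ENNReal.ofReal (bracketWeight a lam x) *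
      econv (fun z => ‖K z‖ₑ) (fun z => ‖g z‖ₑ) x) p volume := by
  rw [wNorm_eq]
  refine eLpNorm_mono_enorm fun x => ?_
  simp only [enorm_eq_self]
  gcongr
  exact enorm_conv_le K g x

theorem eLpNorm_econv_dual_le {K g : Eu d → ℂ} (hK : AEStronglyMeasurable K volume)
    (hg : AEStronglyMeasurable g volume) {s p r : ℝ≥0∞} (hs : 1 ≤ s) (hp : 1 ≤ p)
    (hspr : s⁻¹ + p⁻¹ = 1 + r⁻¹) {a : ℝ} (ha : 0 ≤ a) (lam : ℝ) :
    eLpNorm (fun x => ENNReal.ofReal (bracketWeight (-a) lam x) *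
      econv (fun z => ‖K z‖ₑ) (fun z => ‖g z‖ₑ) x) r volume ≤
      ENNReal.ofReal (Real.sqrt 2 ^ a) * (wNorm s (-a) lam K * wNorm p a lam g) := by
  rw [wNorm_eq, wNorm_eq]
  exact eLpNorm_mul_econv_le hK.enorm hg.enorm hs hp hspr (continuous_bracketWeight _ _)
    (continuous_bracketWeight _ _) (bracketWeight_pos _ _) (by positivity)
    (bracketWeight_neg_le_sub_mul ha lam)

theorem wNorm_conv_dual_le {K g : Eu d → ℂ} (hK : AEStronglyMeasurable K volume)
    (hg : AEStronglyMeasurable g volume) {s p r : ℝ≥0∞} (hs : 1 ≤ s) (hp : 1 ≤ p)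
    (hspr : s⁻¹ + p⁻¹ = 1 + r⁻¹) {a : ℝ} (ha : 0 ≤ a) (lam : ℝ) :
    wNorm r (-a) lam (conv K g) ≤
      ENNReal.ofReal (Real.sqrt 2 ^ a) * (wNorm s (-a) lam K * wNorm p a lam g) :=
  (wNorm_conv_le_econv _ _ _ _ _).trans (eLpNorm_econv_dual_le hK hg hs hp hspr ha lam)

theorem eLpNorm_econv_same_le {K g : Eu d → ℂ} (hK : AEStronglyMeasurable K volume)
    (hg : AEStronglyMeasurable g volume) {s p r : ℝ≥0∞} (hs : 1 ≤ s) (hp : 1 ≤ p)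
    (hspr : s⁻¹ + p⁻¹ = 1 + r⁻¹) (a lam : ℝ) :
    eLpNorm (fun x => ENNReal.ofReal (bracketWeight a lam x) *
      econv (fun z => ‖K z‖ₑ) (fun z => ‖g z‖ₑ) x) r volume ≤
      ENNReal.ofReal (Real.sqrt 2 ^ |a|) * (wNorm s |a| lam K * wNorm p a lam g) := by
  rw [wNorm_eq, wNorm_eq]
  exact eLpNorm_mul_econv_le hK.enorm hg.enorm hs hp hspr (continuous_bracketWeight _ _)
    (continuous_bracketWeight _ _) (bracketWeight_pos _ _) (by positivity)
    (bracketWeight_le_sub_mul a lam)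

theorem wNorm_conv_same_le {K g : Eu d → ℂ} (hK : AEStronglyMeasurable K volume)
    (hg : AEStronglyMeasurable g volume) {p : ℝ≥0∞} (hp : 1 ≤ p) (a lam : ℝ) :
    wNorm p a lam (conv K g) ≤
      ENNReal.ofReal (Real.sqrt 2 ^ |a|) * (wNorm 1 |a| lam K * wNorm p a lam g) :=
  (wNorm_conv_le_econv _ _ _ _ _).trans
    (eLpNorm_econv_same_le hK hg le_rfl hp (by simp) a lam)

/-! ### Weighted norms -/

theorem wNorm_congr {p : ℝ≥0∞} {a lam : ℝ} {g g' : Eu d → ℂ} (h : g =ᵐ[volume] g') :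
    wNorm p a lam g = wNorm p a lam g' := by
  refine eLpNorm_congr_ae ?_
  filter_upwards [h] with x hx
  rw [hx]

theorem aestronglyMeasurable_weight_mul {g : Eu d → ℂ} (hg : AEStronglyMeasurable g volume)
    (a lam : ℝ) :
    AEStronglyMeasurable (fun x => (bracketWeight a lam x : ℂ) * g x) volume :=
  (Complex.continuous_ofReal.comp (continuous_bracketWeight a lam)).aestronglyMeasurable.mul hg

theorem wNorm_add_le {p : ℝ≥0∞} (hp : 1 ≤ p) (a lam : ℝ) {g g' : Eu d → ℂ}
    (hg : AEStronglyMeasurable g volume) (hg' : AEStronglyMeasurable g' volume) :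
    wNorm p a lam (fun x => g x + g' x) ≤ wNorm p a lam g + wNorm p a lam g' := by
  unfold wNorm
  simp_rw [mul_add]
  exact eLpNorm_add_le (aestronglyMeasurable_weight_mul hg a lam)
    (aestronglyMeasurable_weight_mul hg' a lam) hp

theorem wNorm_const_mul (p : ℝ≥0∞) (a lam : ℝ) (c : ℂ) (g : Eu d → ℂ) :
    wNorm p a lam (fun x => c * g x) = ‖c‖ₑ * wNorm p a lam g := by
  unfold wNorm
  rw [← eLpNorm_const_smul c]
  congr 1
  ext x
  simp only [Pi.smul_apply, smul_eq_mul]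
  ring

theorem wNorm_mono_norm {p : ℝ≥0∞} {a b l₁ l₂ : ℝ} {g g' : Eu d → ℂ}
    (h : ∀ x, bracketWeight a l₁ x * ‖g x‖ ≤ bracketWeight b l₂ x * ‖g' x‖) :
    wNorm p a l₁ g ≤ wNorm p b l₂ g' := by
  refine eLpNorm_mono fun x => ?_
  rw [norm_mul, norm_mul, Complex.norm_real, Complex.norm_real,
    Real.norm_of_nonneg (bracketWeight_pos _ _ _).le,
    Real.norm_of_nonneg (bracketWeight_pos _ _ _).le]
  exact h x

theorem wNorm_mono_exp {p : ℝ≥0∞} {a b : ℝ} (hab : a ≤ b) (lam : ℝ) (g : Eu d → ℂ) :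
    wNorm p a lam g ≤ wNorm p b lam g :=
  wNorm_mono_norm fun x => by
    gcongr
    exact bracketWeight_mono hab lam x

theorem bracketWeight_eq_rpow (a lam : ℝ) (x : Eu d) :
    bracketWeight a lam x = (1 + ‖lam • x‖ ^ 2) ^ (a / 2) := by
  unfold bracketWeight
  rw [Real.sqrt_eq_rpow, ← Real.rpow_mul (by positivity)]
  congr 1
  ring

theorem hasTemperateGrowth_bracketWeight (a : ℝ) :
    Function.HasTemperateGrowth (fun x : Eu d => (bracketWeight a 1 x : ℂ)) := by
  have h := Function.hasTemperateGrowth_one_add_norm_sq_rpow (Eu d) (a / 2)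
  have h2 : Function.HasTemperateGrowth (fun x : Eu d => (((1 + ‖x‖ ^ 2) ^ (a / 2) : ℝ) : ℂ)) := by
    fun_prop
  convert h2 using 3 with x
  rw [bracketWeight_eq_rpow, one_smul]

theorem integrable_bracketWeight_neg {b : ℝ} (hb : (d : ℝ) < b) :
    Integrable (fun x : Eu d => bracketWeight (-b) 1 x) volume := by
  have h := integrable_rpow_neg_one_add_norm_sq (E := Eu d) (μ := volume) (r := b) (by simpa using hb)
  convert h using 2 with x
  rw [bracketWeight_eq_rpow, one_smul]

/-- A negative power of the bracket is in `L^q` if it decays fast enough. -/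
theorem eLpNorm_bracketWeight_lt_top {q : ℝ≥0∞} (hq : q ≠ 0) {b : ℝ} (hb : 0 ≤ b)
    (hbq : q ≠ ⊤ → (d : ℝ) < b * q.toReal) :
    eLpNorm (fun x : Eu d => (bracketWeight (-b) 1 x : ℂ)) q volume < ⊤ := by
  have hm : AEStronglyMeasurable (fun x : Eu d => (bracketWeight (-b) 1 x : ℂ)) volume :=
    (Complex.continuous_ofReal.comp (continuous_bracketWeight _ 1)).aestronglyMeasurable
  have hn : ∀ x : Eu d, ‖(bracketWeight (-b) 1 x : ℂ)‖ = bracketWeight (-b) 1 x := fun x => by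
    rw [Complex.norm_real, Real.norm_of_nonneg (bracketWeight_pos _ _ _).le]
  by_cases hqt : q = ⊤
  · subst hqt
    refine (memLp_top_of_bound hm 1 (Eventually.of_forall fun x => ?_)).2
    rw [hn]
    exact bracketWeight_le_one (by linarith) 1 x
  · have hq0 : 0 < q.toReal := ENNReal.toReal_pos hq hqt
    refine ((integrable_norm_rpow_iff hm hq hqt).1 ?_).2
    refine (integrable_bracketWeight_neg (hbq hqt)).congr (Eventually.of_forall fun x => ?_)
    simp only
    rw [hn]
    unfold bracketWeight
    rw [← Real.rpow_mul (Real.sqrt_nonneg _)]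
    congr 1
    ring

/-- Hölder's inequality with weights. -/
theorem wNorm_holder {p q r : ℝ≥0∞} [p.HolderTriple q r] {a b c l₁ l₂ l₃ : ℝ}
    {f g : Eu d → ℂ} (hf : AEStronglyMeasurable f volume) (hg : AEStronglyMeasurable g volume)
    (h : ∀ x : Eu d, bracketWeight c l₃ x ≤ bracketWeight a l₁ x * bracketWeight b l₂ x) :
    wNorm r c l₃ (fun x => f x * g x) ≤ wNorm p a l₁ f * wNorm q b l₂ g := by
  have h1 := eLpNorm_smul_le_mul_eLpNorm (p := p) (q := q) (r := r)
    (aestronglyMeasurable_weight_mul hg b l₂) (aestronglyMeasurable_weight_mul hf a l₁)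
  refine le_trans (eLpNorm_mono fun x => ?_) h1
  simp only [Pi.smul_apply', smul_eq_mul, norm_mul, Complex.norm_real,
    Real.norm_of_nonneg (bracketWeight_pos _ _ _).le]
  calc bracketWeight c l₃ x * (‖f x‖ * ‖g x‖)
      ≤ (bracketWeight a l₁ x * bracketWeight b l₂ x) * (‖f x‖ * ‖g x‖) := by
        gcongr; exact h x
    _ = _ := by ring

/-! ### Tempered functions -/

/-- Measurable functions which are integrable against a negative power of the bracket. -/
def TemperedFun (g : Eu d → ℂ) : Prop :=
  AEStronglyMeasurable g volume ∧ ∃ b : ℝ, wNorm 1 (-b) 1 g < ⊤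

/-- Hölder's inequality against `⟨x⟩^{-(d+1)}`, which lies in every `L^q` with `q ≥ 1`. A further
power `|a|` absorbs the weight `⟨lam x⟩^a`; the condition on `lam` makes `⟨lam x⟩ ≤ ⟨x⟩`. -/
theorem exists_decay_of_wNorm_lt_top {p : ℝ≥0∞} (hp : 1 ≤ p) (a : ℝ) {lam : ℝ} (hlam : |lam| ≤ 1)
    {F : Eu d → ℝ≥0∞} (hF : AEMeasurable F)
    (h : eLpNorm (fun x => ENNReal.ofReal (bracketWeight a lam x) * F x) p volume < ⊤) :
    ∃ b : ℝ, ∫⁻ x, ENNReal.ofReal (bracketWeight (-b) 1 x) * F x < ⊤ := by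
  have := ENNReal.HolderConjugate.inv_one_sub_inv' hp
  set q := (1 - p⁻¹)⁻¹ with hq
  have hq1 : 1 ≤ q := by simp [hq]
  have hq0 : q ≠ 0 := (lt_of_lt_of_le one_pos hq1).ne'
  set b₀ : ℝ := d + 1 with hb₀
  have hb₀0 : 0 ≤ b₀ := by positivity
  refine ⟨b₀ + |a|, ?_⟩
  have h1 := lintegral_mul_le_eLpNorm_mul_eLpNorm (μ := (volume : Measure (Eu d)))
    (p := q) (q := p) inferInstance
    (f := fun x => ENNReal.ofReal (bracketWeight (-b₀) 1 x))
    (g := fun x => ENNReal.ofReal (bracketWeight a lam x) * F x)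
    (continuous_bracketWeight _ _).measurable.ennreal_ofReal.aemeasurable
    ((continuous_bracketWeight _ _).measurable.ennreal_ofReal.aemeasurable.mul hF)
  refine lt_of_le_of_lt (le_trans (lintegral_mono fun x => ?_) h1) (ENNReal.mul_lt_top ?_ h)
  · rw [← mul_assoc, ← ENNReal.ofReal_mul (bracketWeight_pos _ _ _).le]
    gcongr
    rw [neg_add, bracketWeight_add]
    gcongr
    · exact (bracketWeight_pos _ _ _).le
    · have h2 : bracketWeight (-a) lam x ≤ bracketWeight |a| 1 x :=
        (bracketWeight_mono (neg_le_abs a) lam x).trans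
          (bracketWeight_mono_lam (abs_nonneg a) (by simpa using hlam) x)
      rw [bracketWeight_neg_eq_inv] at h2 ⊢
      exact inv_le_of_inv_le₀ (bracketWeight_pos _ _ _) h2
  · have h3 := eLpNorm_bracketWeight_lt_top (d := d) hq0 hb₀0 (fun hqt => by
      have : 1 ≤ q.toReal := by
        simpa using ENNReal.toReal_mono hqt hq1
      nlinarith)
    refine lt_of_le_of_lt (eLpNorm_mono_enorm fun x => ?_) h3
    simp only [enorm_eq_self]
    rw [← ofReal_norm, Complex.norm_real, Real.norm_of_nonneg (bracketWeight_pos _ _ _).le]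

theorem wNorm_one_eq (a : ℝ) (g : Eu d → ℂ) :
    wNorm 1 a 1 g = ∫⁻ x, ENNReal.ofReal (bracketWeight a 1 x) * ‖g x‖ₑ := by
  rw [wNorm_eq, eLpNorm_one_eq_lintegral_enorm]
  simp

theorem TemperedFun.of_wNorm {p : ℝ≥0∞} (hp : 1 ≤ p) {a lam : ℝ} (hlam : |lam| ≤ 1)
    {g : Eu d → ℂ} (hg : AEStronglyMeasurable g volume) (h : wNorm p a lam g < ⊤) :
    TemperedFun g := by
  rw [wNorm_eq] at h
  obtain ⟨b, hb⟩ := exists_decay_of_wNorm_lt_top hp a hlam hg.enorm h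
  exact ⟨hg, b, by rwa [wNorm_one_eq]⟩

/-- Decay of Schwartz functions in terms of brackets. -/
theorem schwartz_bound (θ : 𝓢(Eu d, ℂ)) (b : ℝ) :
    ∃ C : ℝ, 0 ≤ C ∧ ∀ x, ‖θ x‖ ≤ C * bracketWeight (-b) 1 x := by
  set θ' := SchwartzMap.smulLeftCLM ℂ (fun x : Eu d => (bracketWeight b 1 x : ℂ)) θ with hθ'
  refine ⟨SchwartzMap.seminorm ℝ 0 0 θ', by positivity, fun x => ?_⟩
  have h := SchwartzMap.norm_le_seminorm ℝ θ' x
  rw [hθ', SchwartzMap.smulLeftCLM_apply_apply (hasTemperateGrowth_bracketWeight b), smul_eq_mul,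
    norm_mul, Complex.norm_real, Real.norm_of_nonneg (bracketWeight_pos _ _ _).le] at h
  rw [bracketWeight_neg_eq_inv, ← div_eq_mul_inv, le_div_iff₀ (bracketWeight_pos _ _ _), mul_comm]
  exact h

theorem schwartz_wNorm_lt_top (θ : 𝓢(Eu d, ℂ)) (p : ℝ≥0∞) (a : ℝ) : wNorm p a 1 θ < ⊤ := by
  have h := (SchwartzMap.smulLeftCLM ℂ (fun x : Eu d => (bracketWeight a 1 x : ℂ)) θ).eLpNorm_lt_top
    p (volume : Measure (Eu d))
  convert h using 1
  unfold wNorm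
  congr 1
  ext x
  rw [SchwartzMap.smulLeftCLM_apply_apply (hasTemperateGrowth_bracketWeight a), smul_eq_mul]

theorem TemperedFun.integrable_mul {g : Eu d → ℂ} (hg : TemperedFun g) (θ : 𝓢(Eu d, ℂ)) :
    Integrable (fun x => θ x * g x) volume := by
  obtain ⟨hm, b, hb⟩ := hg
  have hi : Integrable (fun x => (bracketWeight (-b) 1 x : ℂ) * g x) volume :=
    memLp_one_iff_integrable.1 ⟨aestronglyMeasurable_weight_mul hm _ _, hb⟩
  obtain ⟨C, hC, hθ⟩ := schwartz_bound θ b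
  refine (hi.norm.const_mul C).mono' (θ.continuous.aestronglyMeasurable.mul hm)
    (Eventually.of_forall fun x => ?_)
  rw [norm_mul, norm_mul, Complex.norm_real, Real.norm_of_nonneg (bracketWeight_pos _ _ _).le,
    ← mul_assoc]
  gcongr
  exact hθ x

/-- Every tempered function represents a tempered distribution. -/
theorem TemperedFun.exists_isRepresentedBy {g : Eu d → ℂ} (hg : TemperedFun g) :
    ∃ u : 𝓢'(Eu d, ℂ), IsRepresentedBy u g := by
  have hg' := hg
  obtain ⟨hm, b, hb⟩ := hg
  have hi : MemLp (fun x => (bracketWeight (-b) 1 x : ℂ) * g x) 1 volume :=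
    ⟨aestronglyMeasurable_weight_mul hm _ _, hb⟩
  have : Fact ((1 : ℝ≥0∞) ≤ 1) := ⟨le_rfl⟩
  -- The distribution is `⟨x⟩^b` times the `L¹` function `⟨x⟩^{-b} g`.
  refine ⟨TemperedDistribution.smulLeftCLM ℂ (fun x => (bracketWeight b 1 x : ℂ))
    (Lp.toTemperedDistribution (hi.toLp _)), hm, fun θ => ⟨hg'.integrable_mul θ, ?_⟩⟩
  rw [TemperedDistribution.smulLeftCLM_apply_apply, Lp.toTemperedDistribution_apply]
  refine integral_congr_ae ?_
  filter_upwards [hi.coeFn_toLp] with x hx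
  rw [hx, SchwartzMap.smulLeftCLM_apply_apply (hasTemperateGrowth_bracketWeight b), smul_eq_mul,
    smul_eq_mul]
  have := bracketWeight_neg_mul b 1 x
  have h2 : (bracketWeight (-b) 1 x : ℂ) * bracketWeight b 1 x = 1 := by exact_mod_cast this
  linear_combination (θ x * g x) * h2

/-! ### Representatives -/

theorem exists_schwartz_eq {θ : Eu d → ℂ} (hθ : ContDiff ℝ ∞ θ) (hc : HasCompactSupport θ) :
    ∃ Θ : 𝓢(Eu d, ℂ), ⇑Θ = θ :=
  ⟨hc.toSchwartzMap hθ, rfl⟩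

theorem exists_schwartz_eq_ofReal {θ : Eu d → ℝ} (hθ : ContDiff ℝ ∞ θ)
    (hc : HasCompactSupport θ) : ∃ Θ : 𝓢(Eu d, ℂ), ∀ x, Θ x = θ x := by
  have h1 : ContDiff ℝ ∞ (Complex.ofRealCLM ∘ θ) := by fun_prop
  have h2 : HasCompactSupport (Complex.ofRealCLM ∘ θ) := hc.comp_left rfl
  obtain ⟨Θ, h⟩ := exists_schwartz_eq h1 h2
  exact ⟨Θ, fun x => congrFun h x⟩

theorem _root_.IsRepresentedBy.locallyIntegrable {u : 𝓢'(Eu d, ℂ)} {g : Eu d → ℂ}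
    (h : IsRepresentedBy u g) : LocallyIntegrable g volume := by
  rw [locallyIntegrable_iff]
  intro k hk
  obtain ⟨r, hr0, hr⟩ : ∃ r : ℝ, 0 < r ∧ k ⊆ Metric.closedBall 0 r := by
    obtain ⟨r, hr⟩ := hk.isBounded.subset_closedBall (0 : Eu d)
    exact ⟨max r 1, by positivity, hr.trans (Metric.closedBall_subset_closedBall (le_max_left _ _))⟩
  let β : ContDiffBump (0 : Eu d) := ⟨r, r + 1, hr0, by linarith⟩
  obtain ⟨Θ, hΘ⟩ := exists_schwartz_eq_ofReal (β.contDiff (n := ⊤)) β.hasCompactSupport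
  have h1 := ((h.2 Θ).1).integrableOn (s := k)
  refine h1.congr_fun (fun x hx => ?_) hk.measurableSet
  have h2 : β x = 1 := β.one_of_mem_closedBall (hr hx)
  simp [hΘ, h2]

theorem _root_.IsRepresentedBy.ae_eq {u : 𝓢'(Eu d, ℂ)} {g g' : Eu d → ℂ}
    (h : IsRepresentedBy u g) (h' : IsRepresentedBy u g') : g =ᵐ[volume] g' := by
  refine ae_eq_of_integral_contDiff_smul_eq h.locallyIntegrable h'.locallyIntegrable
    fun θ hθ hc => ?_
  obtain ⟨Θ, hΘ⟩ := exists_schwartz_eq_ofReal hθ hc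
  have h1 := (h.2 Θ).2
  rw [(h'.2 Θ).2] at h1
  simpa [hΘ] using h1.symm

theorem _root_.IsRepresentedBy.congr {u : 𝓢'(Eu d, ℂ)} {g g' : Eu d → ℂ}
    (h : IsRepresentedBy u g) (h' : g =ᵐ[volume] g') : IsRepresentedBy u g' := by
  refine ⟨h.1.congr h', fun θ => ?_⟩
  have e : (fun x => θ x * g x) =ᵐ[volume] fun x => θ x * g' x := by
    filter_upwards [h'] with x hx
    rw [hx]
  exact ⟨(h.2 θ).1.congr e, (h.2 θ).2.trans (integral_congr_ae e)⟩

theorem _root_.IsRepresentedBy.unique {u v : 𝓢'(Eu d, ℂ)} {g : Eu d → ℂ}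
    (h : IsRepresentedBy u g) (h' : IsRepresentedBy v g) : u = v := by
  ext θ
  rw [(h.2 θ).2, (h'.2 θ).2]

theorem _root_.IsRepresentedBy.add {u v : 𝓢'(Eu d, ℂ)} {g g' : Eu d → ℂ}
    (h : IsRepresentedBy u g) (h' : IsRepresentedBy v g') :
    IsRepresentedBy (u + v) (fun x => g x + g' x) := by
  refine ⟨h.1.add h'.1, fun θ => ?_⟩
  simp_rw [mul_add]
  refine ⟨(h.2 θ).1.add (h'.2 θ).1, ?_⟩
  rw [integral_add (h.2 θ).1 (h'.2 θ).1, ← (h.2 θ).2, ← (h'.2 θ).2]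
  rfl

theorem _root_.IsRepresentedBy.smul {u : 𝓢'(Eu d, ℂ)} {g : Eu d → ℂ}
    (h : IsRepresentedBy u g) (c : ℂ) : IsRepresentedBy (c • u) (fun x => c * g x) := by
  refine ⟨h.1.const_mul c, fun θ => ?_⟩
  have e : (fun x => θ x * (c * g x)) = fun x => c * (θ x * g x) := by ext x; ring
  rw [e]
  refine ⟨(h.2 θ).1.const_mul c, ?_⟩
  rw [integral_const_mul, ← (h.2 θ).2]
  rfl

theorem isRepresentedBy_zero : IsRepresentedBy (0 : 𝓢'(Eu d, ℂ)) (fun _ => 0) :=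
  ⟨aestronglyMeasurable_const, fun θ => by simp⟩

theorem _root_.IsRepresentedBy.sub {u v : 𝓢'(Eu d, ℂ)} {g g' : Eu d → ℂ}
    (h : IsRepresentedBy u g) (h' : IsRepresentedBy v g') :
    IsRepresentedBy (u - v) (fun x => g x - g' x) := by
  have := h.add (h'.smul (-1))
  have e : u - v = u + (-1 : ℂ) • v := by
    ext θ
    change u θ - v θ = u θ + (-1 : ℂ) * v θ
    ring
  rw [e]
  convert this using 2 with x
  ring

theorem _root_.IsRepresentedBy.sum {ι : Type*} (s : Finset ι) {u : ι → 𝓢'(Eu d, ℂ)}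
    {g : ι → Eu d → ℂ} (h : ∀ i ∈ s, IsRepresentedBy (u i) (g i)) :
    IsRepresentedBy (∑ i ∈ s, u i) (fun x => ∑ i ∈ s, g i x) := by
  classical
  induction s using Finset.induction_on with
  | empty => simpa using isRepresentedBy_zero
  | insert a s ha ih =>
    simp only [Finset.sum_insert ha]
    exact (h a (Finset.mem_insert_self a s)).add
      (ih fun i hi => h i (Finset.mem_insert_of_mem hi))

/-- All representatives agree almost everywhere, so the infimum in the definition of the norm is
over equal values. -/
theorem _root_.IsRepresentedBy.weightedLpNorm_eq {u : 𝓢'(Eu d, ℂ)} {g : Eu d → ℂ}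
    (h : IsRepresentedBy u g) (p : ℝ≥0∞) (a lam : ℝ) :
    weightedLpNorm p (bracketWeight a lam) u = wNorm p a lam g := by
  refine le_antisymm (iInf₂_le g h) (le_iInf₂ fun g' h' => ?_)
  exact (wNorm_congr (h.ae_eq h')).le

theorem exists_isRepresentedBy_of_lt_top {u : 𝓢'(Eu d, ℂ)} {p : ℝ≥0∞} {a lam : ℝ}
    (h : weightedLpNorm p (bracketWeight a lam) u < ⊤) :
    ∃ g, IsRepresentedBy u g ∧ wNorm p a lam g < ⊤ := by
  simp only [weightedLpNorm, iInf_lt_iff] at h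
  obtain ⟨g, hg, h⟩ := h
  exact ⟨g, hg, h⟩

/-! ### Convolution of tempered functions -/

/-- The convolution of `K` and `g` converges absolutely and is a tempered function. -/
def ConvPair (K g : Eu d → ℂ) : Prop :=
  AEStronglyMeasurable K volume ∧ AEStronglyMeasurable g volume ∧
    ∃ b : ℝ, ∫⁻ x, ENNReal.ofReal (bracketWeight (-b) 1 x) *
      econv (fun z => ‖K z‖ₑ) (fun z => ‖g z‖ₑ) x < ⊤

theorem aestronglyMeasurable_conv_integrand {K g : Eu d → ℂ} (hK : AEStronglyMeasurable K volume)
    (hg : AEStronglyMeasurable g volume) :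
    AEStronglyMeasurable (fun p : Eu d × Eu d => K (p.1 - p.2) * g p.2) (volume.prod volume) :=
  (hK.comp_quasiMeasurePreserving (quasiMeasurePreserving_sub volume volume)).mul hg.comp_snd

theorem aestronglyMeasurable_conv {K g : Eu d → ℂ} (hK : AEStronglyMeasurable K volume)
    (hg : AEStronglyMeasurable g volume) : AEStronglyMeasurable (conv K g) volume :=
  (aestronglyMeasurable_conv_integrand hK hg).integral_prod_right'

theorem integrable_of_econv_lt_top {K g : Eu d → ℂ} (hK : AEStronglyMeasurable K volume)
    (hg : AEStronglyMeasurable g volume) {x : Eu d}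
    (h : econv (fun z => ‖K z‖ₑ) (fun z => ‖g z‖ₑ) x < ⊤) :
    Integrable (fun y => K (x - y) * g y) volume := by
  refine ⟨(hK.comp_quasiMeasurePreserving
    (quasiMeasurePreserving_sub_left_of_right_invariant volume x)).mul hg, ?_⟩
  refine lt_of_le_of_lt (le_of_eq ?_) h
  simp [econv, enorm_mul]

theorem ConvPair.ae_lt_top {K g : Eu d → ℂ} (h : ConvPair K g) :
    ∀ᵐ x, econv (fun z => ‖K z‖ₑ) (fun z => ‖g z‖ₑ) x < ⊤ := by
  obtain ⟨hK, hg, b, hb⟩ := h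
  filter_upwards [ae_lt_top' ((continuous_bracketWeight _ _).measurable.ennreal_ofReal.aemeasurable.mul
    (aemeasurable_econv hK.enorm hg.enorm)) hb.ne] with x hx
  have h0 : ENNReal.ofReal (bracketWeight (-b) 1 x) ≠ 0 := by
    simpa using bracketWeight_pos (-b) 1 x
  by_contra h1
  rw [not_lt, top_le_iff] at h1
  simp only [Pi.mul_apply, h1, ENNReal.mul_top h0, lt_self_iff_false] at hx

theorem ConvPair.ae_integrable {K g : Eu d → ℂ} (h : ConvPair K g) :
    ∀ᵐ x, Integrable (fun y => K (x - y) * g y) volume := by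
  filter_upwards [h.ae_lt_top] with x hx
  exact integrable_of_econv_lt_top h.1 h.2.1 hx

theorem ConvPair.tempered {K g : Eu d → ℂ} (h : ConvPair K g) : TemperedFun (conv K g) := by
  obtain ⟨hK, hg, b, hb⟩ := h
  refine ⟨aestronglyMeasurable_conv hK hg, b, lt_of_le_of_lt ?_ hb⟩
  rw [wNorm_one_eq]
  gcongr with x
  exact enorm_conv_le K g x

theorem conv_congr_right (K : Eu d → ℂ) {g g' : Eu d → ℂ} (hg : g =ᵐ[volume] g') :
    conv K g = conv K g' := by
  ext x
  refine integral_congr_ae ?_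
  filter_upwards [hg] with y hy
  rw [hy]

theorem convPair_of_wNorm {K g : Eu d → ℂ} (hK : AEStronglyMeasurable K volume)
    (hg : AEStronglyMeasurable g volume) {s p r : ℝ≥0∞} (hs : 1 ≤ s) (hp : 1 ≤ p) (hr : 1 ≤ r)
    (hspr : s⁻¹ + p⁻¹ = 1 + r⁻¹) {a lam : ℝ} (ha : 0 ≤ a) (hlam : |lam| ≤ 1)
    (h1 : wNorm s (-a) lam K < ⊤) (h2 : wNorm p a lam g < ⊤) : ConvPair K g :=
  ⟨hK, hg, exists_decay_of_wNorm_lt_top hr (-a) hlam (aemeasurable_econv hK.enorm hg.enorm)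
    (lt_of_le_of_lt (eLpNorm_econv_dual_le hK hg hs hp hspr ha lam)
      (ENNReal.mul_lt_top (by simp) (ENNReal.mul_lt_top h1 h2)))⟩

theorem convPair_schwartz (κ : 𝓢(Eu d, ℂ)) {g : Eu d → ℂ} (hg : TemperedFun g) :
    ConvPair κ g := by
  obtain ⟨hm, b, hb⟩ := hg
  refine ⟨κ.continuous.aestronglyMeasurable, hm, b, ?_⟩
  have h := eLpNorm_econv_same_le κ.continuous.aestronglyMeasurable hm (s := 1) (p := 1) (r := 1)
    le_rfl le_rfl (by simp) (-b) 1
  rw [eLpNorm_one_eq_lintegral_enorm] at h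
  simp only [enorm_eq_self] at h
  exact lt_of_le_of_lt h (ENNReal.mul_lt_top (by simp)
    (ENNReal.mul_lt_top (schwartz_wNorm_lt_top _ _ _) hb))

/-- By Peetre's inequality a Schwartz kernel is dominated by a multiple of `⟨x⟩^{|b|} ⟨y⟩^{-b}`.
This yields finiteness at every point and not merely almost everywhere, so the associativity laws
below hold as equalities of functions. -/
theorem econv_schwartz_lt_top (κ : 𝓢(Eu d, ℂ)) {h : Eu d → ℝ≥0∞} {b : ℝ}
    (hb : ∫⁻ x, ENNReal.ofReal (bracketWeight (-b) 1 x) * h x < ⊤) (x : Eu d) :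
    econv (fun z => ‖κ z‖ₑ) h x < ⊤ := by
  obtain ⟨C, hC, hκ⟩ := schwartz_bound κ |(-b)|
  set D : ℝ := C * (Real.sqrt 2 ^ |b| * bracketWeight |b| 1 x) with hD
  have key : ∀ y, ‖κ (x - y)‖ₑ ≤ ENNReal.ofReal D * ENNReal.ofReal (bracketWeight (-b) 1 y) := by
    intro y
    have hD0 : 0 ≤ D := by
      have := bracketWeight_pos |b| 1 x
      positivity
    rw [← ENNReal.ofReal_mul hD0, ← ofReal_norm]
    apply ENNReal.ofReal_le_ofReal
    refine (hκ _).trans ?_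
    rw [hD, mul_assoc]
    gcongr
    have h1 := bracketWeight_le_sub_mul (-(|b|)) 1 (x - y) (-y)
    have e : x - y - -y = x := by abel
    rw [e, bracketWeight_neg_apply, abs_neg, abs_abs] at h1
    rw [abs_neg]
    refine h1.trans ?_
    have := bracketWeight_pos |b| 1 x
    gcongr
    exact bracketWeight_mono (by simpa using le_abs_self b) 1 y
  refine lt_of_le_of_lt (lintegral_mono fun y => mul_le_mul_left (key y) (h y)) ?_
  simp_rw [mul_assoc]
  rw [lintegral_const_mul' _ _ (by simp)]
  exact ENNReal.mul_lt_top (by simp) hb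

/-- Convolution with a Schwartz function is associative. -/
theorem conv_schwartz_conv (κ : 𝓢(Eu d, ℂ)) {K g : Eu d → ℂ} (h : ConvPair K g) :
    conv κ (conv K g) = conv (conv κ K) g := by
  obtain ⟨hK, hg, b, hb⟩ := h
  ext x
  have hfin := econv_schwartz_lt_top κ hb x
  have hm : AEStronglyMeasurable (fun p : Eu d × Eu d => κ (x - p.1) * (K (p.1 - p.2) * g p.2))
      (volume.prod volume) := by
    refine AEStronglyMeasurable.mul ?_ (aestronglyMeasurable_conv_integrand hK hg)
    exact (κ.continuous.comp (by fun_prop : Continuous fun p : Eu d × Eu d =>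
      x - p.1)).aestronglyMeasurable
  have hint : Integrable (fun p : Eu d × Eu d => κ (x - p.1) * (K (p.1 - p.2) * g p.2))
      (volume.prod volume) := by
    refine ⟨hm, ?_⟩
    unfold HasFiniteIntegral
    rw [lintegral_prod _ hm.enorm]
    refine lt_of_le_of_lt (le_of_eq ?_) hfin
    unfold econv
    congr 1
    ext y
    rw [← lintegral_const_mul' _ _ (by simp)]
    simp [enorm_mul]
  calc conv κ (conv K g) x = ∫ y, ∫ z, κ (x - y) * (K (y - z) * g z) := by
        unfold conv
        simp_rw [integral_const_mul]
    _ = ∫ z, ∫ y, κ (x - y) * (K (y - z) * g z) := integral_integral_swap hint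
    _ = conv (conv κ K) g x := by
        unfold conv
        congr 1
        ext z
        rw [← integral_mul_const, ← integral_add_right_eq_self _ z]
        congr 1
        ext y
        rw [add_sub_cancel_right, sub_add_eq_sub_sub_swap, mul_assoc]

theorem conv_comm (K g : Eu d → ℂ) : conv K g = conv g K := by
  ext x
  unfold conv
  rw [← integral_sub_left_eq_self _ volume x]
  congr 1
  ext y
  rw [sub_sub_cancel, mul_comm]

/-- The convolution with a Schwartz function commutes with other convolutions. -/
theorem conv_conv_schwartz_comm (κ : 𝓢(Eu d, ℂ)) {K g : Eu d → ℂ} (h : ConvPair K g)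
    (hκ : ∀ x, econv (fun z => ‖K z‖ₑ) (econv (fun z => ‖κ z‖ₑ) (fun z => ‖g z‖ₑ)) x < ⊤) :
    conv K (conv κ g) = conv (conv κ K) g := by
  obtain ⟨hK, hg, b, hb⟩ := h
  ext x
  have hm : AEStronglyMeasurable (fun p : Eu d × Eu d => K (x - p.1) * (κ (p.1 - p.2) * g p.2))
      (volume.prod volume) := by
    refine AEStronglyMeasurable.mul ?_
      (aestronglyMeasurable_conv_integrand κ.continuous.aestronglyMeasurable hg)
    exact (hK.comp_quasiMeasurePreserving
      (quasiMeasurePreserving_sub_left_of_right_invariant volume x)).comp_fst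
  have hint : Integrable (fun p : Eu d × Eu d => K (x - p.1) * (κ (p.1 - p.2) * g p.2))
      (volume.prod volume) := by
    refine ⟨hm, ?_⟩
    unfold HasFiniteIntegral
    rw [lintegral_prod _ hm.enorm]
    refine lt_of_le_of_lt (le_of_eq ?_) (hκ x)
    unfold econv
    congr 1
    ext y
    rw [← lintegral_const_mul' _ _ (by simp)]
    simp [enorm_mul]
  calc conv K (conv κ g) x = ∫ y, ∫ z, K (x - y) * (κ (y - z) * g z) := by
        unfold conv
        simp_rw [integral_const_mul]
    _ = ∫ z, ∫ y, K (x - y) * (κ (y - z) * g z) := integral_integral_swap hint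
    _ = conv (conv κ K) g x := by
        rw [conv_comm κ K]
        unfold conv
        congr 1
        ext z
        rw [← integral_mul_const, ← integral_add_right_eq_self _ z]
        congr 1
        ext y
        rw [add_sub_cancel_right, sub_add_eq_sub_sub_swap, mul_assoc]

/-! ### Convolutions and Fourier transforms -/

theorem fourier_eq_fourierInv_neg (f : Eu d → ℂ) (x : Eu d) : 𝓕 f x = 𝓕⁻ f (-x) := by
  rw [Real.fourierInv_eq_fourier_neg, neg_neg]

theorem integral_fourierInv_mul_eq {f g : Eu d → ℂ} (hf : Integrable f) (hg : Integrable g) :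
    ∫ x, 𝓕⁻ f x * g x = ∫ ξ, f ξ * 𝓕⁻ g ξ := by
  have h := VectorFourier.integral_fourierIntegral_smul_eq_flip (L := -(innerₗ (Eu d)))
    (μ := volume) (ν := volume) Real.continuous_fourierChar
    (continuous_inner.neg : Continuous fun p : Eu d × Eu d => -inner ℝ p.1 p.2) hf hg
  simp only [smul_eq_mul] at h
  have e1 : ∀ f : Eu d → ℂ, VectorFourier.fourierIntegral Real.fourierChar volume
      (-(innerₗ (Eu d))) f = 𝓕⁻ f := by
    intro f
    ext ξ
    simp [VectorFourier.fourierIntegral, Real.fourierInv_eq]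
  have e2 : ∀ f : Eu d → ℂ, VectorFourier.fourierIntegral Real.fourierChar volume
      (-(innerₗ (Eu d))).flip f = 𝓕⁻ f := by
    intro f
    ext ξ
    simp [VectorFourier.fourierIntegral, Real.fourierInv_eq, real_inner_comm]
  rw [e1, e2] at h
  exact h

theorem fourierInv_shift (h : Eu d → ℂ) (x y : Eu d) :
    𝓕⁻ h (x - y) = 𝓕⁻ (fun ξ => Real.fourierChar (-inner ℝ ξ y) • h ξ) x := by
  rw [Real.fourierInv_eq, Real.fourierInv_eq]
  congr 1
  ext ξ
  rw [smul_smul, inner_sub_right, sub_eq_add_neg, AddChar.map_add_eq_mul]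

theorem conv_fourierInv {h f : Eu d → ℂ} (hh : Integrable h) (hf : Integrable f) :
    conv (𝓕⁻ h) f = 𝓕⁻ (fun ξ => h ξ * 𝓕 f ξ) := by
  ext x
  have hm : AEStronglyMeasurable (fun p : Eu d × Eu d =>
      Real.fourierChar (inner ℝ p.2 (x - p.1)) • (h p.2 * f p.1)) (volume.prod volume) := by
    refine AEStronglyMeasurable.smul ?_ (hh.1.comp_snd.mul hf.1.comp_fst)
    exact (continuous_subtype_val.comp (Real.continuous_fourierChar.comp (by fun_prop :
      Continuous fun p : Eu d × Eu d => (inner ℝ p.2 (x - p.1) : ℝ)))).aestronglyMeasurable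
  have hint : Integrable (fun p : Eu d × Eu d =>
      Real.fourierChar (inner ℝ p.2 (x - p.1)) • (h p.2 * f p.1)) (volume.prod volume) := by
    refine (hf.norm.mul_prod hh.norm).mono' hm (Eventually.of_forall fun p => ?_)
    simp [mul_comm]
  calc conv (𝓕⁻ h) f x
      = ∫ y, ∫ ξ, Real.fourierChar (inner ℝ ξ (x - y)) • (h ξ * f y) := by
        unfold conv
        congr 1
        ext y
        rw [Real.fourierInv_eq, ← integral_mul_const]
        simp only [Circle.smul_def, smul_eq_mul, mul_assoc]
    _ = ∫ ξ, ∫ y, Real.fourierChar (inner ℝ ξ (x - y)) • (h ξ * f y) :=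
        integral_integral_swap hint
    _ = 𝓕⁻ (fun ξ => h ξ * 𝓕 f ξ) x := by
        rw [Real.fourierInv_eq]
        congr 1
        ext ξ
        rw [Real.fourier_eq, ← integral_const_mul, Circle.smul_def, ← integral_smul]
        congr 1
        ext y
        rw [inner_sub_right, sub_eq_add_neg, AddChar.map_add_eq_mul, real_inner_comm y ξ]
        simp only [Circle.smul_def, smul_eq_mul, Circle.coe_mul]
        ring

theorem ConvPair.integrable_prod {K g : Eu d → ℂ} (h : ConvPair K g) (θ : 𝓢(Eu d, ℂ)) :
    Integrable (fun p : Eu d × Eu d => θ p.1 * (K (p.1 - p.2) * g p.2))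
      (volume.prod volume) := by
  obtain ⟨hK, hg, b, hb⟩ := h
  have hm : AEStronglyMeasurable (fun p : Eu d × Eu d => θ p.1 * (K (p.1 - p.2) * g p.2))
      (volume.prod volume) :=
    (θ.continuous.aestronglyMeasurable.comp_fst).mul (aestronglyMeasurable_conv_integrand hK hg)
  refine ⟨hm, ?_⟩
  unfold HasFiniteIntegral
  rw [lintegral_prod _ hm.enorm]
  obtain ⟨C, hC, hθ⟩ := schwartz_bound θ b
  refine lt_of_le_of_lt (lintegral_mono (g := fun x => ENNReal.ofReal C *
    (ENNReal.ofReal (bracketWeight (-b) 1 x) * econv (fun z => ‖K z‖ₑ) (fun z => ‖g z‖ₑ) x))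
    fun x => ?_) ?_
  · simp only [enorm_mul]
    rw [lintegral_const_mul' _ _ (by simp), ← mul_assoc, ← ENNReal.ofReal_mul hC, ← ofReal_norm]
    gcongr
    · exact hθ x
    · exact le_rfl
  · rw [lintegral_const_mul' _ _ (by simp)]
    exact ENNReal.mul_lt_top (by simp) hb

/-- The transpose of a multiplier, acting on test functions, is convolution with the reflected
kernel; this is Fourier duality after a modulation of `b`. -/
theorem fourier_smulLeft_fourierInv_apply (b θ : 𝓢(Eu d, ℂ)) (y : Eu d) :
    (𝓕 (SchwartzMap.smulLeftCLM ℂ b (𝓕⁻ θ)) : 𝓢(Eu d, ℂ)) y =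
      ∫ x, (𝓕⁻ b : 𝓢(Eu d, ℂ)) (x - y) * θ x := by
  have h1 : ∀ x, (𝓕⁻ b : 𝓢(Eu d, ℂ)) (x - y) =
      𝓕⁻ (fun ξ => Real.fourierChar (-inner ℝ ξ y) • b ξ) x := fun x => by
    rw [SchwartzMap.fourierInv_coe, fourierInv_shift]
  simp_rw [h1]
  rw [integral_fourierInv_mul_eq _ θ.integrable, SchwartzMap.fourier_coe, Real.fourier_eq]
  · congr 1
    ext ξ
    rw [SchwartzMap.smulLeftCLM_apply_apply b.hasTemperateGrowth, SchwartzMap.fourierInv_coe]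
    simp only [Circle.smul_def, smul_eq_mul]
    ring
  · refine b.integrable.norm.mono' (AEStronglyMeasurable.smul ?_
      b.continuous.aestronglyMeasurable) (Eventually.of_forall fun ξ => by simp)
    exact (continuous_subtype_val.comp (Real.continuous_fourierChar.comp (by fun_prop :
      Continuous fun ξ : Eu d => (-inner ℝ ξ y : ℝ)))).aestronglyMeasurable

/-- A Fourier multiplier with Schwartz symbol acts on tempered functions by convolution. -/
theorem _root_.IsRepresentedBy.fourierMultiplier {u : 𝓢'(Eu d, ℂ)} {g : Eu d → ℂ}
    (h : IsRepresentedBy u g) (hg : TemperedFun g) (b : 𝓢(Eu d, ℂ)) :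
    IsRepresentedBy (TemperedDistribution.fourierMultiplierCLM ℂ b u)
      (conv ⇑(𝓕⁻ b : 𝓢(Eu d, ℂ)) g) := by
  have hcp : ConvPair ⇑(𝓕⁻ b : 𝓢(Eu d, ℂ)) g := convPair_schwartz _ hg
  refine ⟨hcp.tempered.1, fun θ => ⟨hcp.tempered.integrable_mul θ, ?_⟩⟩
  rw [TemperedDistribution.fourierMultiplierCLM_apply_apply, (h.2 _).2]
  simp_rw [fourier_smulLeft_fourierInv_apply]
  calc ∫ y, (∫ x, (𝓕⁻ b : 𝓢(Eu d, ℂ)) (x - y) * θ x) * g y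
      = ∫ y, ∫ x, θ x * ((𝓕⁻ b : 𝓢(Eu d, ℂ)) (x - y) * g y) := by
        congr 1
        ext y
        rw [← integral_mul_const]
        congr 1
        ext x
        ring
    _ = ∫ x, ∫ y, θ x * ((𝓕⁻ b : 𝓢(Eu d, ℂ)) (x - y) * g y) :=
        (integral_integral_swap (hcp.integrable_prod θ)).symm
    _ = ∫ x, θ x * conv ⇑(𝓕⁻ b : 𝓢(Eu d, ℂ)) g x := by
        unfold conv
        simp_rw [integral_const_mul]

/-! ### One-dimensional Cauchy kernels -/

/-- Off the real axis, `1 / (t - z)` is the Fourier transform of a bounded integrable function. -/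
theorem exists_fourier_eq_inv_sub {z : ℂ} (hz : z.im ≠ 0) :
    ∃ k : ℝ → ℂ, Integrable k ∧ (∀ σ, ‖k σ‖ ≤ 2 * Real.pi) ∧ ∀ t : ℝ, 𝓕 k t = ((t : ℂ) - z)⁻¹ := by
  have hπ : (Real.pi : ℂ) ≠ 0 := by exact_mod_cast Real.pi_ne_zero
  have hre : ∀ (w : ℂ), (2 * Real.pi * Complex.I * w).re = -(2 * Real.pi * w.im) := by
    intro w
    simp [Complex.mul_re, Complex.mul_im]
  have hnorm : ∀ σ : ℝ, ‖2 * Real.pi * Complex.I * Complex.exp (2 * Real.pi * Complex.I * z * σ)‖ =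
      2 * Real.pi * Real.exp (-(2 * Real.pi * z.im * σ)) := by
    intro σ
    rw [norm_mul, Complex.norm_exp]
    simp [Complex.mul_re, Complex.mul_im, abs_of_pos Real.pi_pos]
  have hsub : ∀ t : ℝ, (t : ℂ) - z ≠ 0 := by
    intro t h
    apply hz
    have := congrArg Complex.im h
    simpa using this
  -- The function is a one-sided exponential `e^{2πizσ}`, supported on the half-line on which it
  -- decays. Its modulus there is at most `1`, whence the bound `2π` independent of `z`.
  rcases lt_or_gt_of_ne hz with h | h
  · refine ⟨(Set.Iic 0).indicator fun σ =>
      -(2 * Real.pi * Complex.I * Complex.exp (2 * Real.pi * Complex.I * z * σ)), ?_, ?_, ?_⟩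
    · rw [integrable_indicator_iff measurableSet_Iic]
      refine ((integrableOn_exp_mul_complex_Iic (a := 2 * Real.pi * Complex.I * z) ?_ 0).const_mul
        (2 * Real.pi * Complex.I)).neg
      rw [hre]
      nlinarith [Real.pi_pos]
    · intro σ
      by_cases hσ : σ ∈ Set.Iic (0 : ℝ)
      · rw [Set.indicator_of_mem hσ, norm_neg, hnorm]
        have : Real.exp (-(2 * Real.pi * z.im * σ)) ≤ 1 := by
          rw [Real.exp_le_one_iff]
          have h1 : 0 ≤ z.im * σ := mul_nonneg_of_nonpos_of_nonpos h.le hσ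
          nlinarith [Real.pi_pos]
        nlinarith [Real.pi_pos]
      · rw [Set.indicator_of_notMem hσ, norm_zero]
        positivity
    · intro t
      rw [Real.fourier_eq']
      have e : ∀ v : ℝ, Complex.exp (((-2 * Real.pi * inner ℝ v t : ℝ) : ℂ) * Complex.I) •
          (Set.Iic 0).indicator (fun σ : ℝ => -(2 * Real.pi * Complex.I *
            Complex.exp (2 * Real.pi * Complex.I * z * σ))) v =
          (Set.Iic 0).indicator (fun σ : ℝ => -(2 * Real.pi * Complex.I) *
            Complex.exp (2 * Real.pi * Complex.I * (z - t) * σ)) v := by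
        intro v
        by_cases hv : v ∈ Set.Iic (0 : ℝ)
        · rw [Set.indicator_of_mem hv, Set.indicator_of_mem hv, smul_eq_mul]
          have : Complex.exp (2 * Real.pi * Complex.I * (z - t) * v) =
              Complex.exp (((-2 * Real.pi * inner ℝ v t : ℝ) : ℂ) * Complex.I) *
              Complex.exp (2 * Real.pi * Complex.I * z * v) := by
            rw [← Complex.exp_add]
            congr 1
            simp
            ring
          rw [this]
          ring
        · rw [Set.indicator_of_notMem hv, Set.indicator_of_notMem hv, smul_zero]
      simp_rw [e]
      rw [integral_indicator measurableSet_Iic, integral_const_mul,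
        integral_exp_mul_complex_Iic (a := 2 * Real.pi * Complex.I * (z - t))]
      · have h1 := hsub t
        have h2 : z - t ≠ 0 := by
          rw [← neg_sub]; exact neg_ne_zero.2 h1
        simp only [Complex.ofReal_zero, mul_zero, Complex.exp_zero]
        field_simp
        ring
      · rw [hre]
        simp only [Complex.sub_im, Complex.ofReal_im, sub_zero]
        nlinarith [Real.pi_pos]
  · refine ⟨(Set.Ioi 0).indicator fun σ =>
      2 * Real.pi * Complex.I * Complex.exp (2 * Real.pi * Complex.I * z * σ), ?_, ?_, ?_⟩
    · rw [integrable_indicator_iff measurableSet_Ioi]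
      refine (integrableOn_exp_mul_complex_Ioi (a := 2 * Real.pi * Complex.I * z) ?_ 0).const_mul
        (2 * Real.pi * Complex.I)
      rw [hre]
      nlinarith [Real.pi_pos]
    · intro σ
      by_cases hσ : σ ∈ Set.Ioi (0 : ℝ)
      · rw [Set.indicator_of_mem hσ, hnorm]
        have : Real.exp (-(2 * Real.pi * z.im * σ)) ≤ 1 := by
          rw [Real.exp_le_one_iff]
          have h1 : 0 ≤ z.im * σ := mul_nonneg h.le (le_of_lt hσ)
          nlinarith [Real.pi_pos]
        nlinarith [Real.pi_pos]
      · rw [Set.indicator_of_notMem hσ, norm_zero]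
        positivity
    · intro t
      rw [Real.fourier_eq']
      have e : ∀ v : ℝ, Complex.exp (((-2 * Real.pi * inner ℝ v t : ℝ) : ℂ) * Complex.I) •
          (Set.Ioi 0).indicator (fun σ : ℝ => 2 * Real.pi * Complex.I *
            Complex.exp (2 * Real.pi * Complex.I * z * σ)) v =
          (Set.Ioi 0).indicator (fun σ : ℝ => (2 * Real.pi * Complex.I) *
            Complex.exp (2 * Real.pi * Complex.I * (z - t) * σ)) v := by
        intro v
        by_cases hv : v ∈ Set.Ioi (0 : ℝ)
        · rw [Set.indicator_of_mem hv, Set.indicator_of_mem hv, smul_eq_mul]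
          have : Complex.exp (2 * Real.pi * Complex.I * (z - t) * v) =
              Complex.exp (((-2 * Real.pi * inner ℝ v t : ℝ) : ℂ) * Complex.I) *
              Complex.exp (2 * Real.pi * Complex.I * z * v) := by
            rw [← Complex.exp_add]
            congr 1
            simp
            ring
          rw [this]
          ring
        · rw [Set.indicator_of_notMem hv, Set.indicator_of_notMem hv, smul_zero]
      simp_rw [e]
      rw [integral_indicator measurableSet_Ioi, integral_const_mul,
        integral_exp_mul_complex_Ioi (a := 2 * Real.pi * Complex.I * (z - t))]
      · have h1 := hsub t
        have h2 : z - t ≠ 0 := by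
          rw [← neg_sub]; exact neg_ne_zero.2 h1
        simp only [Complex.ofReal_zero, mul_zero, Complex.exp_zero]
        field_simp
        ring
      · rw [hre]
        simp only [Complex.sub_im, Complex.ofReal_im, sub_zero]
        nlinarith [Real.pi_pos]

open Convolution in
-- With `1/(t-z) = 𝓕 k` the product `𝓕 v · 𝓕 k` is the transform of `v ⋆ k`, which is bounded by `2π
-- ‖v‖₁`. Moving the transform to the other factor and inverting leaves `u(-t)`. The point is that
-- the bound does not see the distance of `z` to the real axis.
theorem norm_integral_fourier_mul_inv_sub_le {u v : ℝ → ℂ} (hu : Integrable u)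
    (huc : Continuous u) (hFu : Integrable (𝓕 u)) (hv : Integrable v) {z : ℂ} (hz : z.im ≠ 0) :
    ‖∫ t : ℝ, 𝓕 u t * 𝓕 v t * ((t : ℂ) - z)⁻¹‖ ≤ 2 * Real.pi * (∫ t, ‖u t‖) * ∫ t, ‖v t‖ := by
  obtain ⟨k, hk, hkb, hkF⟩ := exists_fourier_eq_inv_sub hz
  set w := v ⋆[ContinuousLinearMap.mul ℂ ℂ, volume] k with hw
  have hwi : Integrable w := hv.integrable_convolution _ hk
  have hFw : ∀ t, 𝓕 w t = 𝓕 v t * ((t : ℂ) - z)⁻¹ := fun t => by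
    rw [hw, Real.fourier_mul_convolution_eq hv hk, hkF]
  have hwb : ∀ x, ‖w x‖ ≤ 2 * Real.pi * ∫ t, ‖v t‖ := by
    intro x
    rw [← integral_const_mul]
    refine norm_integral_le_of_norm_le (hv.norm.const_mul _) (Eventually.of_forall fun t => ?_)
    simp only [ContinuousLinearMap.mul_apply', norm_mul]
    rw [mul_comm]
    gcongr
    exact hkb _
  have h1 : ∫ t : ℝ, 𝓕 u t * 𝓕 v t * ((t : ℂ) - z)⁻¹ = ∫ t, 𝓕 (𝓕 u) t * w t := by
    have h := VectorFourier.integral_fourierIntegral_smul_eq_flip (L := innerₗ ℝ)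
      (μ := volume) (ν := volume) Real.continuous_fourierChar continuous_inner hFu hwi
    have e1 : ∀ f : ℝ → ℂ, VectorFourier.fourierIntegral Real.fourierChar volume
        (innerₗ ℝ) f = 𝓕 f := fun f => rfl
    have e2 : ∀ f : ℝ → ℂ, VectorFourier.fourierIntegral Real.fourierChar volume
        (innerₗ ℝ).flip f = 𝓕 f := fun f => by
      rw [flip_innerₗ]; rfl
    rw [e1, e2] at h
    simp only [smul_eq_mul] at h
    rw [h]
    congr 1
    ext t
    rw [hFw, mul_assoc]
  have h2 : ∀ t, 𝓕 (𝓕 u) t = u (-t) := by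
    intro t
    have h := congrFun (huc.fourierInv_fourier_eq hu hFu) (-t)
    rw [← h, Real.fourierInv_eq_fourier_neg, neg_neg]
  rw [h1]
  calc ‖∫ t, 𝓕 (𝓕 u) t * w t‖ ≤ ∫ t, ‖u (-t)‖ * (2 * Real.pi * ∫ t, ‖v t‖) := by
        refine norm_integral_le_of_norm_le (hu.norm.comp_neg.mul_const _)
          (Eventually.of_forall fun t => ?_)
        rw [norm_mul, h2]
        gcongr
        exact hwb t
    _ = _ := by
        rw [integral_mul_const, integral_neg_eq_self (fun t => ‖u t‖) volume]
        ring

/-- Moving a point vertically away from the real axis increases its distance to every real number.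
-/
theorem norm_sub_le_norm_sub_perturb (z : ℂ) {ε : ℝ} (hε : 0 ≤ ε) (t : ℝ) :
    ‖(t : ℂ) - z‖ ≤ ‖(t : ℂ) - (z + (if 0 ≤ z.im then ε else -ε : ℝ) * Complex.I)‖ := by
  rw [Complex.norm_def, Complex.norm_def]
  apply Real.sqrt_le_sqrt
  rw [Complex.normSq_apply, Complex.normSq_apply]
  split_ifs with h
  · simp
    nlinarith
  · push Not at h
    simp
    nlinarith

/-- The quotient is `1/(t-z₁) + 1/(t-z₂)`, and each term obeys the bound for Cauchy kernels. The
roots may be real, so they are first moved off the axis and then back by dominated convergence; the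
two integrability hypotheses supply the majorant. -/
theorem norm_integral_fourier_mul_logDeriv_le {u v : ℝ → ℂ} (hu : Integrable u)
    (huc : Continuous u) (hFu : Integrable (𝓕 u)) (hv : Integrable v) (z₁ z₂ : ℂ)
    (h1 : Integrable fun t : ℝ => 𝓕 u t * 𝓕 v t / (((t : ℂ) - z₁) * (t - z₂)))
    (h2 : Integrable fun t : ℝ =>
      𝓕 u t * 𝓕 v t * (2 * t - z₁ - z₂) / (((t : ℂ) - z₁) * (t - z₂))) :
    ‖∫ t : ℝ, 𝓕 u t * 𝓕 v t * (2 * t - z₁ - z₂) / (((t : ℂ) - z₁) * (t - z₂))‖ ≤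
      4 * Real.pi * (∫ t, ‖u t‖) * ∫ t, ‖v t‖ := by
  let ε : ℕ → ℝ := fun n => 1 / ((n : ℝ) + 1)
  have hε0 : ∀ n, 0 < ε n := fun n => by positivity
  have hε1 : ∀ n, ε n ≤ 1 := fun n => by
    simp only [ε]
    rw [div_le_one (by positivity)]
    have : (0 : ℝ) ≤ n := by positivity
    linarith
  have hεt : Tendsto ε atTop (𝓝 0) := tendsto_one_div_add_atTop_nhds_zero_nat
  let p : ℂ → ℕ → ℂ := fun z n => z + (if 0 ≤ z.im then ε n else -ε n : ℝ) * Complex.I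
  have hpim : ∀ z n, (p z n).im ≠ 0 := by
    intro z n
    simp only [p]
    split_ifs with h
    · simp
      have := hε0 n
      linarith
    · push Not at h
      simp
      have := hε0 n
      linarith
  have hpt : ∀ z, Tendsto (p z) atTop (𝓝 z) := by
    intro z
    have h : Tendsto (fun n => ((if 0 ≤ z.im then ε n else -ε n : ℝ) : ℂ) * Complex.I) atTop
        (𝓝 (((0 : ℝ) : ℂ) * Complex.I)) := by
      refine Tendsto.mul_const _ ((Complex.continuous_ofReal.tendsto 0).comp ?_)
      split_ifs
      · exact hεt
      · simpa using hεt.neg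
    simpa [p] using h.const_add z
  have hpn : ∀ z n, ‖p z n - z‖ ≤ 1 := by
    intro z n
    simp only [p, add_sub_cancel_left, norm_mul, Complex.norm_I, mul_one, Complex.norm_real]
    have := hε0 n
    split_ifs
    · rw [Real.norm_of_nonneg this.le]; exact hε1 n
    · rw [norm_neg, Real.norm_of_nonneg this.le]; exact hε1 n
  have hFuc : Continuous (𝓕 u) := VectorFourier.fourierIntegral_continuous
    Real.continuous_fourierChar continuous_inner hu
  have hFvc : Continuous (𝓕 v) := VectorFourier.fourierIntegral_continuous
    Real.continuous_fourierChar continuous_inner hv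
  have hHi : Integrable fun t => 𝓕 u t * 𝓕 v t := by
    refine hFu.mul_bdd (c := ∫ t, ‖v t‖) hFvc.aestronglyMeasurable (Eventually.of_forall fun t => ?_)
    exact VectorFourier.norm_fourierIntegral_le_integral_norm _ _ _ _ _
  have hinvi : ∀ {z : ℂ}, z.im ≠ 0 → Integrable fun t : ℝ => 𝓕 u t * 𝓕 v t * ((t : ℂ) - z)⁻¹ := by
    intro z hz
    have hne : ∀ t : ℝ, (t : ℂ) - z ≠ 0 := by
      intro t h
      apply hz
      have := congrArg Complex.im h
      simpa using this
    refine hHi.mul_bdd (c := |z.im|⁻¹) (Continuous.aestronglyMeasurable ?_)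
      (Eventually.of_forall fun t => ?_)
    · exact Continuous.inv₀ (by fun_prop) hne
    · rw [norm_inv]
      refine inv_anti₀ (abs_pos.2 hz) ?_
      have := Complex.abs_im_le_norm ((t : ℂ) - z)
      simpa using this
  have hbound : ∀ n, ‖∫ t : ℝ, 𝓕 u t * 𝓕 v t * (2 * t - p z₁ n - p z₂ n) /
      (((t : ℂ) - p z₁ n) * (t - p z₂ n))‖ ≤ 4 * Real.pi * (∫ t, ‖u t‖) * ∫ t, ‖v t‖ := by
    intro n
    have e : ∀ t : ℝ, 𝓕 u t * 𝓕 v t * (2 * t - p z₁ n - p z₂ n) /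
        (((t : ℂ) - p z₁ n) * (t - p z₂ n)) =
        𝓕 u t * 𝓕 v t * ((t : ℂ) - p z₁ n)⁻¹ + 𝓕 u t * 𝓕 v t * ((t : ℂ) - p z₂ n)⁻¹ := by
      intro t
      have hne : ∀ z, (t : ℂ) - p z n ≠ 0 := by
        intro z h
        apply hpim z n
        have := congrArg Complex.im h
        simpa using this
      have := hne z₁
      have := hne z₂
      field_simp
      ring
    simp_rw [e]
    rw [integral_add (hinvi (hpim _ _)) (hinvi (hpim _ _))]
    refine (norm_add_le _ _).trans ?_
    have b1 := norm_integral_fourier_mul_inv_sub_le hu huc hFu hv (hpim z₁ n)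
    have b2 := norm_integral_fourier_mul_inv_sub_le hu huc hFu hv (hpim z₂ n)
    linarith
  have hae : ∀ z : ℂ, ∀ᵐ t : ℝ, (t : ℂ) - z ≠ 0 := by
    intro z
    have : ({z.re} : Set ℝ)ᶜ ∈ ae (volume : Measure ℝ) := by
      rw [compl_mem_ae_iff]; exact measure_singleton _
    filter_upwards [this] with t ht h
    apply ht
    have := congrArg Complex.re h
    simp only [Complex.sub_re, Complex.ofReal_re, Complex.zero_re] at this
    rw [Set.mem_singleton_iff]
    linarith
  have hlim : Tendsto (fun n => ∫ t : ℝ, 𝓕 u t * 𝓕 v t * (2 * t - p z₁ n - p z₂ n) /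
      (((t : ℂ) - p z₁ n) * (t - p z₂ n))) atTop
      (𝓝 (∫ t : ℝ, 𝓕 u t * 𝓕 v t * (2 * t - z₁ - z₂) / (((t : ℂ) - z₁) * (t - z₂)))) := by
    -- The perturbation changes the numerator by at most `2` and can only enlarge the denominator.
    refine tendsto_integral_of_dominated_convergence
      (fun t => ‖𝓕 u t * 𝓕 v t * (2 * t - z₁ - z₂) / (((t : ℂ) - z₁) * (t - z₂))‖ +
        2 * ‖𝓕 u t * 𝓕 v t / (((t : ℂ) - z₁) * (t - z₂))‖) (fun n => ?_)
      (h2.norm.add (h1.norm.const_mul 2)) (fun n => ?_) ?_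
    · exact Measurable.aestronglyMeasurable (by
        have := hFuc.measurable
        have := hFvc.measurable
        fun_prop)
    · filter_upwards [hae z₁, hae z₂] with t ht1 ht2
      have p1 : ‖(t : ℂ) - z₁‖ ≤ ‖(t : ℂ) - p z₁ n‖ := norm_sub_le_norm_sub_perturb z₁ (hε0 n).le t
      have p2 : ‖(t : ℂ) - z₂‖ ≤ ‖(t : ℂ) - p z₂ n‖ := norm_sub_le_norm_sub_perturb z₂ (hε0 n).le t
      have q1 : 0 < ‖(t : ℂ) - z₁‖ := norm_pos_iff.2 ht1
      have q2 : 0 < ‖(t : ℂ) - z₂‖ := norm_pos_iff.2 ht2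
      have hnum : ‖2 * (t : ℂ) - p z₁ n - p z₂ n‖ ≤ ‖2 * (t : ℂ) - z₁ - z₂‖ + 2 := by
        have e : 2 * (t : ℂ) - p z₁ n - p z₂ n =
            (2 * (t : ℂ) - z₁ - z₂) - (p z₁ n - z₁) - (p z₂ n - z₂) := by ring
        rw [e]
        have a1 := norm_sub_le ((2 * (t : ℂ) - z₁ - z₂) - (p z₁ n - z₁)) (p z₂ n - z₂)
        have a2 := norm_sub_le (2 * (t : ℂ) - z₁ - z₂) (p z₁ n - z₁)
        have := hpn z₁ n
        have := hpn z₂ n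
        linarith
      simp only [norm_div, norm_mul]
      calc _ ≤ ‖𝓕 u t‖ * ‖𝓕 v t‖ * (‖2 * (t : ℂ) - z₁ - z₂‖ + 2) /
            (‖(t : ℂ) - z₁‖ * ‖(t : ℂ) - z₂‖) := by
            gcongr
        _ = _ := by ring
    · filter_upwards [hae z₁, hae z₂] with t ht1 ht2
      refine Tendsto.div ?_ ?_ (mul_ne_zero ht1 ht2)
      · exact (((tendsto_const_nhds).sub (hpt z₁)).sub (hpt z₂)).const_mul _
      · exact (tendsto_const_nhds.sub (hpt z₁)).mul (tendsto_const_nhds.sub (hpt z₂))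
  exact le_of_tendsto hlim.norm (Eventually.of_forall hbound)

/-! ### Slices parallel to a coordinate axis -/

/-- The point with `j`-th coordinate `t` and remaining coordinates `x`. -/
def slice {n : ℕ} (j : Fin (n + 1)) (t : ℝ) (x : Eu n) : Eu (n + 1) :=
  WithLp.toLp 2 (Fin.insertNth j t (fun i => x i) : Fin (n + 1) → ℝ)

section Slice
variable {n : ℕ} (j : Fin (n + 1))

@[simp] theorem slice_same (t : ℝ) (x : Eu n) : slice j t x j = t := by
  simp [slice]

@[simp] theorem slice_succAbove (t : ℝ) (x : Eu n) (i : Fin n) :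
    slice j t x (j.succAbove i) = x i := by
  simp [slice]

theorem inner_slice (t s : ℝ) (x y : Eu n) :
    inner ℝ (slice j t x) (slice j s y) = t * s + inner ℝ x y := by
  rw [PiLp.inner_apply, PiLp.inner_apply, Fin.sum_univ_succAbove _ j]
  simp [mul_comm]

theorem norm_slice_sq (t : ℝ) (x : Eu n) : ‖slice j t x‖ ^ 2 = t ^ 2 + ‖x‖ ^ 2 := by
  rw [← real_inner_self_eq_norm_sq, inner_slice, real_inner_self_eq_norm_sq]; ring

theorem norm_le_norm_slice (t : ℝ) (x : Eu n) : ‖x‖ ≤ ‖slice j t x‖ := by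
  refine abs_le_of_sq_le_sq' ?_ (norm_nonneg _) |>.2
  rw [norm_slice_sq]; nlinarith [sq_nonneg t]

theorem abs_le_norm_slice (t : ℝ) (x : Eu n) : |t| ≤ ‖slice j t x‖ := by
  refine abs_le_of_sq_le_sq' ?_ (norm_nonneg _) |>.2
  rw [norm_slice_sq, sq_abs]; nlinarith [sq_nonneg ‖x‖]

theorem slice_add (t s : ℝ) (x y : Eu n) : slice j (t + s) (x + y) = slice j t x + slice j s y := by
  ext i
  refine Fin.succAboveCases j ?_ (fun i => ?_) i <;> simp

theorem slice_smul (c t : ℝ) (x : Eu n) : slice j (c * t) (c • x) = c • slice j t x := by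
  ext i
  refine Fin.succAboveCases j ?_ (fun i => ?_) i <;> simp

/-- The slices as a measurable equivalence. -/
def sliceEquiv : ℝ × Eu n ≃ᵐ Eu (n + 1) :=
  ((MeasurableEquiv.refl ℝ).prodCongr (MeasurableEquiv.toLp 2 (Fin n → ℝ)).symm).trans
    ((MeasurableEquiv.piFinSuccAbove (fun _ : Fin (n + 1) => ℝ) j).symm.trans
      (MeasurableEquiv.toLp 2 (Fin (n + 1) → ℝ)))

theorem sliceEquiv_apply (p : ℝ × Eu n) : sliceEquiv j p = slice j p.1 p.2 := rfl

theorem measurePreserving_slice :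
    MeasurePreserving (sliceEquiv j) (volume.prod volume) volume := by
  have h1 : MeasurePreserving ((MeasurableEquiv.refl ℝ).prodCongr
      (MeasurableEquiv.toLp 2 (Fin n → ℝ)).symm) ((volume : Measure ℝ).prod volume)
      ((volume : Measure ℝ).prod volume) :=
    (MeasurePreserving.id volume).prod (EuclideanSpace.volume_preserving_symm_measurableEquiv_toLp _)
  have h2 := (volume_preserving_piFinSuccAbove (fun _ : Fin (n + 1) => ℝ) j).symm
  have h3 := (EuclideanSpace.volume_preserving_symm_measurableEquiv_toLp (Fin (n + 1))).symm
  exact h3.comp (h2.comp h1)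

theorem integral_slice {F : Type*} [NormedAddCommGroup F] [NormedSpace ℝ F] (f : Eu (n + 1) → F) :
    ∫ x, f x = ∫ p : ℝ × Eu n, f (slice j p.1 p.2) ∂(volume.prod volume) :=
  ((measurePreserving_slice j).integral_comp' f).symm

theorem lintegral_slice (f : Eu (n + 1) → ℝ≥0∞) :
    ∫⁻ x, f x = ∫⁻ p : ℝ × Eu n, f (slice j p.1 p.2) ∂(volume.prod volume) :=
  ((measurePreserving_slice j).lintegral_comp_emb (sliceEquiv j).measurableEmbedding f).symm

theorem integrable_slice {F : Type*} [NormedAddCommGroup F] {f : Eu (n + 1) → F}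
    (hf : Integrable f) :
    Integrable (fun p : ℝ × Eu n => f (slice j p.1 p.2)) (volume.prod volume) :=
  ((measurePreserving_slice j).integrable_comp_emb (sliceEquiv j).measurableEmbedding).2 hf

theorem continuous_slice : Continuous (fun p : ℝ × Eu n => slice j p.1 p.2) := by
  refine (PiLp.continuous_toLp 2 _).comp (continuous_pi fun i => ?_)
  refine Fin.succAboveCases j ?_ (fun i => ?_) i
  · simpa using continuous_fst
  · simp only [Fin.insertNth_apply_succAbove]
    fun_prop

/-- The linear embedding of the coordinate hyperplane. -/
def sliceCLM : Eu n →L[ℝ] Eu (n + 1) :=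
  LinearMap.toContinuousLinearMap
    { toFun := slice j 0
      map_add' := fun x y => by simpa using slice_add j 0 0 x y
      map_smul' := fun c x => by simpa using slice_smul j c 0 x }

theorem slice_eq (t : ℝ) (x : Eu n) : slice j t x = slice j t 0 + sliceCLM j x := by
  have := slice_add j t 0 0 x
  rw [add_zero, zero_add] at this
  exact this

theorem exists_schwartz_slice (f : 𝓢(Eu (n + 1), ℂ)) (t : ℝ) :
    ∃ F : 𝓢(Eu n, ℂ), ∀ x, F x = f (slice j t x) := by
  have hg : Function.HasTemperateGrowth (fun x : Eu n => slice j t x) := by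
    have : (fun x : Eu n => slice j t x) = fun x => slice j t 0 + sliceCLM j x :=
      funext fun x => slice_eq j t x
    rw [this]
    exact (Function.HasTemperateGrowth.const _).add (sliceCLM j).hasTemperateGrowth
  have ha : AntilipschitzWith 1 (fun x : Eu n => slice j t x) := by
    refine AntilipschitzWith.of_le_mul_dist fun x y => ?_
    rw [NNReal.coe_one, one_mul, dist_eq_norm, dist_eq_norm]
    have : slice j t x - slice j t y = slice j 0 (x - y) := by
      rw [sub_eq_iff_eq_add, ← slice_add]; simp
    rw [this]
    exact norm_le_norm_slice j 0 _
  exact ⟨SchwartzMap.compCLMOfAntilipschitz ℂ hg ha f, fun x => rfl⟩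

theorem exists_slice_bound (f : 𝓢(Eu (n + 1), ℂ)) :
    ∃ C : ℝ, 0 ≤ C ∧ ∀ t x, ‖f (slice j t x)‖ ≤
      C * ((1 + t ^ 2)⁻¹ * bracketWeight (-((n : ℝ) + 1)) 1 x) := by
  -- Two powers of the bracket give the integrable factor in `t`, the other `n + 1` the integrable
  -- factor in `x`.
  obtain ⟨C, hC, h⟩ := schwartz_bound f ((n : ℝ) + 3)
  refine ⟨C, hC, fun t x => (h _).trans ?_⟩
  gcongr
  rw [bracketWeight_eq_rpow, bracketWeight_eq_rpow, one_smul, one_smul, norm_slice_sq,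
    show (-((n : ℝ) + 3)) / 2 = -1 + -((n : ℝ) + 1) / 2 by ring,
    Real.rpow_add (by positivity), Real.rpow_neg_one]
  gcongr ?_ * ?_
  · gcongr; nlinarith [sq_nonneg ‖x‖]
  · refine Real.rpow_le_rpow_of_nonpos (by positivity) (by nlinarith [sq_nonneg t]) ?_
    have : (0 : ℝ) ≤ n := n.cast_nonneg
    linarith

/-- The partial Fourier transform in the variables other than the `j`-th one. -/
def partialFourier (f : Eu (n + 1) → ℂ) (t : ℝ) (ξ : Eu n) : ℂ :=
  𝓕 (fun x => f (slice j t x)) ξ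

theorem continuous_partialFourier (f : 𝓢(Eu (n + 1), ℂ)) :
    Continuous (fun p : ℝ × Eu n => partialFourier j f p.1 p.2) := by
  obtain ⟨C, hC, hb⟩ := exists_slice_bound j f
  unfold partialFourier
  simp only [Real.fourier_eq]
  refine continuous_of_dominated (bound := fun x => C * bracketWeight (-((n : ℝ) + 1)) 1 x)
    (fun p => ?_) (fun p => Eventually.of_forall fun x => ?_) ?_
    (Eventually.of_forall fun x => ?_)
  · refine Continuous.aestronglyMeasurable ?_
    refine Continuous.smul (continuous_subtype_val.comp (Real.continuous_fourierChar.comp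
      (by fun_prop : Continuous fun x : Eu n => (-inner ℝ x p.2 : ℝ)))) ?_
    exact f.continuous.comp ((continuous_slice j).comp (by fun_prop : Continuous fun x => (p.1, x)))
  · rw [Circle.norm_smul]
    refine (hb _ _).trans ?_
    gcongr
    refine mul_le_of_le_one_left (bracketWeight_pos _ _ _).le ?_
    exact inv_le_one_of_one_le₀ (by nlinarith [sq_nonneg p.1])
  · exact (integrable_bracketWeight_neg (by linarith)).const_mul _
  · refine Continuous.smul (continuous_subtype_val.comp (Real.continuous_fourierChar.comp
      (by fun_prop : Continuous fun p : ℝ × Eu n => (-inner ℝ x p.2 : ℝ)))) ?_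
    exact f.continuous.comp ((continuous_slice j).comp (by fun_prop : Continuous fun p : ℝ × Eu n => (p.1, x)))

theorem integrable_partialFourier (f : 𝓢(Eu (n + 1), ℂ)) (ξ : Eu n) :
    Integrable (fun t => partialFourier j f t ξ) := by
  obtain ⟨C, hC, hb⟩ := exists_slice_bound j f
  have hc := (continuous_partialFourier j f).comp (by fun_prop : Continuous fun t : ℝ => (t, ξ))
  refine Integrable.mono' (g := fun t => (C * ∫ x : Eu n, bracketWeight (-((n : ℝ) + 1)) 1 x) *
    (1 + t ^ 2)⁻¹) ?_ hc.aestronglyMeasurable (Eventually.of_forall fun t => ?_)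
  · exact integrable_inv_one_add_sq.const_mul _
  · have h1 : ‖partialFourier j f t ξ‖ ≤ ∫ x, ‖f (slice j t x)‖ := by
      unfold partialFourier
      exact VectorFourier.norm_fourierIntegral_le_integral_norm _ _ _ _ _
    refine h1.trans ?_
    have h2 : ∫ x, ‖f (slice j t x)‖ ≤
        ∫ x : Eu n, (C * (1 + t ^ 2)⁻¹) * bracketWeight (-((n : ℝ) + 1)) 1 x := by
      refine integral_mono_of_nonneg (Eventually.of_forall fun x => norm_nonneg _) ?_
        (Eventually.of_forall fun x => (hb t x).trans (le_of_eq (mul_assoc _ _ _).symm))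
      exact (integrable_bracketWeight_neg (by linarith)).const_mul _
    refine h2.trans (le_of_eq ?_)
    rw [integral_const_mul]; ring

theorem fourier_partialFourier (f : 𝓢(Eu (n + 1), ℂ)) (τ : ℝ) (ξ : Eu n) :
    𝓕 (fun t => partialFourier j f t ξ) τ = 𝓕 (f : Eu (n + 1) → ℂ) (slice j τ ξ) := by
  rw [Real.fourier_eq, Real.fourier_eq, integral_slice j, integral_prod]
  · refine integral_congr_ae (Eventually.of_forall fun t => ?_)
    simp only [partialFourier, Real.fourier_eq]
    rw [Circle.smul_def, ← integral_smul]
    refine integral_congr_ae (Eventually.of_forall fun x => ?_)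
    simp only [inner_slice]
    rw [← Circle.smul_def, smul_smul, ← AddChar.map_add_eq_mul]
    congr 2
    simp; ring
  · exact integrable_slice j ((Real.fourierIntegral_convergent_iff _).2 f.integrable)

theorem eLpNorm_two_sq {α F : Type*} [MeasurableSpace α] {μ : Measure α} [TopologicalSpace F]
    [ContinuousENorm F] (f : α → F) : eLpNorm f 2 μ ^ 2 = ∫⁻ x, ‖f x‖ₑ ^ 2 ∂μ := by
  have := eLpNorm_nnreal_pow_eq_lintegral (f := f) (p := 2) (μ := μ) two_ne_zero
  simpa using this

/-- Plancherel's theorem on the slice, which is itself a Schwartz function. -/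
theorem lintegral_enorm_sq_partialFourier (f : 𝓢(Eu (n + 1), ℂ)) (t : ℝ) :
    ∫⁻ ξ, ‖partialFourier j f t ξ‖ₑ ^ 2 = ∫⁻ x, ‖f (slice j t x)‖ₑ ^ 2 := by
  obtain ⟨F, hF⟩ := exists_schwartz_slice j f t
  have hF' : (fun x => f (slice j t x)) = F := funext fun x => (hF x).symm
  have key : ∀ G : 𝓢(Eu n, ℂ), ∫⁻ x, ‖G x‖ₑ ^ 2 = ENNReal.ofReal (∫ x, ‖G x‖ ^ 2) := fun G => by
    rw [ofReal_integral_eq_lintegral_ofReal]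
    · refine lintegral_congr fun x => ?_
      rw [ENNReal.ofReal_pow (norm_nonneg _), ofReal_norm]
    · exact (memLp_two_iff_integrable_sq_norm G.continuous.aestronglyMeasurable).1 (G.memLp 2 _)
    · exact Eventually.of_forall fun x => by positivity
  have h1 : ∀ ξ, partialFourier j f t ξ = (𝓕 F : 𝓢(Eu n, ℂ)) ξ := fun ξ => by
    rw [partialFourier, hF', SchwartzMap.fourier_coe]
  simp only [h1, ← hF]
  rw [key, key, SchwartzMap.integral_norm_sq_fourier]

/-- The squared `L²` norm of `(1 + t ^ 2) ^ (-a / 2)`. -/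
def lineConst (a : ℝ) : ℝ≥0∞ := ∫⁻ t : ℝ, ENNReal.ofReal ((1 + t ^ 2) ^ (-a))

theorem lineConst_lt_top {a : ℝ} (ha : 1 / 2 < a) : lineConst a < ⊤ := by
  have h : Integrable (fun t : ℝ => (1 + ‖t‖ ^ 2) ^ (-(2 * a) / 2)) :=
    integrable_rpow_neg_one_add_norm_sq (by simp; linarith)
  refine lt_of_le_of_lt (le_of_eq ?_) h.2
  refine lintegral_congr fun t => ?_
  rw [← ofReal_norm, Real.norm_of_nonneg (by positivity)]
  simp only [Real.norm_eq_abs, sq_abs]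
  congr 2
  ring

theorem measurable_enorm_partialFourier (f : 𝓢(Eu (n + 1), ℂ)) :
    Measurable (fun p : Eu n × ℝ => ‖partialFourier j f p.2 p.1‖ₑ) :=
  ((continuous_partialFourier j f).comp continuous_swap).measurable.enorm

/-- Cauchy-Schwarz in `t` with the weight `(1 + t²)^a`, then Plancherel in the transverse variables
and `1 + x_j² ≤ ⟨x⟩²`. The factor `lineConst a` is finite exactly in the range `a > 1/2` of the
limiting absorption principle. -/
theorem eLpNorm_lintegral_partialFourier_le (f : 𝓢(Eu (n + 1), ℂ)) (a : ℝ) (ha : 0 ≤ a) :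
    eLpNorm (fun ξ => ∫⁻ t, ‖partialFourier j f t ξ‖ₑ) 2 volume ≤
      lineConst a ^ (1 / 2 : ℝ) * wNorm 2 a 1 f := by
  set w : ℝ → ℝ≥0∞ := fun t => ENNReal.ofReal ((1 + t ^ 2) ^ a) with hw
  have hwm : Measurable w := by
    have : Measurable fun t : ℝ => (1 + t ^ 2) := by fun_prop
    exact (this.pow_const a).ennreal_ofReal
  have hm := measurable_enorm_partialFourier j f
  have hA : ∀ ξ, (∫⁻ t, ‖partialFourier j f t ξ‖ₑ) ^ 2 ≤
      lineConst a * ∫⁻ t, w t * ‖partialFourier j f t ξ‖ₑ ^ 2 := by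
    intro ξ
    have hmξ : Measurable fun t => ‖partialFourier j f t ξ‖ₑ :=
      ((continuous_partialFourier j f).comp
        (by fun_prop : Continuous fun t : ℝ => (t, ξ))).measurable.enorm
    have h1 : Measurable fun t : ℝ => ENNReal.ofReal ((1 + t ^ 2) ^ (-a / 2)) := by
      have : Measurable fun t : ℝ => (1 + t ^ 2) := by fun_prop
      exact (this.pow_const _).ennreal_ofReal
    have h2 : Measurable fun t : ℝ => ENNReal.ofReal ((1 + t ^ 2) ^ (a / 2)) := by
      have : Measurable fun t : ℝ => (1 + t ^ 2) := by fun_prop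
      exact (this.pow_const _).ennreal_ofReal
    have := lintegral_mul_le_eLpNorm_mul_eLpNorm (μ := (volume : Measure ℝ)) (p := 2) (q := 2)
      inferInstance h1.aemeasurable (h2.mul hmξ).aemeasurable
    have e : ∀ t : ℝ, ENNReal.ofReal ((1 + t ^ 2) ^ (-a / 2)) *
        (ENNReal.ofReal ((1 + t ^ 2) ^ (a / 2)) * ‖partialFourier j f t ξ‖ₑ) =
        ‖partialFourier j f t ξ‖ₑ := fun t => by
      rw [← mul_assoc, ← ENNReal.ofReal_mul (by positivity), ← Real.rpow_add (by positivity)]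
      simp [neg_div]
    simp only [Pi.mul_apply, e] at this
    have h3 := pow_le_pow_left' this 2
    rw [mul_pow, eLpNorm_two_sq, eLpNorm_two_sq] at h3
    refine h3.trans (le_of_eq ?_)
    congr 1
    · refine lintegral_congr fun t => ?_
      rw [enorm_eq_self, ← ENNReal.ofReal_pow (by positivity), ← Real.rpow_natCast,
        ← Real.rpow_mul (by positivity)]
      congr 2; push_cast; ring
    · refine lintegral_congr fun t => ?_
      rw [enorm_eq_self, Pi.mul_apply, mul_pow, ← ENNReal.ofReal_pow (by positivity),
        ← Real.rpow_natCast, ← Real.rpow_mul (by positivity)]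
      congr 3; push_cast; ring
  have hB : ∫⁻ ξ, (∫⁻ t, ‖partialFourier j f t ξ‖ₑ) ^ 2 ≤ lineConst a * wNorm 2 a 1 f ^ 2 := by
    calc ∫⁻ ξ, (∫⁻ t, ‖partialFourier j f t ξ‖ₑ) ^ 2
        ≤ ∫⁻ ξ, lineConst a * ∫⁻ t, w t * ‖partialFourier j f t ξ‖ₑ ^ 2 := lintegral_mono hA
      _ = lineConst a * ∫⁻ ξ, ∫⁻ t, w t * ‖partialFourier j f t ξ‖ₑ ^ 2 := by
          rw [lintegral_const_mul]
          exact Measurable.lintegral_prod_right'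
            ((hwm.comp measurable_snd).mul (hm.pow_const 2))
      _ = lineConst a * ∫⁻ t, ∫⁻ ξ, w t * ‖partialFourier j f t ξ‖ₑ ^ 2 := by
          rw [lintegral_lintegral_swap]
          exact ((hwm.comp measurable_snd).mul (hm.pow_const 2)).aemeasurable
      _ = lineConst a * ∫⁻ t, ∫⁻ x, w t * ‖f (slice j t x)‖ₑ ^ 2 := by
          congr 1
          refine lintegral_congr fun t => ?_
          rw [lintegral_const_mul, lintegral_const_mul, lintegral_enorm_sq_partialFourier]
          · exact (f.continuous.comp ((continuous_slice j).comp
              (by fun_prop : Continuous fun x : Eu n => (t, x)))).measurable.enorm.pow_const 2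
          · exact ((continuous_partialFourier j f).comp
              (by fun_prop : Continuous fun ξ : Eu n => (t, ξ))).measurable.enorm.pow_const 2
      _ = lineConst a * ∫⁻ x : Eu (n + 1), w (x j) * ‖f x‖ₑ ^ 2 := by
          rw [lintegral_slice j, lintegral_prod]
          · simp
          · have h1 : Measurable fun p : ℝ × Eu n => ‖f (slice j p.1 p.2)‖ₑ :=
              (f.continuous.comp (continuous_slice j)).measurable.enorm
            simp only [slice_same]
            exact ((hwm.comp measurable_fst).mul (h1.pow_const 2)).aemeasurable
      _ ≤ lineConst a * wNorm 2 a 1 f ^ 2 := by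
          gcongr
          rw [wNorm, eLpNorm_two_sq]
          refine lintegral_mono fun x => ?_
          rw [enorm_mul, mul_pow]
          gcongr
          rw [← ofReal_norm, ← ENNReal.ofReal_pow (norm_nonneg _)]
          refine ENNReal.ofReal_le_ofReal ?_
          rw [Complex.norm_real, Real.norm_of_nonneg (bracketWeight_pos _ _ _).le,
            bracketWeight_eq_rpow, one_smul, ← Real.rpow_mul_natCast (by positivity)]
          have : a / 2 * ((2 : ℕ) : ℝ) = a := by push_cast; ring
          rw [this]
          refine Real.rpow_le_rpow (by positivity) ?_ ha
          have := PiLp.norm_apply_le x j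
          rw [← sq_abs (x j), ← Real.norm_eq_abs]
          gcongr
  have h4 : eLpNorm (fun ξ => ∫⁻ t, ‖partialFourier j f t ξ‖ₑ) 2 volume ^ 2 ≤
      (lineConst a ^ (1 / 2 : ℝ) * wNorm 2 a 1 f) ^ 2 := by
    rw [eLpNorm_two_sq, mul_pow, ← ENNReal.rpow_natCast (lineConst a ^ (1 / 2 : ℝ)),
      ← ENNReal.rpow_mul]
    simpa using hB
  exact (ENNReal.pow_le_pow_left_iff two_ne_zero).1 h4

/-- Completing the square, the symbol on the line is `(t + iγ_j)² - w²`: its roots are symmetric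
about `-iγ_j`, so that `t + iγ_j` is half of its derivative. -/
theorem faddeevSymbol_slice (k : ℝ) (γ : Eu (n + 1)) (τ : ℝ) (ξ : Eu n) :
    ∃ w : ℂ, ∀ t : ℝ, faddeevSymbol k γ τ (slice j t ξ) =
      ((t : ℂ) - (-Complex.I * γ j + w)) * (t - (-Complex.I * γ j - w)) := by
  set c : ℂ := (γ j : ℂ) ^ 2 + ‖ξ‖ ^ 2 - k ^ 2 - ‖γ‖ ^ 2 +
    2 * Complex.I * ((inner ℝ γ (slice j 0 ξ) : ℝ) : ℂ) - Complex.I * τ with hc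
  obtain ⟨w, hw⟩ := IsAlgClosed.exists_pow_nat_eq (-c) (n := 2) two_pos
  refine ⟨w, fun t => ?_⟩
  have h1 : inner ℝ γ (slice j t ξ) = γ j * t + inner ℝ γ (slice j 0 ξ) := by
    have h2 : slice j t ξ = slice j t 0 + slice j 0 ξ := by rw [← slice_add]; simp
    have h3 : slice j t (0 : Eu n) = EuclideanSpace.single j t := by
      ext i
      refine Fin.succAboveCases j ?_ (fun i => ?_) i <;> simp [Fin.succAbove_ne]
    rw [h2, inner_add_right, h3, EuclideanSpace.inner_single_right]
    simp [mul_comm]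
  rw [faddeevSymbol, h1, norm_slice_sq]
  have h4 : ((t : ℂ) - (-Complex.I * γ j + w)) * (t - (-Complex.I * γ j - w)) =
      (t + Complex.I * γ j) ^ 2 - w ^ 2 := by ring
  rw [h4, hw, hc]
  push_cast
  linear_combination (-(γ j : ℂ) ^ 2) * Complex.I_sq

theorem continuous_partialFourier_left (f : 𝓢(Eu (n + 1), ℂ)) (ξ : Eu n) :
    Continuous fun t => partialFourier j f t ξ := by
  have h := (continuous_partialFourier j f).comp (by fun_prop : Continuous fun t : ℝ => (t, ξ))
  simpa only [Function.comp_def] using h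

theorem integrable_fourier_partialFourier (f : 𝓢(Eu (n + 1), ℂ)) (ξ : Eu n) :
    Integrable (𝓕 fun t => partialFourier j f t ξ) := by
  obtain ⟨C, hC, hb⟩ := exists_slice_bound j (𝓕 f)
  have hcont : Continuous fun t => (𝓕 f) (slice j t ξ) := (𝓕 f).continuous.comp
    ((continuous_slice j).comp (by fun_prop : Continuous fun t : ℝ => (t, ξ)))
  have : Integrable fun t => (𝓕 f) (slice j t ξ) := by
    refine (integrable_inv_one_add_sq.const_mul
      (C * bracketWeight (-((n : ℝ) + 1)) 1 ξ)).mono' hcont.aestronglyMeasurable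
      (Eventually.of_forall fun t => (hb t ξ).trans (le_of_eq (by ring)))
  refine this.congr (Eventually.of_forall fun t => ?_)
  simp only [fourier_partialFourier, SchwartzMap.fourier_coe]

/-- A Sobolev-free form of the limiting absorption principle, with a constant that depends on the
weight only. -/
theorem enorm_integral_fourier_mul_div_symbol_le (k : ℝ) (γ : Eu (n + 1)) (τ : ℝ)
    (f g : 𝓢(Eu (n + 1), ℂ)) {a : ℝ} (ha : 0 ≤ a)
    (h1 : Integrable fun ξ => (𝓕 f) ξ * (𝓕 g) ξ / faddeevSymbol k γ τ ξ)
    (h2 : Integrable fun ξ => (𝓕 f) ξ * (𝓕 g) ξ * ((ξ j : ℂ) + Complex.I * γ j) /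
      faddeevSymbol k γ τ ξ) :
    ‖∫ ξ, (𝓕 f) ξ * (𝓕 g) ξ * ((ξ j : ℂ) + Complex.I * γ j) / faddeevSymbol k γ τ ξ‖ₑ ≤
      ENNReal.ofReal (2 * Real.pi) * lineConst a * (wNorm 2 a 1 f * wNorm 2 a 1 g) := by
  have h1' := integrable_slice j h1
  have h2' := integrable_slice j h2
  rw [integral_slice j, integral_prod_symm _ h2']
  set A : Eu n → ℝ≥0∞ := fun ξ => ∫⁻ t, ‖partialFourier j f t ξ‖ₑ with hA
  set B : Eu n → ℝ≥0∞ := fun ξ => ∫⁻ t, ‖partialFourier j g t ξ‖ₑ with hB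
  have hAm : Measurable A := (measurable_enorm_partialFourier j f).lintegral_prod_right'
  have hBm : Measurable B := (measurable_enorm_partialFourier j g).lintegral_prod_right'
  refine (enorm_integral_le_lintegral_enorm _).trans ?_
  have key : ∀ᵐ ξ : Eu n, ‖∫ t, (𝓕 f) (slice j t ξ) * (𝓕 g) (slice j t ξ) *
      ((slice j t ξ j : ℂ) + Complex.I * γ j) / faddeevSymbol k γ τ (slice j t ξ)‖ₑ ≤
      ENNReal.ofReal (2 * Real.pi) * (A ξ * B ξ) := by
    filter_upwards [h1'.prod_left_ae, h2'.prod_left_ae] with ξ i1 i2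
    obtain ⟨w, hw⟩ := faddeevSymbol_slice j k γ τ ξ
    set z₁ := -Complex.I * γ j + w
    set z₂ := -Complex.I * γ j - w
    have hf : ∀ t, (𝓕 f) (slice j t ξ) = 𝓕 (fun t => partialFourier j f t ξ) t := fun t => by
      rw [fourier_partialFourier, SchwartzMap.fourier_coe]
    have hg : ∀ t, (𝓕 g) (slice j t ξ) = 𝓕 (fun t => partialFourier j g t ξ) t := fun t => by
      rw [fourier_partialFourier, SchwartzMap.fourier_coe]
    -- The numerator is half the sum of the two linear factors, so the quotient is half of a
    -- logarithmic derivative; this turns the constant `4π` into `2π`.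
    have hd : ∀ t : ℝ, ((t : ℂ) + Complex.I * γ j) = (1 / 2) * (2 * t - z₁ - z₂) := fun t => by
      simp only [z₁, z₂]; ring
    simp only [hf, hg, hw, slice_same, hd] at i1 i2 ⊢
    have i3 : Integrable fun t : ℝ => 𝓕 (fun t => partialFourier j f t ξ) t *
        𝓕 (fun t => partialFourier j g t ξ) t * (2 * t - z₁ - z₂) /
          (((t : ℂ) - z₁) * (t - z₂)) := by
      refine (i2.const_mul 2).congr (Eventually.of_forall fun t => ?_)
      ring
    have := norm_integral_fourier_mul_logDeriv_le (integrable_partialFourier j f ξ)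
      (continuous_partialFourier_left j f ξ) (integrable_fourier_partialFourier j f ξ)
      (integrable_partialFourier j g ξ) z₁ z₂ i1 i3
    have e : ∫ t : ℝ, 𝓕 (fun t => partialFourier j f t ξ) t *
        𝓕 (fun t => partialFourier j g t ξ) t * (1 / 2 * (2 * t - z₁ - z₂)) /
          (((t : ℂ) - z₁) * (t - z₂)) =
        (1 / 2) * ∫ t : ℝ, 𝓕 (fun t => partialFourier j f t ξ) t *
        𝓕 (fun t => partialFourier j g t ξ) t * (2 * t - z₁ - z₂) /
          (((t : ℂ) - z₁) * (t - z₂)) := by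
      rw [← integral_const_mul]
      refine integral_congr_ae (Eventually.of_forall fun t => ?_)
      ring
    have hAf : A ξ = ENNReal.ofReal (∫ t, ‖partialFourier j f t ξ‖) :=
      (ofReal_integral_norm_eq_lintegral_enorm (integrable_partialFourier j f ξ)).symm
    have hBg : B ξ = ENNReal.ofReal (∫ t, ‖partialFourier j g t ξ‖) :=
      (ofReal_integral_norm_eq_lintegral_enorm (integrable_partialFourier j g ξ)).symm
    have p1 : 0 ≤ ∫ t, ‖partialFourier j f t ξ‖ := integral_nonneg fun _ => norm_nonneg _
    rw [e, hAf, hBg, ← ENNReal.ofReal_mul p1, ← ENNReal.ofReal_mul (by positivity), ← ofReal_norm]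
    refine ENNReal.ofReal_le_ofReal ?_
    rw [norm_mul]
    norm_num
    linarith
  calc _ ≤ ∫⁻ ξ, ENNReal.ofReal (2 * Real.pi) * (A ξ * B ξ) := lintegral_mono_ae key
    _ = ENNReal.ofReal (2 * Real.pi) * ∫⁻ ξ, A ξ * B ξ :=
        lintegral_const_mul _ (hAm.mul hBm)
    _ ≤ ENNReal.ofReal (2 * Real.pi) * (eLpNorm A 2 volume * eLpNorm B 2 volume) := by
        gcongr
        exact lintegral_mul_le_eLpNorm_mul_eLpNorm inferInstance hAm.aemeasurable hBm.aemeasurable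
    _ ≤ ENNReal.ofReal (2 * Real.pi) * ((lineConst a ^ (1 / 2 : ℝ) * wNorm 2 a 1 f) *
          (lineConst a ^ (1 / 2 : ℝ) * wNorm 2 a 1 g)) := by
        gcongr
        · exact eLpNorm_lintegral_partialFourier_le j f a ha
        · exact eLpNorm_lintegral_partialFourier_le j g a ha
    _ = _ := by
        rw [mul_mul_mul_comm, ← ENNReal.rpow_add_of_nonneg _ _ (by norm_num) (by norm_num)]
        norm_num [mul_assoc]

end Slice

/-! ### Local integrability of the inverse of the symbol -/

theorem lintegral_enorm_rpow_neg_lt_top {σ : ℝ} (hσ : σ < 1) :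
    ∫⁻ u in Set.Icc (-1 : ℝ) 1, ‖u‖ₑ ^ (-σ) < ⊤ := by
  have h0 : IntegrableOn (fun u : ℝ => u ^ (-σ)) (Set.Ioc 0 1) := by
    have := intervalIntegral.intervalIntegrable_rpow' (a := 0) (b := 1) (r := -σ) (by linarith)
    rwa [intervalIntegrable_iff_integrableOn_Ioc_of_le zero_le_one] at this
  have h1 : ∫⁻ u in Set.Ioc (0 : ℝ) 1, ‖u‖ₑ ^ (-σ) < ⊤ := by
    refine lt_of_le_of_lt (le_of_eq ?_) h0.2
    refine setLIntegral_congr_fun measurableSet_Ioc fun u hu => ?_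
    simp only
    rw [← ofReal_norm, ← ofReal_norm, ENNReal.ofReal_rpow_of_pos (by simpa using hu.1.ne'),
      Real.norm_of_nonneg (Real.rpow_nonneg hu.1.le _), Real.norm_of_nonneg hu.1.le]
  have h2 : ∫⁻ u in Set.Ico (-1 : ℝ) 0, ‖u‖ₑ ^ (-σ) = ∫⁻ u in Set.Ioc (0 : ℝ) 1, ‖u‖ₑ ^ (-σ) := by
    rw [← lintegral_indicator measurableSet_Ico, ← lintegral_indicator measurableSet_Ioc,
      ← lintegral_neg_eq_self]
    refine lintegral_congr fun u => ?_
    by_cases hu : u ∈ Set.Ioc (0 : ℝ) 1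
    · rw [Set.indicator_of_mem hu, Set.indicator_of_mem, enorm_neg]
      exact ⟨by linarith [hu.2], by linarith [hu.1]⟩
    · rw [Set.indicator_of_notMem hu, Set.indicator_of_notMem]
      exact fun h => hu ⟨by linarith [h.2], by linarith [h.1]⟩
  have h3 : Set.Icc (-1 : ℝ) 1 ⊆ Set.Ico (-1 : ℝ) 0 ∪ ({0} ∪ Set.Ioc (0 : ℝ) 1) := by
    intro u hu
    rcases lt_trichotomy u 0 with h | h | h
    · exact Or.inl ⟨hu.1, h⟩
    · exact Or.inr (Or.inl h)
    · exact Or.inr (Or.inr ⟨h, hu.2⟩)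
  refine (lintegral_mono_set h3).trans_lt ((lintegral_union_le _ _ _).trans_lt ?_)
  refine ENNReal.add_lt_top.2 ⟨h2 ▸ h1, (lintegral_union_le _ _ _).trans_lt ?_⟩
  refine ENNReal.add_lt_top.2 ⟨?_, h1⟩
  simp

/-- The power is at most its restriction to `|u| ≤ 1` plus `1`. The integral of the singular part
over the whole line does not depend on the translation `b`. -/
theorem exists_lintegral_inv_enorm_sub_le {σ : ℝ} (h0 : 0 ≤ σ) (hσ : σ < 1) (r : ℝ) :
    ∃ C : ℝ≥0∞, C < ⊤ ∧ ∀ b : ℝ, ∫⁻ t in Set.Icc (-r) r, ‖t - b‖ₑ⁻¹ ^ σ ≤ C := by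
  set G : ℝ → ℝ≥0∞ := (Set.Icc (-1 : ℝ) 1).indicator (fun u => ‖u‖ₑ ^ (-σ)) with hG
  have h1 : ∀ u : ℝ, ‖u‖ₑ⁻¹ ^ σ ≤ G u + 1 := by
    intro u
    rw [ENNReal.inv_rpow, ← ENNReal.rpow_neg]
    by_cases hu : u ∈ Set.Icc (-1 : ℝ) 1
    · rw [hG, Set.indicator_of_mem hu]; exact le_self_add
    · rw [hG, Set.indicator_of_notMem hu, zero_add, ENNReal.rpow_neg, ← ENNReal.inv_rpow]
      refine ENNReal.rpow_le_one ?_ h0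
      rw [ENNReal.inv_le_one, ← ofReal_norm, ENNReal.one_le_ofReal, Real.norm_eq_abs]
      by_contra! h
      exact hu ⟨by linarith [(abs_lt.1 h).1], by linarith [(abs_lt.1 h).2]⟩
  refine ⟨(∫⁻ u, G u) + volume (Set.Icc (-r) r), ENNReal.add_lt_top.2 ⟨?_, by simp⟩, fun b => ?_⟩
  · rw [hG, lintegral_indicator measurableSet_Icc]
    exact lintegral_enorm_rpow_neg_lt_top hσ
  · calc ∫⁻ t in Set.Icc (-r) r, ‖t - b‖ₑ⁻¹ ^ σ
        ≤ ∫⁻ t in Set.Icc (-r) r, (G (t - b) + 1) := lintegral_mono fun t => h1 _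
      _ = (∫⁻ t in Set.Icc (-r) r, G (t - b)) + volume (Set.Icc (-r) r) := by
          rw [lintegral_add_right _ measurable_const]; simp
      _ ≤ (∫⁻ t, G (t - b)) + volume (Set.Icc (-r) r) := by
          gcongr; exact Measure.restrict_le_self
      _ = _ := by rw [lintegral_sub_right_eq_self G b]

/-- With `s = √max(b,0)` one has `|t² - b| ≥ |t - s| |t + s|`. A product is at most the sum of the
squares, which doubles the exponent. The two roots may merge, hence the threshold `1/2`. -/
theorem exists_lintegral_inv_enorm_sq_sub_le {σ : ℝ} (h0 : 0 ≤ σ) (hσ : σ < 1 / 2) (r : ℝ) :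
    ∃ C : ℝ≥0∞, C < ⊤ ∧ ∀ b : ℝ, ∫⁻ t in Set.Icc (-r) r, ‖t ^ 2 - b‖ₑ⁻¹ ^ σ ≤ C := by
  obtain ⟨C, hC, h⟩ := exists_lintegral_inv_enorm_sub_le (σ := 2 * σ) (by linarith)
    (by linarith) r
  refine ⟨C + C, ENNReal.add_lt_top.2 ⟨hC, hC⟩, fun b => ?_⟩
  set s := Real.sqrt (max b 0) with hs
  have hs2 : s ^ 2 = max b 0 := Real.sq_sqrt (le_max_right _ _)
  have key : ∀ t : ℝ, ‖t ^ 2 - b‖ₑ⁻¹ ^ σ ≤ ‖t - s‖ₑ⁻¹ ^ (2 * σ) + ‖t - -s‖ₑ⁻¹ ^ (2 * σ) := by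
    intro t
    have h1 : ‖(t - s) * (t - -s)‖ₑ ≤ ‖t ^ 2 - b‖ₑ := by
      rw [← ofReal_norm, ← ofReal_norm]
      refine ENNReal.ofReal_le_ofReal ?_
      rw [show (t - s) * (t - -s) = t ^ 2 - s ^ 2 by ring, hs2, Real.norm_eq_abs, Real.norm_eq_abs]
      rcases le_total b 0 with hb | hb
      · rw [max_eq_right hb, sub_zero, abs_of_nonneg (by positivity)]
        exact (by linarith : t ^ 2 ≤ t ^ 2 - b).trans (le_abs_self _)
      · rw [max_eq_left hb]
    have h2 : ‖t ^ 2 - b‖ₑ⁻¹ ^ σ ≤ (‖t - s‖ₑ⁻¹ ^ σ) * (‖t - -s‖ₑ⁻¹ ^ σ) := by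
      rw [← ENNReal.mul_rpow_of_nonneg _ _ h0, ← ENNReal.mul_inv (Or.inr enorm_ne_top)
        (Or.inl enorm_ne_top), ← enorm_mul]
      exact ENNReal.rpow_le_rpow (ENNReal.inv_le_inv.2 h1) h0
    refine h2.trans ?_
    rw [two_mul, ENNReal.rpow_add_of_nonneg _ _ h0 h0, ENNReal.rpow_add_of_nonneg _ _ h0 h0]
    rcases le_total (‖t - s‖ₑ⁻¹ ^ σ) (‖t - -s‖ₑ⁻¹ ^ σ) with h | h
    · exact (mul_le_mul_left h _).trans le_add_self
    · exact (mul_le_mul_right h _).trans le_self_add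
  calc ∫⁻ t in Set.Icc (-r) r, ‖t ^ 2 - b‖ₑ⁻¹ ^ σ
      ≤ ∫⁻ t in Set.Icc (-r) r, (‖t - s‖ₑ⁻¹ ^ (2 * σ) + ‖t - -s‖ₑ⁻¹ ^ (2 * σ)) :=
        lintegral_mono key
    _ = _ := lintegral_add_left (by fun_prop) _
    _ ≤ C + C := add_le_add (h s) (h (-s))

theorem setLIntegral_closedBall_le {n : ℕ} (r : ℝ) (F : Eu (n + 1) → ℝ≥0∞) :
    ∫⁻ ξ in Metric.closedBall 0 r, F ξ ≤
      ∫⁻ p : ℝ × Eu n, F (slice 0 p.1 p.2)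
        ∂((volume.restrict (Set.Icc (-r) r)).prod (volume.restrict (Metric.closedBall 0 r))) := by
  rw [Measure.prod_restrict, ← lintegral_indicator Metric.isClosed_closedBall.measurableSet,
    ← lintegral_indicator (measurableSet_Icc.prod Metric.isClosed_closedBall.measurableSet),
    lintegral_slice 0]
  refine lintegral_mono fun p => ?_
  by_cases hp : slice 0 p.1 p.2 ∈ Metric.closedBall (0 : Eu (n + 1)) r
  · rw [Set.indicator_of_mem hp, Set.indicator_of_mem]
    rw [mem_closedBall_zero_iff] at hp
    exact ⟨abs_le.1 ((abs_le_norm_slice 0 p.1 p.2).trans hp),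
      mem_closedBall_zero_iff.2 ((norm_le_norm_slice 0 p.1 p.2).trans hp)⟩
  · rw [Set.indicator_of_notMem hp]; exact zero_le

/-- On each line parallel to the first axis the function has the form `t² - b'`, and the
one-dimensional bound is uniform in `b'`. -/
theorem exists_lintegral_inv_enorm_norm_sq_sub_le {n : ℕ} {σ : ℝ} (h0 : 0 ≤ σ) (hσ : σ < 1 / 2)
    (r : ℝ) : ∃ C : ℝ≥0∞, C < ⊤ ∧ ∀ b : ℝ,
      ∫⁻ ξ : Eu (n + 1) in Metric.closedBall 0 r, ‖‖ξ‖ ^ 2 - b‖ₑ⁻¹ ^ σ ≤ C := by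
  obtain ⟨C, hC, h⟩ := exists_lintegral_inv_enorm_sq_sub_le h0 hσ r
  refine ⟨C * volume (Metric.closedBall (0 : Eu n) r),
    ENNReal.mul_lt_top hC measure_closedBall_lt_top, fun b => ?_⟩
  refine (setLIntegral_closedBall_le r _).trans ?_
  simp only [norm_slice_sq]
  rw [lintegral_prod_symm _ (by fun_prop)]
  calc _ ≤ ∫⁻ x : Eu n in Metric.closedBall 0 r, C := by
        refine lintegral_mono fun x => ?_
        refine le_trans (le_of_eq ?_) (h (b - ‖x‖ ^ 2))
        refine lintegral_congr fun t => ?_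
        rw [sub_sub_eq_add_sub]
    _ = _ := by simp

theorem norm_sq_sub_le_norm_faddeevSymbol (k : ℝ) (γ : Eu d) (τ : ℝ) (ξ : Eu d) :
    |‖ξ‖ ^ 2 - (k ^ 2 + ‖γ‖ ^ 2)| ≤ ‖faddeevSymbol k γ τ ξ‖ := by
  refine le_trans (le_of_eq ?_) (Complex.abs_re_le_norm _)
  simp [faddeevSymbol, -Complex.ofReal_pow]; ring_nf

theorem abs_im_le_norm_faddeevSymbol (k : ℝ) (γ : Eu d) (τ : ℝ) (ξ : Eu d) :
    |2 * inner ℝ γ ξ - τ| ≤ ‖faddeevSymbol k γ τ ξ‖ := by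
  refine le_trans (le_of_eq ?_) (Complex.abs_im_le_norm _)
  simp [faddeevSymbol, -Complex.ofReal_pow]

theorem continuous_faddeevSymbol (k : ℝ) (γ : Eu d) (τ : ℝ) :
    Continuous (faddeevSymbol k γ τ) := by
  unfold faddeevSymbol; fun_prop

theorem exists_isometry_single {n : ℕ} (γ : Eu (n + 1)) :
    ∃ U : Eu (n + 1) ≃ₗᵢ[ℝ] Eu (n + 1), U (EuclideanSpace.single 0 ‖γ‖) = γ :=
  ⟨_, Submodule.reflection_sub (by simp)⟩

theorem setLIntegral_closedBall_comp_isometry (U : Eu d ≃ₗᵢ[ℝ] Eu d) (F : Eu d → ℝ≥0∞) (r : ℝ) :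
    ∫⁻ ξ in Metric.closedBall 0 r, F ξ = ∫⁻ ξ in Metric.closedBall 0 r, F (U ξ) := by
  have hp : U ⁻¹' Metric.closedBall 0 r = Metric.closedBall 0 r := by
    ext ξ; simp
  rw [← (U.measurePreserving).setLIntegral_comp_preimage_emb
    U.toMeasurableEquiv.measurableEmbedding, hp]

/-- After a rotation taking the first axis to the direction of `γ`, the imaginary part of the symbol
depends on `t` only, and for fixed `t` the real part is singular in the transverse variable `x`. The
exponents `5/16 < 1/2` and `15/16 < 1` stay below the two integrability thresholds, while their sum
exceeds `1`. -/
theorem inv_symbol_rotated_le {n : ℕ} (k : ℝ) {γ : Eu (n + 2)} (hγ : γ ≠ 0)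
    {U : Eu (n + 2) ≃ₗᵢ[ℝ] Eu (n + 2)} (hU : U (EuclideanSpace.single 0 ‖γ‖) = γ) (τ t : ℝ)
    (x : Eu (n + 1)) :
    ‖faddeevSymbol k γ τ (U (slice 0 t x))‖ₑ⁻¹ ^ (5 / 4 : ℝ) ≤
      ‖‖x‖ ^ 2 - (k ^ 2 + ‖γ‖ ^ 2 - t ^ 2)‖ₑ⁻¹ ^ (5 / 16 : ℝ) *
        (‖2 * ‖γ‖‖ₑ⁻¹ ^ (15 / 16 : ℝ) * ‖t - τ / (2 * ‖γ‖)‖ₑ⁻¹ ^ (15 / 16 : ℝ)) := by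
  have hγ' : 0 < 2 * ‖γ‖ := by have := norm_pos_iff.2 hγ; positivity
  have i1 := norm_sq_sub_le_norm_faddeevSymbol k γ τ (U (slice 0 t x))
  have i2 : |2 * (‖γ‖ * t) - τ| ≤ ‖faddeevSymbol k γ τ (U (slice 0 t x))‖ := by
    have i2 := abs_im_le_norm_faddeevSymbol k γ τ (U (slice 0 t x))
    have i3 : inner ℝ γ (U (slice 0 t x)) = ‖γ‖ * t := by
      conv_lhs => rw [← hU, U.inner_map_map, EuclideanSpace.inner_single_left, slice_same]
      simp
    rwa [i3] at i2
  rw [U.norm_map, norm_slice_sq] at i1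
  rw [← ENNReal.mul_rpow_of_nonneg _ _ (by norm_num), ← ENNReal.mul_inv (Or.inr enorm_ne_top)
      (Or.inl enorm_ne_top), ← enorm_mul, mul_sub, mul_div_cancel₀ _ hγ'.ne',
    show (5 / 4 : ℝ) = 5 / 16 + 15 / 16 by norm_num,
    ENNReal.rpow_add_of_nonneg _ _ (by norm_num) (by norm_num)]
  refine mul_le_mul' (ENNReal.rpow_le_rpow (ENNReal.inv_le_inv.2 ?_) (by norm_num))
    (ENNReal.rpow_le_rpow (ENNReal.inv_le_inv.2 ?_) (by norm_num))
  · rw [← ofReal_norm, ← ofReal_norm]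
    refine ENNReal.ofReal_le_ofReal (le_trans (le_of_eq ?_) i1)
    rw [Real.norm_eq_abs]; ring_nf
  · rw [← ofReal_norm, ← ofReal_norm]
    refine ENNReal.ofReal_le_ofReal (le_trans (le_of_eq ?_) i2)
    rw [Real.norm_eq_abs]; ring_nf

theorem lintegral_prod_mul_le {α β : Type*} [MeasurableSpace α] [MeasurableSpace β]
    (μ : Measure α) (ν : Measure β) [SFinite ν] {A : α → β → ℝ≥0∞} {B : α → ℝ≥0∞}
    {D C₁ C₂ : ℝ≥0∞} (hA : Measurable (fun p : α × β => A p.1 p.2)) (hB : Measurable B)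
    (h₁ : ∀ t, ∫⁻ x, A t x ∂ν ≤ C₁) (h₂ : ∫⁻ t, B t ∂μ ≤ C₂) :
    ∫⁻ p : α × β, A p.1 p.2 * (D * B p.1) ∂(μ.prod ν) ≤ C₁ * (D * C₂) := by
  calc ∫⁻ p : α × β, A p.1 p.2 * (D * B p.1) ∂(μ.prod ν)
      = ∫⁻ t, ∫⁻ x, A t x * (D * B t) ∂ν ∂μ :=
        lintegral_prod _ (hA.mul ((hB.comp measurable_fst).const_mul D)).aemeasurable
    _ ≤ ∫⁻ t, C₁ * (D * B t) ∂μ := by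
        refine lintegral_mono fun t => ?_
        simp only
        have hAt : Measurable (A t) := hA.comp (measurable_prodMk_left (x := t))
        rw [lintegral_mul_const _ hAt]
        gcongr
        exact h₁ t
    _ ≤ _ := by
        rw [lintegral_const_mul _ (hB.const_mul D), lintegral_const_mul _ hB]
        gcongr

-- Integrating first in the transverse variables and then along `γ` bounds each factor separately.
-- The dimension is at least two, so that transverse variables exist. An exponent above `1` leaves
-- room for a modulus of continuity in `τ`.
set_option maxHeartbeats 1000000 in
theorem exists_lintegral_inv_symbol_le {n : ℕ} (k : ℝ) {γ : Eu (n + 2)} (hγ : γ ≠ 0) (r : ℝ) :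
    ∃ C : ℝ≥0∞, C < ⊤ ∧ ∀ τ : ℝ,
      ∫⁻ ξ in Metric.closedBall 0 r, ‖faddeevSymbol k γ τ ξ‖ₑ⁻¹ ^ (5 / 4 : ℝ) ≤ C := by
  obtain ⟨C₁, hC₁, h₁⟩ := exists_lintegral_inv_enorm_norm_sq_sub_le (n := n) (σ := 5 / 16)
    (by norm_num) (by norm_num) r
  obtain ⟨C₂, hC₂, h₂⟩ := exists_lintegral_inv_enorm_sub_le (σ := 15 / 16) (by norm_num)
    (by norm_num) r
  obtain ⟨U, hU⟩ := exists_isometry_single γ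
  have hD' : ‖2 * ‖γ‖‖ₑ⁻¹ ^ (15 / 16 : ℝ) < ⊤ :=
    ENNReal.rpow_lt_top_of_nonneg (by norm_num) (by simp [hγ])
  generalize hD : ‖2 * ‖γ‖‖ₑ⁻¹ ^ (15 / 16 : ℝ) = D at hD'
  refine ⟨C₁ * (D * C₂), ENNReal.mul_lt_top hC₁ (ENNReal.mul_lt_top hD' hC₂), fun τ => ?_⟩
  obtain ⟨A, hA⟩ : ∃ A : ℝ → Eu (n + 1) → ℝ≥0∞, A = fun t x =>
    ‖‖x‖ ^ 2 - (k ^ 2 + ‖γ‖ ^ 2 - t ^ 2)‖ₑ⁻¹ ^ (5 / 16 : ℝ) := ⟨_, rfl⟩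
  obtain ⟨B, hB⟩ : ∃ B : ℝ → ℝ≥0∞, B = fun t => ‖t - τ / (2 * ‖γ‖)‖ₑ⁻¹ ^ (15 / 16 : ℝ) := ⟨_, rfl⟩
  have hAm : Measurable fun p : ℝ × Eu (n + 1) => A p.1 p.2 := by simp only [hA]; fun_prop
  have hBm : Measurable B := by simp only [hB]; fun_prop
  have hA1 : ∀ t, ∫⁻ x in Metric.closedBall 0 r, A t x ≤ C₁ := fun t => by
    simp only [hA]; exact h₁ _
  have hB1 : ∫⁻ t in Set.Icc (-r) r, B t ≤ C₂ := by simp only [hB]; exact h₂ _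
  have hle : ∀ p : ℝ × Eu (n + 1), ‖faddeevSymbol k γ τ (U (slice 0 p.1 p.2))‖ₑ⁻¹ ^ (5 / 4 : ℝ) ≤
      A p.1 p.2 * (D * B p.1) := fun p => by
    simp only [hA, hB, ← hD]
    exact inv_symbol_rotated_le k hγ hU τ p.1 p.2
  rw [setLIntegral_closedBall_comp_isometry U]
  refine (setLIntegral_closedBall_le r _).trans ?_
  refine (lintegral_mono hle).trans ?_
  exact lintegral_prod_mul_le _ _ hAm hBm hA1 hB1

theorem enorm_inv_le_inv_enorm (z : ℂ) : ‖z⁻¹‖ₑ ≤ ‖z‖ₑ⁻¹ := by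
  rcases eq_or_ne z 0 with rfl | hz
  · simp
  · rw [enorm_inv hz]

theorem le_rpow_add_one (X : ℝ≥0∞) : X ≤ X ^ (5 / 4 : ℝ) + 1 := by
  rcases le_total X 1 with h | h
  · exact h.trans le_add_self
  · refine le_trans ?_ le_self_add
    simpa using ENNReal.rpow_le_rpow_of_exponent_le h (by norm_num : (1 : ℝ) ≤ 5 / 4)

theorem exists_bound_of_compactSupport {h : Eu d → ℂ} (hc : Continuous h)
    (hs : HasCompactSupport h) : ∃ M r : ℝ, 0 ≤ M ∧ 0 ≤ r ∧ (∀ ξ, ‖h ξ‖ ≤ M) ∧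
      ∀ ξ, r < ‖ξ‖ → h ξ = 0 := by
  obtain ⟨M, hM⟩ := hs.exists_bound_of_continuous hc
  obtain ⟨r, hr⟩ := hs.isCompact.isBounded.subset_closedBall 0
  refine ⟨M, max r 0, (norm_nonneg _).trans (hM 0), le_max_right _ _, hM, fun ξ hξ => ?_⟩
  refine image_eq_zero_of_notMem_tsupport fun hmem => ?_
  have := mem_closedBall_zero_iff.1 (hr hmem)
  exact absurd (lt_of_le_of_lt (le_max_left r 0) hξ) (not_lt.2 this)

theorem enorm_mul_le_indicator {h : Eu d → ℂ} {M r : ℝ} (hM : ∀ ξ, ‖h ξ‖ ≤ M)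
    (hr : ∀ ξ, r < ‖ξ‖ → h ξ = 0) (z : Eu d → ℂ) (ξ : Eu d) :
    ‖h ξ * z ξ‖ₑ ≤
      (Metric.closedBall 0 r).indicator (fun ξ => ENNReal.ofReal M * ‖z ξ‖ₑ) ξ := by
  by_cases hξ : ξ ∈ Metric.closedBall (0 : Eu d) r
  · rw [Set.indicator_of_mem hξ, enorm_mul]
    gcongr
    rw [← ofReal_norm]
    exact ENNReal.ofReal_le_ofReal (hM ξ)
  · rw [hr ξ (by simpa using hξ)]; simp

theorem integrable_div_symbol (hd : 2 ≤ d) (k : ℝ) {γ : Eu d} {τ : ℝ} (hγτ : γ ≠ 0 ∨ τ ≠ 0)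
    {h : Eu d → ℂ} (hc : Continuous h) (hs : HasCompactSupport h) :
    Integrable (fun ξ => h ξ / faddeevSymbol k γ τ ξ) := by
  have hmeas : AEStronglyMeasurable (fun ξ => h ξ / faddeevSymbol k γ τ ξ) volume :=
    (hc.measurable.div (continuous_faddeevSymbol k γ τ).measurable).aestronglyMeasurable
  obtain ⟨M, r, hM0, hr0, hM, hr⟩ := exists_bound_of_compactSupport hc hs
  obtain ⟨n, rfl⟩ : ∃ n, d = n + 2 := ⟨d - 2, by omega⟩
  by_cases hγ : γ = 0
  · subst hγ
    have hτ : τ ≠ 0 := by simpa using hγτ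
    refine ((hc.integrable_of_hasCompactSupport hs).norm.mul_const |τ|⁻¹).mono' hmeas
      (Eventually.of_forall fun ξ => ?_)
    rw [norm_div, div_eq_mul_inv]
    have := abs_im_le_norm_faddeevSymbol k (0 : Eu (n + 2)) τ ξ
    simp only [inner_zero_left, mul_zero, zero_sub, abs_neg] at this
    have h0 := abs_pos.2 hτ
    gcongr
  · obtain ⟨C, hC, hb⟩ := exists_lintegral_inv_symbol_le k hγ r
    refine ⟨hmeas, ?_⟩
    rw [hasFiniteIntegral_iff_enorm]
    calc ∫⁻ ξ, ‖h ξ / faddeevSymbol k γ τ ξ‖ₑ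
        ≤ ∫⁻ ξ, (Metric.closedBall 0 r).indicator (fun ξ => ENNReal.ofReal M *
            ‖(faddeevSymbol k γ τ ξ)⁻¹‖ₑ) ξ := by
          refine lintegral_mono fun ξ => ?_
          simp only [div_eq_mul_inv]
          exact enorm_mul_le_indicator hM hr _ ξ
      _ = ∫⁻ ξ in Metric.closedBall 0 r, ENNReal.ofReal M * ‖(faddeevSymbol k γ τ ξ)⁻¹‖ₑ :=
          lintegral_indicator Metric.isClosed_closedBall.measurableSet _
      _ ≤ ∫⁻ ξ in Metric.closedBall 0 r, ENNReal.ofReal M *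
            (‖faddeevSymbol k γ τ ξ‖ₑ⁻¹ ^ (5 / 4 : ℝ) + 1) := by
          gcongr with ξ
          exact (enorm_inv_le_inv_enorm _).trans (le_rpow_add_one _)
      _ < ⊤ := by
          rw [lintegral_const_mul' _ _ ENNReal.ofReal_ne_top, lintegral_add_right _ measurable_const]
          refine ENNReal.mul_lt_top ENNReal.ofReal_lt_top (ENNReal.add_lt_top.2 ⟨?_, ?_⟩)
          · exact (hb τ).trans_lt hC
          · simp [measure_closedBall_lt_top]

/-- Let `N` be the larger of the two inverses. The difference is at most `2N` and at most `δN²`; the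
geometric mean with exponents `3/4` and `1/4` trades a quarter power of `δ` for the integrable power
`N^{5/4}`. -/
theorem enorm_inv_sub_inv_le {z w : ℂ} {δ : ℝ} (hδ : 0 < δ) (h : ‖z - w‖ ≤ δ) :
    ‖z⁻¹ - w⁻¹‖ₑ ≤ ENNReal.ofReal δ ^ (1 / 4 : ℝ) *
      (2 * (‖z‖ₑ⁻¹ ^ (5 / 4 : ℝ) + ‖w‖ₑ⁻¹ ^ (5 / 4 : ℝ))) := by
  set X := ‖z‖ₑ⁻¹
  set Y := ‖w‖ₑ⁻¹
  set N := max X Y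
  have hX0 : X ≠ 0 := ENNReal.inv_ne_zero.2 enorm_ne_top
  have hY0 : Y ≠ 0 := ENNReal.inv_ne_zero.2 enorm_ne_top
  have hδ0 : ENNReal.ofReal δ ≠ 0 := by simpa using hδ
  have h1 : ‖z⁻¹ - w⁻¹‖ₑ ≤ 2 * N := by
    refine (enorm_sub_le).trans ?_
    rw [two_mul]
    exact add_le_add ((enorm_inv_le_inv_enorm z).trans (le_max_left _ _))
      ((enorm_inv_le_inv_enorm w).trans (le_max_right _ _))
  have h2 : ‖z⁻¹ - w⁻¹‖ₑ ≤ ENNReal.ofReal δ * (N * N) := by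
    -- At a zero the complex inverse is `0`, but the inverse in `[0, ∞]` is `∞`, so the right-hand
    -- side is infinite.
    rcases eq_or_ne z 0 with hz | hz
    · have : N = ⊤ := by simp [N, X, hz]
      simp [this, hδ0, ENNReal.mul_top]
    rcases eq_or_ne w 0 with hw | hw
    · have : N = ⊤ := by simp [N, Y, hw]
      simp [this, hδ0, ENNReal.mul_top]
    rw [inv_sub_inv hz hw, div_eq_mul_inv, enorm_mul, enorm_inv (mul_ne_zero hz hw), enorm_mul,
      ENNReal.mul_inv (Or.inr enorm_ne_top) (Or.inl enorm_ne_top)]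
    gcongr
    · rw [← ofReal_norm, norm_sub_rev]; exact ENNReal.ofReal_le_ofReal h
    · exact le_max_left _ _
    · exact le_max_right _ _
  have h3 : ‖z⁻¹ - w⁻¹‖ₑ = ‖z⁻¹ - w⁻¹‖ₑ ^ (1 / 4 : ℝ) * ‖z⁻¹ - w⁻¹‖ₑ ^ (3 / 4 : ℝ) := by
    rw [← ENNReal.rpow_add_of_nonneg _ _ (by norm_num) (by norm_num)]; norm_num
  have h4 : N ^ (5 / 4 : ℝ) ≤ X ^ (5 / 4 : ℝ) + Y ^ (5 / 4 : ℝ) := by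
    rcases le_total X Y with h | h
    · simp only [N, max_eq_right h]; exact le_add_self
    · simp only [N, max_eq_left h]; exact le_self_add
  rw [h3]
  calc _ ≤ (ENNReal.ofReal δ * (N * N)) ^ (1 / 4 : ℝ) * (2 * N) ^ (3 / 4 : ℝ) := by gcongr
    _ = ENNReal.ofReal δ ^ (1 / 4 : ℝ) * (2 ^ (3 / 4 : ℝ) * N ^ (5 / 4 : ℝ)) := by
        rw [ENNReal.mul_rpow_of_nonneg _ _ (by norm_num), ENNReal.mul_rpow_of_nonneg _ _ (by norm_num),
          ENNReal.mul_rpow_of_nonneg _ _ (by norm_num), show (5 / 4 : ℝ) = 1 / 4 + 1 / 4 + 3 / 4 by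
            norm_num, ENNReal.rpow_add_of_nonneg _ _ (by norm_num) (by norm_num),
          ENNReal.rpow_add_of_nonneg _ _ (by norm_num) (by norm_num)]
        ring
    _ ≤ _ := by
        gcongr
        calc (2 : ℝ≥0∞) ^ (3 / 4 : ℝ) ≤ 2 ^ (1 : ℝ) :=
              ENNReal.rpow_le_rpow_of_exponent_le (by norm_num) (by norm_num)
          _ = 2 := ENNReal.rpow_one 2

/-- The difference of the integrals is `O(|τ|^{1/4})`, by the uniform `L^{5/4}` bound. For `γ ≠ 0`
the limit is thus two-sided, and both signs give the same kernel. -/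
theorem tendsto_integral_div_symbol_of_ne {n : ℕ} (k : ℝ) {γ : Eu (n + 2)} (hγ : γ ≠ 0)
    {h : Eu (n + 2) → ℂ} (hc : Continuous h) (hs : HasCompactSupport h) :
    Tendsto (fun τ => ∫ ξ, h ξ / faddeevSymbol k γ τ ξ) (𝓝[≠] 0)
      (𝓝 (∫ ξ, h ξ / faddeevSymbol k γ 0 ξ)) := by
  obtain ⟨M, r, hM0, hr0, hM, hr⟩ := exists_bound_of_compactSupport hc hs
  obtain ⟨C, hC, hb⟩ := exists_lintegral_inv_symbol_le k hγ r
  have hmz : ∀ τ, Measurable fun ξ => ‖faddeevSymbol k γ τ ξ‖ₑ⁻¹ ^ (5 / 4 : ℝ) := fun τ =>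
    ((continuous_faddeevSymbol k γ τ).measurable.enorm.inv).pow_const _
  have key : ∀ τ : ℝ, τ ≠ 0 →
      ‖(∫ ξ, h ξ / faddeevSymbol k γ τ ξ) - ∫ ξ, h ξ / faddeevSymbol k γ 0 ξ‖ₑ ≤
        ENNReal.ofReal |τ| ^ (1 / 4 : ℝ) * (ENNReal.ofReal M * (2 * (C + C))) := by
    intro τ hτ
    rw [← integral_sub (integrable_div_symbol (by omega) k (Or.inl hγ) hc hs)
      (integrable_div_symbol (by omega) k (Or.inl hγ) hc hs)]
    refine (enorm_integral_le_lintegral_enorm _).trans ?_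
    calc _ ≤ ∫⁻ ξ, (Metric.closedBall 0 r).indicator (fun ξ => ENNReal.ofReal M *
            ‖(faddeevSymbol k γ τ ξ)⁻¹ - (faddeevSymbol k γ 0 ξ)⁻¹‖ₑ) ξ := by
          refine lintegral_mono fun ξ => ?_
          simp only [div_eq_mul_inv, ← mul_sub]
          exact enorm_mul_le_indicator hM hr
            (fun ξ => (faddeevSymbol k γ τ ξ)⁻¹ - (faddeevSymbol k γ 0 ξ)⁻¹) ξ
      _ = ∫⁻ ξ in Metric.closedBall 0 r, ENNReal.ofReal M *
            ‖(faddeevSymbol k γ τ ξ)⁻¹ - (faddeevSymbol k γ 0 ξ)⁻¹‖ₑ :=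
          lintegral_indicator Metric.isClosed_closedBall.measurableSet _
      _ ≤ ∫⁻ ξ in Metric.closedBall 0 r, ENNReal.ofReal M * (ENNReal.ofReal |τ| ^ (1 / 4 : ℝ) *
            (2 * (‖faddeevSymbol k γ τ ξ‖ₑ⁻¹ ^ (5 / 4 : ℝ) +
              ‖faddeevSymbol k γ 0 ξ‖ₑ⁻¹ ^ (5 / 4 : ℝ)))) := by
          gcongr with ξ
          refine enorm_inv_sub_inv_le (abs_pos.2 hτ) (le_of_eq ?_)
          simp [faddeevSymbol]
      _ = ENNReal.ofReal M * (ENNReal.ofReal |τ| ^ (1 / 4 : ℝ) *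
            (2 * ((∫⁻ ξ in Metric.closedBall 0 r, ‖faddeevSymbol k γ τ ξ‖ₑ⁻¹ ^ (5 / 4 : ℝ)) +
              ∫⁻ ξ in Metric.closedBall 0 r, ‖faddeevSymbol k γ 0 ξ‖ₑ⁻¹ ^ (5 / 4 : ℝ)))) := by
          rw [lintegral_const_mul' _ _ ENNReal.ofReal_ne_top, lintegral_const_mul' _ _
            (ENNReal.rpow_ne_top_of_nonneg (by norm_num) ENNReal.ofReal_ne_top),
            lintegral_const_mul' _ _ (by simp), lintegral_add_left (hmz τ)]
      _ ≤ ENNReal.ofReal M * (ENNReal.ofReal |τ| ^ (1 / 4 : ℝ) * (2 * (C + C))) := by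
          gcongr
          · exact hb τ
          · exact hb 0
      _ = _ := by ring
  rw [tendsto_iff_edist_tendsto_0]
  refine tendsto_of_tendsto_of_tendsto_of_le_of_le' tendsto_const_nhds ?_
    (Eventually.of_forall fun _ => zero_le) (eventually_nhdsWithin_of_forall fun τ hτ => ?_)
    (h := fun τ => ENNReal.ofReal |τ| ^ (1 / 4 : ℝ) * (ENNReal.ofReal M * (2 * (C + C))))
  · have h1 : Tendsto (fun τ : ℝ => ENNReal.ofReal |τ| ^ (1 / 4 : ℝ)) (𝓝[≠] 0) (𝓝 0) := by
      have : Continuous fun τ : ℝ => ENNReal.ofReal |τ| ^ (1 / 4 : ℝ) :=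
        ENNReal.continuous_rpow_const.comp (ENNReal.continuous_ofReal.comp continuous_abs)
      have h2 := this.tendsto 0
      simp only [abs_zero, ENNReal.ofReal_zero] at h2
      rw [ENNReal.zero_rpow_of_pos (by norm_num)] at h2
      exact h2.mono_left nhdsWithin_le_nhds
    have h2 := ENNReal.Tendsto.mul_const h1 (b := ENNReal.ofReal M * (2 * (C + C)))
      (Or.inr (ENNReal.mul_lt_top ENNReal.ofReal_lt_top (ENNReal.mul_lt_top (by simp)
        (ENNReal.add_lt_top.2 ⟨hC, hC⟩))).ne)
    simpa using h2
  · rw [edist_eq_enorm_sub]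
    exact key τ hτ

/-- The negative part of the logarithm is at most four times a quarter power of the inverse modulus,
which is locally integrable near the zero sphere of the symbol; the argument is at most `π`. -/
theorem norm_log_le {z : ℂ} {a b : ℝ} (ha : 0 < a) (h1 : a ≤ ‖z‖) (h2 : ‖z‖ ≤ b) :
    ‖Complex.log z‖ ≤ b + 4 * a⁻¹ ^ (1 / 4 : ℝ) + Real.pi := by
  have hz : 0 < ‖z‖ := ha.trans_le h1
  refine (Complex.norm_le_abs_re_add_abs_im _).trans ?_
  rw [Complex.log_re, Complex.log_im]
  refine add_le_add ?_ (Complex.abs_arg_le_pi z)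
  have hp : 0 ≤ a⁻¹ ^ (1 / 4 : ℝ) := by positivity
  rw [abs_le]
  constructor
  · have h3 : Real.log a⁻¹ ≤ a⁻¹ ^ (1 / 4 : ℝ) / (1 / 4) :=
      Real.log_le_rpow_div (by positivity) (by norm_num)
    have h4 : Real.log a ≤ Real.log ‖z‖ := Real.log_le_log ha h1
    rw [Real.log_inv] at h3
    have h5 : 0 ≤ b := hz.le.trans h2
    linarith
  · have := Real.log_le_sub_one_of_pos hz
    linarith

/-- For `x < 0` the argument approaches the branch cut from a side fixed by the sign of `τ`. This is
the source of the distinction between the outgoing and the incoming operator when `γ = 0`. -/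
theorem exists_tendsto_log_sub_mul_I {x : ℝ} (hx : x ≠ 0) {l : Filter ℝ}
    (hl : l = 𝓝[>] 0 ∨ l = 𝓝[<] 0) :
    ∃ L : ℂ, Tendsto (fun τ : ℝ => Complex.log ((x : ℂ) - Complex.I * τ)) l (𝓝 L) := by
  have hcont : Tendsto (fun τ : ℝ => (x : ℂ) - Complex.I * τ) (𝓝 0) (𝓝 x) := by
    have : Continuous fun τ : ℝ => (x : ℂ) - Complex.I * τ := by fun_prop
    simpa using this.tendsto 0
  rcases lt_or_gt_of_ne hx with h | h
  · rcases hl with rfl | rfl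
    · refine ⟨_, (Complex.tendsto_log_nhdsWithin_im_neg_of_re_neg_of_im_zero (z := x)
        (by simpa using h) (by simp)).comp (tendsto_nhdsWithin_iff.2
          ⟨hcont.mono_left nhdsWithin_le_nhds, ?_⟩)⟩
      filter_upwards [self_mem_nhdsWithin] with τ hτ
      simpa using hτ
    · refine ⟨_, (Complex.tendsto_log_nhdsWithin_im_nonneg_of_re_neg_of_im_zero (z := x)
        (by simpa using h) (by simp)).comp (tendsto_nhdsWithin_iff.2
          ⟨hcont.mono_left nhdsWithin_le_nhds, ?_⟩)⟩
      filter_upwards [self_mem_nhdsWithin] with τ hτ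
      simpa using (Set.mem_Iio.1 hτ).le
  · refine ⟨_, (((continuousAt_clog (x := (x : ℂ)) (by simp [Complex.mem_slitPlane_iff, h])).tendsto).comp hcont).mono_left ?_⟩
    rcases hl with rfl | rfl <;> exact nhdsWithin_le_nhds

theorem faddeevSymbol_zero (k τ : ℝ) (ξ : Eu d) :
    faddeevSymbol k 0 τ ξ = ((‖ξ‖ ^ 2 - k ^ 2 : ℝ) : ℂ) - Complex.I * τ := by
  simp [faddeevSymbol]

theorem faddeevSymbol_zero_mem_slitPlane {τ : ℝ} (hτ : τ ≠ 0) (k : ℝ) (ξ : Eu d) :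
    faddeevSymbol k 0 τ ξ ∈ Complex.slitPlane := by
  rw [faddeevSymbol_zero, Complex.mem_slitPlane_iff]
  right
  rw [Complex.sub_im, Complex.ofReal_im]
  simpa using hτ

theorem hasFDerivAt_log_faddeevSymbol {τ : ℝ} (hτ : τ ≠ 0) (k : ℝ) (ξ : Eu d) :
    HasFDerivAt (fun ξ : Eu d => Complex.log (faddeevSymbol k 0 τ ξ))
      ((faddeevSymbol k 0 τ ξ)⁻¹ • (Complex.ofRealCLM.comp ((2 : ℕ) • (innerSL ℝ ξ)))) ξ := by
  have h1 : HasFDerivAt (fun ξ : Eu d => ‖ξ‖ ^ 2 - k ^ 2) ((2 : ℕ) • (innerSL ℝ ξ)) ξ :=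
    (hasStrictFDerivAt_norm_sq ξ).hasFDerivAt.sub_const _
  have h2 : HasFDerivAt (fun ξ : Eu d => faddeevSymbol k 0 τ ξ)
      (Complex.ofRealCLM.comp ((2 : ℕ) • (innerSL ℝ ξ))) ξ := by
    refine ((Complex.ofRealCLM.hasFDerivAt.comp ξ h1).sub_const
      (Complex.I * τ)).congr_of_eventuallyEq (Eventually.of_forall fun ξ => ?_)
    simp [faddeevSymbol_zero]
  have h3 := ((Complex.hasDerivAt_log
    (faddeevSymbol_zero_mem_slitPlane hτ k ξ)).hasFDerivAt.restrictScalars ℝ).comp ξ h2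
  refine h3.congr_fderiv ?_
  ext v
  simp only [ContinuousLinearMap.comp_apply, ContinuousLinearMap.coe_restrictScalars',
    ContinuousLinearMap.toSpanSingleton_apply, smul_apply, smul_eq_mul]
  ring

/-- Dominated convergence: the logarithms converge off the sphere of radius `k`, a null set because
`k > 0`, with a quarter power of `1/||ξ|² - k²|` as majorant. -/
theorem exists_tendsto_integral_mul_log {n : ℕ} {k : ℝ} (hk : 0 < k) {l : Filter ℝ}
    (hl : l = 𝓝[>] 0 ∨ l = 𝓝[<] 0) {h : Eu (n + 1) → ℂ} (hc : Continuous h)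
    (hs : HasCompactSupport h) :
    ∃ L : ℂ, Tendsto (fun τ : ℝ => ∫ ξ, h ξ * Complex.log (faddeevSymbol k 0 τ ξ)) l (𝓝 L) := by
  obtain ⟨M, r, hM0, hr0, hM, hr⟩ := exists_bound_of_compactSupport hc hs
  have hlim : ∀ ξ : Eu (n + 1), ∃ L : ℂ, ‖ξ‖ ^ 2 - k ^ 2 ≠ 0 →
      Tendsto (fun τ : ℝ => Complex.log (faddeevSymbol k 0 τ ξ)) l (𝓝 L) := by
    intro ξ
    by_cases hξ : ‖ξ‖ ^ 2 - k ^ 2 = 0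
    · exact ⟨0, fun h => absurd hξ h⟩
    · obtain ⟨L, hL⟩ := exists_tendsto_log_sub_mul_I hξ hl
      exact ⟨L, fun _ => by simpa only [faddeevSymbol_zero] using hL⟩
  choose L hL using hlim
  have hae : ∀ᵐ ξ : Eu (n + 1), ‖ξ‖ ^ 2 - k ^ 2 ≠ 0 := by
    have h0 := Measure.addHaar_sphere_of_ne_zero (volume : Measure (Eu (n + 1))) 0 hk.ne'
    filter_upwards [measure_eq_zero_iff_ae_notMem.1 h0] with ξ hξ hz
    refine hξ (mem_sphere_zero_iff_norm.2 ?_)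
    rw [sub_eq_zero] at hz
    exact (pow_left_inj₀ (norm_nonneg _) hk.le two_ne_zero).1 hz
  set G : Eu (n + 1) → ℝ := (Metric.closedBall 0 r).indicator (fun ξ =>
    M * (r ^ 2 + k ^ 2 + 1 + 4 * |‖ξ‖ ^ 2 - k ^ 2|⁻¹ ^ (1 / 4 : ℝ) + Real.pi)) with hG
  have hGint : Integrable G := by
    rw [hG, integrable_indicator_iff Metric.isClosed_closedBall.measurableSet]
    have hcst : ∀ c : ℝ, IntegrableOn (fun _ : Eu (n + 1) => c) (Metric.closedBall 0 r) :=
      fun c => integrableOn_const (measure_closedBall_lt_top.ne)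
    have hpow : IntegrableOn (fun ξ : Eu (n + 1) => |‖ξ‖ ^ 2 - k ^ 2|⁻¹ ^ (1 / 4 : ℝ))
        (Metric.closedBall 0 r) := by
      have hmeas : Measurable fun ξ : Eu (n + 1) => |‖ξ‖ ^ 2 - k ^ 2|⁻¹ ^ (1 / 4 : ℝ) :=
        ((by fun_prop : Measurable fun ξ : Eu (n + 1) => |‖ξ‖ ^ 2 - k ^ 2|).inv).pow_const _
      obtain ⟨C, hC, hCb⟩ := exists_lintegral_inv_enorm_norm_sq_sub_le (n := n) (σ := 1 / 4)
        (by norm_num) (by norm_num) r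
      refine ⟨hmeas.aestronglyMeasurable, ?_⟩
      rw [hasFiniteIntegral_iff_enorm]
      refine lt_of_le_of_lt (lintegral_mono fun ξ => ?_) ((hCb (k ^ 2)).trans_lt hC)
      rw [← ofReal_norm, Real.norm_of_nonneg (by positivity),
        ← ENNReal.ofReal_rpow_of_nonneg (by positivity) (by norm_num)]
      refine ENNReal.rpow_le_rpow ?_ (by norm_num)
      rw [← Real.norm_eq_abs]
      by_cases hz : ‖ξ‖ ^ 2 - k ^ 2 = 0
      · simp [hz]
      · rw [ENNReal.ofReal_inv_of_pos (norm_pos_iff.2 hz), ofReal_norm]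
    exact ((((hcst _).add (hpow.const_mul 4)).add (hcst Real.pi)).const_mul M)
  have : l.IsCountablyGenerated := by rcases hl with rfl | rfl <;> infer_instance
  have hl0 : l ≤ 𝓝 0 := by rcases hl with rfl | rfl <;> exact nhdsWithin_le_nhds
  refine ⟨∫ ξ, h ξ * L ξ, tendsto_integral_filter_of_dominated_convergence G ?_ ?_ hGint ?_⟩
  · refine Eventually.of_forall fun τ => Measurable.aestronglyMeasurable ?_
    exact hc.measurable.mul (Complex.measurable_log.comp (continuous_faddeevSymbol k 0 τ).measurable)
  · filter_upwards [hl0 (Metric.closedBall_mem_nhds (0 : ℝ) one_pos)] with τ hτ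
    filter_upwards [hae] with ξ hξ
    by_cases hb : ξ ∈ Metric.closedBall (0 : Eu (n + 1)) r
    · rw [hG, Set.indicator_of_mem hb, norm_mul]
      have hξr : ‖ξ‖ ^ 2 ≤ r ^ 2 := by
        have := mem_closedBall_zero_iff.1 hb
        gcongr
      have h1 := norm_sq_sub_le_norm_faddeevSymbol k (0 : Eu (n + 1)) τ ξ
      simp only [norm_zero, ne_eq, OfNat.ofNat_ne_zero, not_false_eq_true, zero_pow,
        add_zero] at h1
      have h2 : ‖faddeevSymbol k 0 τ ξ‖ ≤ r ^ 2 + k ^ 2 + 1 := by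
        rw [faddeevSymbol_zero]
        refine (norm_sub_le _ _).trans (add_le_add ?_ ?_)
        · rw [Complex.norm_real, Real.norm_eq_abs, abs_le]
          constructor <;> nlinarith [sq_nonneg ‖ξ‖, sq_nonneg k]
        · simpa using hτ
      exact mul_le_mul (hM ξ) (norm_log_le (abs_pos.2 hξ) h1 h2) (norm_nonneg _) hM0
    · rw [hG, Set.indicator_of_notMem hb, hr ξ (by simpa using hb)]
      simp
  · filter_upwards [hae] with ξ hξ
    exact (hL ξ hξ).const_mul _

/-- For `γ = 0` one has `∑ ξ_j² = m + (k² + iτ)` and `ξ_j/m = ½ ∂_j log m`. Hence `(k² + iτ) ∫ h/m =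
∑ ∫ h ξ_j (ξ_j/m) - ∫ h`, and integration by parts leaves only logarithms. -/
theorem integral_div_symbol_zero_eq {n : ℕ} {k : ℝ} {τ : ℝ} (hτ : τ ≠ 0)
    {h : Eu (n + 2) → ℂ} (hc : ContDiff ℝ ∞ h) (hs : HasCompactSupport h) :
    ∫ ξ, h ξ / faddeevSymbol k 0 τ ξ = ((k : ℂ) ^ 2 + Complex.I * τ)⁻¹ *
      (-(1 / 2) * ∑ j, (∫ ξ, fderiv ℝ (fun ξ : Eu (n + 2) => h ξ * (ξ j : ℂ)) ξ
        (EuclideanSpace.single j 1) * Complex.log (faddeevSymbol k 0 τ ξ)) - ∫ ξ, h ξ) := by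
  have hlogc : Continuous fun ξ : Eu (n + 2) => Complex.log (faddeevSymbol k 0 τ ξ) :=
    continuous_iff_continuousAt.2 fun ξ => (hasFDerivAt_log_faddeevSymbol hτ k ξ).continuousAt
  have hm0 : ∀ ξ : Eu (n + 2), faddeevSymbol k 0 τ ξ ≠ 0 := fun ξ =>
    Complex.slitPlane_ne_zero (faddeevSymbol_zero_mem_slitPlane hτ k ξ)
  have hmc := continuous_faddeevSymbol k (0 : Eu (n + 2)) τ
  have hc0 : (k : ℂ) ^ 2 + Complex.I * τ ≠ 0 := by
    intro h0
    have := congrArg Complex.im h0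
    rw [Complex.add_im, ← Complex.ofReal_pow, Complex.ofReal_im] at this
    simp [hτ] at this
  have hterm : ∀ j : Fin (n + 2), ∫ ξ : Eu (n + 2), h ξ * (ξ j : ℂ) * ((ξ j : ℂ) /
      faddeevSymbol k 0 τ ξ) = -(1 / 2) * ∫ ξ, fderiv ℝ (fun ξ : Eu (n + 2) => h ξ * (ξ j : ℂ)) ξ
        (EuclideanSpace.single j 1) * Complex.log (faddeevSymbol k 0 τ ξ) := by
    intro j
    have hcj : ContDiff ℝ ∞ fun ξ : Eu (n + 2) => h ξ * (ξ j : ℂ) :=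
      hc.mul (Complex.ofRealCLM.contDiff.comp
        (EuclideanSpace.proj j : Eu (n + 2) →L[ℝ] ℝ).contDiff)
    have hsj : HasCompactSupport fun ξ : Eu (n + 2) => h ξ * (ξ j : ℂ) := hs.mul_right
    have hfd : ∀ ξ : Eu (n + 2), fderiv ℝ (fun ξ => Complex.log (faddeevSymbol k 0 τ ξ)) ξ
        (EuclideanSpace.single j 1) = 2 * ((ξ j : ℂ) / faddeevSymbol k 0 τ ξ) := fun ξ => by
      rw [(hasFDerivAt_log_faddeevSymbol hτ k ξ).fderiv]
      simp [EuclideanSpace.inner_single_right]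
      ring
    have hcd : Continuous fun ξ => fderiv ℝ (fun ξ : Eu (n + 2) => h ξ * (ξ j : ℂ)) ξ
        (EuclideanSpace.single j 1) := (hcj.continuous_fderiv (by simp)).clm_apply continuous_const
    have hsd : HasCompactSupport fun ξ => fderiv ℝ (fun ξ : Eu (n + 2) => h ξ * (ξ j : ℂ)) ξ
        (EuclideanSpace.single j 1) :=
      hsj.fderiv_apply ℝ _
    have hquot : Continuous fun ξ : Eu (n + 2) => 2 * ((ξ j : ℂ) / faddeevSymbol k 0 τ ξ) :=
      continuous_const.mul ((by fun_prop : Continuous fun ξ : Eu (n + 2) => (ξ j : ℂ)).div hmc hm0)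
    have ibp := integral_mul_fderiv_eq_neg_fderiv_mul_of_integrable (μ := volume)
      (f := fun ξ : Eu (n + 2) => h ξ * (ξ j : ℂ))
      (g := fun ξ : Eu (n + 2) => Complex.log (faddeevSymbol k 0 τ ξ))
      (v := EuclideanSpace.single j 1)
      ((hcd.mul hlogc).integrable_of_hasCompactSupport hsd.mul_right)
      (by
        simp only [hfd]
        exact (hcj.continuous.mul hquot).integrable_of_hasCompactSupport hsj.mul_right)
      ((hcj.continuous.mul hlogc).integrable_of_hasCompactSupport hsj.mul_right)
      (fun ξ _ => (hcj.differentiable (by simp)).differentiableAt)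
      (fun ξ _ => (hasFDerivAt_log_faddeevSymbol hτ k ξ).differentiableAt)
    simp only [hfd] at ibp
    have e : ∀ ξ : Eu (n + 2), h ξ * (ξ j : ℂ) * ((ξ j : ℂ) / faddeevSymbol k 0 τ ξ) =
        (1 / 2) * (h ξ * (ξ j : ℂ) * (2 * ((ξ j : ℂ) / faddeevSymbol k 0 τ ξ))) := fun ξ => by ring
    simp only [e]
    rw [integral_const_mul, ibp]
    ring
  rw [eq_inv_mul_iff_mul_eq₀ hc0, Finset.mul_sum, Finset.sum_congr rfl fun j _ => (hterm j).symm,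
    ← integral_finsetSum, ← integral_sub, ← integral_const_mul]
  · refine integral_congr_ae (Eventually.of_forall fun ξ => ?_)
    have hsum : ∑ j, (ξ j : ℂ) ^ 2 = faddeevSymbol k 0 τ ξ + ((k : ℂ) ^ 2 + Complex.I * τ) := by
      have : ∑ j, (ξ j : ℂ) ^ 2 = ((‖ξ‖ ^ 2 : ℝ) : ℂ) := by
        rw [EuclideanSpace.real_norm_sq_eq]; push_cast; rfl
      rw [this, faddeevSymbol_zero]; push_cast; ring
    have e : ∑ j, h ξ * (ξ j : ℂ) * ((ξ j : ℂ) / faddeevSymbol k 0 τ ξ) =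
        h ξ / faddeevSymbol k 0 τ ξ * ∑ j, (ξ j : ℂ) ^ 2 := by
      rw [Finset.mul_sum]
      exact Finset.sum_congr rfl fun j _ => by ring
    simp only [e, hsum]
    have := hm0 ξ
    field_simp
    ring
  · refine integrable_finsetSum _ fun j _ => ?_
    have hquot : Continuous fun ξ : Eu (n + 2) => (ξ j : ℂ) / faddeevSymbol k 0 τ ξ :=
      (by fun_prop : Continuous fun ξ : Eu (n + 2) => (ξ j : ℂ)).div hmc hm0
    exact ((hc.continuous.mul (by fun_prop)).mul hquot).integrable_of_hasCompactSupport
      (hs.mul_right.mul_right)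
  · exact hc.continuous.integrable_of_hasCompactSupport hs
  · intro j _
    have hquot : Continuous fun ξ : Eu (n + 2) => (ξ j : ℂ) / faddeevSymbol k 0 τ ξ :=
      (by fun_prop : Continuous fun ξ : Eu (n + 2) => (ξ j : ℂ)).div hmc hm0
    exact ((hc.continuous.mul (by fun_prop)).mul hquot).integrable_of_hasCompactSupport
      (hs.mul_right.mul_right)

theorem exists_tendsto_integral_div_symbol (hd : 2 ≤ d) {k : ℝ} (hk : 0 < k) (γ : Eu d)
    {l : Filter ℝ} (hl : l = 𝓝[>] 0 ∨ l = 𝓝[<] 0) {h : Eu d → ℂ} (hc : ContDiff ℝ ∞ h)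
    (hs : HasCompactSupport h) :
    ∃ L : ℂ, Tendsto (fun τ => ∫ ξ, h ξ / faddeevSymbol k γ τ ξ) l (𝓝 L) := by
  obtain ⟨n, rfl⟩ : ∃ n, d = n + 2 := ⟨d - 2, by omega⟩
  have hl' : l ≤ 𝓝[≠] 0 := by
    rcases hl with rfl | rfl
    · exact nhdsWithin_mono _ fun x hx => (Set.mem_Ioi.1 hx).ne'
    · exact nhdsWithin_mono _ fun x hx => (Set.mem_Iio.1 hx).ne
  by_cases hγ : γ = 0
  · subst hγ
    have hlog : ∀ j : Fin (n + 2), ∃ L : ℂ, Tendsto (fun τ : ℝ => ∫ ξ, fderiv ℝ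
        (fun ξ : Eu (n + 2) => h ξ * (ξ j : ℂ)) ξ (EuclideanSpace.single j 1) *
          Complex.log (faddeevSymbol k 0 τ ξ)) l (𝓝 L) := by
      intro j
      have hcj : ContDiff ℝ ∞ fun ξ : Eu (n + 2) => h ξ * (ξ j : ℂ) :=
        hc.mul (Complex.ofRealCLM.contDiff.comp (EuclideanSpace.proj j : Eu (n + 2) →L[ℝ] ℝ).contDiff)
      refine exists_tendsto_integral_mul_log hk hl ?_ ?_
      · exact (hcj.continuous_fderiv (by simp)).clm_apply continuous_const
      · exact hs.mul_right.fderiv_apply ℝ _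
    choose L hL using hlog
    have hsum := ((tendsto_finsetSum Finset.univ fun j _ => hL j).const_mul (-(1 / 2) : ℂ)).sub
      (tendsto_const_nhds (x := ∫ ξ, h ξ))
    have hinv : Tendsto (fun τ : ℝ => ((k : ℂ) ^ 2 + Complex.I * τ)⁻¹) l
        (𝓝 ((k : ℂ) ^ 2)⁻¹) := by
      refine Tendsto.inv₀ ?_ (by simp [hk.ne'])
      have : Continuous fun τ : ℝ => (k : ℂ) ^ 2 + Complex.I * τ := by fun_prop
      have := this.tendsto 0
      simp only [Complex.ofReal_zero, mul_zero, add_zero] at this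
      exact this.mono_left (hl'.trans nhdsWithin_le_nhds)
    refine ⟨_, (hinv.mul hsum).congr' ?_⟩
    filter_upwards [hl' self_mem_nhdsWithin] with τ hτ
    exact (integral_div_symbol_zero_eq hτ hc hs).symm
  · exact ⟨_, (tendsto_integral_div_symbol_of_ne k hγ hc.continuous hs).mono_left hl'⟩

/-! ### Decay of inverse Fourier transforms, uniformly in parameters -/

theorem fourierInv_fderiv_apply {f : Eu d → ℂ} (hf : ContDiff ℝ ∞ f) (hs : HasCompactSupport f)
    (v z : Eu d) : 𝓕⁻ (fun ξ => fderiv ℝ f ξ v) z =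
      -(2 * Real.pi * Complex.I) * ((inner ℝ z v : ℝ) * 𝓕⁻ f z) := by
  obtain ⟨F, rfl⟩ := exists_schwartz_eq hf hs
  have h := congrArg (fun G : 𝓢(Eu d, ℂ) => G z) (SchwartzMap.fourierInv_lineDerivOp_eq F v)
  have e : (fun ξ => fderiv ℝ F ξ v) = ⇑(LineDeriv.lineDerivOp v F : 𝓢(Eu d, ℂ)) := by
    ext ξ; rw [SchwartzMap.lineDerivOp_apply_eq_fderiv]
  rw [e, ← SchwartzMap.fourierInv_coe, ← SchwartzMap.fourierInv_coe, h, smul_apply,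
    SchwartzMap.smulLeftCLM_apply_apply (by fun_prop)]
  simp

theorem norm_le_sum_abs (z : Eu d) : ‖z‖ ≤ ∑ j, |z j| := by
  have h0 : 0 ≤ ∑ j, |z j| := Finset.sum_nonneg fun j _ => abs_nonneg _
  refine abs_le_of_sq_le_sq' ?_ h0 |>.2
  rw [EuclideanSpace.real_norm_sq_eq]
  calc ∑ j, z j ^ 2 = ∑ j, |z j| ^ 2 := by simp
    _ ≤ ∑ j, |z j| * ∑ i, |z i| := by
        refine Finset.sum_le_sum fun j _ => ?_
        rw [sq]
        gcongr
        exact Finset.single_le_sum (f := fun i => |z i|) (fun i _ => abs_nonneg _) (Finset.mem_univ j)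
    _ = _ := by rw [← Finset.sum_mul, sq]

theorem norm_fourierInv_le {f : Eu d → ℂ} {M r : ℝ} (hM : ∀ ξ, ‖f ξ‖ ≤ M)
    (hr : ∀ ξ, r < ‖ξ‖ → f ξ = 0) (z : Eu d) :
    ‖𝓕⁻ f z‖ ≤ M * volume.real (Metric.closedBall (0 : Eu d) r) := by
  have hM0 : 0 ≤ M := (norm_nonneg _).trans (hM 0)
  have h1 : ‖𝓕⁻ f z‖ ≤ ∫ ξ, ‖f ξ‖ := by
    rw [Real.fourierInv_eq]
    refine (norm_integral_le_integral_norm _).trans (le_of_eq ?_)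
    simp
  have hi : Integrable ((Metric.closedBall (0 : Eu d) r).indicator fun _ => M) := by
    rw [integrable_indicator_iff Metric.isClosed_closedBall.measurableSet]
    exact integrableOn_const measure_closedBall_lt_top.ne
  have h2 : ∫ ξ, ‖f ξ‖ ≤ ∫ ξ, (Metric.closedBall (0 : Eu d) r).indicator (fun _ => M) ξ := by
    refine integral_mono_of_nonneg (Eventually.of_forall fun _ => norm_nonneg _) hi
      (Eventually.of_forall fun ξ => ?_)
    by_cases hξ : ξ ∈ Metric.closedBall (0 : Eu d) r
    · simp only [Set.indicator_of_mem hξ]; exact hM ξ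
    · simp only [Set.indicator_of_notMem hξ]
      rw [hr ξ (by simpa using hξ), norm_zero]
  refine h1.trans (h2.trans (le_of_eq ?_))
  rw [integral_indicator Metric.isClosed_closedBall.measurableSet]
  simp [mul_comm, Measure.real]

theorem hasCompactSupport_of_norm {f : Eu d → ℂ} {r : ℝ} (hr : ∀ ξ, r < ‖ξ‖ → f ξ = 0) :
    HasCompactSupport f :=
  HasCompactSupport.intro (isCompact_closedBall (0 : Eu d) r) fun ξ hξ => hr ξ (by simpa using hξ)

section Family
variable {P : Type*} [NormedAddCommGroup P] [NormedSpace ℝ P]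

/-- Induction on `N`: multiplying the transform by a coordinate of `z` costs one derivative of the
symbol, and the derivatives form another smooth family with the same support bound. Uniformity on
`B` comes from compactness in the initial case. -/
theorem exists_norm_fourierInv_le_pow {B : Set P} (hB : IsCompact B) {r : ℝ} (N : ℕ) :
    ∀ Φ : P → Eu d → ℂ, ContDiff ℝ ∞ (fun q : P × Eu d => Φ q.1 q.2) →
      (∀ p ξ, r < ‖ξ‖ → Φ p ξ = 0) →
      ∃ C : ℝ, 0 ≤ C ∧ ∀ p ∈ B, ∀ z, (1 + ‖z‖) ^ N * ‖𝓕⁻ (Φ p) z‖ ≤ C := by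
  induction N with
  | zero =>
    intro Φ hΦ hr
    obtain ⟨M, hM⟩ := (hB.prod (isCompact_closedBall (0 : Eu d) r)).exists_bound_of_continuousOn
      hΦ.continuous.continuousOn
    refine ⟨max M 0 * volume.real (Metric.closedBall (0 : Eu d) r), by positivity,
      fun p hp z => ?_⟩
    rw [pow_zero, one_mul]
    refine norm_fourierInv_le (fun ξ => ?_) (hr p) z
    by_cases hξ : ξ ∈ Metric.closedBall (0 : Eu d) r
    · exact (hM (p, ξ) ⟨hp, hξ⟩).trans (le_max_left _ _)
    · rw [hr p ξ (by simpa using hξ), norm_zero]; exact le_max_right _ _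
  | succ N ih =>
    intro Φ hΦ hr
    have hp : ∀ p, ContDiff ℝ ∞ (Φ p) := fun p =>
      hΦ.comp (contDiff_const.prodMk contDiff_id : ContDiff ℝ ∞ fun ξ : Eu d => (p, ξ))
    set D : Fin d → P → Eu d → ℂ := fun j p ξ => fderiv ℝ (Φ p) ξ (EuclideanSpace.single j 1)
      with hD
    have hDeq : ∀ j p ξ, D j p ξ = fderiv ℝ (fun q : P × Eu d => Φ q.1 q.2) (p, ξ)
        (0, EuclideanSpace.single j 1) := by
      intro j p ξ
      have h1 := ((hΦ.differentiable (by simp)) (p, ξ)).hasFDerivAt.comp ξ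
        ((hasFDerivAt_const p ξ).prodMk (hasFDerivAt_id ξ))
      have h2 : fderiv ℝ (Φ p) ξ = _ := h1.fderiv
      rw [hD]
      simp only
      rw [h2]
      simp
    have hDs : ∀ j, ContDiff ℝ ∞ (fun q : P × Eu d => D j q.1 q.2) := by
      intro j
      have : (fun q : P × Eu d => D j q.1 q.2) = fun q => fderiv ℝ
          (fun q : P × Eu d => Φ q.1 q.2) q (0, EuclideanSpace.single j 1) := by
        ext q; exact hDeq j q.1 q.2
      rw [this]
      exact (hΦ.fderiv_right (by simp)).clm_apply contDiff_const
    have hDr : ∀ j p ξ, r < ‖ξ‖ → D j p ξ = 0 := by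
      intro j p ξ hξ
      have : Φ p =ᶠ[𝓝 ξ] fun _ => 0 := by
        filter_upwards [(isOpen_lt continuous_const continuous_norm).mem_nhds hξ] with ζ hζ
        exact hr p ζ hζ
      simp only [hD]
      rw [this.fderiv_eq]
      simp
    obtain ⟨C₀, hC₀, h₀⟩ := ih Φ hΦ hr
    choose C hC h using fun j => ih (D j) (hDs j) (hDr j)
    refine ⟨C₀ + ∑ j, C j, add_nonneg hC₀ (Finset.sum_nonneg fun j _ => hC j),
      fun p hpB z => ?_⟩
    have hj : ∀ j, |z j| * ‖𝓕⁻ (Φ p) z‖ ≤ ‖𝓕⁻ (D j p) z‖ := by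
      intro j
      have := fourierInv_fderiv_apply (hp p) (hasCompactSupport_of_norm (hr p))
        (EuclideanSpace.single j 1) z
      rw [hD]
      simp only
      rw [this, EuclideanSpace.inner_single_right]
      simp only [one_mul, conj_trivial, norm_mul, norm_neg, Complex.norm_real, Complex.norm_I,
        mul_one, Real.norm_eq_abs, abs_of_pos Real.pi_pos, Complex.norm_ofNat]
      refine le_mul_of_one_le_left (by positivity) ?_
      nlinarith [Real.pi_gt_three]
    calc (1 + ‖z‖) ^ (N + 1) * ‖𝓕⁻ (Φ p) z‖
        = (1 + ‖z‖) ^ N * (‖𝓕⁻ (Φ p) z‖ + ‖z‖ * ‖𝓕⁻ (Φ p) z‖) := by ring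
      _ ≤ (1 + ‖z‖) ^ N * (‖𝓕⁻ (Φ p) z‖ + ∑ j, ‖𝓕⁻ (D j p) z‖) := by
          gcongr
          calc ‖z‖ * ‖𝓕⁻ (Φ p) z‖ ≤ (∑ j, |z j|) * ‖𝓕⁻ (Φ p) z‖ := by
                gcongr; exact norm_le_sum_abs z
            _ ≤ _ := by rw [Finset.sum_mul]; exact Finset.sum_le_sum fun j _ => hj j
      _ = (1 + ‖z‖) ^ N * ‖𝓕⁻ (Φ p) z‖ + ∑ j, (1 + ‖z‖) ^ N * ‖𝓕⁻ (D j p) z‖ := by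
          rw [mul_add, Finset.mul_sum]
      _ ≤ _ := add_le_add (h₀ p hpB z) (Finset.sum_le_sum fun j _ => h j p hpB z)

theorem bracketWeight_le_one_add_pow (M : ℝ) (z : Eu d) :
    bracketWeight M 1 z ≤ (1 + ‖z‖) ^ ⌈max M 0⌉₊ := by
  have h1 : Real.sqrt (1 + ‖(1 : ℝ) • z‖ ^ 2) ≤ 1 + ‖z‖ := by
    rw [one_smul, Real.sqrt_le_left (by positivity)]
    nlinarith [norm_nonneg z]
  have h2 : M ≤ (⌈max M 0⌉₊ : ℝ) := (le_max_left _ _).trans (Nat.le_ceil _)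
  refine (bracketWeight_mono h2 1 z).trans ?_
  rw [bracketWeight, Real.rpow_natCast]
  exact pow_le_pow_left₀ (Real.sqrt_nonneg _) h1 _

theorem exists_norm_fourierInv_le {B : Set P} (hB : IsCompact B) {r : ℝ} (M : ℝ)
    {Φ : P → Eu d → ℂ} (hΦ : ContDiff ℝ ∞ (fun q : P × Eu d => Φ q.1 q.2))
    (hr : ∀ p ξ, r < ‖ξ‖ → Φ p ξ = 0) :
    ∃ C : ℝ, 0 ≤ C ∧ ∀ p ∈ B, ∀ z, ‖𝓕⁻ (Φ p) z‖ ≤ C * bracketWeight (-M) 1 z := by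
  obtain ⟨C, hC, h⟩ := exists_norm_fourierInv_le_pow hB ⌈max M 0⌉₊ Φ hΦ hr
  refine ⟨C, hC, fun p hp z => ?_⟩
  rw [bracketWeight_neg_eq_inv, ← div_eq_mul_inv, le_div_iff₀ (bracketWeight_pos _ _ _), mul_comm]
  exact (mul_le_mul_of_nonneg_right (bracketWeight_le_one_add_pow M z) (norm_nonneg _)).trans
    (h p hp z)

end Family

/-! ### A temperate regularization of the inverse -/

/-- With `y = (1 + |w|²)⁻¹` one has `w⁻¹ = w̄ y/(1-y)`, since `y/(1-y) = |w|⁻²`. Values `|w| ≥ c`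
correspond to `y ≤ y₀ < 1`, so a cut-off in `y` away from `1` removes the singularity and keeps
temperate growth. Composed with a symbol bounded below it gives a legitimate multiplier. -/
theorem exists_invReg {c : ℝ} (hc : 0 < c) :
    ∃ F : ℂ → ℂ, F.HasTemperateGrowth ∧ ∀ w, c ≤ ‖w‖ → F w = w⁻¹ := by
  set y₀ : ℝ := (1 + c ^ 2)⁻¹ with hy₀
  have hy0 : 0 < y₀ := by positivity
  have hy1 : y₀ < 1 := inv_lt_one_of_one_lt₀ (by nlinarith [sq_pos_of_pos hc])
  set b : ContDiffBump (0 : ℝ) := ⟨y₀, (1 + y₀) / 2, hy0, by linarith⟩ with hb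
  set g : ℝ → ℝ := fun y => b y * (1 - y)⁻¹ with hg
  have hbz : ∀ y, (1 + y₀) / 2 ≤ |y| → b y = 0 := fun y hy => by
    refine b.zero_of_le_dist ?_
    rw [dist_zero_right, Real.norm_eq_abs]; exact hy
  have hgs : ContDiff ℝ ∞ g := by
    rw [contDiff_iff_contDiffAt]
    intro y
    by_cases hy : y = 1
    · have : g =ᶠ[𝓝 y] fun _ => 0 := by
        have ho : IsOpen {y : ℝ | (1 + y₀) / 2 < y} := isOpen_lt continuous_const continuous_id
        filter_upwards [ho.mem_nhds (by rw [hy]; simp; linarith)] with u hu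
        simp only [hg]
        rw [hbz u (hu.le.trans (le_abs_self u)), zero_mul]
      exact contDiffAt_const.congr_of_eventuallyEq this
    · refine (b.contDiff (n := ⊤)).contDiffAt.mul (ContDiffAt.inv (by fun_prop) ?_)
      exact sub_ne_zero.2 (Ne.symm hy)
  have hgc : HasCompactSupport g := b.hasCompactSupport.mul_right
  have hgt : g.HasTemperateGrowth := (hgc.toSchwartzMap hgs).hasTemperateGrowth
  have hyt : (fun w : ℂ => (1 + ‖w‖ ^ 2) ^ (-1 : ℝ)).HasTemperateGrowth :=
    Function.hasTemperateGrowth_one_add_norm_sq_rpow ℂ (-1)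
  have hgy : (fun w : ℂ => g ((1 + ‖w‖ ^ 2) ^ (-1 : ℝ))).HasTemperateGrowth := hgt.comp hyt
  have hconj : (fun w : ℂ => (starRingEnd ℂ) w).HasTemperateGrowth :=
    (Complex.conjCLE : ℂ →L[ℝ] ℂ).hasTemperateGrowth
  refine ⟨fun w => (starRingEnd ℂ) w * (((1 + ‖w‖ ^ 2) ^ (-1 : ℝ) : ℝ) *
    ((g ((1 + ‖w‖ ^ 2) ^ (-1 : ℝ)) : ℝ) : ℂ)), by fun_prop, fun w hw => ?_⟩
  have hw0 : w ≠ 0 := norm_pos_iff.1 (hc.trans_le hw)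
  have hn : 0 < ‖w‖ := norm_pos_iff.2 hw0
  have hb1 : b ((1 + ‖w‖ ^ 2)⁻¹) = 1 := by
    refine b.one_of_mem_closedBall ?_
    rw [mem_closedBall_zero_iff, Real.norm_of_nonneg (by positivity)]
    show (1 + ‖w‖ ^ 2)⁻¹ ≤ y₀
    rw [hy₀]; gcongr
  simp only [hg]
  rw [Real.rpow_neg_one, hb1, one_mul]
  have e : ((1 + ‖w‖ ^ 2)⁻¹ * (1 - (1 + ‖w‖ ^ 2)⁻¹)⁻¹ : ℝ) = (‖w‖ ^ 2)⁻¹ := by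
    have : (1 + ‖w‖ ^ 2) ≠ 0 := by positivity
    field_simp
    simp
  rw [← Complex.ofReal_mul, e, Complex.inv_def, Complex.normSq_eq_norm_sq]

/-- A smooth function of temperate growth that equals `w⁻¹` for `c ≤ ‖w‖`. -/
def invReg (c : ℝ) : ℂ → ℂ := if hc : 0 < c then (exists_invReg hc).choose else 0

theorem hasTemperateGrowth_invReg (c : ℝ) : (invReg c).HasTemperateGrowth := by
  unfold invReg
  split_ifs with hc
  · exact (exists_invReg hc).choose_spec.1
  · exact Function.HasTemperateGrowth.zero

theorem invReg_eq {c : ℝ} (hc : 0 < c) {w : ℂ} (hw : c ≤ ‖w‖) : invReg c w = w⁻¹ := by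
  unfold invReg
  rw [dif_pos hc]
  exact (exists_invReg hc).choose_spec.2 w hw

theorem contDiff_invReg (c : ℝ) : ContDiff ℝ ∞ (invReg c) := (hasTemperateGrowth_invReg c).1

/-- The quadratic symbols `A |ζ| ^ 2 - B + 2 i ⟨v, ζ⟩ - i σ`. -/
def quadSymbol (A B : ℝ) (v : Eu d) (σ : ℝ) (ζ : Eu d) : ℂ :=
  ((A * ‖ζ‖ ^ 2 - B : ℝ) : ℂ) + 2 * Complex.I * ((inner ℝ v ζ : ℝ) : ℂ) - Complex.I * (σ : ℂ)

/-- The parameters range over a compact set, so the decay is uniform. Two values of `σ` are admitted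
in order to cover the product of inverses in a resolvent difference. Both `A` and `B` are free,
since radii much below and much above the frequency are normalized differently. -/
theorem exists_norm_fourierInv_quadSymbol_le {ϕ : Eu d → ℂ} (hϕ : ContDiff ℝ ∞ ϕ)
    (hs : HasCompactSupport ϕ) {F : ℂ → ℂ → ℂ} (hF : ContDiff ℝ ∞ fun w : ℂ × ℂ => F w.1 w.2)
    (S M : ℝ) :
    ∃ C : ℝ, 0 ≤ C ∧ ∀ (A B : ℝ) (v : Eu d) (σ₁ σ₂ : ℝ), |A| ≤ S → |B| ≤ S → ‖v‖ ≤ S →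
      |σ₁| ≤ S → |σ₂| ≤ S → ∀ z, ‖𝓕⁻ (fun ζ => ϕ ζ * F (quadSymbol A B v σ₁ ζ)
        (quadSymbol A B v σ₂ ζ)) z‖ ≤ C * bracketWeight (-M) 1 z := by
  obtain ⟨_, r, -, -, -, hr⟩ := exists_bound_of_compactSupport hϕ.continuous hs
  have hq : ContDiff ℝ ∞ fun q : (ℝ × ℝ × Eu d × ℝ × ℝ) × Eu d =>
      quadSymbol q.1.1 q.1.2.1 q.1.2.2.1 q.1.2.2.2.1 q.2 := by
    unfold quadSymbol
    have h1 : ContDiff ℝ ∞ fun q : (ℝ × ℝ × Eu d × ℝ × ℝ) × Eu d =>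
      (q.1.1 * ‖q.2‖ ^ 2 - q.1.2.1 : ℝ) := by
      have := (contDiff_norm_sq ℝ (E := Eu d) (n := ⊤)).comp
        (contDiff_snd (𝕜 := ℝ) (E := ℝ × ℝ × Eu d × ℝ × ℝ))
      exact ContDiff.sub (ContDiff.mul (by fun_prop) (this.of_le le_top)) (by fun_prop)
    have h2 : ContDiff ℝ ∞ fun q : (ℝ × ℝ × Eu d × ℝ × ℝ) × Eu d =>
      (inner ℝ q.1.2.2.1 q.2 : ℝ) := ContDiff.inner ℝ (by fun_prop) (by fun_prop)
    have h3 : ContDiff ℝ ∞ fun q : (ℝ × ℝ × Eu d × ℝ × ℝ) × Eu d => q.1.2.2.2.1 := by fun_prop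
    exact ((Complex.ofRealCLM.contDiff.comp h1).add
      (contDiff_const.mul (Complex.ofRealCLM.contDiff.comp h2))).sub
        (contDiff_const.mul (Complex.ofRealCLM.contDiff.comp h3))
  have hq' : ContDiff ℝ ∞ fun q : (ℝ × ℝ × Eu d × ℝ × ℝ) × Eu d =>
      quadSymbol q.1.1 q.1.2.1 q.1.2.2.1 q.1.2.2.2.2 q.2 :=
    hq.comp (by fun_prop : ContDiff ℝ ∞ fun q : (ℝ × ℝ × Eu d × ℝ × ℝ) × Eu d =>
      ((q.1.1, q.1.2.1, q.1.2.2.1, q.1.2.2.2.2, q.1.2.2.2.2), q.2))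
  have hK : IsCompact (Metric.closedBall (0 : ℝ × ℝ × Eu d × ℝ × ℝ) S) := isCompact_closedBall _ _
  obtain ⟨C, hC, h⟩ := exists_norm_fourierInv_le hK M (r := r)
    (Φ := fun p ζ => ϕ ζ * F (quadSymbol p.1 p.2.1 p.2.2.1 p.2.2.2.1 ζ)
      (quadSymbol p.1 p.2.1 p.2.2.1 p.2.2.2.2 ζ))
    ((hϕ.comp contDiff_snd).mul (hF.comp (hq.prodMk hq'))) (fun p ξ hξ => by simp [hr ξ hξ])
  refine ⟨C, hC, fun A B v σ₁ σ₂ hA hB hv h1 h2 z => h (A, B, v, σ₁, σ₂) ?_ z⟩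
  rw [mem_closedBall_zero_iff]
  simp only [Prod.norm_def, Real.norm_eq_abs]
  exact max_le hA (max_le hB (max_le hv (max_le h1 h2)))

/-! ### The regularized kernels -/

/-- The convolution kernel with Fourier transform `ψ / m_{k,γ,τ}`. -/
def symbolKernel (k : ℝ) (γ : Eu d) (τ : ℝ) (ψ : Eu d → ℂ) : Eu d → ℂ :=
  𝓕⁻ (fun ξ => ψ ξ / faddeevSymbol k γ τ ξ)

theorem wNorm_le_of_norm_le {K : Eu d → ℂ} {C M : ℝ} (hK : ∀ z, ‖K z‖ ≤ C * bracketWeight (-M) 1 z)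
    (p : ℝ≥0∞) (a lam : ℝ) : wNorm p a lam K ≤
      ENNReal.ofReal C * wNorm p a lam (fun z : Eu d => (bracketWeight (-M) 1 z : ℂ)) := by
  have hC : 0 ≤ C := by
    have := (norm_nonneg _).trans (hK 0)
    exact nonneg_of_mul_nonneg_left this (bracketWeight_pos _ _ _)
  have : wNorm p a lam (fun z : Eu d => (C : ℂ) * (bracketWeight (-M) 1 z : ℂ)) =
      ENNReal.ofReal C * wNorm p a lam (fun z : Eu d => (bracketWeight (-M) 1 z : ℂ)) := by
    rw [wNorm_const_mul]
    congr 1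
    rw [← ofReal_norm, Complex.norm_real, Real.norm_of_nonneg hC]
  rw [← this]
  refine wNorm_mono_norm fun x => ?_
  gcongr
  · exact (bracketWeight_pos _ _ _).le
  · refine (hK x).trans (le_of_eq ?_)
    rw [norm_mul, Complex.norm_real, Complex.norm_real, Real.norm_of_nonneg hC,
      Real.norm_of_nonneg (bracketWeight_pos _ _ _).le]

theorem wNorm_bracketWeight_lt_top {p : ℝ≥0∞} (hp : p ≠ 0) {a M : ℝ} (h0 : a ≤ M)
    (h : p ≠ ⊤ → (d : ℝ) < (M - a) * p.toReal) :
    wNorm p a 1 (fun z : Eu d => (bracketWeight (-M) 1 z : ℂ)) < ⊤ := by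
  have := eLpNorm_bracketWeight_lt_top (d := d) hp (sub_nonneg.2 h0) h
  unfold wNorm
  convert this using 3 with x
  rw [← Complex.ofReal_mul, ← bracketWeight_add]
  congr 2
  ring

theorem contDiff_fourierInv {h : Eu d → ℂ} (hi : Integrable h) {r : ℝ}
    (hr : ∀ ξ, r < ‖ξ‖ → h ξ = 0) : ContDiff ℝ ∞ (𝓕⁻ h) := by
  have h1 : ContDiff ℝ ∞ (𝓕 h) := by
    refine Real.contDiff_fourier (N := ⊤) fun n _ => ?_
    refine (hi.norm.const_mul (max r 0 ^ n)).mono' (by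
      exact (by fun_prop : Continuous fun ξ : Eu d => ‖ξ‖ ^ n).aestronglyMeasurable.mul hi.1.norm)
      (Eventually.of_forall fun ξ => ?_)
    rw [norm_mul, norm_pow, norm_norm, norm_norm]
    by_cases hξ : r < ‖ξ‖
    · simp [hr ξ hξ]
    · gcongr
      exact (not_lt.1 hξ).trans (le_max_left _ _)
  have h2 : 𝓕⁻ h = fun x => 𝓕 h (-x) := by
    ext x; rw [fourier_eq_fourierInv_neg, neg_neg]
  rw [h2]
  exact h1.comp contDiff_neg

/-! ### Fatou's lemma and duality for weighted norms -/

theorem wNorm_le_of_tendsto {ι : Type*} {l : Filter ι} [l.NeBot] [l.IsCountablyGenerated]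
    {F : ι → Eu d → ℂ} {G : Eu d → ℂ} {p : ℝ≥0∞} {a lam : ℝ} {C : ℝ≥0∞}
    (hF : ∀ i, AEStronglyMeasurable (F i) volume) (hb : ∀ᶠ i in l, wNorm p a lam (F i) ≤ C)
    (hlim : ∀ᵐ x, Tendsto (fun i => F i x) l (𝓝 (G x))) : wNorm p a lam G ≤ C := by
  obtain ⟨u, hu⟩ := l.exists_seq_tendsto
  have h1 := Lp.eLpNorm_lim_le_liminf_eLpNorm (p := p) (μ := volume)
    (f := fun n x => (bracketWeight a lam x : ℂ) * F (u n) x)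
    (fun n => aestronglyMeasurable_weight_mul (hF _) _ _)
    (fun x => (bracketWeight a lam x : ℂ) * G x)
    (by
      filter_upwards [hlim] with x hx
      exact (hx.comp hu).const_mul _)
  refine h1.trans ?_
  refine liminf_le_of_le (by isBoundedDefault) fun b hb' => ?_
  obtain ⟨n, h2, h3⟩ := (hb'.and (hu.eventually hb)).exists
  exact h2.trans h3

/-- The test function is the truncation by `b_N` of `⟨x⟩^{-2a}` times the conjugate of `F`; it is
Schwartz because `F` is smooth. With `I` the resulting integral, the hypothesis reads `I ≤ C
I^{1/2}`, and `I` is the squared norm of `√b_N F`. The finite quantity `I` cancels, and Fatou's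
lemma removes the truncation. -/
theorem wNorm_le_of_dual {F : Eu d → ℂ} (hF : ContDiff ℝ ∞ F) {a : ℝ} {C : ℝ≥0∞}
    (h : ∀ g : 𝓢(Eu d, ℂ), ‖∫ x, F x * g x‖ₑ ≤ C * wNorm 2 a 1 g) : wNorm 2 (-a) 1 F ≤ C := by
  have hb : ∀ N : ℕ, ∃ b : Eu d → ℝ, ContDiff ℝ ∞ b ∧ HasCompactSupport b ∧ (∀ x, 0 ≤ b x) ∧
      (∀ x, b x ≤ 1) ∧ ∀ x, ‖x‖ ≤ N → b x = 1 := fun N => by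
    set b : ContDiffBump (0 : Eu d) := ⟨N + 1, N + 2, by positivity, by linarith⟩
    refine ⟨b, b.contDiff (n := ⊤), b.hasCompactSupport, fun x => b.nonneg, fun x => b.le_one,
      fun x hx => b.one_of_mem_closedBall ?_⟩
    rw [mem_closedBall_zero_iff]
    exact hx.trans (by linarith : (N : ℝ) ≤ N + 1)
  choose b hbs hbc hb0 hb1 hbN using hb
  refine wNorm_le_of_tendsto (l := atTop) (F := fun N x => (Real.sqrt (b N x) : ℂ) * F x)
    (fun N => ?_) (Eventually.of_forall fun N => ?_) (Eventually.of_forall fun x => ?_)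
  · exact ((Complex.continuous_ofReal.comp (Real.continuous_sqrt.comp (hbs N).continuous)).mul
      hF.continuous).aestronglyMeasurable
  · have hbw : ContDiff ℝ ∞ fun x : Eu d => (bracketWeight (-(2 * a)) 1 x : ℂ) :=
      (hasTemperateGrowth_bracketWeight _).1
    have hconj : ContDiff ℝ ∞ fun x => (starRingEnd ℂ) (F x) := Complex.conjCLE.contDiff.comp hF
    obtain ⟨g, hg⟩ := exists_schwartz_eq (θ := fun x => (b N x : ℂ) *
      ((bracketWeight (-(2 * a)) 1 x : ℂ) * (starRingEnd ℂ) (F x)))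
      ((Complex.ofRealCLM.contDiff.comp (hbs N)).mul (hbw.mul hconj))
      (((hbc N).comp_left (g := Complex.ofReal) (by simp)).mul_right)
    have hg' : ∀ x, g x = (b N x : ℂ) *
        ((bracketWeight (-(2 * a)) 1 x : ℂ) * (starRingEnd ℂ) (F x)) := fun x => congrFun hg x
    set D : Eu d → ℝ := fun x => b N x * (bracketWeight (-(2 * a)) 1 x * ‖F x‖ ^ 2) with hD
    have hD0 : ∀ x, 0 ≤ D x := fun x =>
      mul_nonneg (hb0 N x) (mul_nonneg (bracketWeight_pos _ _ _).le (by positivity))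
    have hDc : Continuous D := (hbs N).continuous.mul
      ((continuous_bracketWeight _ _).mul (hF.continuous.norm.pow 2))
    have hDi : Integrable D := hDc.integrable_of_hasCompactSupport (hbc N).mul_right
    set I : ℝ≥0∞ := ∫⁻ x, ENNReal.ofReal (D x) with hI
    have hItop : I < ⊤ := by
      have := hDi.lintegral_lt_top
      exact this
    have e1 : ‖∫ x, F x * g x‖ₑ = I := by
      have : ∀ x, F x * g x = (D x : ℂ) := fun x => by
        rw [hg' x]
        simp only [hD]
        push_cast
        rw [← Complex.ofReal_pow, ← Complex.normSq_eq_norm_sq, Complex.normSq_eq_conj_mul_self]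
        ring
      simp only [this]
      rw [integral_complex_ofReal, ← ofReal_norm, Complex.norm_real,
        Real.norm_of_nonneg (integral_nonneg hD0),
        ofReal_integral_eq_lintegral_ofReal hDi (Eventually.of_forall hD0)]
    have ew : ∀ x : Eu d, bracketWeight (-(2 * a)) 1 x = bracketWeight (-a) 1 x ^ 2 := fun x => by
      rw [sq, ← bracketWeight_add]; congr 1; ring
    have e2 : wNorm 2 a 1 g ^ 2 ≤ I := by
      rw [wNorm, eLpNorm_two_sq]
      refine lintegral_mono fun x => ?_
      rw [← ofReal_norm, ← ENNReal.ofReal_pow (norm_nonneg _)]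
      refine ENNReal.ofReal_le_ofReal ?_
      rw [hg' x]
      simp only [hD, norm_mul, Complex.norm_real, Real.norm_of_nonneg (bracketWeight_pos _ _ _).le,
        Real.norm_of_nonneg (hb0 N x), RCLike.norm_conj]
      simp only [ew]
      have h1 : bracketWeight a 1 x * bracketWeight (-a) 1 x = 1 := by
        rw [mul_comm, bracketWeight_neg_mul]
      have h2 : (bracketWeight a 1 x * (b N x * (bracketWeight (-a) 1 x ^ 2 * ‖F x‖))) ^ 2 =
          (bracketWeight a 1 x * bracketWeight (-a) 1 x) ^ 2 *
            (b N x * (b N x * (bracketWeight (-a) 1 x ^ 2 * ‖F x‖ ^ 2))) := by ring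
      rw [h2, h1, one_pow, one_mul]
      exact mul_le_of_le_one_left (hD0 x |> fun h => by simpa only [hD, ew] using h) (hb1 N x)
    have e3 : wNorm 2 (-a) 1 (fun x => (Real.sqrt (b N x) : ℂ) * F x) ^ 2 = I := by
      rw [wNorm, eLpNorm_two_sq]
      refine lintegral_congr fun x => ?_
      rw [← ofReal_norm, ← ENNReal.ofReal_pow (norm_nonneg _)]
      congr 1
      simp only [hD, norm_mul, Complex.norm_real, Real.norm_of_nonneg (bracketWeight_pos _ _ _).le,
        Real.norm_of_nonneg (Real.sqrt_nonneg _), ew]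
      rw [mul_pow, mul_pow, Real.sq_sqrt (hb0 N x)]
      ring
    have h3 := h g
    rw [e1] at h3
    refine (ENNReal.pow_le_pow_left_iff two_ne_zero).1 ?_
    rw [e3]
    rcases eq_or_ne I 0 with h0 | h0
    · rw [h0]; exact zero_le
    · have h4 : I * I ≤ C ^ 2 * I := by
        calc I * I = I ^ 2 := (sq I).symm
          _ ≤ (C * wNorm 2 a 1 g) ^ 2 := pow_le_pow_left' h3 2
          _ = C ^ 2 * wNorm 2 a 1 g ^ 2 := mul_pow _ _ _
          _ ≤ C ^ 2 * I := by gcongr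
      exact (ENNReal.mul_le_mul_iff_left h0 hItop.ne).1 h4
  · refine tendsto_const_nhds.congr' ?_
    filter_upwards [eventually_ge_atTop ⌈‖x‖⌉₊] with N hN
    rw [hbN N x ((Nat.le_ceil _).trans (by exact_mod_cast hN))]
    simp

theorem exists_schwartz_conv {c : Eu d → ℂ} (hc : ContDiff ℝ ∞ c) (hs : HasCompactSupport c)
    (f : 𝓢(Eu d, ℂ)) : ∃ f' : 𝓢(Eu d, ℂ), (∀ ξ, (𝓕 f') ξ = c ξ * (𝓕 f) ξ) ∧
      ⇑f' = conv (𝓕⁻ c) f := by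
  have h1 : ContDiff ℝ ∞ (fun ξ => (𝓕 f : 𝓢(Eu d, ℂ)) ξ) := (𝓕 f : 𝓢(Eu d, ℂ)).smooth ⊤
  have h2 : ContDiff ℝ ∞ (fun ξ => c ξ * (𝓕 f : 𝓢(Eu d, ℂ)) ξ) := hc.mul h1
  obtain ⟨F, hF⟩ := exists_schwartz_eq h2 hs.mul_right
  refine ⟨𝓕⁻ F, fun ξ => ?_, ?_⟩
  · rw [FourierTransform.fourier_fourierInv_eq, hF]
  · rw [SchwartzMap.fourierInv_coe, hF, conv_fourierInv
      (hc.continuous.integrable_of_hasCompactSupport hs) f.integrable, SchwartzMap.fourier_coe]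

/-- Reflection turns the inverse transform into the direct one without changing the even weights, so
that the bilinear pairing takes the form required by the slicing estimate. -/
theorem exists_schwartz_reflect (g : 𝓢(Eu d, ℂ)) : ∃ g' : 𝓢(Eu d, ℂ),
    (∀ ξ, (𝓕 g') ξ = (𝓕⁻ g) ξ) ∧ ∀ a, wNorm 2 a 1 g' = wNorm 2 a 1 g := by
  refine ⟨SchwartzMap.compCLMOfContinuousLinearEquiv ℂ (ContinuousLinearEquiv.neg ℝ) g,
    fun ξ => ?_, fun a => ?_⟩
  · rw [SchwartzMap.fourier_coe, SchwartzMap.fourierInv_coe, Real.fourier_eq, Real.fourierInv_eq,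
      ← integral_neg_eq_self]
    simp
  · unfold wNorm
    have := (Measure.measurePreserving_neg (volume : Measure (Eu d)))
    rw [← eLpNorm_comp_measurePreserving (aestronglyMeasurable_weight_mul
      g.continuous.aestronglyMeasurable a 1) this]
    congr 1
    ext x
    simp [bracketWeight_neg_apply]

/-! ### Reduction of the resolvent to logarithmic derivatives -/

theorem faddeevRadius_sq (k : ℝ) (γ : Eu d) : faddeevRadius k γ ^ 2 = k ^ 2 + ‖γ‖ ^ 2 :=
  Real.sq_sqrt (by positivity)

theorem ae_faddeevSymbol_ne_zero {k : ℝ} {γ : Eu d} (hR : 0 < faddeevRadius k γ) (τ : ℝ) :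
    ∀ᵐ ξ : Eu d, faddeevSymbol k γ τ ξ ≠ 0 := by
  have h0 := Measure.addHaar_sphere_of_ne_zero (volume : Measure (Eu d)) 0 hR.ne'
  filter_upwards [measure_eq_zero_iff_ae_notMem.1 h0] with ξ hξ hz
  refine hξ (mem_sphere_zero_iff_norm.2 ?_)
  have := norm_sq_sub_le_norm_faddeevSymbol k γ τ ξ
  rw [hz, norm_zero, ← faddeevRadius_sq] at this
  have h2 := abs_nonpos_iff.1 this
  rw [sub_eq_zero] at h2
  exact (pow_left_inj₀ (norm_nonneg _) hR.le two_ne_zero).1 h2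

/-- The elliptic denominator `|ξ| ^ 2 + R ^ 2 + i τ`. -/
def ellipticSymbol (R τ : ℝ) (ξ : Eu d) : ℂ := ((‖ξ‖ ^ 2 + R ^ 2 : ℝ) : ℂ) + Complex.I * τ

theorem ellipticSymbol_ne_zero {R : ℝ} (hR : 0 < R) (τ : ℝ) (ξ : Eu d) :
    ellipticSymbol R τ ξ ≠ 0 := by
  intro h
  have := congrArg Complex.re h
  simp only [ellipticSymbol, Complex.add_re, Complex.ofReal_re, Complex.mul_re, Complex.I_re,
    zero_mul, Complex.I_im, Complex.ofReal_im, mul_zero, sub_zero, Complex.zero_re, add_zero] at this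
  nlinarith [sq_nonneg ‖ξ‖]

theorem contDiff_ellipticSymbol (R : ℝ) :
    ContDiff ℝ ∞ fun q : ℝ × Eu d => ellipticSymbol R q.1 q.2 := by
  unfold ellipticSymbol
  have h1 : ContDiff ℝ ∞ fun q : ℝ × Eu d => (‖q.2‖ ^ 2 + R ^ 2 : ℝ) :=
    (((contDiff_norm_sq ℝ (E := Eu d) (n := ⊤)).comp (contDiff_snd (𝕜 := ℝ) (E := ℝ))).of_le
      le_top).add contDiff_const
  exact (Complex.ofRealCLM.contDiff.comp h1).add
    (contDiff_const.mul (Complex.ofRealCLM.contDiff.comp contDiff_fst))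

/-- The sum `2 ∑ ξ_j (ξ_j + iγ_j) = 2|ξ|² + 2iγ·ξ` minus the symbol is the elliptic denominator `q`;
dividing by `q m` gives the identity. Every numerator `ξ_j + iγ_j` is half a partial derivative of
the symbol. -/
theorem div_symbol_eq {k : ℝ} {γ : Eu d} {τ : ℝ} (hR : 0 < faddeevRadius k γ) {ξ : Eu d}
    (hm : faddeevSymbol k γ τ ξ ≠ 0) :
    (faddeevSymbol k γ τ ξ)⁻¹ = (∑ j, 2 * (ξ j : ℂ) / ellipticSymbol (faddeevRadius k γ) τ ξ *
      (((ξ j : ℂ) + Complex.I * γ j) / faddeevSymbol k γ τ ξ)) -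
        (ellipticSymbol (faddeevRadius k γ) τ ξ)⁻¹ := by
  have hq := ellipticSymbol_ne_zero hR τ ξ
  have e : ∑ j, 2 * (ξ j : ℂ) / ellipticSymbol (faddeevRadius k γ) τ ξ *
      (((ξ j : ℂ) + Complex.I * γ j) / faddeevSymbol k γ τ ξ) =
      2 * (∑ j, (ξ j : ℂ) * ((ξ j : ℂ) + Complex.I * γ j)) /
        (ellipticSymbol (faddeevRadius k γ) τ ξ * faddeevSymbol k γ τ ξ) := by
    rw [Finset.mul_sum, Finset.sum_div]
    refine Finset.sum_congr rfl fun j _ => ?_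
    field_simp
  have e2 : ∑ j, (ξ j : ℂ) * ((ξ j : ℂ) + Complex.I * γ j) =
      ((‖ξ‖ ^ 2 : ℝ) : ℂ) + Complex.I * ((inner ℝ γ ξ : ℝ) : ℂ) := by
    rw [EuclideanSpace.real_norm_sq_eq, PiLp.inner_apply]
    push_cast
    rw [Finset.mul_sum, ← Finset.sum_add_distrib]
    refine Finset.sum_congr rfl fun j _ => ?_
    simp
    ring
  rw [e, e2]
  field_simp
  rw [ellipticSymbol, faddeevSymbol, faddeevRadius_sq]
  push_cast
  ring

theorem exists_wNorm_elliptic_le {ψ : Eu d → ℂ} (hψ : ContDiff ℝ ∞ ψ) (hs : HasCompactSupport ψ)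
    {R : ℝ} (hR : 0 < R) {e : Eu d → ℂ} (he : ContDiff ℝ ∞ e) (a : ℝ) :
    ∃ C : ℝ≥0∞, C < ⊤ ∧ ∀ τ : ℝ, |τ| ≤ 1 →
      wNorm 1 a 1 (𝓕⁻ fun ξ : Eu d => ψ ξ * (e ξ / ellipticSymbol R τ ξ)) ≤ C := by
  obtain ⟨_, r, -, -, -, hr⟩ := exists_bound_of_compactSupport hψ.continuous hs
  obtain ⟨C, hC, h⟩ := exists_norm_fourierInv_le (isCompact_closedBall (0 : ℝ) 1)
    (max a 0 + d + 1) (r := r) (Φ := fun τ ξ => ψ ξ * (e ξ / ellipticSymbol R τ ξ))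
    (by
      simp only [div_eq_mul_inv]
      exact (hψ.comp contDiff_snd).mul ((he.comp contDiff_snd).mul ((contDiff_ellipticSymbol R).inv
        fun q => ellipticSymbol_ne_zero hR _ _))) (fun p ξ hξ => by simp [hr ξ hξ])
  refine ⟨_, ENNReal.mul_lt_top ENNReal.ofReal_lt_top (wNorm_bracketWeight_lt_top (p := 1) (a := a)
    (M := max a 0 + d + 1) one_ne_zero ?_ ?_), fun τ hτ =>
      wNorm_le_of_norm_le (h τ (by simpa using hτ)) 1 a 1⟩
  · have := le_max_left a 0
    have : (0 : ℝ) ≤ d := d.cast_nonneg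
    linarith
  · intro _
    have := le_max_left a 0
    simp only [ENNReal.toReal_one, mul_one]
    linarith

theorem enorm_integral_mul_le {F g : Eu d → ℂ} (hF : AEStronglyMeasurable F volume)
    (hg : AEStronglyMeasurable g volume) (a lam : ℝ) :
    ‖∫ x, F x * g x‖ₑ ≤ wNorm 2 (-a) lam F * wNorm 2 a lam g := by
  refine (enorm_integral_le_lintegral_enorm _).trans ?_
  have := wNorm_holder (p := 2) (q := 2) (r := 1) (a := -a) (b := a) (c := 0) (l₁ := lam)
    (l₂ := lam) (l₃ := lam) hF hg (fun x => by rw [bracketWeight_zero, bracketWeight_neg_mul])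
  refine le_trans (le_of_eq ?_) this
  rw [wNorm, eLpNorm_one_eq_lintegral_enorm]
  simp [bracketWeight_zero]

theorem contDiff_div_ellipticSymbol {ψ : Eu d → ℂ} (hψ : ContDiff ℝ ∞ ψ)
    {R : ℝ} (hR : 0 < R) {e : Eu d → ℂ} (he : ContDiff ℝ ∞ e) (τ : ℝ) :
    ContDiff ℝ ∞ fun ξ : Eu d => ψ ξ * (e ξ / ellipticSymbol R τ ξ) := by
  have hell : ContDiff ℝ ∞ fun ξ : Eu d => ellipticSymbol R τ ξ := by
    have h := (contDiff_ellipticSymbol (d := d) R).comp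
      ((contDiff_const (c := τ)).prodMk contDiff_id)
    simpa only [Function.comp_def, id] using h
  simp only [div_eq_mul_inv]
  exact hψ.mul (he.mul (hell.inv fun ξ => ellipticSymbol_ne_zero hR _ _))

theorem wNorm_conv_fourierInv_le {c : Eu d → ℂ} (hc : ContDiff ℝ ∞ c) (hs : HasCompactSupport c)
    (f : 𝓢(Eu d, ℂ)) (a : ℝ) : wNorm 2 a 1 (conv (𝓕⁻ c) f) ≤
      ENNReal.ofReal (Real.sqrt 2 ^ |a|) * (wNorm 1 |a| 1 (𝓕⁻ c) * wNorm 2 a 1 f) := by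
  obtain ⟨_, r, -, -, -, hr⟩ := exists_bound_of_compactSupport hc.continuous hs
  exact wNorm_conv_same_le (contDiff_fourierInv (hc.continuous.integrable_of_hasCompactSupport hs)
    hr).continuous.aestronglyMeasurable f.continuous.aestronglyMeasurable one_le_two a 1

/-- On the support of `ψ` the elliptic quotient is smooth, uniformly in `τ`. Its kernel is thus in a
weighted `L¹` space, and the factor can be absorbed into the function it acts on. -/
theorem exists_schwartz_elliptic {ψ : Eu d → ℂ} (hψ : ContDiff ℝ ∞ ψ) (hs : HasCompactSupport ψ)
    {R : ℝ} (hR : 0 < R) {e : Eu d → ℂ} (he : ContDiff ℝ ∞ e) (a : ℝ) :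
    ∃ D : ℝ≥0∞, D < ⊤ ∧ ∀ τ : ℝ, |τ| ≤ 1 → ∀ f : 𝓢(Eu d, ℂ), ∃ F : 𝓢(Eu d, ℂ),
      (∀ ξ, (𝓕 F) ξ = ψ ξ * (e ξ / ellipticSymbol R τ ξ) * (𝓕 f) ξ) ∧
        wNorm 2 a 1 F ≤ D * wNorm 2 a 1 f := by
  obtain ⟨D, hD, hDb⟩ := exists_wNorm_elliptic_le hψ hs hR he |a|
  refine ⟨ENNReal.ofReal (Real.sqrt 2 ^ |a|) * D, ENNReal.mul_lt_top ENNReal.ofReal_lt_top hD,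
    fun τ hτ f => ?_⟩
  have hcs := contDiff_div_ellipticSymbol hψ hR he τ
  have hcc : HasCompactSupport fun ξ : Eu d => ψ ξ * (e ξ / ellipticSymbol R τ ξ) := hs.mul_right
  obtain ⟨F, hF, hFc⟩ := exists_schwartz_conv hcs hcc f
  refine ⟨F, hF, ?_⟩
  rw [hFc]
  refine (wNorm_conv_fourierInv_le hcs hcc f a).trans ?_
  rw [mul_assoc]
  gcongr
  exact hDb τ hτ

theorem integral_fourier_mul_eq (f g g' : 𝓢(Eu d, ℂ)) (hg : ∀ ξ, (𝓕 g') ξ = (𝓕⁻ g) ξ) :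
    ∫ x, f x * g x = ∫ ξ, (𝓕 f) ξ * (𝓕 g') ξ := by
  have : (f : Eu d → ℂ) = 𝓕⁻ (𝓕 (f : Eu d → ℂ)) := by
    rw [← SchwartzMap.fourier_coe, ← SchwartzMap.fourierInv_coe,
      FourierTransform.fourierInv_fourier_eq]
  conv_lhs => rw [this]
  rw [integral_fourierInv_mul_eq (by rw [← SchwartzMap.fourier_coe]; exact (𝓕 f).integrable)
    g.integrable]
  simp only [hg, SchwartzMap.fourierInv_coe, SchwartzMap.fourier_coe]

theorem conv_symbolKernel_eq (hd : 2 ≤ d) {ψ : Eu d → ℂ} (hψ : ContDiff ℝ ∞ ψ)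
    (hs : HasCompactSupport ψ) {k : ℝ} {γ : Eu d} {τ : ℝ} (hτ : τ ≠ 0) (f : 𝓢(Eu d, ℂ)) :
    Integrable (fun ξ => ψ ξ * (𝓕 f) ξ / faddeevSymbol k γ τ ξ) ∧
      conv (symbolKernel k γ τ ψ) f = symbolKernel k γ τ (fun ξ => ψ ξ * (𝓕 f) ξ) := by
  have hψi : Integrable fun ξ => ψ ξ / faddeevSymbol k γ τ ξ :=
    integrable_div_symbol hd k (Or.inr hτ) hψ.continuous hs
  refine ⟨integrable_div_symbol hd k (Or.inr hτ) (hψ.continuous.mul (𝓕 f).continuous)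
    hs.mul_right, ?_⟩
  rw [symbolKernel, conv_fourierInv hψi f.integrable, symbolKernel, ← SchwartzMap.fourier_coe]
  congr 1
  ext ξ
  ring

theorem integral_conv_symbolKernel_eq (hd : 2 ≤ d) {ψ : Eu d → ℂ} (hψ : ContDiff ℝ ∞ ψ)
    (hs : HasCompactSupport ψ) {k : ℝ} {γ : Eu d} {τ : ℝ} (hR : 0 < faddeevRadius k γ) (hτ : τ ≠ 0)
    (f g gr F₀ : 𝓢(Eu d, ℂ)) (F : Fin d → 𝓢(Eu d, ℂ)) (hgr : ∀ ξ, (𝓕 gr) ξ = (𝓕⁻ g) ξ)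
    (hF : ∀ j ξ, (𝓕 (F j)) ξ =
      ψ ξ * (2 * (ξ j : ℂ) / ellipticSymbol (faddeevRadius k γ) τ ξ) * (𝓕 f) ξ)
    (hF₀ : ∀ ξ, (𝓕 F₀) ξ = ψ ξ * (1 / ellipticSymbol (faddeevRadius k γ) τ ξ) * (𝓕 f) ξ)
    (hi2 : ∀ j, Integrable fun ξ : Eu d => (𝓕 (F j)) ξ * (𝓕 gr) ξ *
      ((ξ j : ℂ) + Complex.I * γ j) / faddeevSymbol k γ τ ξ) :
    ∫ x, conv (symbolKernel k γ τ ψ) f x * g x =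
      (∑ j, ∫ ξ, (𝓕 (F j)) ξ * (𝓕 gr) ξ * ((ξ j : ℂ) + Complex.I * γ j) /
        faddeevSymbol k γ τ ξ) - ∫ x, F₀ x * g x := by
  have hi0 : Integrable fun ξ => (𝓕 F₀) ξ * (𝓕 gr) ξ := by
    refine ((𝓕 F₀).continuous.mul (𝓕 gr).continuous).integrable_of_hasCompactSupport ?_
    have e : (fun ξ => (𝓕 F₀ : 𝓢(Eu d, ℂ)) ξ * (𝓕 gr : 𝓢(Eu d, ℂ)) ξ) = fun ξ => ψ ξ *
        (1 / ellipticSymbol (faddeevRadius k γ) τ ξ) * (𝓕 f) ξ * (𝓕 gr) ξ :=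
      funext fun ξ => by rw [hF₀]
    have h2 : HasCompactSupport (fun ξ => (𝓕 F₀ : 𝓢(Eu d, ℂ)) ξ * (𝓕 gr : 𝓢(Eu d, ℂ)) ξ) := by
      rw [e]
      exact hs.mul_right.mul_right.mul_right
    exact h2
  obtain ⟨hi3, hc⟩ := conv_symbolKernel_eq hd hψ hs (k := k) (γ := γ) hτ f
  rw [integral_fourier_mul_eq F₀ g gr hgr, ← integral_finsetSum _ fun j _ => hi2 j,
    ← integral_sub (integrable_finsetSum _ fun j _ => hi2 j) hi0, hc, symbolKernel,
    integral_fourierInv_mul_eq hi3 g.integrable]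
  refine integral_congr_ae ?_
  filter_upwards [ae_faddeevSymbol_ne_zero hR τ] with ξ hm
  simp only [hF, hF₀, hgr, ← SchwartzMap.fourierInv_coe]
  rw [div_eq_mul_inv, div_symbol_eq hR hm, mul_sub, sub_mul,
    Finset.mul_sum, Finset.sum_mul]
  congr 1
  · refine Finset.sum_congr rfl fun j _ => ?_
    ring
  · ring

/-- Each term of the decomposition pairs an elliptic modification of `f` with `g` through a
logarithmic derivative, whose bound does not involve `k`, `γ` or `τ`. Only the elliptic factors
depend on the parameters, and they do so through `R` and `τ` alone. -/
theorem exists_pairing_bound (hd : 2 ≤ d) {ψ : Eu d → ℂ} (hψ : ContDiff ℝ ∞ ψ)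
    (hs : HasCompactSupport ψ) {R : ℝ} (hR : 0 < R) {a : ℝ} (ha : 1 / 2 < a) :
    ∃ C : ℝ≥0∞, C < ⊤ ∧ ∀ (k : ℝ) (γ : Eu d) (τ : ℝ), faddeevRadius k γ = R → τ ≠ 0 → |τ| ≤ 1 →
      ∀ f g : 𝓢(Eu d, ℂ), ‖∫ x, conv (symbolKernel k γ τ ψ) f x * g x‖ₑ ≤
        C * wNorm 2 a 1 f * wNorm 2 a 1 g := by
  have ha0 : 0 ≤ a := by linarith
  have he : ∀ j : Fin d, ContDiff ℝ ∞ fun ξ : Eu d => 2 * (ξ j : ℂ) := fun j =>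
    contDiff_const.mul (Complex.ofRealCLM.contDiff.comp
      (EuclideanSpace.proj j : Eu d →L[ℝ] ℝ).contDiff)
  choose D hD hDb using fun j : Fin d => exists_schwartz_elliptic hψ hs hR (he j) a
  obtain ⟨D₀, hD₀, hD₀b⟩ := exists_schwartz_elliptic hψ hs hR (contDiff_const (c := (1 : ℂ))) a
  set L := ENNReal.ofReal (2 * Real.pi) * lineConst a with hL
  have hLtop : L < ⊤ := ENNReal.mul_lt_top ENNReal.ofReal_lt_top (lineConst_lt_top ha)
  refine ⟨(∑ j, L * D j) + D₀, ENNReal.add_lt_top.2 ⟨ENNReal.sum_lt_top.2 fun j _ =>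
    ENNReal.mul_lt_top hLtop (hD j), hD₀⟩, fun k γ τ hkR hτ hτ1 f g => ?_⟩
  obtain ⟨gr, hgr, hgn⟩ := exists_schwartz_reflect g
  choose F hF hFn using fun j : Fin d => hDb j τ hτ1 f
  obtain ⟨F₀, hF₀, hF₀n⟩ := hD₀b τ hτ1 f
  have hi1 : ∀ j, Integrable fun ξ => (𝓕 (F j)) ξ * (𝓕 gr) ξ / faddeevSymbol k γ τ ξ := fun j => by
    refine integrable_div_symbol hd k (Or.inr hτ)
      ((𝓕 (F j)).continuous.mul (𝓕 gr).continuous) ?_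
    simp only [hF]
    exact (hs.mul_right.mul_right.mul_right)
  have hi2 : ∀ j, Integrable fun ξ : Eu d => (𝓕 (F j)) ξ * (𝓕 gr) ξ *
      ((ξ j : ℂ) + Complex.I * γ j) / faddeevSymbol k γ τ ξ := fun j => by
    refine integrable_div_symbol hd k (Or.inr hτ)
      (((𝓕 (F j)).continuous.mul (𝓕 gr).continuous).mul (by fun_prop)) ?_
    simp only [hF]
    exact (hs.mul_right.mul_right.mul_right.mul_right)
  subst hkR
  rw [integral_conv_symbolKernel_eq hd hψ hs hR hτ f g gr F₀ F hgr hF hF₀ hi2]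
  refine (enorm_sub_le).trans ?_
  have hcore : ∀ j, ‖∫ ξ, (𝓕 (F j)) ξ * (𝓕 gr) ξ * ((ξ j : ℂ) + Complex.I * γ j) /
        faddeevSymbol k γ τ ξ‖ₑ ≤ L * D j * wNorm 2 a 1 f * wNorm 2 a 1 g := fun j => by
    have h1 : ‖∫ ξ, (𝓕 (F j)) ξ * (𝓕 gr) ξ * ((ξ j : ℂ) + Complex.I * γ j) /
        faddeevSymbol k γ τ ξ‖ₑ ≤ L * (wNorm 2 a 1 (F j) * wNorm 2 a 1 gr) := by
      clear hFn hF₀n hD hDb hF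
      obtain ⟨n, rfl⟩ : ∃ n, d = n + 1 := ⟨d - 1, by omega⟩
      exact enorm_integral_fourier_mul_div_symbol_le j k γ τ (F j) gr ha0 (hi1 j) (hi2 j)
    rw [hgn] at h1
    refine h1.trans ?_
    calc _ ≤ L * ((D j * wNorm 2 a 1 f) * wNorm 2 a 1 g) := by
          gcongr
          exact hFn j
      _ = _ := by ring
  calc _ ≤ (∑ j, L * D j * wNorm 2 a 1 f * wNorm 2 a 1 g) +
        D₀ * wNorm 2 a 1 f * wNorm 2 a 1 g := by
        refine add_le_add ((enorm_sum_le _ _).trans (Finset.sum_le_sum fun j _ => hcore j)) ?_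
        refine (enorm_integral_mul_le F₀.continuous.aestronglyMeasurable
          g.continuous.aestronglyMeasurable a 1).trans ?_
        gcongr
        exact (wNorm_mono_exp (by linarith) 1 _).trans hF₀n
    _ = _ := by rw [← Finset.sum_mul, ← Finset.sum_mul, add_mul, add_mul]

/-! ### From Schwartz functions to weighted `L²` -/

theorem wNorm_sub_left_le {K : Eu d → ℂ} (hK : AEStronglyMeasurable K volume) {a : ℝ} (ha : 0 ≤ a)
    (p : ℝ≥0∞) (x : Eu d) : wNorm p (-a) 1 (fun y : Eu d => K (x - y)) ≤
      ENNReal.ofReal (Real.sqrt 2 ^ a * bracketWeight a 1 x) * wNorm p (-a) 1 K := by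
  rw [wNorm, wNorm, ← eLpNorm_comp_measurePreserving
    (f := fun y : Eu d => x - y) (aestronglyMeasurable_weight_mul hK (-a) 1)
    (Measure.measurePreserving_sub_left volume x)]
  refine eLpNorm_le_mul_eLpNorm_of_ae_le_mul (Eventually.of_forall fun y => ?_) p
  rw [Function.comp_apply, norm_mul, norm_mul, Complex.norm_real, Complex.norm_real,
    Real.norm_of_nonneg (bracketWeight_pos _ _ _).le,
    Real.norm_of_nonneg (bracketWeight_pos _ _ _).le, ← mul_assoc]
  gcongr
  refine (bracketWeight_neg_le_sub_mul ha 1 y x).trans (le_of_eq ?_)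
  rw [← bracketWeight_neg_apply (-a) 1 (y - x), neg_sub]
  ring

theorem econv_apply_le {K g : Eu d → ℂ} (hK : AEStronglyMeasurable K volume)
    (hg : AEStronglyMeasurable g volume) {a : ℝ} (ha : 0 ≤ a) (x : Eu d) :
    econv (fun z => ‖K z‖ₑ) (fun z => ‖g z‖ₑ) x ≤
      ENNReal.ofReal (Real.sqrt 2 ^ a * bracketWeight a 1 x) *
        (wNorm 2 (-a) 1 K * wNorm 2 a 1 g) := by
  have hKx : AEStronglyMeasurable (fun y : Eu d => K (x - y)) :=
    hK.comp_measurePreserving (Measure.measurePreserving_sub_left volume x)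
  rw [← mul_assoc]
  refine le_trans ?_ (mul_le_mul_left (wNorm_sub_left_le hK ha 2 x) _)
  have := wNorm_holder (p := 2) (q := 2) (r := 1) (a := -a) (b := a) (c := 0) (l₁ := 1)
    (l₂ := 1) (l₃ := 1) hKx hg (fun x => by rw [bracketWeight_zero, bracketWeight_neg_mul])
  refine le_trans (le_of_eq ?_) this
  rw [wNorm, eLpNorm_one_eq_lintegral_enorm]
  simp [bracketWeight_zero, econv]

theorem enorm_conv_apply_le {K g : Eu d → ℂ} (hK : AEStronglyMeasurable K volume)
    (hg : AEStronglyMeasurable g volume) {a : ℝ} (ha : 0 ≤ a) (x : Eu d) :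
    ‖conv K g x‖ₑ ≤ ENNReal.ofReal (Real.sqrt 2 ^ a * bracketWeight a 1 x) *
        (wNorm 2 (-a) 1 K * wNorm 2 a 1 g) :=
  (enorm_conv_le K g x).trans (econv_apply_le hK hg ha x)

theorem integrable_conv_integrand {K g : Eu d → ℂ} (hK : AEStronglyMeasurable K volume)
    (hg : AEStronglyMeasurable g volume) {a : ℝ} (ha : 0 ≤ a) (h1 : wNorm 2 (-a) 1 K < ⊤)
    (h2 : wNorm 2 a 1 g < ⊤) (x : Eu d) : Integrable (fun y => K (x - y) * g y) :=
  integrable_of_econv_lt_top hK hg ((econv_apply_le hK hg ha x).trans_lt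
    (ENNReal.mul_lt_top ENNReal.ofReal_lt_top (ENNReal.mul_lt_top h1 h2)))

theorem wNorm_sub_le {p : ℝ≥0∞} (hp : 1 ≤ p) (a lam : ℝ) {g g' : Eu d → ℂ}
    (hg : AEStronglyMeasurable g volume) (hg' : AEStronglyMeasurable g' volume) :
    wNorm p a lam (fun x => g x - g' x) ≤ wNorm p a lam g + wNorm p a lam g' := by
  have h := wNorm_add_le hp a lam hg (hg'.const_mul (-1))
  rw [wNorm_const_mul] at h
  simpa [sub_eq_add_neg] using h

/-- Multiplication by the weight carries the question to the density of Schwartz functions in `L²`,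
and multiplication by its inverse preserves Schwartz functions. -/
theorem exists_schwartz_approx {f : Eu d → ℂ} (hf : AEStronglyMeasurable f volume) {a : ℝ}
    (h : wNorm 2 a 1 f < ⊤) {ε : ℝ≥0∞} (hε : ε ≠ 0) :
    ∃ f' : 𝓢(Eu d, ℂ), wNorm 2 a 1 (fun x => f x - f' x) ≤ ε := by
  have hm : MemLp (fun x => (bracketWeight a 1 x : ℂ) * f x) 2 volume :=
    ⟨aestronglyMeasurable_weight_mul hf a 1, h⟩
  obtain ⟨φ, hφ⟩ := (EMetric.dense_iff.1 (SchwartzMap.denseRange_toLpCLM (F := ℂ) (E := Eu d)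
    (μ := volume) (p := 2) ENNReal.ofNat_ne_top)) hm.toLp ε (pos_iff_ne_zero.2 hε)
  obtain ⟨h1, φ, rfl⟩ := hφ
  refine ⟨SchwartzMap.smulLeftCLM ℂ (fun x : Eu d => (bracketWeight (-a) 1 x : ℂ)) φ, ?_⟩
  rw [Metric.mem_eball, edist_comm, Lp.edist_def] at h1
  refine le_trans (le_of_eq ?_) h1.le
  unfold wNorm
  refine eLpNorm_congr_ae ?_
  filter_upwards [hm.coeFn_toLp, φ.coeFn_toLp 2 volume] with x hx hx'
  simp only [Pi.sub_apply, SchwartzMap.toLpCLM_apply]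
  rw [hx, hx', SchwartzMap.smulLeftCLM_apply_apply (hasTemperateGrowth_bracketWeight _),
    smul_eq_mul, mul_sub, ← mul_assoc, ← Complex.ofReal_mul, mul_comm (bracketWeight a 1 x),
    bracketWeight_neg_mul]
  simp

theorem conv_sub_right_apply {K f f' : Eu d → ℂ} {x : Eu d}
    (h : Integrable fun y => K (x - y) * f y) (h' : Integrable fun y => K (x - y) * f' y) :
    conv K (fun y => f y - f' y) x = conv K f x - conv K f' x := by
  simp only [conv, mul_sub]
  exact integral_sub h h'

theorem conv_sub_left_apply {K K' f : Eu d → ℂ} {x : Eu d}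
    (h : Integrable fun y => K (x - y) * f y) (h' : Integrable fun y => K' (x - y) * f y) :
    conv (fun z => K z - K' z) f x = conv K f x - conv K' f x := by
  simp only [conv, sub_mul]
  exact integral_sub h h'

/-- A bound for convolution operators on Schwartz functions extends to all functions of finite
weighted norm. -/
theorem wNorm_conv_le_of_schwartz {K : Eu d → ℂ} (hK : AEStronglyMeasurable K volume) {a : ℝ}
    (ha : 0 ≤ a) (hKn : wNorm 2 (-a) 1 K < ⊤) {C : ℝ≥0∞} (hC : C ≠ ⊤)
    (h : ∀ f : 𝓢(Eu d, ℂ), wNorm 2 (-a) 1 (conv K f) ≤ C * wNorm 2 a 1 f) {f : Eu d → ℂ}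
    (hf : AEStronglyMeasurable f volume) (hfn : wNorm 2 a 1 f < ⊤) :
    wNorm 2 (-a) 1 (conv K f) ≤ C * wNorm 2 a 1 f := by
  have hε : ∀ n : ℕ, ((n : ℝ≥0∞) + 1)⁻¹ ≠ 0 := fun n =>
    ENNReal.inv_ne_zero.2 (ENNReal.add_ne_top.2 ⟨ENNReal.natCast_ne_top n, ENNReal.one_ne_top⟩)
  have hlim : Tendsto (fun n : ℕ => ((n : ℝ≥0∞) + 1)⁻¹) atTop (𝓝 0) := by
    have := (tendsto_add_atTop_iff_nat 1).2 ENNReal.tendsto_inv_nat_nhds_zero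
    simpa using this
  choose f' hf' using fun n : ℕ => exists_schwartz_approx hf hfn (hε n)
  have hb : ∀ n, wNorm 2 a 1 (f' n) ≤ wNorm 2 a 1 f + ((n : ℝ≥0∞) + 1)⁻¹ := fun n => by
    have h1 := wNorm_sub_le one_le_two a 1 hf
      (hf.sub (f' n).continuous.aestronglyMeasurable)
    simp only [Pi.sub_apply, sub_sub_cancel] at h1
    exact h1.trans (by gcongr; exact hf' n)
  -- Along the approximating sequence the convolutions converge pointwise, so Fatou's lemma keeps
  -- the bound; `δ` absorbs the approximation error in the norm of `f`.
  have hmain : ∀ δ : ℝ≥0∞, δ ≠ 0 → wNorm 2 (-a) 1 (conv K f) ≤ C * (wNorm 2 a 1 f + δ) := by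
    intro δ hδ
    refine wNorm_le_of_tendsto (l := atTop) (F := fun n => conv K (f' n))
      (fun n => aestronglyMeasurable_conv hK (f' n).continuous.aestronglyMeasurable) ?_
      (Eventually.of_forall fun x => ?_)
    · filter_upwards [hlim.eventually_le_const (pos_iff_ne_zero.2 hδ)] with n hn
      exact (h _).trans (by gcongr; exact (hb n).trans (by gcongr))
    · rw [tendsto_iff_edist_tendsto_0]
      have hD := ENNReal.mul_lt_top (ENNReal.ofReal_lt_top
        (r := Real.sqrt 2 ^ a * bracketWeight a 1 x)) hKn
      refine tendsto_of_tendsto_of_tendsto_of_le_of_le tendsto_const_nhds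
        (by simpa using ENNReal.Tendsto.const_mul hlim (Or.inr hD.ne)) (fun _ => zero_le)
        fun n => ?_
      rw [edist_comm, edist_eq_enorm_sub, ← conv_sub_right_apply
        (integrable_conv_integrand hK hf ha hKn hfn x)
        (integrable_conv_integrand hK (f' n).continuous.aestronglyMeasurable ha hKn
          (schwartz_wNorm_lt_top _ _ _) x)]
      refine (enorm_conv_apply_le hK (hf.sub (f' n).continuous.aestronglyMeasurable) ha x).trans ?_
      rw [← mul_assoc]
      gcongr
      exact hf' n
  refine ENNReal.le_of_forall_pos_le_add fun ε hε _ => ?_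
  rcases eq_or_ne C 0 with h0 | h0
  · refine (hmain 1 one_ne_zero).trans ?_
    simp [h0]
  · refine (hmain (C⁻¹ * ε) (mul_ne_zero (ENNReal.inv_ne_zero.2 hC) (by simpa using hε.ne'))).trans ?_
    rw [mul_add, ← mul_assoc, ENNReal.mul_inv_cancel h0 hC, one_mul]

theorem contDiff_symbolKernel (hd : 2 ≤ d) {ψ : Eu d → ℂ} (hψ : ContDiff ℝ ∞ ψ)
    (hs : HasCompactSupport ψ) (k : ℝ) (γ : Eu d) {τ : ℝ} (hτ : τ ≠ 0) :
    ContDiff ℝ ∞ (symbolKernel k γ τ ψ) := by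
  obtain ⟨_, r, -, -, -, hr⟩ := exists_bound_of_compactSupport hψ.continuous hs
  exact contDiff_fourierInv (integrable_div_symbol hd k (Or.inr hτ) hψ.continuous hs)
    fun ξ hξ => by rw [hr ξ hξ, zero_div]

/-- A function whose transform is `1` on the support of `ψ` reproduces the kernel of `ψ` under
convolution. This turns operator bounds into bounds for the kernel itself. -/
theorem exists_schwartz_fourier_eq_one {ψ : Eu d → ℂ} (hψ : Continuous ψ)
    (hs : HasCompactSupport ψ) : ∃ θ : 𝓢(Eu d, ℂ), ∀ ξ, ψ ξ * (𝓕 θ) ξ = ψ ξ := by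
  obtain ⟨_, r, -, hr0, -, hr⟩ := exists_bound_of_compactSupport hψ hs
  set b : ContDiffBump (0 : Eu d) := ⟨r + 1, r + 2, by linarith, by linarith⟩
  obtain ⟨B, hB⟩ := exists_schwartz_eq_ofReal (b.contDiff (n := ⊤)) b.hasCompactSupport
  refine ⟨𝓕⁻ B, fun ξ => ?_⟩
  rw [FourierTransform.fourier_fourierInv_eq, hB]
  by_cases hξ : r < ‖ξ‖
  · rw [hr ξ hξ, zero_mul]
  · rw [b.one_of_mem_closedBall (mem_closedBall_zero_iff.2 (by
      show ‖ξ‖ ≤ r + 1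
      linarith [not_lt.1 hξ]))]
    simp

/-- The uniform weighted resolvent bound. -/
theorem exists_wNorm_symbolKernel_le (hd : 2 ≤ d) {ψ : Eu d → ℂ} (hψ : ContDiff ℝ ∞ ψ)
    (hs : HasCompactSupport ψ) {R : ℝ} (hR : 0 < R) {a : ℝ} (ha : 1 / 2 < a) :
    ∃ C : ℝ≥0∞, C < ⊤ ∧ ∀ (k : ℝ) (γ : Eu d) (τ : ℝ), faddeevRadius k γ = R → τ ≠ 0 → |τ| ≤ 1 →
      wNorm 2 (-a) 1 (symbolKernel k γ τ ψ) ≤ C ∧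
      (∀ z, ‖symbolKernel k γ τ ψ z‖ₑ ≤ C * ENNReal.ofReal (bracketWeight a 1 z)) ∧
      ∀ f : Eu d → ℂ, AEStronglyMeasurable f volume → wNorm 2 a 1 f < ⊤ →
        wNorm 2 (-a) 1 (conv (symbolKernel k γ τ ψ) f) ≤ C * wNorm 2 a 1 f := by
  have ha0 : 0 ≤ a := by linarith
  obtain ⟨C, hC, hCb⟩ := exists_pairing_bound hd hψ hs hR ha
  obtain ⟨θ, hθ⟩ := exists_schwartz_fourier_eq_one hψ.continuous hs
  set W := wNorm 2 a 1 θ with hW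
  have hWt : W < ⊤ := schwartz_wNorm_lt_top _ _ _
  set C₂ := ENNReal.ofReal (Real.sqrt 2 ^ a) * (C * W * W)
  have hC₂ : C₂ < ⊤ := ENNReal.mul_lt_top ENNReal.ofReal_lt_top
    (ENNReal.mul_lt_top (ENNReal.mul_lt_top hC hWt) hWt)
  refine ⟨C * W + C₂ + C, ENNReal.add_lt_top.2 ⟨ENNReal.add_lt_top.2
    ⟨ENNReal.mul_lt_top hC hWt, hC₂⟩, hC⟩, fun k γ τ hkR hτ hτ1 => ?_⟩
  have hsch : ∀ f : 𝓢(Eu d, ℂ), wNorm 2 (-a) 1 (conv (symbolKernel k γ τ ψ) f) ≤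
      C * wNorm 2 a 1 f := fun f => by
    refine wNorm_le_of_dual ?_ fun g => hCb k γ τ hkR hτ hτ1 f g
    rw [(conv_symbolKernel_eq hd hψ hs hτ f).2]
    have h1 : ContDiff ℝ ∞ (fun ξ => (𝓕 f : 𝓢(Eu d, ℂ)) ξ) := (𝓕 f : 𝓢(Eu d, ℂ)).smooth ⊤
    exact contDiff_symbolKernel hd (hψ.mul h1) hs.mul_right k γ hτ
  -- The kernel is its own convolution with `θ`: the operator bound controls its weighted norm, and
  -- Cauchy-Schwarz then controls it pointwise.
  have hKθ : conv (symbolKernel k γ τ ψ) θ = symbolKernel k γ τ ψ := by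
    rw [(conv_symbolKernel_eq hd hψ hs hτ θ).2]
    simp only [hθ]
  have hKm : AEStronglyMeasurable (symbolKernel k γ τ ψ) volume :=
    (contDiff_symbolKernel hd hψ hs k γ hτ).continuous.aestronglyMeasurable
  have hK : wNorm 2 (-a) 1 (symbolKernel k γ τ ψ) ≤ C * W := by
    have := hsch θ
    rwa [hKθ] at this
  refine ⟨hK.trans (by rw [add_assoc]; exact le_self_add), fun z => ?_, fun f hf hfn => ?_⟩
  · rw [← hKθ]
    refine (enorm_conv_apply_le hKm θ.continuous.aestronglyMeasurable ha0 z).trans ?_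
    rw [ENNReal.ofReal_mul (by positivity)]
    calc _ ≤ ENNReal.ofReal (Real.sqrt 2 ^ a) * ENNReal.ofReal (bracketWeight a 1 z) *
          ((C * W) * W) := by gcongr
      _ = C₂ * ENNReal.ofReal (bracketWeight a 1 z) := by simp only [C₂]; ring
      _ ≤ _ := by
        gcongr
        exact (le_add_self).trans (le_self_add)
  · refine (wNorm_conv_le_of_schwartz hKm ha0
      (hK.trans_lt (ENNReal.mul_lt_top hC hWt)) hC.ne hsch hf hfn).trans ?_
    gcongr
    exact le_add_self

/-! ### The limit kernels -/

/-- The limit of the regularized kernels as `τ → 0` along `l`. -/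
def limitKernel (l : Filter ℝ) (k : ℝ) (γ : Eu d) (ψ : Eu d → ℂ) : Eu d → ℂ :=
  fun z => limUnder l fun τ => symbolKernel k γ τ ψ z

theorem neBot_of_side {l : Filter ℝ} (hl : l = 𝓝[>] 0 ∨ l = 𝓝[<] 0) : l.NeBot := by
  rcases hl with rfl | rfl <;> infer_instance

theorem isCountablyGenerated_of_side {l : Filter ℝ} (hl : l = 𝓝[>] 0 ∨ l = 𝓝[<] 0) :
    l.IsCountablyGenerated := by
  rcases hl with rfl | rfl <;> infer_instance

theorem le_nhds_of_side {l : Filter ℝ} (hl : l = 𝓝[>] 0 ∨ l = 𝓝[<] 0) : l ≤ 𝓝 0 := by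
  rcases hl with rfl | rfl <;> exact nhdsWithin_le_nhds

theorem eventually_small_of_side {l : Filter ℝ} (hl : l = 𝓝[>] 0 ∨ l = 𝓝[<] 0) :
    ∀ᶠ τ in l, τ ≠ 0 ∧ |τ| ≤ 1 := by
  have h1 : ∀ᶠ τ in l, |τ| ≤ 1 := by
    refine le_nhds_of_side hl ?_
    filter_upwards [Metric.closedBall_mem_nhds (0 : ℝ) one_pos] with τ hτ
    simpa using hτ
  refine Filter.Eventually.and ?_ h1
  rcases hl with rfl | rfl
  · filter_upwards [self_mem_nhdsWithin] with τ hτ using (Set.mem_Ioi.1 hτ).ne'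
  · filter_upwards [self_mem_nhdsWithin] with τ hτ using (Set.mem_Iio.1 hτ).ne

theorem tendsto_symbolKernel (hd : 2 ≤ d) {k : ℝ} (hk : 0 < k) (γ : Eu d)
    {l : Filter ℝ} (hl : l = 𝓝[>] 0 ∨ l = 𝓝[<] 0) {ψ : Eu d → ℂ} (hψ : ContDiff ℝ ∞ ψ)
    (hs : HasCompactSupport ψ) (z : Eu d) :
    Tendsto (fun τ => symbolKernel k γ τ ψ z) l (𝓝 (limitKernel l k γ ψ z)) := by
  have hne := neBot_of_side hl
  have hin : ContDiff ℝ ∞ fun ξ : Eu d => (inner ℝ ξ z : ℝ) := contDiff_id.inner ℝ contDiff_const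
  have h1 : ContDiff ℝ ∞ fun ξ : Eu d => Complex.exp (2 * Real.pi * (inner ℝ ξ z : ℝ) * Complex.I) :=
    ((contDiff_const.mul (Complex.ofRealCLM.contDiff.comp hin)).mul contDiff_const).cexp
  obtain ⟨L, hL⟩ := exists_tendsto_integral_div_symbol hd hk γ hl (h1.mul hψ) hs.mul_left
  refine tendsto_nhds_limUnder ⟨L, ?_⟩
  refine hL.congr fun τ => ?_
  rw [symbolKernel, Real.fourierInv_eq]
  refine integral_congr_ae (Eventually.of_forall fun ξ => ?_)
  simp only [Circle.smul_def, Real.fourierChar_apply, smul_eq_mul, mul_div_assoc]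
  congr 2
  push_cast
  ring

theorem aestronglyMeasurable_limitKernel (hd : 2 ≤ d) {k : ℝ} (hk : 0 < k) (γ : Eu d)
    {l : Filter ℝ} (hl : l = 𝓝[>] 0 ∨ l = 𝓝[<] 0) {ψ : Eu d → ℂ} (hψ : ContDiff ℝ ∞ ψ)
    (hs : HasCompactSupport ψ) : AEStronglyMeasurable (limitKernel l k γ ψ) volume := by
  have hne := neBot_of_side hl
  have hcg := isCountablyGenerated_of_side hl
  obtain ⟨u, hu⟩ := l.exists_seq_tendsto
  have h0 := (eventually_small_of_side hl)
  obtain ⟨N, hN⟩ := eventually_atTop.1 (hu.eventually h0)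
  refine aestronglyMeasurable_of_tendsto_ae atTop (f := fun n => symbolKernel k γ (u (n + N)) ψ)
    (fun n => (contDiff_symbolKernel hd hψ hs k γ
      (hN (n + N) (by omega)).1).continuous.aestronglyMeasurable)
    (Eventually.of_forall fun z => ?_)
  exact ((tendsto_symbolKernel hd hk γ hl hψ hs z).comp hu).comp (tendsto_add_atTop_nat N)

/-! ### Interpolation between weights -/

theorem one_le_split {w t a b c : ℝ} (hw : 1 ≤ w) (ht : 1 ≤ t) (hca : c ≤ a) (hab : a ≤ b) :
    w ^ (-a) ≤ t ^ (b - a) * w ^ (-b) + t ^ (-(a - c)) * w ^ (-c) := by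
  have hw0 : 0 < w := by linarith
  have ht0 : 0 < t := by linarith
  rcases le_total w t with h | h
  · have h1 : w ^ (-a) = w ^ (b - a) * w ^ (-b) := by rw [← Real.rpow_add hw0]; ring_nf
    have h2 : w ^ (b - a) ≤ t ^ (b - a) := Real.rpow_le_rpow hw0.le h (by linarith)
    have h3 : 0 ≤ t ^ (-(a - c)) * w ^ (-c) := by positivity
    have h4 : w ^ (b - a) * w ^ (-b) ≤ t ^ (b - a) * w ^ (-b) := by gcongr
    linarith
  · have h1 : w ^ (-a) = w ^ (-(a - c)) * w ^ (-c) := by rw [← Real.rpow_add hw0]; ring_nf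
    have h2 : w ^ (-(a - c)) ≤ t ^ (-(a - c)) := Real.rpow_le_rpow_of_nonpos ht0 h (by linarith)
    have h3 : 0 ≤ t ^ (b - a) * w ^ (-b) := by positivity
    have h4 : w ^ (-(a - c)) * w ^ (-c) ≤ t ^ (-(a - c)) * w ^ (-c) := by gcongr
    linarith

/-- Where the bracket is at most `t` the stronger weight `-b` suffices at the price `t^{b-a}`;
beyond `t` the weaker weight `-c` gains `t^{-(a-c)}`. Smallness in the first norm and boundedness in
the second thus give smallness in between. -/
theorem wNorm_split {F : Eu d → ℂ} (hF : AEStronglyMeasurable F volume) {p : ℝ≥0∞} (hp : 1 ≤ p)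
    {t a b c : ℝ} (ht : 1 ≤ t) (hca : c ≤ a) (hab : a ≤ b) :
    wNorm p (-a) 1 F ≤ ENNReal.ofReal (t ^ (b - a)) * wNorm p (-b) 1 F +
      ENNReal.ofReal (t ^ (-(a - c))) * wNorm p (-c) 1 F := by
  have ht0 : 0 < t := by linarith
  set u : ℝ → ℝ → Eu d → ℂ := fun s b x => (s : ℂ) * ((bracketWeight b 1 x : ℂ) * F x) with hu
  have hu1 : ∀ s b, 0 ≤ s → eLpNorm (u s b) p volume ≤ ENNReal.ofReal s * wNorm p b 1 F :=
    fun s b hs => eLpNorm_le_mul_eLpNorm_of_ae_le_mul (Eventually.of_forall fun y => by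
      simp [hu, abs_of_nonneg hs]) p
  have hum : ∀ s b, AEStronglyMeasurable (u s b) volume := fun s b =>
    (aestronglyMeasurable_weight_mul hF b 1).const_mul _
  have hs1 : 0 ≤ t ^ (b - a) := by positivity
  have hs2 : 0 ≤ t ^ (-(a - c)) := by positivity
  calc wNorm p (-a) 1 F ≤ eLpNorm (fun x => ‖u (t ^ (b - a)) (-b) x‖ +
        ‖u (t ^ (-(a - c))) (-c) x‖) p volume := by
        refine eLpNorm_mono_real fun x => ?_
        simp only [hu, norm_mul, Complex.norm_real, Real.norm_of_nonneg (bracketWeight_pos _ _ _).le,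
          Real.norm_of_nonneg hs1, Real.norm_of_nonneg hs2, ← mul_assoc, ← add_mul]
        gcongr
        exact one_le_split (one_le_bracket 1 x) ht hca hab
    _ ≤ eLpNorm (u (t ^ (b - a)) (-b)) p volume + eLpNorm (u (t ^ (-(a - c))) (-c)) p volume := by
        refine (eLpNorm_add_le (hum _ _).norm (hum _ _).norm hp).trans (le_of_eq ?_)
        rw [eLpNorm_norm, eLpNorm_norm]
    _ ≤ _ := add_le_add (hu1 _ _ hs1) (hu1 _ _ hs2)

/-- A choice of a splitting parameter making both terms small. -/
theorem exists_split_le {ι : Type*} {l : Filter ι} {Y : ι → ℝ≥0∞} (hY : Tendsto Y l (𝓝 0))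
    {C ε : ℝ≥0∞} (hC : C ≠ ⊤) (hε : ε ≠ 0) (p : ℝ) {δ : ℝ} (hδ : 0 < δ) :
    ∃ t : ℝ, 1 ≤ t ∧ ∀ᶠ i in l,
      ENNReal.ofReal (t ^ p) * Y i + ENNReal.ofReal (t ^ (-δ)) * C ≤ ε := by
  have h1 : Tendsto (fun t : ℝ => ENNReal.ofReal (t ^ (-δ)) * C) atTop (𝓝 0) := by
    have := ENNReal.tendsto_ofReal (tendsto_rpow_neg_atTop hδ)
    rw [ENNReal.ofReal_zero] at this
    simpa using ENNReal.Tendsto.mul_const this (Or.inr hC)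
  have hε2 : 0 < ε / 2 := ENNReal.half_pos hε
  obtain ⟨t, ht, ht1⟩ := ((h1.eventually_le_const hε2).and (eventually_ge_atTop 1)).exists
  refine ⟨t, ht1, ?_⟩
  have h2 : Tendsto (fun i => ENNReal.ofReal (t ^ p) * Y i) l (𝓝 0) := by
    simpa using ENNReal.Tendsto.const_mul hY (Or.inr ENNReal.ofReal_ne_top)
  filter_upwards [h2.eventually_le_const hε2] with i hi
  calc _ ≤ ε / 2 + ε / 2 := add_le_add hi ht
    _ = ε := ENNReal.add_halves ε

theorem wNorm_two_sq (a lam : ℝ) (F : Eu d → ℂ) :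
    wNorm 2 a lam F ^ 2 = ∫⁻ x, (ENNReal.ofReal (bracketWeight a lam x) * ‖F x‖ₑ) ^ 2 := by
  rw [wNorm, eLpNorm_two_sq]
  refine lintegral_congr fun x => ?_
  rw [enorm_mul, ← ofReal_norm (bracketWeight a lam x : ℂ), Complex.norm_real,
    Real.norm_of_nonneg (bracketWeight_pos _ _ _).le]

theorem exists_wNorm_le_of_enorm_le {a b : ℝ} (hab : a + d < b) :
    ∃ A : ℝ≥0∞, A < ⊤ ∧ ∀ (F : Eu d → ℂ) (c : ℝ≥0∞),
      (∀ x, ‖F x‖ₑ ≤ c * ENNReal.ofReal (bracketWeight a 1 x)) → wNorm 2 (-b) 1 F ≤ c * A := by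
  have hd : (0 : ℝ) ≤ d := d.cast_nonneg
  refine ⟨wNorm 2 (a - b) 1 (fun _ : Eu d => (1 : ℂ)), ?_, fun F c h => ?_⟩
  · have := eLpNorm_bracketWeight_lt_top (d := d) (q := 2) two_ne_zero (b := b - a) (by linarith)
      (fun _ => by norm_num; linarith)
    simpa [wNorm] using this
  · refine (ENNReal.pow_le_pow_left_iff two_ne_zero).1 ?_
    rw [mul_pow, wNorm_two_sq, wNorm_two_sq, ← lintegral_const_mul _ (by
      exact (((continuous_bracketWeight _ _).measurable.ennreal_ofReal).mul_const _).pow_const _)]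
    refine lintegral_mono fun x => ?_
    rw [← mul_pow]
    refine pow_le_pow_left' ?_ 2
    rw [enorm_one, mul_one]
    calc _ ≤ ENNReal.ofReal (bracketWeight (-b) 1 x) *
          (c * ENNReal.ofReal (bracketWeight a 1 x)) := by gcongr; exact h x
      _ = c * (ENNReal.ofReal (bracketWeight a 1 x) * ENNReal.ofReal (bracketWeight (-b) 1 x)) := by
          ring
      _ = _ := by rw [← ENNReal.ofReal_mul (bracketWeight_pos _ _ _).le, ← bracketWeight_add,
            sub_eq_add_neg]

/-- The condition on `b` makes `⟨x⟩^{2(a-b)}` integrable, so this is dominated convergence for the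
squared norms. -/
theorem tendsto_wNorm_of_dominated {l : Filter ℝ} [l.IsCountablyGenerated] {a b : ℝ}
    (hab : a + d < b) {F : ℝ → Eu d → ℂ} {c : ℝ≥0∞} (hc : c ≠ ⊤)
    (hF : ∀ᶠ τ in l, AEStronglyMeasurable (F τ) volume)
    (hb : ∀ᶠ τ in l, ∀ x, ‖F τ x‖ₑ ≤ c * ENNReal.ofReal (bracketWeight a 1 x))
    (hlim : ∀ x, Tendsto (fun τ => F τ x) l (𝓝 0)) :
    Tendsto (fun τ => wNorm 2 (-b) 1 (F τ)) l (𝓝 0) := by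
  have hd : (0 : ℝ) ≤ d := d.cast_nonneg
  have h2 : Tendsto (fun τ => wNorm 2 (-b) 1 (F τ) ^ 2) l (𝓝 0) := by
    simp only [wNorm_two_sq]
    have h0 : (0 : ℝ≥0∞) = ∫⁻ _ : Eu d, 0 := by simp
    rw [h0]
    refine tendsto_lintegral_filter_of_dominated_convergence'
      (fun x => (c * ENNReal.ofReal (bracketWeight (a - b) 1 x)) ^ 2) ?_ ?_ ?_ ?_
    · filter_upwards [hF] with τ h
      exact (((continuous_bracketWeight _ _).measurable.ennreal_ofReal.aemeasurable).mul
        h.enorm).pow_const 2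
    · filter_upwards [hb] with τ h
      refine Eventually.of_forall fun x => pow_le_pow_left' ?_ 2
      calc _ ≤ ENNReal.ofReal (bracketWeight (-b) 1 x) *
            (c * ENNReal.ofReal (bracketWeight a 1 x)) := by gcongr; exact h x
        _ = c * (ENNReal.ofReal (bracketWeight a 1 x) *
            ENNReal.ofReal (bracketWeight (-b) 1 x)) := by ring
        _ = _ := by rw [← ENNReal.ofReal_mul (bracketWeight_pos _ _ _).le, ← bracketWeight_add,
              sub_eq_add_neg]
    · simp only [mul_pow]
      rw [lintegral_const_mul' _ _ (by finiteness)]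
      refine (ENNReal.mul_lt_top (by finiteness) ?_).ne
      have h3 := eLpNorm_bracketWeight_lt_top (d := d) (q := 2) two_ne_zero (b := b - a)
        (by linarith) (fun _ => by norm_num; linarith)
      have h4 : wNorm 2 (a - b) 1 (fun _ : Eu d => (1 : ℂ)) < ⊤ := by simpa [wNorm] using h3
      have h5 := ENNReal.pow_lt_top h4 (n := 2)
      rw [wNorm_two_sq] at h5
      simpa using h5
    · refine Eventually.of_forall fun x => ?_
      have h3 := (hlim x).enorm
      rw [enorm_zero] at h3
      have h4 := ENNReal.Tendsto.pow (n := 2) (ENNReal.Tendsto.const_mul h3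
        (Or.inr (ENNReal.ofReal_ne_top (r := bracketWeight (-b) 1 x))))
      simpa using h4
  have h3 := (ENNReal.continuous_rpow_const (y := (1 / 2 : ℝ))).tendsto 0 |>.comp h2
  rw [ENNReal.zero_rpow_of_pos (by norm_num)] at h3
  refine h3.congr fun τ => ?_
  rw [Function.comp_apply, ← ENNReal.rpow_natCast, ← ENNReal.rpow_mul]
  norm_num

/-! ### Convergence of kernels and of convolution operators -/

section limit

variable (hd : 2 ≤ d) {k : ℝ} (hk : 0 < k) (γ : Eu d) {l : Filter ℝ}
  (hl : l = 𝓝[>] 0 ∨ l = 𝓝[<] 0) {ψ : Eu d → ℂ} (hψ : ContDiff ℝ ∞ ψ) (hs : HasCompactSupport ψ)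
  {a : ℝ} (ha : 1 / 2 < a)

theorem faddeevRadius_pos (hk : 0 < k) (γ : Eu d) : 0 < faddeevRadius k γ :=
  Real.sqrt_pos.2 (by positivity)

include hd hk hl hψ hs ha

/-- For the exponent `-(a+d+1)`, pointwise convergence and the uniform polynomial bound suffice. For
`-c` with `1/2 < c < a` the norms are uniformly bounded by the resolvent bound. Splitting the weight
interpolates between the two. -/
theorem tendsto_wNorm_symbolKernel_sub :
    Tendsto (fun τ => wNorm 2 (-a) 1 (fun z => symbolKernel k γ τ ψ z - limitKernel l k γ ψ z)) l
      (𝓝 0) := by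
  have hne := neBot_of_side hl
  have hcg := isCountablyGenerated_of_side hl
  obtain ⟨c, hc1, hca⟩ := exists_between ha
  obtain ⟨C, hC, hCb⟩ := exists_wNorm_symbolKernel_le hd hψ hs (faddeevRadius_pos hk γ) hc1
  have hlim := tendsto_symbolKernel hd hk γ hl hψ hs
  have hev := eventually_small_of_side hl
  have hm := aestronglyMeasurable_limitKernel hd hk γ hl hψ hs
  have hmτ : ∀ τ ≠ 0, AEStronglyMeasurable (symbolKernel k γ τ ψ) volume := fun τ hτ =>
    (contDiff_symbolKernel hd hψ hs k γ hτ).continuous.aestronglyMeasurable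
  have h0 : ∀ z, ‖limitKernel l k γ ψ z‖ₑ ≤ C * ENNReal.ofReal (bracketWeight c 1 z) := fun z => by
    refine le_of_tendsto (hlim z).enorm ?_
    filter_upwards [hev] with τ hτ using (hCb k γ τ rfl hτ.1 hτ.2).2.1 z
  have hd0 : (0 : ℝ) ≤ d := d.cast_nonneg
  have hY : Tendsto (fun τ => wNorm 2 (-(a + d + 1)) 1
      (fun z => symbolKernel k γ τ ψ z - limitKernel l k γ ψ z)) l (𝓝 0) := by
    refine tendsto_wNorm_of_dominated (a := c) (c := 2 * C) (by linarith) (by finiteness) ?_ ?_ ?_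
    · filter_upwards [hev] with τ hτ using (hmτ τ hτ.1).sub hm
    · filter_upwards [hev] with τ hτ x
      refine enorm_sub_le.trans ((add_le_add ((hCb k γ τ rfl hτ.1 hτ.2).2.1 x) (h0 x)).trans ?_)
      rw [two_mul, add_mul]
    · intro x
      simpa using (hlim x).sub_const (limitKernel l k γ ψ x)
  have h0w : wNorm 2 (-c) 1 (limitKernel l k γ ψ) ≤ C := by
    -- Measurability of the regularized kernels is available for `τ ≠ 0`, so the value at `0`, which
    -- the limit does not see, is replaced by the zero function.
    refine wNorm_le_of_tendsto (l := l)
      (F := fun τ => if τ = 0 then 0 else symbolKernel k γ τ ψ) (fun τ => ?_) ?_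
      (Eventually.of_forall fun z => (hlim z).congr' ?_)
    · by_cases hτ : τ = 0
      · simp only [hτ, if_true]; exact aestronglyMeasurable_const
      · simp only [hτ, if_false]; exact hmτ τ hτ
    · filter_upwards [hev] with τ hτ
      simpa only [hτ.1, if_false] using (hCb k γ τ rfl hτ.1 hτ.2).1
    · filter_upwards [hev] with τ hτ
      simp only [hτ.1, if_false]
  rw [ENNReal.tendsto_nhds_zero]
  intro ε hε
  obtain ⟨t, ht, hte⟩ := exists_split_le hY (C := 2 * C) (by finiteness) hε.ne' (d + 1 : ℝ)
    (sub_pos.2 hca)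
  filter_upwards [hev, hte] with τ hτ h
  refine (wNorm_split ((hmτ τ hτ.1).sub hm) one_le_two ht hca.le
    (by linarith : a ≤ a + d + 1)).trans (le_trans ?_ h)
  rw [show a + d + 1 - a = (d + 1 : ℝ) by ring]
  refine add_le_add le_rfl ?_
  gcongr
  refine (wNorm_sub_le one_le_two (-c) 1 (hmτ τ hτ.1) hm).trans ?_
  rw [two_mul]
  exact add_le_add (hCb k γ τ rfl hτ.1 hτ.2).1 h0w

theorem wNorm_limitKernel_lt_top : wNorm 2 (-a) 1 (limitKernel l k γ ψ) < ⊤ := by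
  have hne := neBot_of_side hl
  obtain ⟨C, hC, hCb⟩ := exists_wNorm_symbolKernel_le hd hψ hs (faddeevRadius_pos hk γ) ha
  have h1 := tendsto_wNorm_symbolKernel_sub hd hk γ hl hψ hs ha
  obtain ⟨τ, hτ, h2⟩ := ((eventually_small_of_side hl).and
    (h1.eventually_le_const one_pos)).exists
  have hmτ : AEStronglyMeasurable (symbolKernel k γ τ ψ) volume :=
    (contDiff_symbolKernel hd hψ hs k γ hτ.1).continuous.aestronglyMeasurable
  have h3 := wNorm_sub_le one_le_two (-a) 1 hmτ
    (hmτ.sub (aestronglyMeasurable_limitKernel hd hk γ hl hψ hs))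
  simp only [Pi.sub_apply, sub_sub_cancel] at h3
  exact h3.trans_lt (ENNReal.add_lt_top.2 ⟨(hCb k γ τ rfl hτ.1 hτ.2).1.trans_lt hC,
    h2.trans_lt ENNReal.one_lt_top⟩)

theorem tendsto_conv_symbolKernel {f : Eu d → ℂ} (hf : AEStronglyMeasurable f volume)
    (hfn : wNorm 2 a 1 f < ⊤) (x : Eu d) :
    Tendsto (fun τ => conv (symbolKernel k γ τ ψ) f x) l (𝓝 (conv (limitKernel l k γ ψ) f x)) := by
  have hne := neBot_of_side hl
  obtain ⟨C, hC, hCb⟩ := exists_wNorm_symbolKernel_le hd hψ hs (faddeevRadius_pos hk γ) ha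
  have ha0 : 0 ≤ a := by linarith
  have hm := aestronglyMeasurable_limitKernel hd hk γ hl hψ hs
  have h1 := tendsto_wNorm_symbolKernel_sub hd hk γ hl hψ hs ha
  rw [tendsto_iff_edist_tendsto_0]
  have h2 := ENNReal.Tendsto.const_mul (a := ENNReal.ofReal (Real.sqrt 2 ^ a * bracketWeight a 1 x))
    (ENNReal.Tendsto.mul_const (b := wNorm 2 a 1 f) h1 (Or.inr hfn.ne))
    (Or.inr ENNReal.ofReal_ne_top)
  rw [zero_mul, mul_zero] at h2
  refine tendsto_of_tendsto_of_tendsto_of_le_of_le' tendsto_const_nhds h2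
    (Eventually.of_forall fun _ => zero_le) ?_
  filter_upwards [eventually_small_of_side hl] with τ hτ
  have hmτ : AEStronglyMeasurable (symbolKernel k γ τ ψ) volume :=
    (contDiff_symbolKernel hd hψ hs k γ hτ.1).continuous.aestronglyMeasurable
  rw [edist_eq_enorm_sub, ← conv_sub_left_apply
    (integrable_conv_integrand hmτ hf ha0 ((hCb k γ τ rfl hτ.1 hτ.2).1.trans_lt hC) hfn x)
    (integrable_conv_integrand hm hf ha0 (wNorm_limitKernel_lt_top hd hk γ hl hψ hs ha) hfn x)]
  exact enorm_conv_apply_le (hmτ.sub hm) hf ha0 x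

-- Fatou's lemma transfers the uniform bounds for `τ ≠ 0` to the limit, with one constant for both
-- signs and for all `(k,γ)` of the same radius.
omit hk hl in
theorem exists_wNorm_limitKernel_le {R : ℝ} (hR : 0 < R) :
    ∃ C : ℝ≥0∞, C < ⊤ ∧ ∀ (l : Filter ℝ) (_ : l = 𝓝[>] 0 ∨ l = 𝓝[<] 0) (k : ℝ) (_ : 0 < k)
      (γ : Eu d), faddeevRadius k γ = R →
      wNorm 2 (-a) 1 (limitKernel l k γ ψ) ≤ C ∧
      ∀ f : Eu d → ℂ, AEStronglyMeasurable f volume → wNorm 2 a 1 f < ⊤ →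
        wNorm 2 (-a) 1 (conv (limitKernel l k γ ψ) f) ≤ C * wNorm 2 a 1 f := by
  obtain ⟨C, hC, hCb⟩ := exists_wNorm_symbolKernel_le hd hψ hs hR ha
  refine ⟨C, hC, fun l hl k hk γ hkR => ?_⟩
  have hne := neBot_of_side hl
  have hcg := isCountablyGenerated_of_side hl
  have hev := eventually_small_of_side hl
  have hmτ : ∀ τ ≠ 0, AEStronglyMeasurable (symbolKernel k γ τ ψ) volume := fun τ hτ =>
    (contDiff_symbolKernel hd hψ hs k γ hτ).continuous.aestronglyMeasurable
  have key : ∀ (F : ℝ → Eu d → ℂ) (G : Eu d → ℂ) (B : ℝ≥0∞),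
      (∀ τ ≠ 0, AEStronglyMeasurable (F τ) volume) → (∀ τ ≠ 0, |τ| ≤ 1 → wNorm 2 (-a) 1 (F τ) ≤ B) →
      (∀ x, Tendsto (fun τ => F τ x) l (𝓝 (G x))) → wNorm 2 (-a) 1 G ≤ B := by
    intro F G B hF hB hlim
    refine wNorm_le_of_tendsto (l := l)
      (F := fun τ => if τ = 0 then 0 else F τ) (fun τ => ?_) ?_
      (Eventually.of_forall fun z => (hlim z).congr' ?_)
    · by_cases hτ : τ = 0
      · simp only [hτ, if_true]; exact aestronglyMeasurable_const
      · simp only [hτ, if_false]; exact hF τ hτ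
    · filter_upwards [hev] with τ hτ
      simpa only [hτ.1, if_false] using hB τ hτ.1 hτ.2
    · filter_upwards [hev] with τ hτ
      simp only [hτ.1, if_false]
  refine ⟨key _ _ _ hmτ (fun τ hτ hτ1 => (hCb k γ τ hkR hτ hτ1).1)
    (tendsto_symbolKernel hd hk γ hl hψ hs), fun f hf hfn => ?_⟩
  exact key _ _ _ (fun τ hτ => aestronglyMeasurable_conv (hmτ τ hτ) hf)
    (fun τ hτ hτ1 => (hCb k γ τ hkR hτ hτ1).2.2 f hf hfn)
    (tendsto_conv_symbolKernel hd hk γ hl hψ hs ha hf hfn)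

/-- The splitting argument, uniformly over `f`: under the weight `-(a+d+1)` the pointwise bound of
the convolution involves the kernel difference, which tends to zero; under `-c` both operators are
bounded by the resolvent estimate with exponent `c`. -/
theorem eventually_wNorm_conv_sub_le {ε : ℝ≥0∞} (hε : ε ≠ 0) :
    ∀ᶠ τ in l, ∀ f : Eu d → ℂ, AEStronglyMeasurable f volume → wNorm 2 a 1 f < ⊤ →
      wNorm 2 (-a) 1 (conv (fun z => symbolKernel k γ τ ψ z - limitKernel l k γ ψ z) f) ≤
        ε * wNorm 2 a 1 f := by
  have ha0 : 0 ≤ a := by linarith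
  have hd0 : (0 : ℝ) ≤ d := d.cast_nonneg
  have hm := aestronglyMeasurable_limitKernel hd hk γ hl hψ hs
  obtain ⟨c, hc1, hca⟩ := exists_between ha
  have hc0 : 0 ≤ c := by linarith
  obtain ⟨C, hC, hCb⟩ := exists_wNorm_symbolKernel_le hd hψ hs (faddeevRadius_pos hk γ) hc1
  obtain ⟨C₀, hC₀, hC₀b⟩ := exists_wNorm_limitKernel_le hd hψ hs hc1 (faddeevRadius_pos hk γ)
  obtain ⟨A, hA, hAb⟩ := exists_wNorm_le_of_enorm_le (d := d) (a := a) (b := a + d + 1)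
    (by linarith)
  have h1 := tendsto_wNorm_symbolKernel_sub hd hk γ hl hψ hs ha
  have hY := ENNReal.Tendsto.const_mul (a := ENNReal.ofReal (Real.sqrt 2 ^ a) * A) h1
    (Or.inr (ENNReal.mul_lt_top ENNReal.ofReal_lt_top hA).ne)
  rw [mul_zero] at hY
  obtain ⟨t, ht, hte⟩ := exists_split_le hY (C := C + C₀) (by finiteness) hε (d + 1 : ℝ)
    (sub_pos.2 hca)
  filter_upwards [eventually_small_of_side hl, hte] with τ hτ hle f hf hfn
  have hmτ : AEStronglyMeasurable (symbolKernel k γ τ ψ) volume :=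
    (contDiff_symbolKernel hd hψ hs k γ hτ.1).continuous.aestronglyMeasurable
  have hfc : wNorm 2 c 1 f ≤ wNorm 2 a 1 f := wNorm_mono_exp hca.le 1 f
  have hfcn := hfc.trans_lt hfn
  refine (wNorm_split (aestronglyMeasurable_conv (hmτ.sub hm) hf) one_le_two ht hca.le
    (by linarith : a ≤ a + d + 1)).trans (le_trans ?_ (mul_le_mul_left hle (wNorm 2 a 1 f)))
  rw [show a + d + 1 - a = (d + 1 : ℝ) by ring, add_mul, mul_assoc (ENNReal.ofReal (t ^ (d + 1 : ℝ))),
    mul_assoc (ENNReal.ofReal (t ^ (-(a - c))))]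
  refine add_le_add ?_ ?_
  · gcongr
    refine (hAb _ (ENNReal.ofReal (Real.sqrt 2 ^ a) *
      (wNorm 2 (-a) 1 (fun z => symbolKernel k γ τ ψ z - limitKernel l k γ ψ z) * wNorm 2 a 1 f))
      fun x => ?_).trans (le_of_eq (by ring))
    refine (enorm_conv_apply_le (hmτ.sub hm) hf ha0 x).trans (le_of_eq ?_)
    rw [ENNReal.ofReal_mul (by positivity)]
    simp only [Pi.sub_def]
    ring
  · gcongr
    have e : conv (fun z => symbolKernel k γ τ ψ z - limitKernel l k γ ψ z) f =
        fun x => conv (symbolKernel k γ τ ψ) f x - conv (limitKernel l k γ ψ) f x := by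
      ext x
      exact conv_sub_left_apply
        (integrable_conv_integrand hmτ hf hc0 ((hCb k γ τ rfl hτ.1 hτ.2).1.trans_lt hC) hfcn x)
        (integrable_conv_integrand hm hf hc0 ((hC₀b l hl k hk γ rfl).1.trans_lt hC₀) hfcn x)
    have e2 : conv (symbolKernel k γ τ ψ - limitKernel l k γ ψ) f =
        conv (fun z => symbolKernel k γ τ ψ z - limitKernel l k γ ψ z) f := rfl
    rw [e2, e]
    refine (wNorm_sub_le one_le_two (-c) 1 (aestronglyMeasurable_conv hmτ hf)
      (aestronglyMeasurable_conv hm hf)).trans ?_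
    rw [add_mul]
    refine add_le_add ((hCb k γ τ rfl hτ.1 hτ.2).2.2 f hf hfcn |>.trans (by gcongr))
      ((hC₀b l hl k hk γ rfl).2 f hf hfcn |>.trans (by gcongr))

omit ha in
theorem conv_limitKernel_schwartz (f : 𝓢(Eu d, ℂ)) :
    conv (limitKernel l k γ ψ) f = limitKernel l k γ (fun ξ => ψ ξ * (𝓕 f) ξ) := by
  have hne := neBot_of_side hl
  have h1 : ContDiff ℝ ∞ (fun ξ => (𝓕 f : 𝓢(Eu d, ℂ)) ξ) := (𝓕 f : 𝓢(Eu d, ℂ)).smooth ⊤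
  ext x
  refine tendsto_nhds_unique (tendsto_conv_symbolKernel hd hk γ hl hψ hs (a := 1) (by norm_num)
    f.continuous.aestronglyMeasurable (schwartz_wNorm_lt_top _ _ _) x) ?_
  refine (tendsto_symbolKernel hd hk γ hl (hψ.mul h1) hs.mul_right x).congr' ?_
  filter_upwards [eventually_small_of_side hl] with τ hτ
  rw [(conv_symbolKernel_eq hd hψ hs hτ.1 f).2]

omit hψ hs ha in
theorem limitKernel_add {ψ ψ' : Eu d → ℂ} (hψ : ContDiff ℝ ∞ ψ) (hs : HasCompactSupport ψ)
    (hψ' : ContDiff ℝ ∞ ψ') (hs' : HasCompactSupport ψ') :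
    limitKernel l k γ (fun ξ => ψ ξ + ψ' ξ) =
      fun x => limitKernel l k γ ψ x + limitKernel l k γ ψ' x := by
  have hne := neBot_of_side hl
  ext x
  refine tendsto_nhds_unique (tendsto_symbolKernel hd hk γ hl (hψ.add hψ') (hs.add hs') x) ?_
  refine ((tendsto_symbolKernel hd hk γ hl hψ hs x).add
    (tendsto_symbolKernel hd hk γ hl hψ' hs' x)).congr' ?_
  filter_upwards [eventually_small_of_side hl] with τ hτ
  simp only [symbolKernel, add_div]
  have h1 := integrable_div_symbol hd k (γ := γ) (Or.inr hτ.1) hψ.continuous hs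
  have h2 := integrable_div_symbol hd k (γ := γ) (Or.inr hτ.1) hψ'.continuous hs'
  simp only [Real.fourierInv_eq, smul_add]
  rw [integral_add]
  · simpa using (Real.fourierIntegral_convergent_iff (-x)).2 h1
  · simpa using (Real.fourierIntegral_convergent_iff (-x)).2 h2

end limit

/-! ### Non-singular limits and dilations -/

theorem limitKernel_eq_fourierInv (hd : 2 ≤ d) {k : ℝ} (hk : 0 < k) (γ : Eu d)
    {l : Filter ℝ} (hl : l = 𝓝[>] 0 ∨ l = 𝓝[<] 0) {ψ : Eu d → ℂ} (hψ : ContDiff ℝ ∞ ψ)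
    (hs : HasCompactSupport ψ) {δ : ℝ} (hδ : 0 < δ)
    (h : ∀ ξ, ψ ξ ≠ 0 → δ ≤ |‖ξ‖ ^ 2 - faddeevRadius k γ ^ 2|) :
    limitKernel l k γ ψ = symbolKernel k γ 0 ψ := by
  have hne := neBot_of_side hl
  have hcg := isCountablyGenerated_of_side hl
  have hm : ∀ τ ξ, ψ ξ ≠ 0 → δ ≤ ‖faddeevSymbol k γ τ ξ‖ := fun τ ξ hξ => by
    refine (h ξ hξ).trans ?_
    rw [faddeevRadius_sq]
    exact norm_sq_sub_le_norm_faddeevSymbol k γ τ ξ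
  ext z
  refine tendsto_nhds_unique (tendsto_symbolKernel hd hk γ hl hψ hs z) ?_
  simp only [symbolKernel, Real.fourierInv_eq]
  -- The symbol is bounded below by `δ` on the support of `ψ`, uniformly in `τ`, so the limit is
  -- simply the value at `τ = 0`.
  refine tendsto_integral_filter_of_dominated_convergence (fun ξ => ‖ψ ξ‖ * δ⁻¹) ?_ ?_
    ((hψ.continuous.integrable_of_hasCompactSupport hs).norm.mul_const _) ?_
  · refine Eventually.of_forall fun τ => ?_
    refine AEStronglyMeasurable.smul (𝕜 := Circle) ?_
      (hψ.continuous.measurable.div (continuous_faddeevSymbol k γ τ).measurable).aestronglyMeasurable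
    exact (Real.continuous_fourierChar.comp
      (by fun_prop : Continuous fun ξ : Eu d => inner ℝ ξ z)).aestronglyMeasurable
  · refine Eventually.of_forall fun τ => Eventually.of_forall fun ξ => ?_
    rw [Circle.norm_smul, norm_div, div_eq_mul_inv]
    by_cases hξ : ψ ξ = 0
    · simp [hξ]
    · gcongr
      exact hm τ ξ hξ
  · refine Eventually.of_forall fun ξ => ?_
    by_cases hξ : ψ ξ = 0
    · simp [hξ]
    · have hc : Continuous fun τ : ℝ => faddeevSymbol k γ τ ξ := by
        unfold faddeevSymbol; fun_prop
      have h0 : faddeevSymbol k γ 0 ξ ≠ 0 := norm_pos_iff.1 (hδ.trans_le (hm 0 ξ hξ))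
      exact ((tendsto_const_nhds.div ((hc.tendsto 0).mono_left (le_nhds_of_side hl)) h0)).const_smul _

theorem faddeevSymbol_smul {c : ℝ} (hc : 0 < c) (k : ℝ) (γ : Eu d) (τ : ℝ) (ζ : Eu d) :
    faddeevSymbol k γ τ (c • ζ) =
      (c : ℂ) ^ 2 * faddeevSymbol (k / c) (c⁻¹ • γ) (τ / c ^ 2) ζ := by
  have hc' : (c : ℂ) ≠ 0 := by exact_mod_cast hc.ne'
  simp only [faddeevSymbol, norm_smul, Real.norm_eq_abs, mul_pow, sq_abs, inner_smul_left,
    inner_smul_right, RCLike.conj_to_real]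
  push_cast
  field_simp

theorem faddeevRadius_smul {c : ℝ} (hc : 0 < c) (k : ℝ) (γ : Eu d) :
    faddeevRadius (k / c) (c⁻¹ • γ) = faddeevRadius k γ / c := by
  rw [faddeevRadius, faddeevRadius, norm_smul, norm_inv, Real.norm_of_nonneg hc.le,
    ← Real.sqrt_sq hc.le, ← Real.sqrt_div (by positivity), Real.sqrt_sq hc.le]
  congr 1
  field_simp

theorem fourierInv_smul {c : ℝ} (hc : 0 < c) (f : Eu d → ℂ) (x : Eu d) :
    𝓕⁻ f x = (c : ℂ) ^ d * 𝓕⁻ (fun ζ => f (c • ζ)) (c • x) := by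
  have hc' : (c : ℂ) ≠ 0 := by exact_mod_cast hc.ne'
  have h := Measure.integral_comp_smul (volume : Measure (Eu d))
    (fun ξ => Real.fourierChar (inner ℝ ξ x) • f ξ) c
  rw [finrank_euclideanSpace_fin, abs_of_nonneg (by positivity)] at h
  rw [Real.fourierInv_eq, Real.fourierInv_eq]
  have h2 : ∀ ζ : Eu d, inner ℝ (c • ζ) x = (inner ℝ ζ (c • x) : ℝ) := fun ζ => by
    rw [inner_smul_left, inner_smul_right]; simp
  simp only [h2] at h
  rw [h, Complex.real_smul]
  push_cast
  field_simp

theorem symbolKernel_smul {c : ℝ} (hc : 0 < c) (k : ℝ) (γ : Eu d) (τ : ℝ) (ψ : Eu d → ℂ)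
    (x : Eu d) : symbolKernel k γ τ ψ x = (c : ℂ) ^ d / (c : ℂ) ^ 2 *
      symbolKernel (k / c) (c⁻¹ • γ) (τ / c ^ 2) (fun ζ => ψ (c • ζ)) (c • x) := by
  have hc' : (c : ℂ) ≠ 0 := by exact_mod_cast hc.ne'
  rw [symbolKernel, fourierInv_smul hc, symbolKernel, div_mul_eq_mul_div, mul_div_assoc]
  congr 1
  simp only [faddeevSymbol_smul hc, Real.fourierInv_eq]
  rw [eq_div_iff (by positivity), mul_comm, ← smul_eq_mul, ← integral_smul]
  refine integral_congr_ae (Eventually.of_forall fun ζ => ?_)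
  simp only [smul_eq_mul, Circle.smul_def]
  rw [mul_left_comm]
  congr 1
  field_simp

theorem tendsto_div_of_side {l : Filter ℝ} (hl : l = 𝓝[>] 0 ∨ l = 𝓝[<] 0) {c : ℝ} (hc : 0 < c) :
    Tendsto (fun τ => τ / c) l l := by
  have h0 : Tendsto (fun τ : ℝ => τ / c) (𝓝 0) (𝓝 0) := by
    simpa using (continuous_id.div_const c).tendsto (0 : ℝ)
  rcases hl with rfl | rfl
  · refine tendsto_nhdsWithin_iff.2 ⟨h0.mono_left nhdsWithin_le_nhds, ?_⟩
    filter_upwards [self_mem_nhdsWithin] with τ hτ using div_pos hτ hc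
  · refine tendsto_nhdsWithin_iff.2 ⟨h0.mono_left nhdsWithin_le_nhds, ?_⟩
    filter_upwards [self_mem_nhdsWithin] with τ hτ using div_neg_of_neg_of_pos hτ hc

theorem hasCompactSupport_comp_smul {c : ℝ} (hc : 0 < c) {ψ : Eu d → ℂ}
    (hs : HasCompactSupport ψ) : HasCompactSupport fun ζ => ψ (c • ζ) :=
  hs.comp_homeomorph (Homeomorph.smulOfNeZero c hc.ne')

theorem contDiff_comp_smul (c : ℝ) {ψ : Eu d → ℂ} (hψ : ContDiff ℝ ∞ ψ) :
    ContDiff ℝ ∞ fun ζ => ψ (c • ζ) :=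
  hψ.comp (contDiff_const_smul c)

/-- The symbol is homogeneous of degree two if `k`, `γ` scale linearly and `τ` quadratically. A
positive rescaling of `τ` keeps the side from which `0` is approached. -/
theorem limitKernel_smul (hd : 2 ≤ d) {k : ℝ} (hk : 0 < k) (γ : Eu d)
    {l : Filter ℝ} (hl : l = 𝓝[>] 0 ∨ l = 𝓝[<] 0) {ψ : Eu d → ℂ} (hψ : ContDiff ℝ ∞ ψ)
    (hs : HasCompactSupport ψ) {c : ℝ} (hc : 0 < c) (x : Eu d) :
    limitKernel l k γ ψ x = (c : ℂ) ^ d / (c : ℂ) ^ 2 *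
      limitKernel l (k / c) (c⁻¹ • γ) (fun ζ => ψ (c • ζ)) (c • x) := by
  have hne := neBot_of_side hl
  refine tendsto_nhds_unique (tendsto_symbolKernel hd hk γ hl hψ hs x) ?_
  have h := (tendsto_symbolKernel hd (div_pos hk hc) (c⁻¹ • γ) hl (contDiff_comp_smul c hψ)
    (hasCompactSupport_comp_smul hc hs) (c • x)).comp
    (tendsto_div_of_side hl (by positivity : 0 < c ^ 2))
  refine (h.const_mul ((c : ℂ) ^ d / (c : ℂ) ^ 2)).congr fun τ => ?_
  rw [symbolKernel_smul hc, Function.comp_apply]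

/-! ### Kernel families for the regularized and limiting operators -/

theorem hasTemperateGrowth_faddeevSymbol (k : ℝ) (γ : Eu d) (τ : ℝ) :
    (faddeevSymbol k γ τ).HasTemperateGrowth := by
  have h1 : (fun ξ : Eu d => ‖ξ‖ ^ 2 - k ^ 2 - ‖γ‖ ^ 2).HasTemperateGrowth :=
    ((Function.hasTemperateGrowth_norm_sq (H := Eu d)).sub (.const _)).sub (.const _)
  have h2 := Function.HasTemperateGrowth.comp Function.Complex.hasTemperateGrowth_ofReal h1
  have h3 := Function.HasTemperateGrowth.comp Function.Complex.hasTemperateGrowth_ofReal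
    (Function.hasTemperateGrowth_inner_right γ)
  exact (h2.add ((Function.HasTemperateGrowth.const (2 * Complex.I)).mul h3)).sub
    (.const (Complex.I * (τ : ℂ)))

/-- A family of convolution kernels `K ψ`, with symbol `ψ` times a fixed singular symbol, which
outside of a neighbourhood of its singularities (where `Ψ = 1`) is a smooth function: `b` is
`1 - Ψ` times the symbol. -/
structure KernelFamily (K : (Eu d → ℂ) → Eu d → ℂ) (Ψ b : Eu d → ℂ) : Prop where
  temperate : b.HasTemperateGrowth
  smooth : ContDiff ℝ ∞ Ψ
  compact : HasCompactSupport Ψ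
  aestronglyMeasurable : ∀ ψ, ContDiff ℝ ∞ ψ → HasCompactSupport ψ →
    AEStronglyMeasurable (K ψ) volume
  wNorm_lt_top : ∀ ψ, ContDiff ℝ ∞ ψ → HasCompactSupport ψ → ∀ a : ℝ, 1 / 2 < a →
    wNorm 2 (-a) 1 (K ψ) < ⊤
  map_add : ∀ ψ ψ', ContDiff ℝ ∞ ψ → HasCompactSupport ψ → ContDiff ℝ ∞ ψ' →
    HasCompactSupport ψ' → K (fun ξ => ψ ξ + ψ' ξ) = fun x => K ψ x + K ψ' x
  conv_schwartz : ∀ ψ, ContDiff ℝ ∞ ψ → HasCompactSupport ψ → ∀ f : 𝓢(Eu d, ℂ),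
    conv (K ψ) f = K (fun ξ => ψ ξ * (𝓕 f) ξ)
  high : ∀ ψ, ContDiff ℝ ∞ ψ → HasCompactSupport ψ →
    K (fun ξ => (1 - Ψ ξ) * ψ ξ) = 𝓕⁻ (fun ξ => b ξ * ψ ξ)

/-- The symbol `(1 - Ψ) / m_{k,γ,τ}`, for `Ψ = 1` on a ball of radius `2 r_{k,γ}`. -/
def highSymbol (k : ℝ) (γ : Eu d) (τ : ℝ) (Ψ : Eu d → ℂ) (ξ : Eu d) : ℂ :=
  (1 - Ψ ξ) * invReg (faddeevRadius k γ ^ 2) (faddeevSymbol k γ τ ξ)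

theorem le_abs_norm_sq_sub {R : ℝ} {Ψ : Eu d → ℂ} (hR : 0 < R)
    (hΨ1 : ∀ ξ : Eu d, ‖ξ‖ ≤ 2 * R → Ψ ξ = 1) {ξ : Eu d} (hξ : 1 - Ψ ξ ≠ 0) :
    R ^ 2 ≤ |‖ξ‖ ^ 2 - R ^ 2| := by
  have h : 2 * R < ‖ξ‖ := by
    by_contra h
    exact hξ (by rw [hΨ1 ξ (not_lt.1 h), sub_self])
  refine le_trans ?_ (le_abs_self _)
  nlinarith

/-- Where `1 - Ψ` does not vanish, `|ξ| > 2R` and the real part of the symbol is at least `R²`, the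
threshold above which the regularized inverse is the true one. -/
theorem highSymbol_eq {k : ℝ} {γ : Eu d} {Ψ : Eu d → ℂ} (hR : 0 < faddeevRadius k γ)
    (hΨ1 : ∀ ξ : Eu d, ‖ξ‖ ≤ 2 * faddeevRadius k γ → Ψ ξ = 1) (τ : ℝ) (ξ : Eu d) :
    highSymbol k γ τ Ψ ξ = (1 - Ψ ξ) / faddeevSymbol k γ τ ξ := by
  rw [highSymbol, div_eq_mul_inv]
  by_cases hξ : 1 - Ψ ξ = 0
  · rw [hξ, zero_mul, zero_mul]
  · rw [invReg_eq (by positivity)]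
    refine (le_abs_norm_sq_sub hR hΨ1 hξ).trans ?_
    rw [faddeevRadius_sq]
    exact norm_sq_sub_le_norm_faddeevSymbol k γ τ ξ

theorem hasTemperateGrowth_highSymbol (k : ℝ) (γ : Eu d) (τ : ℝ) {Ψ : Eu d → ℂ}
    (hΨ : ContDiff ℝ ∞ Ψ) (hΨs : HasCompactSupport Ψ) :
    (highSymbol k γ τ Ψ).HasTemperateGrowth :=
  ((Function.HasTemperateGrowth.const 1).sub (hΨs.hasTemperateGrowth hΨ)).mul
    ((hasTemperateGrowth_invReg _).comp (hasTemperateGrowth_faddeevSymbol k γ τ))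

theorem kernelFamily_symbolKernel (hd : 2 ≤ d) {k : ℝ} (hk : 0 < k) (γ : Eu d) {τ : ℝ}
    (hτ : τ ≠ 0) (hτ1 : |τ| ≤ 1) {Ψ : Eu d → ℂ} (hΨ : ContDiff ℝ ∞ Ψ) (hΨs : HasCompactSupport Ψ)
    (hΨ1 : ∀ ξ : Eu d, ‖ξ‖ ≤ 2 * faddeevRadius k γ → Ψ ξ = 1) :
    KernelFamily (symbolKernel k γ τ) Ψ (highSymbol k γ τ Ψ) where
  temperate := hasTemperateGrowth_highSymbol k γ τ hΨ hΨs
  smooth := hΨ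
  compact := hΨs
  aestronglyMeasurable ψ hψ hs :=
    (contDiff_symbolKernel hd hψ hs k γ hτ).continuous.aestronglyMeasurable
  wNorm_lt_top ψ hψ hs a ha := by
    obtain ⟨C, hC, h⟩ := exists_wNorm_symbolKernel_le hd hψ hs (faddeevRadius_pos hk γ) ha
    exact (h k γ τ rfl hτ hτ1).1.trans_lt hC
  map_add ψ ψ' hψ hs hψ' hs' := by
    ext x
    simp only [symbolKernel, add_div]
    have h1 := integrable_div_symbol hd k (γ := γ) (Or.inr hτ) hψ.continuous hs
    have h2 := integrable_div_symbol hd k (γ := γ) (Or.inr hτ) hψ'.continuous hs'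
    simp only [Real.fourierInv_eq, smul_add]
    rw [integral_add]
    · simpa using (Real.fourierIntegral_convergent_iff (-x)).2 h1
    · simpa using (Real.fourierIntegral_convergent_iff (-x)).2 h2
  conv_schwartz ψ hψ hs f := (conv_symbolKernel_eq hd hψ hs hτ f).2
  high ψ hψ hs := by
    rw [symbolKernel]
    congr 1
    ext ξ
    rw [highSymbol_eq (faddeevRadius_pos hk γ) hΨ1]
    ring

theorem kernelFamily_limitKernel (hd : 2 ≤ d) {k : ℝ} (hk : 0 < k) (γ : Eu d) {l : Filter ℝ}
    (hl : l = 𝓝[>] 0 ∨ l = 𝓝[<] 0) {Ψ : Eu d → ℂ} (hΨ : ContDiff ℝ ∞ Ψ) (hΨs : HasCompactSupport Ψ)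
    (hΨ1 : ∀ ξ : Eu d, ‖ξ‖ ≤ 2 * faddeevRadius k γ → Ψ ξ = 1) :
    KernelFamily (limitKernel l k γ) Ψ (highSymbol k γ 0 Ψ) where
  temperate := hasTemperateGrowth_highSymbol k γ 0 hΨ hΨs
  smooth := hΨ
  compact := hΨs
  aestronglyMeasurable ψ hψ hs := aestronglyMeasurable_limitKernel hd hk γ hl hψ hs
  wNorm_lt_top ψ hψ hs a ha := wNorm_limitKernel_lt_top hd hk γ hl hψ hs ha
  map_add ψ ψ' hψ hs hψ' hs' := limitKernel_add hd hk γ hl hψ hs hψ' hs'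
  conv_schwartz ψ hψ hs f := conv_limitKernel_schwartz hd hk γ hl hψ hs f
  high ψ hψ hs := by
    have hR := faddeevRadius_pos hk γ
    rw [limitKernel_eq_fourierInv hd hk γ hl ((contDiff_const.sub hΨ).mul hψ) hs.mul_left
      (pow_pos hR 2) fun ξ hξ => le_abs_norm_sq_sub hR hΨ1 (left_ne_zero_of_mul hξ), symbolKernel]
    congr 1
    ext ξ
    rw [highSymbol_eq hR hΨ1]
    ring

/-! ### Littlewood-Paley cut-offs -/

section cutoff

variable {χ φ : Eu d → ℝ} (h : IsDyadicPair χ φ)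
include h

theorem contDiff_dyadicCutoff (m : ℕ) : ContDiff ℝ ∞ (dyadicCutoff χ φ m) := by
  cases m with
  | zero => exact h.smooth_low
  | succ n => exact h.smooth_high.comp (contDiff_const_smul _)

theorem norm_le_of_dyadicCutoff_ne_zero {m : ℕ} {ξ : Eu d} (hξ : dyadicCutoff χ φ m ξ ≠ 0) :
    ‖ξ‖ ≤ 4 / 3 * 2 ^ m := by
  cases m with
  | zero =>
    have := h.supp_low (subset_tsupport _ hξ)
    simpa using this
  | succ n =>
    have := (h.supp_high (subset_tsupport _ hξ)).2
    rw [norm_smul, Real.norm_of_nonneg (by positivity), Real.rpow_neg two_pos.le,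
      Real.rpow_natCast, inv_mul_le_iff₀ (by positivity)] at this
    rw [pow_succ]
    linarith

theorem le_norm_of_dyadicCutoff_ne_zero {n : ℕ} {ξ : Eu d}
    (hξ : dyadicCutoff χ φ (n + 1) ξ ≠ 0) : 3 / 4 * 2 ^ n ≤ ‖ξ‖ := by
  have := (h.supp_high (subset_tsupport _ hξ)).1
  rw [norm_smul, Real.norm_of_nonneg (by positivity), Real.rpow_neg two_pos.le,
    Real.rpow_natCast, le_inv_mul_iff₀ (by positivity)] at this
  linarith

theorem hasCompactSupport_dyadicCutoff (m : ℕ) : HasCompactSupport (dyadicCutoff χ φ m) := by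
  refine HasCompactSupport.of_support_subset_isCompact
    (isCompact_closedBall (0 : Eu d) (4 / 3 * 2 ^ m)) fun ξ hξ => ?_
  rw [mem_closedBall_zero_iff]
  exact norm_le_of_dyadicCutoff_ne_zero h hξ

theorem contDiff_dyadicCutoff_ofReal (m : ℕ) :
    ContDiff ℝ ∞ fun ξ => (dyadicCutoff χ φ m ξ : ℂ) :=
  Complex.ofRealCLM.contDiff.comp (contDiff_dyadicCutoff h m)

theorem hasCompactSupport_dyadicCutoff_ofReal (m : ℕ) :
    HasCompactSupport fun ξ => (dyadicCutoff χ φ m ξ : ℂ) :=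
  (hasCompactSupport_dyadicCutoff h m).comp_left (g := Complex.ofReal) (by simp)

theorem hasSum_dyadicCutoff (ξ : Eu d) : HasSum (fun m => dyadicCutoff χ φ m ξ) 1 := by
  have h1 : HasSum (fun n => dyadicCutoff χ φ (n + 1) ξ) (1 - χ ξ) := h.sum_eq_one ξ
  have h2 := (hasSum_nat_add_iff (f := fun m => dyadicCutoff χ φ m ξ) 1).1 h1
  simpa [dyadicCutoff] using h2

theorem sum_dyadicCutoff_eq_one {s : Finset ℕ} {ξ : Eu d}
    (hs : ∀ i ∉ s, dyadicCutoff χ φ i ξ = 0) : ∑ i ∈ s, dyadicCutoff χ φ i ξ = 1 :=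
  (hasSum_sum_of_ne_finset_zero hs).unique (hasSum_dyadicCutoff h ξ)

theorem sum_range_dyadicCutoff {N : ℕ} {ξ : Eu d} (hξ : ‖ξ‖ < 3 / 4 * 2 ^ N) :
    ∑ i ∈ Finset.range (N + 1), dyadicCutoff χ φ i ξ = 1 := by
  refine sum_dyadicCutoff_eq_one h fun i hi => ?_
  by_contra hne
  obtain ⟨n, rfl⟩ : ∃ n, i = n + 1 := ⟨i - 1, by simp at hi; omega⟩
  have h1 := le_norm_of_dyadicCutoff_ne_zero h hne
  have h2 : (2 : ℝ) ^ N ≤ 2 ^ n := pow_le_pow_right₀ one_le_two (by simp at hi; omega)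
  linarith

omit h in
/-- The dyadic indices adjacent to `m`. -/
def nbr (m : ℕ) : Finset ℕ := Finset.Icc (m - 1) (m + 1)

/-- The supports are separated because `4/3 · 2^m < 3/4 · 2^{m+1}`. -/
theorem dyadicCutoff_eq_zero_of_lt {m i : ℕ} (hi : m + 1 < i) {ξ : Eu d}
    (hξ : dyadicCutoff χ φ m ξ ≠ 0) : dyadicCutoff χ φ i ξ = 0 := by
  by_contra hne
  obtain ⟨n, rfl⟩ : ∃ n, i = n + 1 := ⟨i - 1, by omega⟩
  have h1 := le_norm_of_dyadicCutoff_ne_zero h hne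
  have h2 : (2 : ℝ) ^ (m + 1) ≤ 2 ^ n := pow_le_pow_right₀ one_le_two (by omega)
  have h3 := norm_le_of_dyadicCutoff_ne_zero h hξ
  rw [pow_succ] at h2
  have h4 : (0 : ℝ) < 2 ^ m := by positivity
  linarith

theorem dyadicCutoff_mul_sum_nbr (m : ℕ) (ξ : Eu d) :
    dyadicCutoff χ φ m ξ * ∑ i ∈ nbr m, dyadicCutoff χ φ i ξ = dyadicCutoff χ φ m ξ := by
  by_cases hξ : dyadicCutoff χ φ m ξ = 0
  · rw [hξ, zero_mul]
  · rw [sum_dyadicCutoff_eq_one h, mul_one]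
    intro i hi
    by_contra hne
    rcases lt_or_ge (m + 1) i with h1 | h1
    · exact hne (dyadicCutoff_eq_zero_of_lt h h1 hξ)
    · exact hξ (dyadicCutoff_eq_zero_of_lt h (by simp [nbr] at hi; omega) hne)

theorem exists_schwartz_sum_dyadicCutoff (s : Finset ℕ) :
    ∃ σ : 𝓢(Eu d, ℂ), ∀ ξ, σ ξ = ∑ i ∈ s, (dyadicCutoff χ φ i ξ : ℂ) := by
  choose σ hσ using fun i => exists_schwartz_eq (contDiff_dyadicCutoff_ofReal h i)
    (hasCompactSupport_dyadicCutoff_ofReal h i)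
  refine ⟨∑ i ∈ s, σ i, fun ξ => ?_⟩
  rw [sum_apply]
  exact Finset.sum_congr rfl fun i _ => congrFun (hσ i) ξ

theorem sum_dyadicBlock_eq {s : Finset ℕ} {σ : 𝓢(Eu d, ℂ)}
    (hσ : ∀ ξ, σ ξ = ∑ i ∈ s, (dyadicCutoff χ φ i ξ : ℂ)) (f : 𝓢'(Eu d, ℂ)) :
    ∑ i ∈ s, dyadicBlock χ φ i f = TemperedDistribution.fourierMultiplierCLM ℂ σ f := by
  have h1 := TemperedDistribution.fourierMultiplierCLM_sum ℂ (s := s)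
    (g := fun i ξ => (dyadicCutoff χ φ i ξ : ℂ)) fun i _ =>
      (hasCompactSupport_dyadicCutoff_ofReal h i).hasTemperateGrowth
        (contDiff_dyadicCutoff_ofReal h i)
  have h2 : (σ : Eu d → ℂ) = fun ξ => ∑ i ∈ s, (dyadicCutoff χ φ i ξ : ℂ) := funext hσ
  rw [h2, h1, sum_apply]
  rfl

end cutoff

/-! ### Convolution pairs -/

/-- Finiteness of a triple convolution can thus be checked with the Schwartz factor outermost, where
it holds at every point. -/
theorem econv_left_comm {k w h : Eu d → ℝ≥0∞} (hk : AEMeasurable k) (hw : AEMeasurable w)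
    (hh : AEMeasurable h) (x : Eu d) : econv k (econv w h) x = econv w (econv k h) x := by
  have hm : AEMeasurable (fun p : Eu d × Eu d => k (x - p.1) * (h (p.1 - p.2) * w p.2))
      (volume.prod volume) :=
    (aemeasurable_sub_left hk x).comp_fst.mul (aemeasurable_econv_integrand hh hw)
  have h1 : econv k (econv w h) x = ∫⁻ y, ∫⁻ z, k (x - y) * (h (y - z) * w z) := by
    refine lintegral_congr fun y => ?_
    have hyz : AEMeasurable (fun z => h (y - z) * w z) := (aemeasurable_sub_left hh y).mul hw
    rw [econv_eq_swap, lintegral_const_mul'' _ hyz]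
    simp only [mul_comm]
  have h2 : econv w (econv k h) x = ∫⁻ z, ∫⁻ y, k (x - y) * (h (y - z) * w z) := by
    rw [econv_eq_swap]
    refine lintegral_congr fun z => ?_
    have e : econv k h (x - z) = ∫⁻ y, k (x - y) * h (y - z) := by
      rw [econv, ← lintegral_sub_right_eq_self _ z]
      refine lintegral_congr fun y => ?_
      congr 2
      abel
    have hyz : AEMeasurable (fun y => k (x - y) * h (y - z)) :=
      (aemeasurable_sub_left hk x).mul
        (hh.comp_quasiMeasurePreserving (measurePreserving_sub_right volume z).quasiMeasurePreserving)
    rw [e, ← lintegral_const_mul'' _ hyz]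
    refine lintegral_congr fun y => ?_
    ring
  rw [h1, h2, lintegral_lintegral_swap hm]

theorem ConvPair.conv_conv {K g : Eu d → ℂ} (h : ConvPair K g) (κ : 𝓢(Eu d, ℂ)) :
    conv K (conv κ g) = conv (conv κ K) g := by
  obtain ⟨hK, hg, b, hb⟩ := id h
  refine conv_conv_schwartz_comm κ h fun x => ?_
  rw [econv_left_comm hK.enorm κ.continuous.measurable.enorm.aemeasurable hg.enorm]
  exact econv_schwartz_lt_top κ hb x

theorem ConvPair.add_right {K g g' : Eu d → ℂ} (h : ConvPair K g) (h' : ConvPair K g') :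
    ConvPair K (fun x => g x + g' x) := by
  obtain ⟨hK, hg, b, hb⟩ := h
  obtain ⟨-, hg', b', hb'⟩ := h'
  refine ⟨hK, hg.add hg', max b b', ?_⟩
  have hw : ∀ b : ℝ, Measurable fun x : Eu d => ENNReal.ofReal (bracketWeight b 1 x) := fun b =>
    (continuous_bracketWeight b 1).measurable.ennreal_ofReal
  refine lt_of_le_of_lt ?_ (ENNReal.add_lt_top.2 ⟨hb, hb'⟩)
  have hm : AEMeasurable fun x => ENNReal.ofReal (bracketWeight (-b) 1 x) *
      econv (fun z => ‖K z‖ₑ) (fun z => ‖g z‖ₑ) x :=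
    (hw _).aemeasurable.mul (aemeasurable_econv hK.enorm hg.enorm)
  rw [← lintegral_add_left' hm]
  refine lintegral_mono fun x => ?_
  have h1 : econv (fun z => ‖K z‖ₑ) (fun z => ‖g z + g' z‖ₑ) x ≤
      econv (fun z => ‖K z‖ₑ) (fun z => ‖g z‖ₑ) x + econv (fun z => ‖K z‖ₑ) (fun z => ‖g' z‖ₑ) x := by
    unfold econv
    have hm' : AEMeasurable fun y => ‖K (x - y)‖ₑ * ‖g y‖ₑ :=
      (aemeasurable_sub_left hK.enorm x).mul hg.enorm
    rw [← lintegral_add_left' hm']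
    refine lintegral_mono fun y => ?_
    rw [← mul_add]
    gcongr
    exact enorm_add_le _ _
  calc _ ≤ ENNReal.ofReal (bracketWeight (-max b b') 1 x) * _ := by gcongr
    _ = _ := mul_add _ _ _
    _ ≤ _ := by
      gcongr
      · exact bracketWeight_mono (by simp) 1 x
      · exact bracketWeight_mono (by simp) 1 x

theorem ConvPair.smul_right {K g : Eu d → ℂ} (h : ConvPair K g) (c : ℂ) :
    ConvPair K (fun x => c * g x) := by
  obtain ⟨hK, hg, b, hb⟩ := h
  refine ⟨hK, hg.const_mul c, b, ?_⟩
  have h1 : ∀ x, econv (fun z => ‖K z‖ₑ) (fun z => ‖c * g z‖ₑ) x =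
      ‖c‖ₑ * econv (fun z => ‖K z‖ₑ) (fun z => ‖g z‖ₑ) x := fun x => by
    unfold econv
    rw [← lintegral_const_mul' _ _ enorm_ne_top]
    refine lintegral_congr fun y => ?_
    simp only [enorm_mul]; ring
  simp only [h1, mul_left_comm _ ‖c‖ₑ]
  rw [lintegral_const_mul' _ _ enorm_ne_top]
  exact ENNReal.mul_lt_top enorm_lt_top hb

theorem ConvPair.zero_right {K : Eu d → ℂ} (hK : AEStronglyMeasurable K volume) :
    ConvPair K (fun _ => 0) :=
  ⟨hK, aestronglyMeasurable_const, 0, by simp [econv]⟩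

theorem ConvPair.sum_right {K : Eu d → ℂ} (hK : AEStronglyMeasurable K volume) {ι : Type*}
    (s : Finset ι) {g : ι → Eu d → ℂ} (h : ∀ i ∈ s, ConvPair K (g i)) :
    ConvPair K (fun x => ∑ i ∈ s, g i x) := by
  classical
  induction s using Finset.induction_on with
  | empty => simpa using ConvPair.zero_right hK
  | insert i s hi ih =>
    simp only [Finset.sum_insert hi]
    exact (h i (Finset.mem_insert_self i s)).add_right
      (ih fun j hj => h j (Finset.mem_insert_of_mem hj))

theorem ConvPair.conv_add_right {K g g' : Eu d → ℂ} (h : ConvPair K g) (h' : ConvPair K g') :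
    conv K (fun x => g x + g' x) =ᵐ[volume] fun x => conv K g x + conv K g' x := by
  filter_upwards [h.ae_integrable, h'.ae_integrable] with x hx hx'
  simp only [conv, mul_add]
  exact integral_add hx hx'

theorem conv_smul_right (K g : Eu d → ℂ) (c : ℂ) :
    conv K (fun x => c * g x) = fun x => c * conv K g x := by
  ext x
  simp only [conv, mul_left_comm _ c]
  exact integral_const_mul _ _

theorem ConvPair.conv_add_left {K K' g : Eu d → ℂ} (h : ConvPair K g) (h' : ConvPair K' g) :
    conv (fun x => K x + K' x) g =ᵐ[volume] fun x => conv K g x + conv K' g x := by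
  filter_upwards [h.ae_integrable, h'.ae_integrable] with x hx hx'
  simp only [conv, add_mul]
  exact integral_add hx hx'

/-- Convolution with the kernel `K`, as an operation on tempered distributions; it is zero unless
the distribution is a function whose convolution with `K` makes sense. -/
def convOp (K : Eu d → ℂ) (u : 𝓢'(Eu d, ℂ)) : 𝓢'(Eu d, ℂ) :=
  open Classical in
  if h : ∃ v g, IsRepresentedBy u g ∧ ConvPair K g ∧ IsRepresentedBy v (conv K g) then
    h.choose else 0

/-- The choice made in `convOp` is immaterial: two representatives of `u` agree almost everywhere
and have the same convolution with `K`. -/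
theorem isRepresentedBy_convOp {K : Eu d → ℂ} {u : 𝓢'(Eu d, ℂ)} {g : Eu d → ℂ}
    (hu : IsRepresentedBy u g) (hp : ConvPair K g) : IsRepresentedBy (convOp K u) (conv K g) := by
  obtain ⟨v, hv⟩ := hp.tempered.exists_isRepresentedBy
  have h : ∃ v g, IsRepresentedBy u g ∧ ConvPair K g ∧ IsRepresentedBy v (conv K g) :=
    ⟨v, g, hu, hp, hv⟩
  rw [convOp, dif_pos h]
  obtain ⟨g', h1, h2, h3⟩ := h.choose_spec
  rwa [conv_congr_right K (hu.ae_eq h1)]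

theorem convOp_add {K : Eu d → ℂ} {u u' : 𝓢'(Eu d, ℂ)} {g g' : Eu d → ℂ}
    (hu : IsRepresentedBy u g) (hp : ConvPair K g) (hu' : IsRepresentedBy u' g')
    (hp' : ConvPair K g') : convOp K (u + u') = convOp K u + convOp K u' :=
  (isRepresentedBy_convOp (hu.add hu') (hp.add_right hp')).unique
    (((isRepresentedBy_convOp hu hp).add (isRepresentedBy_convOp hu' hp')).congr
      (hp.conv_add_right hp').symm)

theorem convOp_smul {K : Eu d → ℂ} {u : 𝓢'(Eu d, ℂ)} {g : Eu d → ℂ}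
    (hu : IsRepresentedBy u g) (hp : ConvPair K g) (c : ℂ) :
    convOp K (c • u) = c • convOp K u := by
  have h1 := isRepresentedBy_convOp (hu.smul c) (hp.smul_right c)
  rw [conv_smul_right] at h1
  exact h1.unique ((isRepresentedBy_convOp hu hp).smul c)

theorem TemperedFun.add {g g' : Eu d → ℂ} (h : TemperedFun g) (h' : TemperedFun g') :
    TemperedFun (fun x => g x + g' x) := by
  obtain ⟨hg, b, hb⟩ := h
  obtain ⟨hg', b', hb'⟩ := h'
  refine ⟨hg.add hg', max b b', (wNorm_add_le le_rfl _ 1 hg hg').trans_lt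
    (ENNReal.add_lt_top.2 ⟨?_, ?_⟩)⟩
  · exact (wNorm_mono_exp (by simp) 1 g).trans_lt hb
  · exact (wNorm_mono_exp (by simp) 1 g').trans_lt hb'

theorem TemperedFun.sum {ι : Type*} (s : Finset ι) {g : ι → Eu d → ℂ}
    (h : ∀ i ∈ s, TemperedFun (g i)) : TemperedFun (fun x => ∑ i ∈ s, g i x) := by
  classical
  induction s using Finset.induction_on with
  | empty => exact ⟨aestronglyMeasurable_const, 0, by simp [wNorm]⟩
  | insert i s hi ih =>
    simp only [Finset.sum_insert hi]
    exact (h i (Finset.mem_insert_self i s)).add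
      (ih fun j hj => h j (Finset.mem_insert_of_mem hj))

/-! ### The operator attached to a kernel family -/

/-- The Fourier multiplier attached to a kernel family: the high frequencies are treated with the
smooth symbol `b`, the low ones by convolution with `K Ψ`. -/
def faddeevFun (χ φ : Eu d → ℝ) (K : (Eu d → ℂ) → Eu d → ℂ) (Ψ b : Eu d → ℂ) (N : ℕ)
    (f : 𝓢'(Eu d, ℂ)) : 𝓢'(Eu d, ℂ) :=
  TemperedDistribution.fourierMultiplierCLM ℂ b f +
    convOp (K Ψ) (∑ i ∈ Finset.range (N + 1), dyadicBlock χ φ i f)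

/-- The functions `g i` are the Littlewood-Paley blocks of `f`, and they can be convolved with all
the kernels `K ψ`. -/
structure BlockData (χ φ : Eu d → ℝ) (K : (Eu d → ℂ) → Eu d → ℂ) (f : 𝓢'(Eu d, ℂ))
    (g : ℕ → Eu d → ℂ) : Prop where
  rep : ∀ i, IsRepresentedBy (dyadicBlock χ φ i f) (g i)
  tempered : ∀ i, TemperedFun (g i)
  pair : ∀ i ψ, ContDiff ℝ ∞ ψ → HasCompactSupport ψ → ConvPair (K ψ) (g i)

section faddeevFun

variable {χ φ : Eu d → ℝ} {K : (Eu d → ℂ) → Eu d → ℂ} {Ψ b : Eu d → ℂ} {N : ℕ}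

theorem BlockData.rep_sum {f : 𝓢'(Eu d, ℂ)} {g : ℕ → Eu d → ℂ} (h : BlockData χ φ K f g)
    (s : Finset ℕ) :
    IsRepresentedBy (∑ i ∈ s, dyadicBlock χ φ i f) (fun x => ∑ i ∈ s, g i x) :=
  IsRepresentedBy.sum s fun i _ => h.rep i

theorem BlockData.tempered_sum {f : 𝓢'(Eu d, ℂ)} {g : ℕ → Eu d → ℂ} (h : BlockData χ φ K f g)
    (s : Finset ℕ) : TemperedFun (fun x => ∑ i ∈ s, g i x) :=
  TemperedFun.sum s fun i _ => h.tempered i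

variable (hK : KernelFamily K Ψ b)
include hK

theorem BlockData.pair_sum {f : 𝓢'(Eu d, ℂ)} {g : ℕ → Eu d → ℂ} (h : BlockData χ φ K f g)
    (s : Finset ℕ) {ψ : Eu d → ℂ} (hψ : ContDiff ℝ ∞ ψ) (hs : HasCompactSupport ψ) :
    ConvPair (K ψ) (fun x => ∑ i ∈ s, g i x) :=
  ConvPair.sum_right (hK.aestronglyMeasurable ψ hψ hs) s fun i _ => h.pair i ψ hψ hs

theorem faddeevFun_add {f f' : 𝓢'(Eu d, ℂ)} {g g' : ℕ → Eu d → ℂ} (h : BlockData χ φ K f g)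
    (h' : BlockData χ φ K f' g') : faddeevFun χ φ K Ψ b N (f + f') =
      faddeevFun χ φ K Ψ b N f + faddeevFun χ φ K Ψ b N f' := by
  have e : ∑ i ∈ Finset.range (N + 1), dyadicBlock χ φ i (f + f') =
      (∑ i ∈ Finset.range (N + 1), dyadicBlock χ φ i f) +
        ∑ i ∈ Finset.range (N + 1), dyadicBlock χ φ i f' := by
    simp [dyadicBlock, Finset.sum_add_distrib]
  rw [faddeevFun, faddeevFun, faddeevFun, e, map_add,
    convOp_add (h.rep_sum _) (h.pair_sum hK _ hK.smooth hK.compact) (h'.rep_sum _)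
      (h'.pair_sum hK _ hK.smooth hK.compact)]
  abel

theorem faddeevFun_smul {f : 𝓢'(Eu d, ℂ)} {g : ℕ → Eu d → ℂ} (h : BlockData χ φ K f g) (c : ℂ) :
    faddeevFun χ φ K Ψ b N (c • f) = c • faddeevFun χ φ K Ψ b N f := by
  have e : ∑ i ∈ Finset.range (N + 1), dyadicBlock χ φ i (c • f) =
      c • ∑ i ∈ Finset.range (N + 1), dyadicBlock χ φ i f := by
    simp [dyadicBlock, Finset.smul_sum]
  rw [faddeevFun, faddeevFun, e, map_smul,
    convOp_smul (h.rep_sum _) (h.pair_sum hK _ hK.smooth hK.compact), smul_add]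

/-- The blocks of the operator are convolutions with the kernels `K φ_m`. -/
theorem isRepresentedBy_dyadicBlock_faddeevFun (hχφ : IsDyadicPair χ φ)
    (hN : ∀ ξ, Ψ ξ ≠ 0 → ‖ξ‖ < 3 / 4 * 2 ^ N) {f : 𝓢'(Eu d, ℂ)} {g : ℕ → Eu d → ℂ}
    (h : BlockData χ φ K f g) (m : ℕ) :
    IsRepresentedBy (dyadicBlock χ φ m (faddeevFun χ φ K Ψ b N f))
      (conv (K fun ξ => (dyadicCutoff χ φ m ξ : ℂ)) (fun x => ∑ i ∈ nbr m, g i x)) := by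
  have hφs := contDiff_dyadicCutoff_ofReal hχφ m
  have hφc := hasCompactSupport_dyadicCutoff_ofReal hχφ m
  obtain ⟨κ, hκ⟩ := exists_schwartz_eq hφs hφc
  obtain ⟨σ, hσ⟩ := exists_schwartz_sum_dyadicCutoff hχφ (nbr m)
  obtain ⟨S, hS⟩ := exists_schwartz_sum_dyadicCutoff hχφ (Finset.range (N + 1))
  obtain ⟨B, hB⟩ := exists_schwartz_eq (hK.temperate.1.mul hφs) hφc.mul_left
  have hκ' : ∀ ξ, κ ξ = (dyadicCutoff χ φ m ξ : ℂ) := fun ξ => congrFun hκ ξ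
  have hB' : ∀ ξ, B ξ = b ξ * (dyadicCutoff χ φ m ξ : ℂ) := fun ξ => congrFun hB ξ
  have hφσ : ∀ ξ, (dyadicCutoff χ φ m ξ : ℂ) * σ ξ = dyadicCutoff χ φ m ξ := fun ξ => by
    rw [hσ]; exact_mod_cast dyadicCutoff_mul_sum_nbr hχφ m ξ
  have hΨS : ∀ ξ, Ψ ξ * S ξ = Ψ ξ := fun ξ => by
    by_cases hξ : Ψ ξ = 0
    · rw [hξ, zero_mul]
    · rw [hS]
      have := sum_range_dyadicCutoff hχφ (hN ξ hξ)
      rw [← Complex.ofReal_sum, this]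
      simp
  set gn : Eu d → ℂ := fun x => ∑ i ∈ nbr m, g i x with hgn
  set gS : Eu d → ℂ := fun x => ∑ i ∈ Finset.range (N + 1), g i x with hgS
  have hrn : IsRepresentedBy (TemperedDistribution.fourierMultiplierCLM ℂ σ f) gn := by
    rw [← sum_dyadicBlock_eq hχφ hσ]; exact h.rep_sum _
  have hrS : IsRepresentedBy (TemperedDistribution.fourierMultiplierCLM ℂ S f) gS := by
    rw [← sum_dyadicBlock_eq hχφ hS]; exact h.rep_sum _
  have htn := h.tempered_sum (nbr m)
  have htS := h.tempered_sum (Finset.range (N + 1))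
  -- the high frequency part
  have hhs : ContDiff ℝ ∞ fun ξ => (1 - Ψ ξ) * (dyadicCutoff χ φ m ξ : ℂ) :=
    (contDiff_const.sub hK.smooth).mul hφs
  have hhc : HasCompactSupport fun ξ => (1 - Ψ ξ) * (dyadicCutoff χ φ m ξ : ℂ) := hφc.mul_left
  have h1 : IsRepresentedBy (dyadicBlock χ φ m (TemperedDistribution.fourierMultiplierCLM ℂ b f))
      (conv (K fun ξ => (1 - Ψ ξ) * (dyadicCutoff χ φ m ξ : ℂ)) gn) := by
    have e1 : dyadicBlock χ φ m (TemperedDistribution.fourierMultiplierCLM ℂ b f) =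
        TemperedDistribution.fourierMultiplierCLM ℂ B
          (TemperedDistribution.fourierMultiplierCLM ℂ σ f) := by
      rw [dyadicBlock, TemperedDistribution.fourierMultiplierCLM_fourierMultiplierCLM_apply
        hK.temperate (hφc.hasTemperateGrowth hφs),
        TemperedDistribution.fourierMultiplierCLM_fourierMultiplierCLM_apply
        σ.hasTemperateGrowth B.hasTemperateGrowth]
      congr 2
      ext ξ
      simp only [Pi.mul_apply, hB']
      rw [mul_left_comm, mul_comm (σ ξ), hφσ]
    have e2 : (𝓕⁻ B : 𝓢(Eu d, ℂ)) = K fun ξ => (1 - Ψ ξ) * (dyadicCutoff χ φ m ξ : ℂ) := by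
      rw [hK.high _ hφs hφc, SchwartzMap.fourierInv_coe, hB]
    rw [e1, ← e2]
    exact hrn.fourierMultiplier htn B
  -- the low frequency part
  set ψ : Eu d → ℂ := fun ξ => Ψ ξ * (dyadicCutoff χ φ m ξ : ℂ) with hψd
  have hψs : ContDiff ℝ ∞ ψ := hK.smooth.mul hφs
  have hψc : HasCompactSupport ψ := hφc.mul_left
  have hpS := h.pair_sum hK (Finset.range (N + 1)) hψs hψc
  have hpn := h.pair_sum hK (nbr m) hψs hψc
  have hp0 := h.pair_sum hK (Finset.range (N + 1)) hK.smooth hK.compact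
  have habs : ∀ w : 𝓢(Eu d, ℂ), (∀ ξ, ψ ξ * w ξ = ψ ξ) →
      conv ⇑(𝓕⁻ w : 𝓢(Eu d, ℂ)) (K ψ) = K ψ := fun w hw => by
    rw [conv_comm, hK.conv_schwartz ψ hψs hψc]
    simp only [FourierTransform.fourier_fourierInv_eq, hw]
  have h2 : IsRepresentedBy (dyadicBlock χ φ m (convOp (K Ψ)
      (∑ i ∈ Finset.range (N + 1), dyadicBlock χ φ i f))) (conv (K ψ) gn) := by
    have e0 := (isRepresentedBy_convOp (h.rep_sum _) hp0).fourierMultiplier hp0.tempered κ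
    have e1 : conv ⇑(𝓕⁻ κ : 𝓢(Eu d, ℂ)) (K Ψ) = K ψ := by
      rw [conv_comm, hK.conv_schwartz Ψ hK.smooth hK.compact]
      simp only [FourierTransform.fourier_fourierInv_eq, hκ', hψd]
    rw [conv_schwartz_conv _ hp0, e1] at e0
    -- The multiplier `σ` is `1` on the support of `φ_m` and `S` is `1` on that of `Ψ`, so the
    -- kernel with symbol `ψ = Ψ φ_m` absorbs either. Filtering the low-frequency sum by `σ` and the
    -- neighbour sum by `S` gives two representatives of the same distribution `σS f`.
    have e2 : conv (K ψ) gS = conv (K ψ) gn := by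
      have a1 : conv (K ψ) gS = conv (K ψ) (conv ⇑(𝓕⁻ σ : 𝓢(Eu d, ℂ)) gS) := by
        rw [hpS.conv_conv, habs σ fun ξ => by simp only [hψd]; rw [mul_assoc, hφσ]]
      have a2 : conv (K ψ) gn = conv (K ψ) (conv ⇑(𝓕⁻ S : 𝓢(Eu d, ℂ)) gn) := by
        rw [hpn.conv_conv, habs S fun ξ => by simp only [hψd]; rw [mul_right_comm, hΨS]]
      rw [a1, a2]
      refine conv_congr_right _ ((hrS.fourierMultiplier htS σ).ae_eq ?_)
      have a3 := hrn.fourierMultiplier htn S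
      rw [TemperedDistribution.fourierMultiplierCLM_fourierMultiplierCLM_apply
        σ.hasTemperateGrowth S.hasTemperateGrowth, mul_comm] at a3
      rwa [TemperedDistribution.fourierMultiplierCLM_fourierMultiplierCLM_apply
        S.hasTemperateGrowth σ.hasTemperateGrowth]
    rw [← e2]
    have e3 : dyadicBlock χ φ m = TemperedDistribution.fourierMultiplierCLM ℂ κ := by
      ext1 u
      rw [dyadicBlock, hκ]
    rw [e3]
    exact e0
  have e4 : (K fun ξ => (dyadicCutoff χ φ m ξ : ℂ)) =
      fun x => K (fun ξ => (1 - Ψ ξ) * (dyadicCutoff χ φ m ξ : ℂ)) x + K ψ x := by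
    rw [← hK.map_add _ _ hhs hhc hψs hψc]
    congr 1
    ext ξ
    simp only [hψd]
    ring
  rw [e4, faddeevFun]
  have e5 := h1.add h2
  rw [dyadicBlock, dyadicBlock, ← map_add] at e5
  exact e5.congr ((h.pair_sum hK (nbr m) hhs hhc).conv_add_left hpn).symm

end faddeevFun

/-! ### Action on Schwartz functions -/

theorem isRepresentedBy_schwartz (g : 𝓢(Eu d, ℂ)) :
    IsRepresentedBy (SchwartzMap.toTemperedDistributionCLM (Eu d) ℂ volume g) g := by
  refine ⟨g.continuous.aestronglyMeasurable, fun θ => ⟨?_, ?_⟩⟩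
  · exact (TemperedFun.of_wNorm le_rfl (by simp) g.continuous.aestronglyMeasurable
      (schwartz_wNorm_lt_top g 1 0) (lam := 1)).integrable_mul θ
  · simp [SchwartzMap.toTemperedDistributionCLM_apply_apply]

theorem integral_mul_eq_fourier (h θ : 𝓢(Eu d, ℂ)) :
    ∫ x, θ x * h x = ∫ ξ, (𝓕 h) ξ * (𝓕⁻ θ) ξ := by
  have e : (h : Eu d → ℂ) = 𝓕⁻ (⇑(𝓕 h : 𝓢(Eu d, ℂ))) := by
    rw [← SchwartzMap.fourierInv_coe, FourierTransform.fourierInv_fourier_eq]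
  rw [SchwartzMap.fourierInv_coe, ← integral_fourierInv_mul_eq (𝓕 h).integrable θ.integrable, ← e]
  simp only [mul_comm]

/-- On Schwartz functions the two parts have the symbols `(1-Ψ)/m` and `Ψ/m`, which add up to `1/m`.
The blocks up to `N` may be summed first, since their cut-offs add up to `1` on the support of `Ψ`.
-/
theorem isMultiplierValue_faddeevFun (hd : 2 ≤ d) {χ φ : Eu d → ℝ} (hχφ : IsDyadicPair χ φ) {k : ℝ}
    (hk : 0 < k) (γ : Eu d) {τ : ℝ} (hτ : τ ≠ 0) (hτ1 : |τ| ≤ 1) {Ψ : Eu d → ℂ}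
    (hΨ : ContDiff ℝ ∞ Ψ) (hΨs : HasCompactSupport Ψ)
    (hΨ1 : ∀ ξ : Eu d, ‖ξ‖ ≤ 2 * faddeevRadius k γ → Ψ ξ = 1) {N : ℕ}
    (hN : ∀ ξ, Ψ ξ ≠ 0 → ‖ξ‖ < 3 / 4 * 2 ^ N) (g : 𝓢(Eu d, ℂ)) :
    IsMultiplierValue k γ τ g (faddeevFun χ φ (symbolKernel k γ τ) Ψ (highSymbol k γ τ Ψ) N
      (SchwartzMap.toTemperedDistributionCLM (Eu d) ℂ volume g)) := by
  have hK := kernelFamily_symbolKernel hd hk γ hτ hτ1 hΨ hΨs hΨ1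
  obtain ⟨S, hS⟩ := exists_schwartz_sum_dyadicCutoff hχφ (Finset.range (N + 1))
  have hΨS : ∀ ξ, Ψ ξ * S ξ = Ψ ξ := fun ξ => by
    by_cases hξ : Ψ ξ = 0
    · rw [hξ, zero_mul]
    · rw [hS]
      have := sum_range_dyadicCutoff hχφ (hN ξ hξ)
      rw [← Complex.ofReal_sum, this]
      simp
  obtain ⟨gS, hgS⟩ : ∃ gS, gS = SchwartzMap.fourierMultiplierCLM ℂ S g := ⟨_, rfl⟩
  obtain ⟨gb, hgb⟩ : ∃ gb, gb = SchwartzMap.fourierMultiplierCLM ℂ (highSymbol k γ τ Ψ) g :=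
    ⟨_, rfl⟩
  have hgSf : ∀ ξ, (𝓕 gS) ξ = S ξ * (𝓕 g) ξ := fun ξ => by
    rw [hgS, SchwartzMap.fourierMultiplierCLM_apply, FourierTransform.fourier_fourierInv_eq,
      SchwartzMap.smulLeftCLM_apply_apply S.hasTemperateGrowth, smul_eq_mul]
  have hgbf : ∀ ξ, (𝓕 gb) ξ = highSymbol k γ τ Ψ ξ * (𝓕 g) ξ := fun ξ => by
    rw [hgb, SchwartzMap.fourierMultiplierCLM_apply, FourierTransform.fourier_fourierInv_eq,
      SchwartzMap.smulLeftCLM_apply_apply hK.temperate, smul_eq_mul]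
  have hpair : ConvPair (symbolKernel k γ τ Ψ) gS :=
    convPair_of_wNorm (s := 2) (p := 2) (r := ⊤) (a := 1) (lam := 1)
      (hK.aestronglyMeasurable Ψ hΨ hΨs) gS.continuous.aestronglyMeasurable one_le_two one_le_two
      le_top (by simp [ENNReal.inv_two_add_inv_two]) zero_le_one (by simp)
      (hK.wNorm_lt_top Ψ hΨ hΨs 1 (by norm_num)) (schwartz_wNorm_lt_top _ _ _)
  have hconv : conv (symbolKernel k γ τ Ψ) gS = symbolKernel k γ τ (fun ξ => Ψ ξ * (𝓕 g) ξ) := by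
    rw [(conv_symbolKernel_eq hd hΨ hΨs hτ gS).2]
    simp only [hgSf, ← mul_assoc, hΨS]
  have hrep := isRepresentedBy_convOp (isRepresentedBy_schwartz gS) hpair
  rw [hconv] at hrep
  have hval : faddeevFun χ φ (symbolKernel k γ τ) Ψ (highSymbol k γ τ Ψ) N
      (SchwartzMap.toTemperedDistributionCLM (Eu d) ℂ volume g) =
      SchwartzMap.toTemperedDistributionCLM (Eu d) ℂ volume gb +
        convOp (symbolKernel k γ τ Ψ) (SchwartzMap.toTemperedDistributionCLM (Eu d) ℂ volume gS) := by
    rw [faddeevFun, sum_dyadicBlock_eq hχφ hS, hgb, hgS,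
      TemperedDistribution.fourierMultiplierCLM_toTemperedDistributionCLM_eq hK.temperate,
      TemperedDistribution.fourierMultiplierCLM_toTemperedDistributionCLM_eq S.hasTemperateGrowth]
  obtain ⟨hi3, -⟩ := conv_symbolKernel_eq hd hΨ hΨs (k := k) (γ := γ) hτ g
  intro θ
  have e1 : SchwartzMap.toTemperedDistributionCLM (Eu d) ℂ volume gb θ =
      ∫ ξ, (𝓕 gb) ξ * (𝓕⁻ θ) ξ := by
    rw [((isRepresentedBy_schwartz gb).2 θ).2, integral_mul_eq_fourier]
  have e2 : convOp (symbolKernel k γ τ Ψ) (SchwartzMap.toTemperedDistributionCLM (Eu d) ℂ volume gS)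
      θ = ∫ ξ, Ψ ξ * (𝓕 g) ξ / faddeevSymbol k γ τ ξ * (𝓕⁻ θ) ξ := by
    rw [(hrep.2 θ).2, SchwartzMap.fourierInv_coe, ← integral_fourierInv_mul_eq hi3 θ.integrable]
    simp only [symbolKernel, mul_comm]
  have i1 : Integrable fun ξ => (𝓕 gb) ξ * (𝓕⁻ θ) ξ :=
    (TemperedFun.of_wNorm le_rfl (by simp) (𝓕⁻ θ).continuous.aestronglyMeasurable
      (schwartz_wNorm_lt_top (𝓕⁻ θ) 1 0) (lam := 1)).integrable_mul (𝓕 gb)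
  have i2 : Integrable fun ξ => Ψ ξ * (𝓕 g) ξ / faddeevSymbol k γ τ ξ * (𝓕⁻ θ) ξ := by
    have h1 := integrable_div_symbol hd k (γ := γ) (τ := τ) (Or.inr hτ)
      ((hΨ.continuous.mul (𝓕 g).continuous).mul (𝓕⁻ θ).continuous) hΨs.mul_right.mul_right
    refine h1.congr (Eventually.of_forall fun ξ => ?_)
    simp only [Pi.mul_apply]
    ring
  have e3 : ∀ ξ, (𝓕 gb) ξ * (𝓕⁻ θ) ξ + Ψ ξ * (𝓕 g) ξ / faddeevSymbol k γ τ ξ * (𝓕⁻ θ) ξ =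
      (𝓕 g) ξ * (𝓕⁻ θ) ξ / faddeevSymbol k γ τ ξ := fun ξ => by
    rw [hgbf, highSymbol_eq (faddeevRadius_pos hk γ) hΨ1]
    ring
  refine ⟨(i1.add i2).congr (Eventually.of_forall e3), ?_⟩
  rw [hval]
  change SchwartzMap.toTemperedDistributionCLM (Eu d) ℂ volume gb θ + convOp (symbolKernel k γ τ Ψ)
    (SchwartzMap.toTemperedDistributionCLM (Eu d) ℂ volume gS) θ = _
  rw [e1, e2, ← integral_add i1 i2]
  simp only [e3]

/-! ### Besov norms -/

/-- The `ℓ^q` norm of a sequence. -/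
def seqNorm (q : ℝ≥0∞) (A : ℕ → ℝ≥0∞) : ℝ≥0∞ :=
  if q = ⊤ then ⨆ m, A m else (∑' m, A m ^ q.toReal) ^ (1 / q.toReal)

theorem seqNorm_eq_eLpNorm {q : ℝ≥0∞} (hq : q ≠ 0) (A : ℕ → ℝ≥0∞) :
    seqNorm q A = eLpNorm A q Measure.count := by
  unfold seqNorm
  split_ifs with h
  · subst h
    simp [eLpNormEssSup]
  · rw [eLpNorm_eq_lintegral_rpow_enorm_toReal hq h, lintegral_count]
    simp

theorem seqNorm_mono {q : ℝ≥0∞} {A B : ℕ → ℝ≥0∞} (h : ∀ m, A m ≤ B m) :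
    seqNorm q A ≤ seqNorm q B := by
  unfold seqNorm
  split_ifs
  · exact iSup_mono h
  · gcongr with m
    exact h m

theorem seqNorm_add_le {q : ℝ≥0∞} (hq : 1 ≤ q) (A B : ℕ → ℝ≥0∞) :
    seqNorm q (fun m => A m + B m) ≤ seqNorm q A + seqNorm q B := by
  have h0 : q ≠ 0 := (zero_lt_one.trans_le hq).ne'
  rw [seqNorm_eq_eLpNorm h0, seqNorm_eq_eLpNorm h0, seqNorm_eq_eLpNorm h0]
  exact eLpNorm_add_le (Measurable.of_discrete).aestronglyMeasurable
    (Measurable.of_discrete).aestronglyMeasurable hq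

theorem seqNorm_const_mul {q : ℝ≥0∞} (hq : 1 ≤ q) (c : ℝ≥0∞) (A : ℕ → ℝ≥0∞) :
    seqNorm q (fun m => c * A m) = c * seqNorm q A := by
  unfold seqNorm
  split_ifs with h
  · rw [ENNReal.mul_iSup]
  · have h0 : 0 < q.toReal := ENNReal.toReal_pos (zero_lt_one.trans_le hq).ne' h
    simp only [ENNReal.mul_rpow_of_nonneg _ _ h0.le]
    rw [ENNReal.tsum_mul_left, ENNReal.mul_rpow_of_nonneg _ _ (by positivity), ← ENNReal.rpow_mul,
      mul_one_div_cancel h0.ne', ENNReal.rpow_one]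

theorem le_seqNorm {q : ℝ≥0∞} (hq : 1 ≤ q) (A : ℕ → ℝ≥0∞) (m : ℕ) : A m ≤ seqNorm q A := by
  unfold seqNorm
  split_ifs with h
  · exact le_iSup A m
  · have h0 : 0 < q.toReal := ENNReal.toReal_pos (zero_lt_one.trans_le hq).ne' h
    calc A m = (A m ^ q.toReal) ^ (1 / q.toReal) := by
          rw [← ENNReal.rpow_mul, mul_one_div_cancel h0.ne', ENNReal.rpow_one]
      _ ≤ _ := by
          gcongr
          exact ENNReal.le_tsum m

theorem seqNorm_succ_le {q : ℝ≥0∞} (A : ℕ → ℝ≥0∞) : seqNorm q (fun m => A (m + 1)) ≤ seqNorm q A := by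
  unfold seqNorm
  split_ifs with h
  · exact iSup_le fun m => le_iSup A (m + 1)
  · refine ENNReal.rpow_le_rpow ?_ (by positivity)
    exact ENNReal.tsum_comp_le_tsum_of_injective (add_left_injective 1) fun m => A m ^ q.toReal

/-- Truncated subtraction repeats the term of index `0` once, which accounts for the factor `2`. -/
theorem seqNorm_pred_le {q : ℝ≥0∞} (hq : 1 ≤ q) (A : ℕ → ℝ≥0∞) :
    seqNorm q (fun m => A (m - 1)) ≤ 2 * seqNorm q A := by
  unfold seqNorm
  split_ifs with h
  · refine iSup_le fun m => (le_iSup A (m - 1)).trans ?_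
    exact le_mul_of_one_le_left' one_le_two
  · have h1 : 1 ≤ q.toReal := by
      rw [← ENNReal.toReal_one]; exact ENNReal.toReal_mono h hq
    have h0 : 0 < q.toReal := by linarith
    have h2 : ∑' m, A (m - 1) ^ q.toReal ≤ 2 * ∑' m, A m ^ q.toReal := by
      rw [tsum_eq_zero_add' ENNReal.summable, two_mul]
      simp only [Nat.zero_sub, Nat.add_sub_cancel]
      gcongr
      exact ENNReal.le_tsum (f := fun m => A m ^ q.toReal) 0
    calc _ ≤ (2 * ∑' m, A m ^ q.toReal) ^ (1 / q.toReal) := by gcongr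
      _ = 2 ^ (1 / q.toReal) * (∑' m, A m ^ q.toReal) ^ (1 / q.toReal) :=
        ENNReal.mul_rpow_of_nonneg _ _ (by positivity)
      _ ≤ 2 ^ (1 : ℝ) * (∑' m, A m ^ q.toReal) ^ (1 / q.toReal) := by
        gcongr
        · exact one_le_two
        · exact (div_le_one h0).2 h1
      _ = _ := by rw [ENNReal.rpow_one]

theorem sum_nbr_le (B : ℕ → ℝ≥0∞) (m : ℕ) :
    ∑ i ∈ nbr m, B i ≤ B (m - 1) + B m + B (m + 1) := by
  cases m with
  | zero =>
    have : nbr 0 = {0, 1} := by ext i; simp [nbr]; omega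
    rw [this]
    simp only [Finset.sum_pair zero_ne_one, Nat.zero_sub, zero_add]
    gcongr
    exact le_add_self
  | succ n =>
    have : nbr (n + 1) = {n, n + 1, n + 2} := by ext i; simp [nbr]; omega
    rw [this, Finset.sum_insert (by simp), Finset.sum_pair (by simp), ← add_assoc]
    rfl

theorem seqNorm_sum_nbr_le {q : ℝ≥0∞} (hq : 1 ≤ q) (B : ℕ → ℝ≥0∞) :
    seqNorm q (fun m => ∑ i ∈ nbr m, B i) ≤ 4 * seqNorm q B := by
  calc _ ≤ seqNorm q fun m => B (m - 1) + B m + B (m + 1) := seqNorm_mono (sum_nbr_le B)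
    _ ≤ seqNorm q (fun m => B (m - 1)) + seqNorm q B + seqNorm q (fun m => B (m + 1)) :=
      (seqNorm_add_le hq (fun m => B (m - 1) + B m) _).trans (by
        gcongr; exact seqNorm_add_le hq _ _)
    _ ≤ 2 * seqNorm q B + seqNorm q B + seqNorm q B := by
      gcongr
      · exact seqNorm_pred_le hq B
      · exact seqNorm_succ_le B
    _ = _ := by ring

section besov

variable {χ φ : Eu d → ℝ}

theorem besovNorm_eq_seqNorm (r : ℝ) (p q : ℝ≥0∞) (a lam : ℝ) (f : 𝓢'(Eu d, ℂ)) :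
    besovNorm χ φ r p q a lam f = seqNorm q fun m : ℕ => ENNReal.ofReal (2 ^ (((m : ℝ) - 1) * r)) *
      weightedLpNorm p (bracketWeight a lam) (dyadicBlock χ φ m f) := rfl

theorem weightedLpNorm_lt_top_of_besovNorm {r : ℝ} {p q : ℝ≥0∞} (hq : 1 ≤ q) {a lam : ℝ}
    {f : 𝓢'(Eu d, ℂ)} (h : besovNorm χ φ r p q a lam f < ⊤) (m : ℕ) :
    weightedLpNorm p (bracketWeight a lam) (dyadicBlock χ φ m f) < ⊤ := by
  rw [besovNorm_eq_seqNorm] at h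
  have h1 := (le_seqNorm hq _ m).trans_lt h
  refine lt_top_iff_ne_top.2 fun h2 => h1.ne ?_
  rw [h2]
  exact ENNReal.mul_top (by simp; positivity)

theorem weightedLpNorm_add_le {p : ℝ≥0∞} (hp : 1 ≤ p) (a lam : ℝ) (u v : 𝓢'(Eu d, ℂ)) :
    weightedLpNorm p (bracketWeight a lam) (u + v) ≤
      weightedLpNorm p (bracketWeight a lam) u + weightedLpNorm p (bracketWeight a lam) v := by
  rcases eq_or_ne (weightedLpNorm p (bracketWeight a lam) u) ⊤ with h | h
  · simp [h]
  rcases eq_or_ne (weightedLpNorm p (bracketWeight a lam) v) ⊤ with h' | h'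
  · simp [h']
  obtain ⟨g, hg, -⟩ := exists_isRepresentedBy_of_lt_top (lt_top_iff_ne_top.2 h)
  obtain ⟨g', hg', -⟩ := exists_isRepresentedBy_of_lt_top (lt_top_iff_ne_top.2 h')
  rw [hg.weightedLpNorm_eq, hg'.weightedLpNorm_eq, (hg.add hg').weightedLpNorm_eq]
  exact wNorm_add_le hp a lam hg.1 hg'.1

theorem weightedLpNorm_smul_le (p : ℝ≥0∞) (a lam : ℝ) (c : ℂ) {u : 𝓢'(Eu d, ℂ)}
    (h : weightedLpNorm p (bracketWeight a lam) u < ⊤) :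
    weightedLpNorm p (bracketWeight a lam) (c • u) ≤
      ‖c‖ₑ * weightedLpNorm p (bracketWeight a lam) u := by
  obtain ⟨g, hg, -⟩ := exists_isRepresentedBy_of_lt_top h
  rw [hg.weightedLpNorm_eq, (hg.smul c).weightedLpNorm_eq, wNorm_const_mul]

theorem besovNorm_add_le (r : ℝ) {p q : ℝ≥0∞} (hp : 1 ≤ p) (hq : 1 ≤ q) (a lam : ℝ)
    (f g : 𝓢'(Eu d, ℂ)) : besovNorm χ φ r p q a lam (f + g) ≤
      besovNorm χ φ r p q a lam f + besovNorm χ φ r p q a lam g := by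
  simp only [besovNorm_eq_seqNorm]
  refine (seqNorm_mono fun m => ?_).trans (seqNorm_add_le hq _ _)
  rw [← mul_add]
  gcongr
  simp only [dyadicBlock, map_add]
  exact weightedLpNorm_add_le hp a lam _ _

theorem besovNorm_smul_lt_top {r : ℝ} {p q : ℝ≥0∞} (hq : 1 ≤ q) {a lam : ℝ} (c : ℂ)
    {f : 𝓢'(Eu d, ℂ)} (h : besovNorm χ φ r p q a lam f < ⊤) :
    besovNorm χ φ r p q a lam (c • f) < ⊤ := by
  have h1 : besovNorm χ φ r p q a lam (c • f) ≤ ‖c‖ₑ * besovNorm χ φ r p q a lam f := by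
    simp only [besovNorm_eq_seqNorm]
    rw [← seqNorm_const_mul hq]
    refine seqNorm_mono fun m => ?_
    rw [mul_left_comm]
    gcongr
    have := weightedLpNorm_smul_le p a lam c (weightedLpNorm_lt_top_of_besovNorm hq h m)
    simpa [dyadicBlock] using this
  exact h1.trans_lt (ENNReal.mul_lt_top enorm_lt_top h)

theorem besovNorm_zero_lt_top {r : ℝ} {p q : ℝ≥0∞} (hq : 1 ≤ q) {a lam : ℝ} :
    besovNorm χ φ r p q a lam (0 : 𝓢'(Eu d, ℂ)) < ⊤ := by
  have h : ∀ m, weightedLpNorm p (bracketWeight a lam) (dyadicBlock χ φ m (0 : 𝓢'(Eu d, ℂ))) = 0 :=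
    fun m => by
      have e : dyadicBlock χ φ m (0 : 𝓢'(Eu d, ℂ)) = 0 := by simp [dyadicBlock]
      rw [e, isRepresentedBy_zero.weightedLpNorm_eq]
      simp [wNorm]
  rw [besovNorm_eq_seqNorm]
  simp only [h, mul_zero]
  have := seqNorm_const_mul hq 0 (fun _ => 0)
  simp only [zero_mul] at this
  rw [this]
  exact ENNReal.zero_lt_top

theorem weightedLpNorm_mono_exp {p : ℝ≥0∞} {a b : ℝ} (hab : a ≤ b) (lam : ℝ) (u : 𝓢'(Eu d, ℂ)) :
    weightedLpNorm p (bracketWeight a lam) u ≤ weightedLpNorm p (bracketWeight b lam) u := by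
  rcases eq_or_ne (weightedLpNorm p (bracketWeight b lam) u) ⊤ with h | h
  · rw [h]; exact le_top
  obtain ⟨g, hg, -⟩ := exists_isRepresentedBy_of_lt_top (lt_top_iff_ne_top.2 h)
  rw [hg.weightedLpNorm_eq, hg.weightedLpNorm_eq]
  exact wNorm_mono_exp hab lam g

theorem besovNorm_mono_lt_top {r r' : ℝ} (hr : r' ≤ r) {p q : ℝ≥0∞} (hq : 1 ≤ q) {a a' : ℝ}
    (ha : a' ≤ a) {lam : ℝ} {f : 𝓢'(Eu d, ℂ)} (h : besovNorm χ φ r p q a lam f < ⊤) :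
    besovNorm χ φ r' p q a' lam f < ⊤ := by
  have h1 : besovNorm χ φ r' p q a' lam f ≤
      ENNReal.ofReal (2 ^ (r - r')) * besovNorm χ φ r p q a lam f := by
    simp only [besovNorm_eq_seqNorm]
    rw [← seqNorm_const_mul hq]
    refine seqNorm_mono fun m => ?_
    rw [← mul_assoc, ← ENNReal.ofReal_mul (by positivity), ← Real.rpow_add two_pos]
    gcongr
    · exact one_le_two
    · have : (0 : ℝ) ≤ m := m.cast_nonneg
      nlinarith
    · exact weightedLpNorm_mono_exp ha lam _
  exact h1.trans_lt (ENNReal.mul_lt_top ENNReal.ofReal_lt_top h)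

/-- Bounds for the individual blocks give bounds for Besov norms. -/
theorem besovNorm_le_of_blocks (r s : ℝ) {p₁ p₂ q : ℝ≥0∞} (hq : 1 ≤ q) {a₁ a₂ lam : ℝ}
    {u f : 𝓢'(Eu d, ℂ)} (c : ℝ≥0∞)
    (h : ∀ m : ℕ, weightedLpNorm p₁ (bracketWeight a₁ lam) (dyadicBlock χ φ m u) ≤
      c * ENNReal.ofReal (2 ^ (-(((m : ℝ) - 1) * s))) *
        ∑ i ∈ nbr m, weightedLpNorm p₂ (bracketWeight a₂ lam) (dyadicBlock χ φ i f)) :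
    besovNorm χ φ r p₁ q a₁ lam u ≤
      c * ENNReal.ofReal (2 ^ |r - s|) * 4 * besovNorm χ φ (r - s) p₂ q a₂ lam f := by
  simp only [besovNorm_eq_seqNorm]
  rw [mul_assoc _ (4 : ℝ≥0∞)]
  refine le_trans ?_ (mul_le_mul_right (seqNorm_sum_nbr_le hq _) _)
  rw [← seqNorm_const_mul hq]
  refine seqNorm_mono fun m => ?_
  refine (mul_le_mul_right (h m) _).trans ?_
  rw [Finset.mul_sum, Finset.mul_sum, Finset.mul_sum]
  refine Finset.sum_le_sum fun i hi => ?_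
  -- Moving the dyadic weight from `m` to an index at distance at most one costs at most
  -- `2^{|r-s|}`.
  have h1 : ENNReal.ofReal (2 ^ (((m : ℝ) - 1) * r)) * ENNReal.ofReal (2 ^ (-(((m : ℝ) - 1) * s))) ≤
      ENNReal.ofReal (2 ^ |r - s|) * ENNReal.ofReal (2 ^ (((i : ℝ) - 1) * (r - s))) := by
    rw [← ENNReal.ofReal_mul (by positivity), ← ENNReal.ofReal_mul (by positivity),
      ← Real.rpow_add two_pos, ← Real.rpow_add two_pos]
    refine ENNReal.ofReal_le_ofReal (Real.rpow_le_rpow_of_exponent_le one_le_two ?_)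
    have h2 : |(m : ℝ) - i| ≤ 1 := by
      simp only [nbr, Finset.mem_Icc] at hi
      have h3 : (m : ℝ) ≤ i + 1 := by exact_mod_cast (by omega : m ≤ i + 1)
      have h4 : (i : ℝ) ≤ m + 1 := by exact_mod_cast hi.2
      rw [abs_le]
      constructor <;> linarith
    have h3 : ((m : ℝ) - i) * (r - s) ≤ |r - s| := by
      refine (le_abs_self _).trans ?_
      rw [abs_mul]
      exact mul_le_of_le_one_left (abs_nonneg _) h2
    linarith
  calc _ = c * (ENNReal.ofReal (2 ^ (((m : ℝ) - 1) * r)) *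
        ENNReal.ofReal (2 ^ (-(((m : ℝ) - 1) * s)))) *
        weightedLpNorm p₂ (bracketWeight a₂ lam) (dyadicBlock χ φ i f) := by ring
    _ ≤ c * (ENNReal.ofReal (2 ^ |r - s|) * ENNReal.ofReal (2 ^ (((i : ℝ) - 1) * (r - s)))) *
        weightedLpNorm p₂ (bracketWeight a₂ lam) (dyadicBlock χ φ i f) := by gcongr
    _ = _ := by ring

/-- The weighted Besov space, as a submodule of the tempered distributions. -/
def besovSpace (χ φ : Eu d → ℝ) (r : ℝ) (p q : ℝ≥0∞) (hp : 1 ≤ p) (hq : 1 ≤ q) (a lam : ℝ) :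
    Submodule ℂ 𝓢'(Eu d, ℂ) where
  carrier := {f | besovNorm χ φ r p q a lam f < ⊤}
  add_mem' hf hg := (besovNorm_add_le r hp hq a lam _ _).trans_lt (ENNReal.add_lt_top.2 ⟨hf, hg⟩)
  zero_mem' := besovNorm_zero_lt_top hq
  smul_mem' c _ hf := besovNorm_smul_lt_top hq c hf

/-- The union of the weighted Sobolev spaces with weights `⟨x⟩^a`, `a > 1 / 2`. -/
def sobolevUnion (χ φ : Eu d → ℝ) : Submodule ℂ 𝓢'(Eu d, ℂ) where
  carrier := {f | ∃ ρ a : ℝ, 1 / 2 < a ∧ sobolevNorm χ φ ρ a f < ⊤}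
  add_mem' := by
    rintro f g ⟨ρ, a, ha, hf⟩ ⟨ρ', a', ha', hg⟩
    refine ⟨min ρ ρ', min a a', lt_min ha ha', ?_⟩
    exact (besovNorm_add_le _ one_le_two one_le_two _ _ _ _).trans_lt (ENNReal.add_lt_top.2
      ⟨besovNorm_mono_lt_top (min_le_left _ _) one_le_two (min_le_left _ _) hf,
        besovNorm_mono_lt_top (min_le_right _ _) one_le_two (min_le_right _ _) hg⟩)
  zero_mem' := ⟨0, 1, by norm_num, besovNorm_zero_lt_top one_le_two⟩
  smul_mem' := by
    rintro c f ⟨ρ, a, ha, hf⟩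
    exact ⟨ρ, a, ha, besovNorm_smul_lt_top one_le_two c hf⟩

end besov

/-- The partial linear map with domain `D` given by a function that is linear on `D`. -/
def linearOn (D : Submodule ℂ 𝓢'(Eu d, ℂ)) (F : 𝓢'(Eu d, ℂ) → 𝓢'(Eu d, ℂ))
    (hadd : ∀ f ∈ D, ∀ g ∈ D, F (f + g) = F f + F g) (hsmul : ∀ (c : ℂ), ∀ f ∈ D, F (c • f) = c • F f) :
    𝓢'(Eu d, ℂ) →ₗ.[ℂ] 𝓢'(Eu d, ℂ) where
  domain := D
  toFun :=
    { toFun := fun f => F f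
      map_add' := fun f g => hadd f f.2 g g.2
      map_smul' := fun c f => hsmul c f f.2 }

/-! ### Kernels localized away from the singularities of the symbol -/

theorem bracketWeight_smul {c : ℝ} (hc : 0 < c) (a lam : ℝ) (x : Eu d) :
    bracketWeight a lam x = bracketWeight a (lam / c) (c • x) := by
  rw [bracketWeight, bracketWeight, smul_smul, div_mul_cancel₀ _ hc.ne']

theorem wNorm_comp_smul (G : Eu d → ℂ) {c : ℝ} (hc : 0 < c)
    {s : ℝ≥0∞} (hs : s ≠ ⊤) (b lam : ℝ) : wNorm s b lam (fun x => G (c • x)) =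
      ENNReal.ofReal (c ^ (-(d / s.toReal : ℝ))) * wNorm s b (lam / c) G := by
  have e : (fun x : Eu d => (bracketWeight b lam x : ℂ) * G (c • x)) =
      (fun z => (bracketWeight b (lam / c) z : ℂ) * G z) ∘ fun x => c • x := by
    ext x
    simp only [Function.comp_apply]
    rw [bracketWeight_smul hc]
  have hme : MeasurableEmbedding (fun x : Eu d => c • x) :=
    (Homeomorph.smulOfNeZero c hc.ne').measurableEmbedding
  rw [wNorm, e, ← hme.eLpNorm_map_measure, Measure.map_addHaar_smul _ hc.ne',
    eLpNorm_smul_measure_of_ne_top hs, smul_eq_mul, wNorm, finrank_euclideanSpace_fin]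
  congr 1
  rw [ENNReal.ofReal_rpow_of_pos (by positivity), abs_of_pos (by positivity), ← Real.rpow_natCast,
    ← Real.rpow_neg hc.le, ← Real.rpow_mul hc.le]
  congr 2
  simp [div_eq_mul_inv]

theorem re_quadSymbol (A B : ℝ) (v : Eu d) (σ : ℝ) (ζ : Eu d) :
    |A * ‖ζ‖ ^ 2 - B| ≤ ‖quadSymbol A B v σ ζ‖ := by
  refine le_trans (le_of_eq ?_) (Complex.abs_re_le_norm _)
  simp [quadSymbol, -Complex.ofReal_pow]

theorem continuous_quadSymbol (A B : ℝ) (v : Eu d) (σ : ℝ) : Continuous (quadSymbol A B v σ) := by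
  unfold quadSymbol; fun_prop

/-- Uniform decay for kernels with quadratic denominators bounded below on the support. -/
theorem exists_norm_fourierInv_div_quadSymbol_le {ϕ : Eu d → ℂ} (hϕ : ContDiff ℝ ∞ ϕ)
    (hs : HasCompactSupport ϕ) (M : ℝ) :
    ∃ C : ℝ, 0 ≤ C ∧ ∀ (A B : ℝ) (v : Eu d) (σ : ℝ), |A| ≤ 1 → |B| ≤ 1 → ‖v‖ ≤ 1 →
      |σ| ≤ 1 → (∀ ζ, ϕ ζ ≠ 0 → 1 / 2 ≤ |A * ‖ζ‖ ^ 2 - B|) → ∀ z,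
      ‖𝓕⁻ (fun ζ => ϕ ζ / quadSymbol A B v σ ζ) z‖ ≤ C * bracketWeight (-M) 1 z ∧
      ‖𝓕⁻ (fun ζ => ϕ ζ / quadSymbol A B v σ ζ) z - 𝓕⁻ (fun ζ => ϕ ζ / quadSymbol A B v 0 ζ) z‖ ≤
        |σ| * (C * bracketWeight (-M) 1 z) := by
  have hF1 : ContDiff ℝ ∞ fun w : ℂ × ℂ => invReg (1 / 2) w.1 :=
    (contDiff_invReg _).comp contDiff_fst
  have hF2 : ContDiff ℝ ∞ fun w : ℂ × ℂ => invReg (1 / 2) w.1 * invReg (1 / 2) w.2 :=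
    hF1.mul ((contDiff_invReg _).comp contDiff_snd)
  obtain ⟨C₁, hC₁, h₁⟩ := exists_norm_fourierInv_quadSymbol_le hϕ hs
    (F := fun w _ => invReg (1 / 2) w) hF1 1 M
  obtain ⟨C₂, hC₂, h₂⟩ := exists_norm_fourierInv_quadSymbol_le hϕ hs
    (F := fun w w' => invReg (1 / 2) w * invReg (1 / 2) w') hF2 1 M
  refine ⟨C₁ + C₂, by positivity, fun A B v σ hA hB hv hσ hlow z => ?_⟩
  have hm : ∀ σ ζ, ϕ ζ ≠ 0 → 1 / 2 ≤ ‖quadSymbol A B v σ ζ‖ := fun σ ζ hζ =>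
    (hlow ζ hζ).trans (re_quadSymbol A B v σ ζ)
  have e : ∀ σ, (fun ζ => ϕ ζ / quadSymbol A B v σ ζ) =
      fun ζ => ϕ ζ * invReg (1 / 2) (quadSymbol A B v σ ζ) := fun σ => by
    ext ζ
    by_cases hζ : ϕ ζ = 0
    · simp [hζ]
    · rw [invReg_eq (by norm_num) (hm σ ζ hζ), div_eq_mul_inv]
  have hw := (bracketWeight_pos (-M) 1 z).le
  have hint : ∀ σ, Integrable fun ζ => ϕ ζ / quadSymbol A B v σ ζ := fun σ => by
    rw [e]
    exact (hϕ.continuous.mul ((contDiff_invReg _).continuous.comp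
      (continuous_quadSymbol A B v σ))).integrable_of_hasCompactSupport hs.mul_right
  refine ⟨?_, ?_⟩
  · rw [e]
    refine (h₁ A B v σ 0 hA hB hv hσ (by simp) z).trans ?_
    gcongr
    linarith
  · have e2 : 𝓕⁻ (fun ζ => ϕ ζ / quadSymbol A B v σ ζ) z - 𝓕⁻ (fun ζ => ϕ ζ / quadSymbol A B v 0 ζ) z =
        (Complex.I * σ) * 𝓕⁻ (fun ζ => ϕ ζ * (invReg (1 / 2) (quadSymbol A B v σ ζ) *
          invReg (1 / 2) (quadSymbol A B v 0 ζ))) z := by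
      simp only [Real.fourierInv_eq]
      rw [← integral_sub (by simpa using (Real.fourierIntegral_convergent_iff (-z)).2 (hint σ))
        (by simpa using (Real.fourierIntegral_convergent_iff (-z)).2 (hint 0)), ← smul_eq_mul,
        ← integral_smul]
      refine integral_congr_ae (Eventually.of_forall fun ζ => ?_)
      simp only [← smul_sub, smul_comm (Complex.I * (σ : ℂ))]
      congr 1
      by_cases hζ : ϕ ζ = 0
      · simp [hζ]
      · have h1 := hm σ ζ hζ
        have h0 := hm 0 ζ hζ
        have h1' : quadSymbol A B v σ ζ ≠ 0 := norm_pos_iff.1 (by linarith)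
        have h0' : quadSymbol A B v 0 ζ ≠ 0 := norm_pos_iff.1 (by linarith)
        rw [invReg_eq (by norm_num) h1, invReg_eq (by norm_num) h0]
        have h3 : quadSymbol A B v 0 ζ - quadSymbol A B v σ ζ = Complex.I * σ := by
          simp only [quadSymbol]; push_cast; ring
        rw [smul_eq_mul, ← h3]
        field_simp
    rw [e2, norm_mul, norm_mul, Complex.norm_I, one_mul, Complex.norm_real, Real.norm_eq_abs]
    gcongr
    refine (h₂ A B v σ 0 hA hB hv hσ (by simp) z).trans ?_
    gcongr
    linarith

theorem symbolKernel_eq_quadSymbol (k : ℝ) (γ : Eu d) (τ : ℝ) (ϕ : Eu d → ℂ) :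
    symbolKernel k γ τ ϕ =
      𝓕⁻ (fun ζ => ϕ ζ / quadSymbol 1 (faddeevRadius k γ ^ 2) γ τ ζ) := by
  rw [symbolKernel]
  congr 1
  ext ζ
  rw [faddeevRadius_sq, faddeevSymbol, quadSymbol]
  push_cast
  ring_nf

theorem norm_le_faddeevRadius (k : ℝ) (γ : Eu d) : ‖γ‖ ≤ faddeevRadius k γ :=
  Real.le_sqrt_of_sq_le (by nlinarith [sq_nonneg k])

theorem faddeevRadius_nonneg (k : ℝ) (γ : Eu d) : 0 ≤ faddeevRadius k γ := Real.sqrt_nonneg _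

/-- Decay of kernels localized to frequencies much larger than `r_{k,γ}`. -/
theorem exists_norm_symbolKernel_near_le {ϕ : Eu d → ℂ} (hϕ : ContDiff ℝ ∞ ϕ)
    (hs : HasCompactSupport ϕ) (hlow : ∀ ζ, ϕ ζ ≠ 0 → 3 / 4 ≤ ‖ζ‖) (M : ℝ) :
    ∃ C : ℝ, 0 ≤ C ∧ ∀ (k : ℝ) (γ : Eu d) (τ : ℝ), faddeevRadius k γ ≤ 3 / 16 → |τ| ≤ 1 → ∀ z,
      ‖symbolKernel k γ τ ϕ z‖ ≤ C * bracketWeight (-M) 1 z ∧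
      ‖symbolKernel k γ τ ϕ z - symbolKernel k γ 0 ϕ z‖ ≤ |τ| * (C * bracketWeight (-M) 1 z) := by
  obtain ⟨C, hC, h⟩ := exists_norm_fourierInv_div_quadSymbol_le hϕ hs M
  refine ⟨C, hC, fun k γ τ hR hτ z => ?_⟩
  have h0 := faddeevRadius_nonneg k γ
  rw [symbolKernel_eq_quadSymbol, symbolKernel_eq_quadSymbol]
  refine h 1 _ γ τ (by simp) ?_ ((norm_le_faddeevRadius k γ).trans (by linarith)) hτ
    (fun ζ hζ => ?_) z
  · rw [abs_of_nonneg (by positivity)]; nlinarith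
  -- Here `(3/4)² - (3/16)² = 135/256`, which exceeds `1/2`.
  · refine le_trans ?_ (le_abs_self _)
    have := hlow ζ hζ
    nlinarith

/-- Dividing the symbol by `ρ²` makes its constant term `1`; for large `ρ ≥ ‖γ‖` the remaining
coefficients are then bounded. -/
theorem fourierInv_div_quadSymbol_rescale {ρ : ℝ} (hρ0 : 0 < ρ) (ϕ : Eu d → ℂ) (γ z : Eu d) :
    𝓕⁻ (fun ζ => ϕ ζ / quadSymbol 1 (ρ ^ 2) γ 0 ζ) z = ((ρ⁻¹ ^ 2 : ℝ) : ℂ) *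
      𝓕⁻ (fun ζ => ϕ ζ / quadSymbol (ρ⁻¹ ^ 2) 1 (ρ⁻¹ ^ 2 • γ) 0 ζ) z := by
  rw [Real.fourierInv_eq, Real.fourierInv_eq, ← smul_eq_mul,
    ← integral_smul]
  refine integral_congr_ae (Eventually.of_forall fun ζ => ?_)
  simp only [smul_comm ((ρ⁻¹ ^ 2 : ℝ) : ℂ)]
  congr 1
  have hρc : (ρ : ℂ) ≠ 0 := by exact_mod_cast hρ0.ne'
  have e1 : quadSymbol (ρ⁻¹ ^ 2) 1 (ρ⁻¹ ^ 2 • γ) 0 ζ =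
      ((ρ⁻¹ ^ 2 : ℝ) : ℂ) * quadSymbol 1 (ρ ^ 2) γ 0 ζ := by
    simp only [quadSymbol, inner_smul_left, RCLike.conj_to_real]
    push_cast
    field_simp
    ring
  have hc0 : ((ρ⁻¹ ^ 2 : ℝ) : ℂ) ≠ 0 := by exact_mod_cast (by positivity : ρ⁻¹ ^ 2 ≠ 0)
  rw [e1, smul_eq_mul, mul_div_assoc', mul_div_mul_left _ _ hc0]

/-- Decay of kernels localized to frequencies much smaller than `r_{k,γ}`. -/
theorem exists_norm_symbolKernel_far_le {ϕ : Eu d → ℂ} (hϕ : ContDiff ℝ ∞ ϕ)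
    (hs : HasCompactSupport ϕ) (hup : ∀ ζ, ϕ ζ ≠ 0 → ‖ζ‖ ≤ 8 / 3) (M : ℝ) :
    ∃ C : ℝ, 0 ≤ C ∧ ∀ (k : ℝ) (γ : Eu d), 6 ≤ faddeevRadius k γ → ∀ z,
      ‖symbolKernel k γ 0 ϕ z‖ ≤ faddeevRadius k γ ^ (-2 : ℝ) * (C * bracketWeight (-M) 1 z) := by
  obtain ⟨C, hC, h⟩ := exists_norm_fourierInv_div_quadSymbol_le hϕ hs M
  refine ⟨C, hC, fun k γ hR z => ?_⟩
  obtain ⟨ρ, hρ⟩ : ∃ ρ, ρ = faddeevRadius k γ := ⟨_, rfl⟩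
  rw [← hρ] at hR ⊢
  have hγ := norm_le_faddeevRadius k γ
  rw [← hρ] at hγ
  have hρ0 : 0 < ρ := by linarith
  have hi : ρ⁻¹ ≤ 1 / 6 := by rw [one_div]; exact inv_anti₀ (by norm_num) hR
  have hi0 : 0 < ρ⁻¹ := inv_pos.2 hρ0
  have hi2 : ρ⁻¹ ^ 2 ≤ 1 / 36 := by nlinarith
  have e := fourierInv_div_quadSymbol_rescale hρ0 ϕ γ z
  rw [symbolKernel_eq_quadSymbol, ← hρ]
  have e2 : ρ ^ (-2 : ℝ) = ρ⁻¹ ^ 2 := by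
    rw [Real.rpow_neg hρ0.le, inv_pow]
    norm_cast
  rw [e, norm_mul, Complex.norm_real, Real.norm_of_nonneg (sq_nonneg _), e2]
  refine mul_le_mul_of_nonneg_left ?_ (sq_nonneg _)
  refine (h (ρ⁻¹ ^ 2) 1 (ρ⁻¹ ^ 2 • γ) 0 ?_ (by simp) ?_ (by simp) (fun ζ hζ => ?_) z).1
  · rw [abs_of_nonneg (sq_nonneg _)]
    linarith
  · rw [norm_smul, Real.norm_of_nonneg (sq_nonneg _)]
    calc ρ⁻¹ ^ 2 * ‖γ‖ ≤ ρ⁻¹ ^ 2 * ρ := by gcongr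
      _ = ρ⁻¹ := by field_simp
      _ ≤ 1 := by linarith
  · rw [abs_sub_comm]
    refine le_trans ?_ (le_abs_self _)
    have h1 := hup ζ hζ
    have h2 : ρ⁻¹ ^ 2 * ‖ζ‖ ^ 2 ≤ 1 / 36 * (8 / 3) ^ 2 := by gcongr
    linarith

theorem dyadicCutoff_succ_smul (χ φ : Eu d → ℝ) (n : ℕ) (ζ : Eu d) :
    dyadicCutoff χ φ (n + 1) ((2 : ℝ) ^ n • ζ) = φ ζ := by
  simp only [dyadicCutoff]
  rw [smul_smul, Real.rpow_neg two_pos.le, Real.rpow_natCast,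
    inv_mul_cancel₀ (by positivity), one_smul]

theorem symbolKernel_dyadicCutoff_succ (χ φ : Eu d → ℝ) (k : ℝ) (γ : Eu d) (τ : ℝ) (n : ℕ)
    (x : Eu d) : symbolKernel k γ τ (fun ξ => (dyadicCutoff χ φ (n + 1) ξ : ℂ)) x =
      (((2 : ℝ) ^ n) ^ ((d : ℝ) - 2) : ℝ) * symbolKernel (k / 2 ^ n) (((2 : ℝ) ^ n)⁻¹ • γ)
        (τ / ((2 : ℝ) ^ n) ^ 2) (fun ζ => (φ ζ : ℂ)) ((2 : ℝ) ^ n • x) := by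
  rw [symbolKernel_smul (c := 2 ^ n) (by positivity)]
  simp only [dyadicCutoff_succ_smul]
  congr 1
  rw [Real.rpow_sub (by positivity), Real.rpow_natCast]
  norm_cast

/-- Dilation by `2^n` leads to frequencies of size one, where the decay is uniform. The kernel
scales with the factor `2^{n(d-2)}` and its `L¹` norm with `2^{-nd}`, leaving `2^{-2n}`. The dilated
weight `⟨2^{-n}x⟩^a` is at most `⟨x⟩^a`, and the rescaled `τ` is smaller than `τ`. -/
theorem exists_wNorm_near_le {χ φ : Eu d → ℝ} (h : IsDyadicPair χ φ) {a : ℝ} (ha : 0 ≤ a) :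
    ∃ C : ℝ≥0∞, C < ⊤ ∧ ∀ (n : ℕ) (k : ℝ) (γ : Eu d) (τ : ℝ),
      faddeevRadius k γ ≤ 3 / 16 * 2 ^ n → |τ| ≤ 1 →
      wNorm 1 a 1 (symbolKernel k γ τ (fun ξ => (dyadicCutoff χ φ (n + 1) ξ : ℂ))) ≤
        C * ENNReal.ofReal (2 ^ (-((n : ℝ) * 2))) ∧
      wNorm 1 a 1 (fun x => symbolKernel k γ τ (fun ξ => (dyadicCutoff χ φ (n + 1) ξ : ℂ)) x -
        symbolKernel k γ 0 (fun ξ => (dyadicCutoff χ φ (n + 1) ξ : ℂ)) x) ≤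
        ENNReal.ofReal |τ| * C * ENNReal.ofReal (2 ^ (-((n : ℝ) * 2))) := by
  have hφs := contDiff_dyadicCutoff_ofReal h 1
  have hφc := hasCompactSupport_dyadicCutoff_ofReal h 1
  have h1 : ∀ ζ, dyadicCutoff χ φ 1 ζ = φ ζ := fun ζ => by simp [dyadicCutoff]
  simp only [h1] at hφs hφc
  obtain ⟨C, hC, hb⟩ := exists_norm_symbolKernel_near_le hφs hφc (fun ζ hζ => by
    have := le_norm_of_dyadicCutoff_ne_zero h (n := 0) (ξ := ζ)
      (by rw [zero_add, h1]; exact_mod_cast hζ)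
    simpa using this) (a + d + 1)
  set W := wNorm 1 a 1 (fun z : Eu d => (bracketWeight (-(a + d + 1)) 1 z : ℂ)) with hW
  have hWt : W < ⊤ := wNorm_bracketWeight_lt_top one_ne_zero
    (by have : (0 : ℝ) ≤ d := d.cast_nonneg
        linarith) (fun _ => by rw [ENNReal.toReal_one, mul_one]; linarith)
  refine ⟨ENNReal.ofReal C * W, ENNReal.mul_lt_top ENNReal.ofReal_lt_top hWt,
    fun n k γ τ hR hτ => ?_⟩
  have hc : (0 : ℝ) < 2 ^ n := by positivity
  have hc1 : (1 : ℝ) ≤ 2 ^ n := one_le_pow₀ one_le_two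
  have hR' : faddeevRadius (k / 2 ^ n) (((2 : ℝ) ^ n)⁻¹ • γ) ≤ 3 / 16 := by
    rw [faddeevRadius_smul hc, div_le_iff₀ hc]; exact hR
  have hτ2 : |τ / ((2 : ℝ) ^ n) ^ 2| ≤ |τ| := by
    rw [abs_div, abs_of_pos (by positivity : (0 : ℝ) < (2 ^ n) ^ 2)]
    exact div_le_self (abs_nonneg _) (one_le_pow₀ hc1)
  have hb' := hb _ _ _ hR' (hτ2.trans hτ)
  -- a bound for dilated functions dominated by the weight
  have key : ∀ (c₀ : ℝ) (F : Eu d → ℂ), 0 ≤ c₀ → (∀ x, ‖F x‖ ≤ ((2 : ℝ) ^ n) ^ ((d : ℝ) - 2) *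
      (c₀ * (C * bracketWeight (-(a + d + 1)) 1 ((2 : ℝ) ^ n • x)))) →
      wNorm 1 a 1 F ≤ ENNReal.ofReal c₀ * (ENNReal.ofReal C * W) *
        ENNReal.ofReal (2 ^ (-((n : ℝ) * 2))) := by
    intro c₀ F hc₀ hF
    set B : Eu d → ℂ := fun z => (bracketWeight (-(a + d + 1)) 1 z : ℂ) with hB
    set D : ℝ := ((2 : ℝ) ^ n) ^ ((d : ℝ) - 2) * (c₀ * C) with hD
    have hD0 : 0 ≤ D := by positivity
    calc wNorm 1 a 1 F ≤ wNorm 1 a 1 (fun x => (D : ℂ) * B ((2 : ℝ) ^ n • x)) := by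
          refine wNorm_mono_norm fun x => ?_
          have h2 := bracketWeight_pos a 1 x
          gcongr
          refine (hF x).trans (le_of_eq ?_)
          rw [norm_mul, Complex.norm_real, Complex.norm_real, Real.norm_of_nonneg hD0,
            Real.norm_of_nonneg (bracketWeight_pos _ _ _).le, hD]
          ring
      _ = ENNReal.ofReal D * (ENNReal.ofReal (((2 : ℝ) ^ n) ^ (-(d : ℝ))) *
            wNorm 1 a (1 / 2 ^ n) B) := by
          rw [wNorm_const_mul, wNorm_comp_smul B hc ENNReal.one_ne_top, ← ofReal_norm,
            Complex.norm_real, Real.norm_of_nonneg hD0]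
          simp
      _ ≤ ENNReal.ofReal D * (ENNReal.ofReal (((2 : ℝ) ^ n) ^ (-(d : ℝ))) * W) := by
          gcongr
          refine wNorm_mono_norm fun x => ?_
          gcongr
          refine bracketWeight_mono_lam ha ?_ x
          rw [abs_of_pos (by positivity), abs_one]
          exact (div_le_one hc).2 hc1
      _ = _ := by
          rw [hD, ← mul_assoc, ← ENNReal.ofReal_mul (by positivity)]
          have e : ((2 : ℝ) ^ n) ^ ((d : ℝ) - 2) * (c₀ * C) * ((2 : ℝ) ^ n) ^ (-(d : ℝ)) =
              c₀ * (C * 2 ^ (-((n : ℝ) * 2))) := by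
            have : ((2 : ℝ) ^ n) ^ ((d : ℝ) - 2) * ((2 : ℝ) ^ n) ^ (-(d : ℝ)) =
                2 ^ (-((n : ℝ) * 2)) := by
              rw [← Real.rpow_add hc, ← Real.rpow_natCast, ← Real.rpow_mul two_pos.le]
              congr 1; ring
            rw [← this]; ring
          rw [e, ENNReal.ofReal_mul hc₀, ENNReal.ofReal_mul hC]
          ring
  have hpow : 0 ≤ ((2 : ℝ) ^ n) ^ ((d : ℝ) - 2) := by positivity
  refine ⟨?_, ?_⟩
  · have := key 1 (symbolKernel k γ τ (fun ξ => (dyadicCutoff χ φ (n + 1) ξ : ℂ))) zero_le_one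
      fun x => by
        rw [symbolKernel_dyadicCutoff_succ, norm_mul, Complex.norm_real, Real.norm_of_nonneg hpow,
          one_mul]
        gcongr
        exact (hb' _).1
    simpa using this
  · refine key |τ| _ (abs_nonneg _) fun x => ?_
    rw [symbolKernel_dyadicCutoff_succ, symbolKernel_dyadicCutoff_succ, ← mul_sub, norm_mul,
      Complex.norm_real, Real.norm_of_nonneg hpow, zero_div]
    gcongr
    refine (hb' _).2.trans ?_
    have := (bracketWeight_pos (-(a + d + 1)) 1 ((2 : ℝ) ^ n • x)).le
    gcongr

/-! ### The limiting operator on weighted Sobolev spaces -/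

/-- Convolution with `K` maps `L²(⟨x⟩^a)` to `L²(⟨x⟩^{-a})` with norm at most `c`. -/
def ConvBound (a : ℝ) (c : ℝ≥0∞) (K : Eu d → ℂ) : Prop :=
  ∀ f : Eu d → ℂ, AEStronglyMeasurable f volume → wNorm 2 a 1 f < ⊤ →
    wNorm 2 (-a) 1 (conv K f) ≤ c * wNorm 2 a 1 f

theorem ConvBound.mono {a : ℝ} {c c' : ℝ≥0∞} {K : Eu d → ℂ} (h : ConvBound a c K) (hc : c ≤ c') :
    ConvBound a c' K := fun f hf hfn => (h f hf hfn).trans (by gcongr)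

theorem convBound_of_wNorm_one {K : Eu d → ℂ} (hK : AEStronglyMeasurable K volume) {a : ℝ}
    (ha : 0 ≤ a) : ConvBound a (ENNReal.ofReal (Real.sqrt 2 ^ a) * wNorm 1 a 1 K) K := by
  intro f hf _
  have h := wNorm_conv_same_le hK hf one_le_two (-a) 1
  rw [abs_neg, abs_of_nonneg ha] at h
  refine h.trans ?_
  rw [mul_assoc]
  gcongr
  exact wNorm_mono_exp (by linarith) 1 f

theorem ofReal_two_rpow_mul_neg (x : ℝ) :
    ENNReal.ofReal (2 ^ x) * ENNReal.ofReal (2 ^ (-x)) = 1 := by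
  rw [← ENNReal.ofReal_mul (by positivity), ← Real.rpow_add two_pos]
  simp

theorem exists_uniform_of_eventually {P : ℕ → ℝ≥0∞ → Prop}
    (hmono : ∀ m c c', P m c → c ≤ c' → P m c') (hlow : ∀ m, ∃ c < ⊤, P m c) {n : ℕ}
    (hhigh : ∃ c < ⊤, ∀ m, n ≤ m → P m c) : ∃ c < ⊤, ∀ m, P m c := by
  choose c hc hP using hlow
  obtain ⟨C, hC, hPC⟩ := hhigh
  refine ⟨∑ m ∈ Finset.range n, c m + C,
    ENNReal.add_lt_top.2 ⟨ENNReal.sum_lt_top.2 fun m _ => hc m, hC⟩, fun m => ?_⟩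
  rcases lt_or_ge m n with h | h
  · exact hmono m _ _ (hP m) ((Finset.single_le_sum (f := c) (fun _ _ => zero_le)
      (Finset.mem_range.2 h)).trans le_self_add)
  · exact hmono m _ _ (hPC m h) le_add_self

theorem exists_radius_le (R : ℝ) : ∃ n₀ : ℕ, ∀ n, n₀ ≤ n → R ≤ 3 / 16 * 2 ^ n := by
  obtain ⟨n₀, h⟩ := pow_unbounded_of_one_lt (16 / 3 * R) one_lt_two
  refine ⟨n₀, fun n hn => ?_⟩
  have : (2 : ℝ) ^ n₀ ≤ 2 ^ n := pow_le_pow_right₀ one_le_two hn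
  linarith

section blocks

variable {χ φ : Eu d → ℝ} (hχφ : IsDyadicPair χ φ)
include hχφ

theorem limitKernel_dyadicCutoff_eq (hd : 2 ≤ d) {k : ℝ} (hk : 0 < k) (γ : Eu d) {l : Filter ℝ}
    (hl : l = 𝓝[>] 0 ∨ l = 𝓝[<] 0) {n : ℕ} (hR : faddeevRadius k γ ≤ 3 / 16 * 2 ^ n) :
    limitKernel l k γ (fun ξ => (dyadicCutoff χ φ (n + 1) ξ : ℂ)) =
      symbolKernel k γ 0 (fun ξ => (dyadicCutoff χ φ (n + 1) ξ : ℂ)) := by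
  refine limitKernel_eq_fourierInv hd hk γ hl (contDiff_dyadicCutoff_ofReal hχφ _)
    (hasCompactSupport_dyadicCutoff_ofReal hχφ _) (δ := 1 / 4) (by norm_num) fun ξ hξ => ?_
  refine le_trans ?_ (le_abs_self _)
  have h1 := le_norm_of_dyadicCutoff_ne_zero hχφ (n := n) (ξ := ξ) (by exact_mod_cast hξ)
  have h2 : (1 : ℝ) ≤ 2 ^ n := one_le_pow₀ one_le_two
  have h3 := faddeevRadius_nonneg k γ
  nlinarith

/-- Blocks with `2^n` much larger than `R` have kernels in weighted `L¹` with the gain `2^{-2n}`.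
The finitely many others use the resolvent bound, and for them the dyadic factor only changes the
constant. -/
theorem exists_convBound_symbolKernel (hd : 2 ≤ d) {R : ℝ} (hR : 0 < R) {a : ℝ} (ha : 1 / 2 < a) :
    ∃ C : ℝ≥0∞, C < ⊤ ∧ ∀ (m : ℕ) (k : ℝ) (γ : Eu d) (τ : ℝ), faddeevRadius k γ = R → τ ≠ 0 →
      |τ| ≤ 1 → ConvBound a (C * ENNReal.ofReal (2 ^ (-(((m : ℝ) - 1) * 2))))
        (symbolKernel k γ τ (fun ξ => (dyadicCutoff χ φ m ξ : ℂ))) := by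
  have ha0 : 0 ≤ a := by linarith
  obtain ⟨n₀, hn₀⟩ := exists_radius_le R
  obtain ⟨C, hC, hb⟩ := exists_wNorm_near_le hχφ ha0
  refine exists_uniform_of_eventually (P := fun m C => ∀ (k : ℝ) (γ : Eu d) (τ : ℝ),
    faddeevRadius k γ = R → τ ≠ 0 → |τ| ≤ 1 →
      ConvBound a (C * ENNReal.ofReal (2 ^ (-(((m : ℝ) - 1) * 2))))
        (symbolKernel k γ τ (fun ξ => (dyadicCutoff χ φ m ξ : ℂ))))
    (fun m c c' h hc k γ τ h1 h2 h3 => (h k γ τ h1 h2 h3).mono (by gcongr)) (fun m => ?_)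
    (n := n₀ + 1) ⟨ENNReal.ofReal (Real.sqrt 2 ^ a) * C, ENNReal.mul_lt_top (by simp) hC, ?_⟩
  · obtain ⟨C, hC, h⟩ := exists_wNorm_symbolKernel_le hd (contDiff_dyadicCutoff_ofReal hχφ m)
      (hasCompactSupport_dyadicCutoff_ofReal hχφ m) hR ha
    refine ⟨C * ENNReal.ofReal (2 ^ (((m : ℝ) - 1) * 2)), ENNReal.mul_lt_top hC (by simp),
      fun k γ τ h1 h2 h3 => ?_⟩
    rw [mul_assoc, ofReal_two_rpow_mul_neg, mul_one]
    exact (h k γ τ h1 h2 h3).2.2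
  · rintro m hm k γ τ h1 h2 h3
    obtain ⟨n, rfl⟩ : ∃ n, m = n + 1 := ⟨m - 1, by omega⟩
    refine (convBound_of_wNorm_one (contDiff_symbolKernel hd (contDiff_dyadicCutoff_ofReal hχφ _)
      (hasCompactSupport_dyadicCutoff_ofReal hχφ _) k γ h2).continuous.aestronglyMeasurable
        ha0).mono ?_
    rw [mul_assoc]
    gcongr
    have := (hb n k γ τ (h1 ▸ hn₀ n (by omega)) h3).1
    simpa using this

theorem exists_convBound_limitKernel (hd : 2 ≤ d) {R : ℝ} (hR : 0 < R) {a : ℝ} (ha : 1 / 2 < a) :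
    ∃ C : ℝ≥0∞, C < ⊤ ∧ ∀ (m : ℕ) (l : Filter ℝ) (_ : l = 𝓝[>] 0 ∨ l = 𝓝[<] 0) (k : ℝ) (_ : 0 < k)
      (γ : Eu d), faddeevRadius k γ = R →
      ConvBound a (C * ENNReal.ofReal (2 ^ (-(((m : ℝ) - 1) * 2))))
        (limitKernel l k γ (fun ξ => (dyadicCutoff χ φ m ξ : ℂ))) := by
  have ha0 : 0 ≤ a := by linarith
  obtain ⟨n₀, hn₀⟩ := exists_radius_le R
  obtain ⟨C, hC, hb⟩ := exists_wNorm_near_le hχφ ha0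
  refine exists_uniform_of_eventually (P := fun m C => ∀ (l : Filter ℝ)
    (_ : l = 𝓝[>] 0 ∨ l = 𝓝[<] 0) (k : ℝ) (_ : 0 < k) (γ : Eu d), faddeevRadius k γ = R →
      ConvBound a (C * ENNReal.ofReal (2 ^ (-(((m : ℝ) - 1) * 2))))
        (limitKernel l k γ (fun ξ => (dyadicCutoff χ φ m ξ : ℂ))))
    (fun m c c' h hc l h1 k h2 γ h3 => (h l h1 k h2 γ h3).mono (by gcongr)) (fun m => ?_)
    (n := n₀ + 1) ⟨ENNReal.ofReal (Real.sqrt 2 ^ a) * C, ENNReal.mul_lt_top (by simp) hC, ?_⟩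
  · obtain ⟨C, hC, h⟩ := exists_wNorm_limitKernel_le hd (contDiff_dyadicCutoff_ofReal hχφ m)
      (hasCompactSupport_dyadicCutoff_ofReal hχφ m) ha hR
    refine ⟨C * ENNReal.ofReal (2 ^ (((m : ℝ) - 1) * 2)), ENNReal.mul_lt_top hC (by simp),
      fun l h1 k h2 γ h3 => ?_⟩
    rw [mul_assoc, ofReal_two_rpow_mul_neg, mul_one]
    exact (h l h1 k h2 γ h3).2
  · rintro m hm l h1 k h2 γ h3
    obtain ⟨n, rfl⟩ : ∃ n, m = n + 1 := ⟨m - 1, by omega⟩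
    have hRn : faddeevRadius k γ ≤ 3 / 16 * 2 ^ n := h3 ▸ hn₀ n (by omega)
    refine (convBound_of_wNorm_one (aestronglyMeasurable_limitKernel hd h2 γ h1
      (contDiff_dyadicCutoff_ofReal hχφ _) (hasCompactSupport_dyadicCutoff_ofReal hχφ _))
        ha0).mono ?_
    rw [mul_assoc]
    gcongr
    rw [limitKernel_dyadicCutoff_eq hχφ hd h2 γ h1 hRn]
    have := (hb n k γ 0 hRn (by simp)).1
    simpa using this

/-- Only finitely many blocks meet the singularity, and they are handled one at a time; on all the
others the kernel difference is `O(|τ|)` with the gain `2^{-2n}`, uniformly in `n`. -/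
theorem eventually_convBound_sub (hd : 2 ≤ d) {k : ℝ} (hk : 0 < k) (γ : Eu d) {l : Filter ℝ}
    (hl : l = 𝓝[>] 0 ∨ l = 𝓝[<] 0) {a : ℝ} (ha : 1 / 2 < a) {ε : ℝ≥0∞} (hε : ε ≠ 0) :
    ∀ᶠ τ in l, ∀ m : ℕ, ConvBound a (ε * ENNReal.ofReal (2 ^ (-(((m : ℝ) - 1) * 2))))
      (fun z => symbolKernel k γ τ (fun ξ => (dyadicCutoff χ φ m ξ : ℂ)) z -
        limitKernel l k γ (fun ξ => (dyadicCutoff χ φ m ξ : ℂ)) z) := by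
  have ha0 : 0 ≤ a := by linarith
  obtain ⟨n₀, hn₀⟩ := exists_radius_le (faddeevRadius k γ)
  obtain ⟨C, hC, hb⟩ := exists_wNorm_near_le hχφ ha0
  have hlow : ∀ᶠ τ in l, ∀ m ∈ Finset.range (n₀ + 1),
      ConvBound a (ε * ENNReal.ofReal (2 ^ (-(((m : ℝ) - 1) * 2))))
      (fun z => symbolKernel k γ τ (fun ξ => (dyadicCutoff χ φ m ξ : ℂ)) z -
        limitKernel l k γ (fun ξ => (dyadicCutoff χ φ m ξ : ℂ)) z) := by
    rw [Filter.eventually_all_finset]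
    intro m _
    refine eventually_wNorm_conv_sub_le hd hk γ hl (contDiff_dyadicCutoff_ofReal hχφ m)
      (hasCompactSupport_dyadicCutoff_ofReal hχφ m) ha (mul_ne_zero hε ?_)
    exact (ENNReal.ofReal_pos.2 (by positivity)).ne'
  have hsmall : ∀ᶠ τ in l, ENNReal.ofReal (Real.sqrt 2 ^ a) * (ENNReal.ofReal |τ| * C) ≤ ε := by
    have h0 : Tendsto (fun τ : ℝ => ENNReal.ofReal (Real.sqrt 2 ^ a) * (ENNReal.ofReal |τ| * C))
        (𝓝 0) (𝓝 0) := by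
      have h1 : Tendsto (fun τ : ℝ => ENNReal.ofReal |τ|) (𝓝 0) (𝓝 0) := by
        have := (ENNReal.continuous_ofReal.comp continuous_abs).tendsto (0 : ℝ)
        simpa [Function.comp_def] using this
      have h2 := ENNReal.Tendsto.mul_const h1 (Or.inr hC.ne)
      have h3 := ENNReal.Tendsto.const_mul h2
        (Or.inr (ENNReal.ofReal_ne_top (r := Real.sqrt 2 ^ a)))
      simpa using h3
    exact ((tendsto_order.1 (h0.mono_left (le_nhds_of_side hl))).2 ε
      (pos_iff_ne_zero.2 hε)).mono fun τ h => h.le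
  filter_upwards [hlow, hsmall, eventually_small_of_side hl] with τ h1 h2 h3 m
  rcases lt_or_ge m (n₀ + 1) with h | h
  · exact h1 m (Finset.mem_range.2 h)
  · obtain ⟨n, rfl⟩ : ∃ n, m = n + 1 := ⟨m - 1, by omega⟩
    have hRn : faddeevRadius k γ ≤ 3 / 16 * 2 ^ n := hn₀ n (by omega)
    have hψ := contDiff_dyadicCutoff_ofReal hχφ (n + 1)
    have hs := hasCompactSupport_dyadicCutoff_ofReal hχφ (n + 1)
    refine (convBound_of_wNorm_one ((contDiff_symbolKernel hd hψ hs k γ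
      h3.1).continuous.aestronglyMeasurable.sub
        (aestronglyMeasurable_limitKernel hd hk γ hl hψ hs)) ha0).mono ?_
    have h4 := (hb n k γ τ hRn h3.2).2
    rw [← limitKernel_dyadicCutoff_eq hχφ hd hk γ hl hRn] at h4
    calc _ ≤ ENNReal.ofReal (Real.sqrt 2 ^ a) *
          (ENNReal.ofReal |τ| * C * ENNReal.ofReal (2 ^ (-((n : ℝ) * 2)))) := by
          gcongr
          exact h4
      _ ≤ ε * ENNReal.ofReal (2 ^ (-((n : ℝ) * 2))) := by
          rw [← mul_assoc]
          gcongr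
      _ = _ := by simp

omit hχφ in
theorem wNorm_sum_le {ι : Type*} {p : ℝ≥0∞} (hp : 1 ≤ p) (a lam : ℝ) (s : Finset ι)
    {g : ι → Eu d → ℂ} (hg : ∀ i, AEStronglyMeasurable (g i) volume) :
    wNorm p a lam (fun x => ∑ i ∈ s, g i x) ≤ ∑ i ∈ s, wNorm p a lam (g i) := by
  classical
  induction s using Finset.induction_on with
  | empty => simp [wNorm]
  | insert i s hi ih =>
    simp only [Finset.sum_insert hi]
    refine (wNorm_add_le hp a lam (hg i) (Finset.aestronglyMeasurable_fun_sum s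
      fun i _ => hg i)).trans ?_
    gcongr

omit hχφ in
theorem exists_blocks {r : ℝ} {p q : ℝ≥0∞} (hq : 1 ≤ q) {a lam : ℝ} {f : 𝓢'(Eu d, ℂ)}
    (h : besovNorm χ φ r p q a lam f < ⊤) : ∃ g : ℕ → Eu d → ℂ,
      ∀ i, IsRepresentedBy (dyadicBlock χ φ i f) (g i) ∧ wNorm p a lam (g i) < ⊤ := by
  choose g hg using fun i =>
    exists_isRepresentedBy_of_lt_top (weightedLpNorm_lt_top_of_besovNorm hq h i)
  exact ⟨g, hg⟩

omit hχφ in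
/-- Block-wise convolution operators gaining two derivatives. -/
theorem sobolevNorm_le_of_convBound {ρ s a : ℝ} (hs0 : 0 ≤ s) (hs2 : s ≤ 2)
    {u f : 𝓢'(Eu d, ℂ)} {g L : ℕ → Eu d → ℂ} {c : ℝ≥0∞}
    (hg : ∀ i, IsRepresentedBy (dyadicBlock χ φ i f) (g i) ∧ wNorm 2 a 1 (g i) < ⊤)
    (hu : ∀ m, IsRepresentedBy (dyadicBlock χ φ m u) (conv (L m) fun x => ∑ i ∈ nbr m, g i x))
    (hL : ∀ m : ℕ, ConvBound a (c * ENNReal.ofReal (2 ^ (-(((m : ℝ) - 1) * 2)))) (L m)) :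
    sobolevNorm χ φ (ρ + s) (-a) u ≤
      c * (ENNReal.ofReal (2 ^ |ρ|) * 16) * sobolevNorm χ φ ρ a f := by
  have h := besovNorm_le_of_blocks (χ := χ) (φ := φ) (ρ + s) s (p₁ := 2) (p₂ := 2) (q := 2)
    one_le_two (a₁ := -a) (a₂ := a) (lam := 1) (u := u) (f := f) (c * 4) fun m => by
      rw [(hu m).weightedLpNorm_eq]
      have hsum : ∑ i ∈ nbr m, weightedLpNorm 2 (bracketWeight a 1) (dyadicBlock χ φ i f) =
          ∑ i ∈ nbr m, wNorm 2 a 1 (g i) :=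
        Finset.sum_congr rfl fun i _ => (hg i).1.weightedLpNorm_eq _ _ _
      rw [hsum]
      have hle := wNorm_sum_le one_le_two a 1 (nbr m) (g := g) fun i => (hg i).1.1
      refine (hL m _ (Finset.aestronglyMeasurable_fun_sum _ fun i _ => (hg i).1.1)
        (hle.trans_lt (ENNReal.sum_lt_top.2 fun i _ => (hg i).2))).trans ?_
      -- A gain of two derivatives dominates a gain of `s ≤ 2`, except at the dyadic index `-1`,
      -- where the factor `4` compensates.
      have hpow : ENNReal.ofReal (2 ^ (-(((m : ℝ) - 1) * 2))) ≤
          4 * ENNReal.ofReal (2 ^ (-(((m : ℝ) - 1) * s))) := by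
        rw [show (4 : ℝ≥0∞) = ENNReal.ofReal (2 ^ (2 : ℝ)) by norm_num,
          ← ENNReal.ofReal_mul (by positivity), ← Real.rpow_add two_pos]
        refine ENNReal.ofReal_le_ofReal (Real.rpow_le_rpow_of_exponent_le one_le_two ?_)
        have : (0 : ℝ) ≤ m := m.cast_nonneg
        nlinarith
      calc _ ≤ c * (4 * ENNReal.ofReal (2 ^ (-(((m : ℝ) - 1) * s)))) *
            ∑ i ∈ nbr m, wNorm 2 a 1 (g i) := by gcongr
        _ = _ := by ring
  rw [add_sub_cancel_right] at h
  refine h.trans (le_of_eq ?_)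
  rw [sobolevNorm]
  ring

omit hχφ in
theorem KernelFamily.blockData {K : (Eu d → ℂ) → Eu d → ℂ} {Ψ b : Eu d → ℂ}
    (hK : KernelFamily K Ψ b) {a : ℝ} (ha : 1 / 2 < a) {f : 𝓢'(Eu d, ℂ)} {g : ℕ → Eu d → ℂ}
    (hg : ∀ i, IsRepresentedBy (dyadicBlock χ φ i f) (g i) ∧ wNorm 2 a 1 (g i) < ⊤) :
    BlockData χ φ K f g where
  rep i := (hg i).1
  tempered i := TemperedFun.of_wNorm one_le_two (lam := 1) (by simp) (hg i).1.1 (hg i).2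
  pair i ψ hψ hs := convPair_of_wNorm (s := 2) (p := 2) (r := ⊤) (a := a) (lam := 1)
    (hK.aestronglyMeasurable ψ hψ hs) (hg i).1.1 one_le_two one_le_two le_top
    (by simp [ENNReal.inv_two_add_inv_two]) (by linarith) (by simp) (hK.wNorm_lt_top ψ hψ hs a ha)
    (hg i).2

end blocks

theorem exists_lowCutoff (R : ℝ) : ∃ (Ψ : Eu d → ℂ) (N : ℕ), ContDiff ℝ ∞ Ψ ∧
    HasCompactSupport Ψ ∧ (∀ ξ, ‖ξ‖ ≤ R → Ψ ξ = 1) ∧ ∀ ξ, Ψ ξ ≠ 0 → ‖ξ‖ < 3 / 4 * 2 ^ N := by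
  let β : ContDiffBump (0 : Eu d) := ⟨|R| + 1, |R| + 2, by positivity, by linarith⟩
  obtain ⟨N, hN⟩ := pow_unbounded_of_one_lt (4 / 3 * (|R| + 2)) one_lt_two
  refine ⟨fun ξ => (β ξ : ℂ), N, Complex.ofRealCLM.contDiff.comp (β.contDiff (n := ⊤)),
    β.hasCompactSupport.comp_left (g := fun x : ℝ => (x : ℂ)) (by simp), fun ξ hξ => ?_,
    fun ξ hξ => ?_⟩
  · have : β ξ = 1 := β.one_of_mem_closedBall (by
      rw [mem_closedBall_zero_iff]
      exact hξ.trans ((le_abs_self R).trans (by simp [β])))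
    simp [this]
  · have h1 : β ξ ≠ 0 := fun h => hξ (by simp [h])
    have h2 : ξ ∈ Function.support β := h1
    rw [β.support_eq, mem_ball_zero_iff] at h2
    have h3 : ‖ξ‖ < |R| + 2 := h2
    linarith

theorem dyadicBlock_sub (χ φ : Eu d → ℝ) (m : ℕ) (u v : 𝓢'(Eu d, ℂ)) :
    dyadicBlock χ φ m (u - v) = dyadicBlock χ φ m u - dyadicBlock χ φ m v :=
  map_sub _ u v

theorem exists_nnreal_eq {c : ℝ≥0∞} (hc : c < ⊤) : ∃ M : ℝ≥0, (M : ℝ≥0∞) = c :=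
  ⟨c.toNNReal, ENNReal.coe_toNNReal hc.ne⟩

/-- The Faddeev operator, given on the union of the weighted Sobolev spaces by `faddeevFun`. -/
theorem exists_isFaddeevOperator (hd : 2 ≤ d) {χ φ : Eu d → ℝ} (hχφ : IsDyadicPair χ φ) {k : ℝ}
    (hk : 0 < k) (γ : Eu d) {l : Filter ℝ} (hl : l = 𝓝[>] 0 ∨ l = 𝓝[<] 0) {Ψ : Eu d → ℂ}
    (hΨ : ContDiff ℝ ∞ Ψ) (hΨs : HasCompactSupport Ψ)
    (hΨ1 : ∀ ξ : Eu d, ‖ξ‖ ≤ 2 * faddeevRadius k γ → Ψ ξ = 1) {N : ℕ}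
    (hN : ∀ ξ, Ψ ξ ≠ 0 → ‖ξ‖ < 3 / 4 * 2 ^ N) :
    ∃ H : 𝓢'(Eu d, ℂ) →ₗ.[ℂ] 𝓢'(Eu d, ℂ), IsFaddeevOperator χ φ l k γ H ∧
      ∀ f : H.domain, H f = faddeevFun χ φ (limitKernel l k γ) Ψ (highSymbol k γ 0 Ψ) N f := by
  have hR := faddeevRadius_pos hk γ
  have hK := kernelFamily_limitKernel hd hk γ hl hΨ hΨs hΨ1
  have hdat : ∀ f ∈ sobolevUnion χ φ, ∃ g : ℕ → Eu d → ℂ,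
      BlockData χ φ (limitKernel l k γ) f g := by
    rintro f ⟨ρ, a, ha, hf⟩
    obtain ⟨g, hg⟩ := exists_blocks one_le_two hf
    exact ⟨g, hK.blockData ha hg⟩
  refine ⟨linearOn (sobolevUnion χ φ)
    (faddeevFun χ φ (limitKernel l k γ) Ψ (highSymbol k γ 0 Ψ) N)
    (fun f hf g hg => ?_) (fun c f hf => ?_), ⟨fun f => Iff.rfl, ?_, ?_⟩, fun f => rfl⟩
  · obtain ⟨_, h⟩ := hdat f hf
    obtain ⟨_, h'⟩ := hdat g hg
    exact faddeevFun_add hK h h'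
  · obtain ⟨_, h⟩ := hdat f hf
    exact faddeevFun_smul hK h c
  · intro ρ s a hs0 hs2 ha
    obtain ⟨C, hC, hb⟩ := exists_convBound_limitKernel hχφ hd hR ha
    obtain ⟨M, hM⟩ := exists_nnreal_eq (c := C * (ENNReal.ofReal (2 ^ |ρ|) * 16))
      (ENNReal.mul_lt_top hC (ENNReal.mul_lt_top (by simp) (by simp)))
    refine ⟨M, fun f hf => ?_⟩
    obtain ⟨g, hg⟩ := exists_blocks one_le_two hf
    rw [hM]
    exact sobolevNorm_le_of_convBound hs0 hs2 hg
      (isRepresentedBy_dyadicBlock_faddeevFun hK hχφ hN (hK.blockData ha hg))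
      fun m => hb m l hl k hk γ rfl
  · intro ρ s a hs0 hs2 ha ε hε
    -- Passing from block bounds to Sobolev norms loses the factor `D`, so the blocks are made small
    -- to the order `ε / D`.
    obtain ⟨D, hD⟩ := exists_nnreal_eq (c := ENNReal.ofReal (2 ^ |ρ|) * 16)
      (ENNReal.mul_lt_top (by simp) (by simp))
    have hD0 : (D : ℝ≥0∞) ≠ 0 := by
      rw [hD]
      exact mul_ne_zero (ENNReal.ofReal_pos.2 (by positivity)).ne' (by simp)
    have hε' : (ε : ℝ≥0∞) / D ≠ 0 :=
      ENNReal.div_ne_zero.2 ⟨by exact_mod_cast hε.ne', ENNReal.coe_ne_top⟩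
    filter_upwards [eventually_convBound_sub hχφ hd hk γ hl ha hε', eventually_small_of_side hl]
      with τ hτ ⟨hτ0, hτ1⟩
    have hKτ := kernelFamily_symbolKernel hd hk γ hτ0 hτ1 hΨ hΨs hΨ1
    have hdatτ : ∀ f ∈ besovSpace χ φ ρ 2 2 one_le_two one_le_two a 1, ∃ g : ℕ → Eu d → ℂ,
        BlockData χ φ (symbolKernel k γ τ) f g := by
      intro f hf
      obtain ⟨g, hg⟩ := exists_blocks one_le_two hf
      exact ⟨g, hKτ.blockData ha hg⟩
    refine ⟨linearOn (besovSpace χ φ ρ 2 2 one_le_two one_le_two a 1)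
      (faddeevFun χ φ (symbolKernel k γ τ) Ψ (highSymbol k γ τ Ψ) N)
      (fun f hf g hg => ?_) (fun c f hf => ?_), ⟨fun f => Iff.rfl, ?_, ?_⟩, ?_⟩
    · obtain ⟨_, h⟩ := hdatτ f hf
      obtain ⟨_, h'⟩ := hdatτ g hg
      exact faddeevFun_add hKτ h h'
    · obtain ⟨_, h⟩ := hdatτ f hf
      exact faddeevFun_smul hKτ h c
    · obtain ⟨C, hC, hb⟩ := exists_convBound_symbolKernel hχφ hd hR ha
      obtain ⟨M, hM⟩ := exists_nnreal_eq (c := C * (ENNReal.ofReal (2 ^ |ρ|) * 16))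
        (ENNReal.mul_lt_top hC (ENNReal.mul_lt_top (by simp) (by simp)))
      refine ⟨M, fun f => ?_⟩
      obtain ⟨g, hg⟩ := exists_blocks one_le_two f.2
      rw [hM]
      exact sobolevNorm_le_of_convBound hs0 hs2 hg
        (isRepresentedBy_dyadicBlock_faddeevFun hKτ hχφ hN (hKτ.blockData ha hg))
        fun m => hb m k γ τ rfl hτ0 hτ1
    · intro g f hf
      have := isMultiplierValue_faddeevFun hd hχφ hk γ hτ0 hτ1 hΨ hΨs hΨ1 hN g
      rw [← hf] at this
      exact this
    · rintro ⟨f, hf⟩ ⟨f', hf'⟩ (rfl : f = f')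
      obtain ⟨g, hg⟩ := exists_blocks one_le_two hf
      have hgm : ∀ m, AEStronglyMeasurable (fun x => ∑ i ∈ nbr m, g i x) volume := fun m =>
        Finset.aestronglyMeasurable_fun_sum _ fun i _ => (hg i).1.1
      have hgn : ∀ m, wNorm 2 a 1 (fun x => ∑ i ∈ nbr m, g i x) < ⊤ := fun m =>
        (wNorm_sum_le one_le_two a 1 (nbr m) (g := g) fun i => (hg i).1.1).trans_lt
          (ENNReal.sum_lt_top.2 fun i _ => (hg i).2)
      have := sobolevNorm_le_of_convBound (χ := χ) (φ := φ) (ρ := ρ) hs0 hs2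
        (u := faddeevFun χ φ (symbolKernel k γ τ) Ψ (highSymbol k γ τ Ψ) N f -
          faddeevFun χ φ (limitKernel l k γ) Ψ (highSymbol k γ 0 Ψ) N f) hg
        (L := fun m z => symbolKernel k γ τ (fun ξ => (dyadicCutoff χ φ m ξ : ℂ)) z -
          limitKernel l k γ (fun ξ => (dyadicCutoff χ φ m ξ : ℂ)) z) (fun m => ?_) hτ
      · rw [← hD, ENNReal.div_mul_cancel hD0 ENNReal.coe_ne_top] at this
        exact this
      · rw [dyadicBlock_sub]
        have hψ := contDiff_dyadicCutoff_ofReal hχφ m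
        have hs := hasCompactSupport_dyadicCutoff_ofReal hχφ m
        refine ((isRepresentedBy_dyadicBlock_faddeevFun hKτ hχφ hN (hKτ.blockData ha hg) m).sub
          (isRepresentedBy_dyadicBlock_faddeevFun hK hχφ hN (hK.blockData ha hg) m)).congr
          (Eventually.of_forall fun x => ?_)
        exact (conv_sub_left_apply (integrable_conv_integrand (hKτ.aestronglyMeasurable _ hψ hs)
          (hgm m) (by linarith) (hKτ.wNorm_lt_top _ hψ hs a ha) (hgn m) x)
          (integrable_conv_integrand (hK.aestronglyMeasurable _ hψ hs)
          (hgm m) (by linarith) (hK.wNorm_lt_top _ hψ hs a ha) (hgn m) x)).symm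

/-! ### Uniform bounds for the localized limiting kernels -/

theorem bracketWeight_mul_lam_le {a c : ℝ} (ha : 0 ≤ a) (hc : 1 ≤ c) (lam : ℝ) (x : Eu d) :
    bracketWeight a (c * lam) x ≤ c ^ a * bracketWeight a lam x := by
  rw [bracketWeight, bracketWeight, ← Real.mul_rpow (by linarith) (Real.sqrt_nonneg _)]
  refine Real.rpow_le_rpow (Real.sqrt_nonneg _) ?_ ha
  rw [← Real.sqrt_sq (by linarith : (0 : ℝ) ≤ c), ← Real.sqrt_mul (sq_nonneg c),
    Real.sqrt_sq (by linarith : (0 : ℝ) ≤ c), mul_smul, norm_smul,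
    Real.norm_of_nonneg (by linarith)]
  refine Real.sqrt_le_sqrt ?_
  nlinarith [one_le_pow₀ hc (n := 2)]

/-- Enlarging the dilation parameter by `T` enlarges the bracket by at most `T`. Comparing the scale
`lam / R` with `1` in this way is what produces the powers `λ^{-η}` and `R^η`. -/
theorem bracketWeight_neg_le_mul {a T lam lam' : ℝ} (ha : 0 ≤ a) (hT : 1 ≤ T)
    (h : |lam'| ≤ T * |lam|) (x : Eu d) :
    bracketWeight (-a) lam x ≤ T ^ a * bracketWeight (-a) lam' x := by
  have h1 : bracketWeight a lam' x ≤ T ^ a * bracketWeight a lam x :=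
    (bracketWeight_mono_lam ha (by rwa [abs_mul, abs_of_nonneg (by linarith : 0 ≤ T)]) x).trans
      (bracketWeight_mul_lam_le ha hT lam x)
  rw [bracketWeight_neg_eq_inv, bracketWeight_neg_eq_inv]
  have p1 := bracketWeight_pos a lam x
  have p2 := bracketWeight_pos a lam' x
  rw [← div_eq_mul_inv, inv_eq_one_div, div_le_div_iff₀ p1 p2, one_mul]
  exact h1

theorem wNorm_neg_le_mul {s : ℝ≥0∞} {a T lam lam' : ℝ} (ha : 0 ≤ a) (hT : 1 ≤ T)
    (h : |lam'| ≤ T * |lam|) (F : Eu d → ℂ) :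
    wNorm s (-a) lam F ≤ ENNReal.ofReal (T ^ a) * wNorm s (-a) lam' F := by
  have hT0 : 0 ≤ T ^ a := Real.rpow_nonneg (by linarith) _
  have e : ENNReal.ofReal (T ^ a) = ‖((T ^ a : ℝ) : ℂ)‖ₑ := by
    rw [← ofReal_norm, Complex.norm_real, Real.norm_of_nonneg hT0]
  rw [e, ← wNorm_const_mul]
  refine wNorm_mono_norm fun x => ?_
  rw [norm_mul, Complex.norm_real, Real.norm_of_nonneg hT0, ← mul_assoc, mul_comm _ (T ^ a)]
  gcongr
  exact bracketWeight_neg_le_mul ha hT h x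

/-- Decay of order `d + 1` is enough for every `L^s` with `s ≥ 1`, and the decaying weight is at
most `1`, so the bound is uniform in `lam`. -/
theorem wNorm_le_of_decay {s : ℝ≥0∞} (hs1 : 1 ≤ s) :
    ∃ W : ℝ≥0∞, W < ⊤ ∧ ∀ (F : Eu d → ℂ) (C η lam : ℝ), 0 ≤ η →
      (∀ z, ‖F z‖ ≤ C * bracketWeight (-(d + 1)) 1 z) → wNorm s (-η) lam F ≤ ENNReal.ofReal C * W := by
  have hd0 : (0 : ℝ) ≤ d := d.cast_nonneg
  refine ⟨wNorm s 0 1 (fun z : Eu d => (bracketWeight (-(d + 1)) 1 z : ℂ)),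
    wNorm_bracketWeight_lt_top (zero_lt_one.trans_le hs1).ne' (by positivity) fun hs => ?_,
    fun F C η lam hη hF => (wNorm_le_of_norm_le hF s (-η) lam).trans ?_⟩
  · have : 1 ≤ s.toReal := by
      rw [← ENNReal.toReal_one]; exact ENNReal.toReal_mono hs hs1
    nlinarith
  · gcongr
    refine wNorm_mono_norm fun x => ?_
    gcongr
    rw [bracketWeight_zero]
    exact bracketWeight_le_one (by linarith) lam x

/-- The kernel contributes the power `d - 2` and the `L^s` norm the power `-d/s = α - d`; together
they give the gain `α - 2`. -/
theorem wNorm_limitKernel_comp_smul (hd : 2 ≤ d) {k : ℝ} (hk : 0 < k) (γ : Eu d) {l : Filter ℝ}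
    (hl : l = 𝓝[>] 0 ∨ l = 𝓝[<] 0) {ϕ : Eu d → ℂ} (hϕ : ContDiff ℝ ∞ ϕ) (hϕs : HasCompactSupport ϕ)
    {c : ℝ} (hc : 0 < c) {s : ℝ≥0∞} (hs : s ≠ ⊤) {α : ℝ} (hsd : d / s.toReal = d - α) (b lam : ℝ) :
    wNorm s b lam (limitKernel l k γ fun ξ => ϕ (c⁻¹ • ξ)) = ENNReal.ofReal (c ^ (α - 2)) *
      wNorm s b (lam / c) (limitKernel l (k / c) (c⁻¹ • γ) ϕ) := by
  have hc' : 0 < c⁻¹ := inv_pos.2 hc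
  have e : (limitKernel l k γ fun ξ => ϕ (c⁻¹ • ξ)) = fun x => ((c ^ ((d : ℝ) - 2) : ℝ) : ℂ) *
      limitKernel l (k / c) (c⁻¹ • γ) ϕ (c • x) := by
    ext x
    rw [limitKernel_smul hd hk γ hl (contDiff_comp_smul c⁻¹ hϕ) (hasCompactSupport_comp_smul hc' hϕs)
      hc x]
    simp only [smul_smul, inv_mul_cancel₀ hc.ne', one_smul]
    congr 1
    rw [Real.rpow_sub hc, Real.rpow_natCast]
    norm_cast
  rw [e, wNorm_const_mul, wNorm_comp_smul (limitKernel l (k / c) (c⁻¹ • γ) ϕ) hc hs, hsd,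
    ← mul_assoc, ← ofReal_norm, Complex.norm_real, Real.norm_of_nonneg (by positivity),
    ← ENNReal.ofReal_mul (by positivity), ← Real.rpow_add hc]
  congr 3
  ring

theorem exists_wNorm_limitKernel_near_le (hd : 2 ≤ d) {ϕ : Eu d → ℂ} (hϕ : ContDiff ℝ ∞ ϕ)
    (hs : HasCompactSupport ϕ) (hlow : ∀ ζ, ϕ ζ ≠ 0 → 3 / 4 ≤ ‖ζ‖) {s : ℝ≥0∞} (hs1 : 1 ≤ s)
    {η : ℝ} (hη : 0 ≤ η) :
    ∃ C : ℝ≥0∞, C < ⊤ ∧ ∀ (l : Filter ℝ) (_ : l = 𝓝[>] 0 ∨ l = 𝓝[<] 0) (k : ℝ) (_ : 0 < k)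
      (γ : Eu d), faddeevRadius k γ ≤ 3 / 16 → ∀ lam : ℝ,
        wNorm s (-η) lam (limitKernel l k γ ϕ) ≤ C := by
  obtain ⟨W, hW, hWb⟩ := wNorm_le_of_decay (d := d) hs1
  obtain ⟨C, hC, h⟩ := exists_norm_symbolKernel_near_le hϕ hs hlow (d + 1)
  refine ⟨ENNReal.ofReal C * W, ENNReal.mul_lt_top (by simp) hW, fun l hl k hk γ hR lam => ?_⟩
  rw [limitKernel_eq_fourierInv hd hk γ hl hϕ hs (δ := 1 / 4) (by norm_num) fun ξ hξ => ?_]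
  · exact hWb _ _ _ _ hη fun z => (h k γ 0 hR (by simp) z).1
  · refine le_trans ?_ (le_abs_self _)
    have h1 := hlow ξ hξ
    have h2 := faddeevRadius_nonneg k γ
    nlinarith

theorem exists_wNorm_limitKernel_far_le (hd : 2 ≤ d) {ϕ : Eu d → ℂ} (hϕ : ContDiff ℝ ∞ ϕ)
    (hs : HasCompactSupport ϕ) (hup : ∀ ζ, ϕ ζ ≠ 0 → ‖ζ‖ ≤ 8 / 3) {s : ℝ≥0∞} (hs1 : 1 ≤ s)
    {η : ℝ} (hη : 0 ≤ η) :
    ∃ C : ℝ≥0∞, C < ⊤ ∧ ∀ (l : Filter ℝ) (_ : l = 𝓝[>] 0 ∨ l = 𝓝[<] 0) (k : ℝ) (_ : 0 < k)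
      (γ : Eu d), 6 ≤ faddeevRadius k γ → ∀ lam : ℝ,
        wNorm s (-η) lam (limitKernel l k γ ϕ) ≤ C := by
  obtain ⟨W, hW, hWb⟩ := wNorm_le_of_decay (d := d) hs1
  obtain ⟨C, hC, h⟩ := exists_norm_symbolKernel_far_le hϕ hs hup (d + 1)
  refine ⟨ENNReal.ofReal C * W, ENNReal.mul_lt_top (by simp) hW, fun l hl k hk γ hR lam => ?_⟩
  rw [limitKernel_eq_fourierInv hd hk γ hl hϕ hs (δ := 1 / 4) (by norm_num) fun ξ hξ => ?_]
  · refine hWb _ _ _ _ hη fun z => (h k γ hR z).trans ?_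
    have h1 : faddeevRadius k γ ^ (-2 : ℝ) ≤ 1 :=
      Real.rpow_le_one_of_one_le_of_nonpos (by linarith) (by norm_num)
    exact mul_le_of_le_one_left (mul_nonneg hC (bracketWeight_pos _ _ _).le) h1
  · rw [abs_sub_comm]
    refine le_trans ?_ (le_abs_self _)
    have h1 := hup ξ hξ
    nlinarith [norm_nonneg ξ]

/-- Kernels localized to frequencies comparable to `r_{k,γ}`, in `L²`. -/
theorem exists_wNorm_two_limitKernel_dilate_le (hd : 2 ≤ d) {ϕ : Eu d → ℂ} (hϕ : ContDiff ℝ ∞ ϕ)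
    (hs : HasCompactSupport ϕ) {a : ℝ} (ha : 1 / 2 < a) :
    ∃ C : ℝ≥0∞, C < ⊤ ∧ ∀ (l : Filter ℝ) (_ : l = 𝓝[>] 0 ∨ l = 𝓝[<] 0) (k : ℝ) (_ : 0 < k)
      (γ : Eu d), faddeevRadius k γ = 1 → ∀ t : ℝ, 3 / 32 ≤ t → t ≤ 6 →
        wNorm 2 (-a) 1 (limitKernel l k γ fun ζ => ϕ (t • ζ)) ≤ C := by
  have ha0 : 0 ≤ a := by linarith
  obtain ⟨r, hr⟩ := hs.isCompact.isBounded.exists_norm_le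
  -- For `t ≥ 3/32` the support of `ϕ(t·)` lies in the ball of radius `32r/3`, where `Ψ = 1`. One
  -- kernel therefore serves all `t`, convolved with a Schwartz function depending on `t`.
  obtain ⟨Ψ, N, hΨ, hΨs, hΨ1, -⟩ := exists_lowCutoff (d := d) (32 / 3 * r)
  obtain ⟨C, hC, h⟩ := exists_wNorm_limitKernel_le hd hΨ hΨs ha one_pos
  obtain ⟨Θ, hΘ⟩ := exists_schwartz_eq hϕ hs
  have hG := schwartz_wNorm_lt_top (𝓕⁻ Θ : 𝓢(Eu d, ℂ)) 2 a
  set G : ℝ≥0∞ := wNorm 2 a 1 (𝓕⁻ Θ : 𝓢(Eu d, ℂ)) with hGdef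
  refine ⟨C * (ENNReal.ofReal ((32 / 3) ^ d) * (ENNReal.ofReal (6 ^ ((d : ℝ) / 2)) *
    (ENNReal.ofReal (6 ^ a) * G))), ?_, fun l hl k hk γ hR t ht0 ht1 => ?_⟩
  · exact ENNReal.mul_lt_top hC (ENNReal.mul_lt_top (by simp) (ENNReal.mul_lt_top (by simp)
      (ENNReal.mul_lt_top (by simp) hG)))
  have ht : 0 < t := by linarith
  obtain ⟨Θt, hΘt⟩ := exists_schwartz_eq (contDiff_comp_smul t hϕ) (hasCompactSupport_comp_smul ht hs)
  have e1 : (limitKernel l k γ fun ζ => ϕ (t • ζ)) =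
      conv (limitKernel l k γ Ψ) (𝓕⁻ Θt : 𝓢(Eu d, ℂ)) := by
    rw [conv_limitKernel_schwartz hd hk γ hl hΨ hΨs]
    congr 1
    ext ζ
    rw [FourierTransform.fourier_fourierInv_eq, hΘt]
    by_cases hζ : ϕ (t • ζ) = 0
    · simp [hζ]
    · have h1 := hr _ (subset_tsupport _ (Function.mem_support.2 hζ))
      rw [norm_smul, Real.norm_of_nonneg ht.le] at h1
      rw [hΨ1 ζ (by nlinarith [norm_nonneg ζ]), one_mul]
  have e2 : ((𝓕⁻ Θt : 𝓢(Eu d, ℂ)) : Eu d → ℂ) =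
      fun x => (((t⁻¹) ^ d : ℝ) : ℂ) * (𝓕⁻ Θ : 𝓢(Eu d, ℂ)) (t⁻¹ • x) := by
    ext x
    rw [SchwartzMap.fourierInv_coe, SchwartzMap.fourierInv_coe, hΘt, hΘ,
      fourierInv_smul (inv_pos.2 ht)]
    simp only [smul_smul, mul_inv_cancel₀ ht.ne', one_smul]
    push_cast
    rfl
  -- The amplitude is `t^{-d} ≤ (32/3)^d`, the `L²` scaling is `t^{d/2} ≤ 6^{d/2}`, and the weight
  -- at scale `t ≤ 6` costs `6^a`.
  have e3 : wNorm 2 a 1 (𝓕⁻ Θt : 𝓢(Eu d, ℂ)) ≤ ENNReal.ofReal ((32 / 3) ^ d) *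
      (ENNReal.ofReal (6 ^ ((d : ℝ) / 2)) * (ENNReal.ofReal (6 ^ a) * G)) := by
    rw [e2, wNorm_const_mul, wNorm_comp_smul _ (inv_pos.2 ht) (by simp), ← ofReal_norm,
      Complex.norm_real, Real.norm_of_nonneg (by positivity), ENNReal.toReal_ofNat,
      Real.rpow_neg (by positivity), ← Real.inv_rpow (by positivity), inv_inv, one_div, inv_inv]
    gcongr ENNReal.ofReal ?_ * (ENNReal.ofReal ?_ * ?_)
    · gcongr
      rw [inv_le_comm₀ ht (by norm_num)]
      linarith
    · gcongr
    · have e : ENNReal.ofReal ((6 : ℝ) ^ a) = ‖((6 ^ a : ℝ) : ℂ)‖ₑ := by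
        rw [← ofReal_norm, Complex.norm_real, Real.norm_of_nonneg (by positivity)]
      rw [e, hGdef, ← wNorm_const_mul]
      refine wNorm_mono_norm fun x => ?_
      rw [norm_mul, Complex.norm_real, Real.norm_of_nonneg (by positivity), ← mul_assoc,
        mul_comm _ ((6 : ℝ) ^ a)]
      gcongr
      refine (bracketWeight_mono_lam ha0 (l₂ := 6 * 1) ?_ x).trans
        (bracketWeight_mul_lam_le ha0 (by norm_num) 1 x)
      rw [abs_of_pos ht, abs_of_pos (by norm_num)]
      linarith
  rw [e1]
  refine ((h l hl k hk γ hR).2 _ (SchwartzMap.continuous _).aestronglyMeasurable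
    (schwartz_wNorm_lt_top _ _ _)).trans ?_
  gcongr

/-- The weighted `L²` space embeds into the weighted `L^s` space. -/
def ExponentEmbedding (d : ℕ) (s : ℝ≥0∞) (η : ℝ) : Prop :=
  ∃ a : ℝ, 1 / 2 < a ∧ ∃ A : ℝ≥0∞, A < ⊤ ∧ ∀ F : Eu d → ℂ, AEStronglyMeasurable F volume →
    wNorm s (-η) 1 F ≤ A * wNorm 2 (-a) 1 F

/-- Dilation by `R` normalizes the radius to `1`, where the `L²` bound holds for all dilates of the
cut-off at once. The weight at scale `lam / R` is then replaced by the one at scale `1`, and the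
embedding into `L^s` applies. -/
theorem exists_wNorm_limitKernel_mid_le (hd : 2 ≤ d) {ϕ : Eu d → ℂ} (hϕ : ContDiff ℝ ∞ ϕ)
    (hs : HasCompactSupport ϕ) {s : ℝ≥0∞} (hst : s ≠ ⊤) {α : ℝ} (hα : 0 ≤ α)
    (hsd : d / s.toReal = d - α) {η : ℝ} (hη : 0 ≤ η) (hemb : ExponentEmbedding d s η) :
    ∃ C : ℝ≥0∞, C < ⊤ ∧ ∀ (l : Filter ℝ) (_ : l = 𝓝[>] 0 ∨ l = 𝓝[<] 0) (k : ℝ) (_ : 0 < k)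
      (γ : Eu d), 3 / 32 ≤ faddeevRadius k γ → faddeevRadius k γ ≤ 6 → ∀ lam : ℝ, 0 < lam →
        wNorm s (-η) lam (limitKernel l k γ ϕ) ≤ C * ENNReal.ofReal (max 1 lam⁻¹ ^ η) := by
  obtain ⟨a, ha, A, hA, hAb⟩ := hemb
  obtain ⟨C, hC, h⟩ := exists_wNorm_two_limitKernel_dilate_le hd hϕ hs ha
  refine ⟨ENNReal.ofReal (6 ^ α * (32 / 3) ^ 2) * (ENNReal.ofReal (6 ^ η) * (A * C)),
    ENNReal.mul_lt_top (by simp) (ENNReal.mul_lt_top (by simp) (ENNReal.mul_lt_top hA hC)),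
    fun l hl k hk γ h1 h2 lam hlam => ?_⟩
  obtain ⟨R, hR⟩ : ∃ R, R = faddeevRadius k γ := ⟨_, rfl⟩
  rw [← hR] at h1 h2
  have hR0 : 0 < R := by linarith
  have hk' : 0 < k / R := div_pos hk hR0
  have hψ := contDiff_comp_smul R hϕ
  have hψs := hasCompactSupport_comp_smul hR0 hs
  have e := wNorm_limitKernel_comp_smul hd hk γ hl hψ hψs hR0 hst hsd (-η) lam
  simp only [smul_smul, mul_inv_cancel₀ hR0.ne', one_smul] at e
  have hrad : faddeevRadius (k / R) (R⁻¹ • γ) = 1 := by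
    rw [faddeevRadius_smul hR0, ← hR, div_self hR0.ne']
  have hT : (1 : ℝ) ≤ max 1 lam⁻¹ := le_max_left _ _
  -- Since `R ≤ 6`, the scale `lam / R` times `6 max(1, lam⁻¹)` is at least `1`.
  have h3 := wNorm_neg_le_mul (s := s) (T := 6 * max 1 lam⁻¹) (lam := lam / R) (lam' := 1) hη
    (by linarith) (by
      rw [abs_one, abs_of_pos (by positivity), mul_div_assoc', le_div_iff₀ hR0]
      have : lam⁻¹ * lam ≤ max 1 lam⁻¹ * lam := by gcongr; exact le_max_right _ _
      rw [inv_mul_cancel₀ hlam.ne'] at this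
      linarith) (limitKernel l (k / R) (R⁻¹ • γ) fun ζ => ϕ (R • ζ))
  have h4 := hAb _ (aestronglyMeasurable_limitKernel hd hk' (R⁻¹ • γ) hl hψ hψs)
  have h5 := h l hl (k / R) hk' (R⁻¹ • γ) hrad R h1 h2
  have h6 : R ^ (α - 2) ≤ 6 ^ α * (32 / 3) ^ 2 := by
    rw [sub_eq_add_neg, Real.rpow_add hR0]
    have h7 : R ^ (-2 : ℝ) = R⁻¹ ^ 2 := by
      rw [Real.rpow_neg hR0.le, inv_pow]
      norm_cast
    rw [h7]
    gcongr
    rw [inv_le_comm₀ hR0 (by norm_num)]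
    linarith
  rw [e]
  calc _ ≤ ENNReal.ofReal (6 ^ α * (32 / 3) ^ 2) *
        (ENNReal.ofReal ((6 * max 1 lam⁻¹) ^ η) * (A * C)) := by
        gcongr
        exact h3.trans (by gcongr; exact h4.trans (by gcongr))
    _ = _ := by
        rw [Real.mul_rpow (by norm_num) (by positivity),
          ENNReal.ofReal_mul (by positivity : (0 : ℝ) ≤ 6 ^ η)]
        ring

/-- Hölder's inequality with `1/s = 1/2 + (1/2 - α/d)`. The spare weight `⟨x⟩^{-(η-a)}` has to lie
in the Lebesgue space of exponent `(1/2 - α/d)⁻¹`, which holds when `η - a > d/2 - α`. An `a > 1/2`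
with this property exists precisely when `η > (d+1)/2 - α`; the condition `α < d/2` keeps the
complementary exponent finite. -/
theorem exponentEmbedding (hd : 2 ≤ d) {α η : ℝ} (hα0 : 0 ≤ α) (hα : α < (d : ℝ) / 2)
    (hη : ((d : ℝ) + 1) / 2 - α < η) :
    ExponentEmbedding d (ENNReal.ofReal (1 - α / d))⁻¹ η := by
  have hd0 : (0 : ℝ) < d := by positivity
  have h1 : α / d < 1 / 2 := by rw [div_lt_iff₀ hd0]; linarith
  have h2 : 0 ≤ α / d := by positivity
  obtain ⟨a, ha, hab⟩ : ∃ a : ℝ, 1 / 2 < a ∧ a < η - (d / 2 - α) :=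
    exists_between (by linarith)
  have : ENNReal.HolderTriple 2 (ENNReal.ofReal (1 / 2 - α / d))⁻¹
      (ENNReal.ofReal (1 - α / d))⁻¹ := ⟨by
    rw [inv_inv, inv_inv, show (2 : ℝ≥0∞)⁻¹ = ENNReal.ofReal (1 / 2) by
      rw [one_div, ENNReal.ofReal_inv_of_pos two_pos, ENNReal.ofReal_ofNat],
      ← ENNReal.ofReal_add (by norm_num) (by linarith)]
    congr 1; ring⟩
  refine ⟨a, ha, wNorm (ENNReal.ofReal (1 / 2 - α / d))⁻¹ 0 1
    (fun z : Eu d => (bracketWeight (-(η - a)) 1 z : ℂ)), ?_, fun F hF => ?_⟩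
  · refine wNorm_bracketWeight_lt_top (ENNReal.inv_ne_zero.2 ENNReal.ofReal_ne_top)
      (by linarith) fun _ => ?_
    rw [ENNReal.toReal_inv, ENNReal.toReal_ofReal (by linarith), sub_zero, ← div_eq_mul_inv,
      lt_div_iff₀ (by linarith)]
    have : (d : ℝ) * (1 / 2 - α / d) = d / 2 - α := by field_simp
    rw [this]
    linarith
  · have hw : AEStronglyMeasurable (fun z : Eu d => (bracketWeight (-(η - a)) 1 z : ℂ)) volume :=
      (Complex.continuous_ofReal.comp (continuous_bracketWeight _ _)).aestronglyMeasurable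
    have h3 := wNorm_holder (p := 2) (q := (ENNReal.ofReal (1 / 2 - α / d))⁻¹)
      (r := (ENNReal.ofReal (1 - α / d))⁻¹) (a := -a) (b := 0) (c := -a)
      (l₁ := 1) (l₂ := 1) (l₃ := 1) hF hw fun x => by rw [bracketWeight_zero, mul_one]
    rw [mul_comm]
    refine le_trans (wNorm_mono_norm fun x => ?_) h3
    rw [norm_mul, Complex.norm_real, Real.norm_of_nonneg (bracketWeight_pos _ _ _).le,
      show -η = -a + -(η - a) by ring, bracketWeight_add]
    exact le_of_eq (by ring)

/-! ### The low-frequency block for small radii -/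

theorem low_eq_dilate_add {χ φ : Eu d → ℝ} (h : IsDyadicPair χ φ) (ξ : Eu d) :
    χ ξ = χ ((2 : ℝ) • ξ) + φ ((2 : ℝ) • ξ) := by
  have h1 := h.sum_eq_one ξ
  have h2 := (hasSum_nat_add_iff' 1).2 (h.sum_eq_one ((2 : ℝ) • ξ))
  have e : ∀ n : ℕ, (2 : ℝ) ^ (-((n + 1 : ℕ) : ℝ)) • (2 : ℝ) • ξ = (2 : ℝ) ^ (-(n : ℝ)) • ξ :=
    fun n => by
      rw [smul_smul]
      congr 1
      nth_rewrite 2 [← Real.rpow_one 2]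
      rw [← Real.rpow_add two_pos]
      congr 1
      push_cast; ring
  simp only [e] at h2
  -- Without its first term, the series of the partition of unity at `2ξ` is the series at `ξ`.
  have h3 := h1.unique h2
  simp at h3
  linarith

/-- Scaling by `c = 1/2` contributes `2^{2-α}`, at most `4` since `α ≥ 0`, and doubles the radius.
-/
theorem wNorm_limitKernel_comp_two_smul_le (hd : 2 ≤ d) {k : ℝ} (hk : 0 < k) (γ : Eu d)
    {l : Filter ℝ} (hl : l = 𝓝[>] 0 ∨ l = 𝓝[<] 0) {ϕ : Eu d → ℂ} (hϕ : ContDiff ℝ ∞ ϕ)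
    (hϕs : HasCompactSupport ϕ) {s : ℝ≥0∞} (hs : s ≠ ⊤) {α : ℝ} (hα : 0 ≤ α)
    (hsd : d / s.toReal = d - α) (b lam : ℝ) :
    wNorm s b lam (limitKernel l k γ fun ξ => ϕ ((2 : ℝ) • ξ)) ≤ 4 *
      wNorm s b (lam / (1 / 2)) (limitKernel l (k / (1 / 2)) ((1 / 2 : ℝ)⁻¹ • γ) ϕ) := by
  obtain ⟨c, hc⟩ : ∃ c : ℝ, c = 1 / 2 := ⟨_, rfl⟩
  have hc0 : 0 < c := by rw [hc]; norm_num
  have hci : (2 : ℝ) = c⁻¹ := by rw [hc]; norm_num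
  rw [← hc, hci, wNorm_limitKernel_comp_smul hd hk γ hl hϕ hϕs hc0 hs hsd b lam]
  gcongr
  have h2 : c ^ (-2 : ℝ) = 4 := by
    rw [hc, Real.rpow_neg (by norm_num), Real.rpow_ofNat]; norm_num
  calc ENNReal.ofReal (c ^ (α - 2)) ≤ ENNReal.ofReal 4 := by
        rw [← h2]
        exact ENNReal.ofReal_le_ofReal (Real.rpow_le_rpow_of_exponent_ge hc0
          (by rw [hc]; norm_num) (by linarith))
    _ = 4 := ENNReal.ofReal_ofNat 4

theorem wNorm_limitKernel_low_step (hd : 2 ≤ d) {χ φ : Eu d → ℝ} (h : IsDyadicPair χ φ)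
    {s : ℝ≥0∞} (hs1 : 1 ≤ s) (hst : s ≠ ⊤) {α : ℝ} (hα : 0 ≤ α)
    (hsd : d / s.toReal = d - α) (η : ℝ) (l : Filter ℝ) (hl : l = 𝓝[>] 0 ∨ l = 𝓝[<] 0) {k : ℝ}
    (hk : 0 < k) (γ : Eu d) (lam : ℝ) :
    wNorm s (-η) lam (limitKernel l k γ fun ξ => (χ ξ : ℂ)) ≤
      4 * wNorm s (-η) (lam / (1 / 2)) (limitKernel l (k / (1 / 2)) ((1 / 2 : ℝ)⁻¹ • γ)
        fun ξ => (χ ξ : ℂ)) +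
      4 * wNorm s (-η) (lam / (1 / 2)) (limitKernel l (k / (1 / 2)) ((1 / 2 : ℝ)⁻¹ • γ)
        fun ξ => (φ ξ : ℂ)) := by
  have hχ := contDiff_dyadicCutoff_ofReal h 0
  have hχs := hasCompactSupport_dyadicCutoff_ofReal h 0
  have hφ := contDiff_dyadicCutoff_ofReal h 1
  have hφs := hasCompactSupport_dyadicCutoff_ofReal h 1
  have e1 : ∀ ζ, dyadicCutoff χ φ 1 ζ = φ ζ := fun ζ => by simp [dyadicCutoff]
  simp only [e1] at hφ hφs
  simp only [dyadicCutoff] at hχ hχs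
  have hχ2 := contDiff_comp_smul 2 hχ
  have hχs2 := hasCompactSupport_comp_smul two_pos hχs
  have hφ2 := contDiff_comp_smul 2 hφ
  have hφs2 := hasCompactSupport_comp_smul two_pos hφs
  have hsplit : (fun ξ => (χ ξ : ℂ)) =
      fun ξ => (χ ((2 : ℝ) • ξ) : ℂ) + (φ ((2 : ℝ) • ξ) : ℂ) := by
    ext ξ
    rw [low_eq_dilate_add h ξ]
    push_cast
    rfl
  have hadd : wNorm s (-η) lam (limitKernel l k γ fun ξ => (χ ξ : ℂ)) ≤
      wNorm s (-η) lam (limitKernel l k γ fun ξ => (χ ((2 : ℝ) • ξ) : ℂ)) +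
        wNorm s (-η) lam (limitKernel l k γ fun ξ => (φ ((2 : ℝ) • ξ) : ℂ)) := by
    rw [hsplit, limitKernel_add hd hk γ hl hχ2 hχs2 hφ2 hφs2]
    exact wNorm_add_le hs1 _ _ (aestronglyMeasurable_limitKernel hd hk γ hl hχ2 hχs2)
      (aestronglyMeasurable_limitKernel hd hk γ hl hφ2 hφs2)
  exact hadd.trans (add_le_add 
    (wNorm_limitKernel_comp_two_smul_le hd hk γ hl hχ hχs hst hα hsd _ lam)
    (wNorm_limitKernel_comp_two_smul_le hd hk γ hl hφ hφs hst hα hsd _ lam))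

/-- Each doubling of the radius costs a factor `4` and adds a non-singular annular kernel bounded by
`B`. About `log₂(1/R)` doublings reach a radius of order one, where the intermediate bound applies,
and `4` to that number is of order `R^{-2}`. -/
theorem exists_wNorm_limitKernel_low_le (hd : 2 ≤ d) {χ φ : Eu d → ℝ} (h : IsDyadicPair χ φ)
    {s : ℝ≥0∞} (hs1 : 1 ≤ s) (hst : s ≠ ⊤) {α : ℝ} (hα : 0 ≤ α)
    (hsd : d / s.toReal = d - α) {η : ℝ} (hη : 0 ≤ η) (hemb : ExponentEmbedding d s η) :
    ∃ C : ℝ≥0∞, C < ⊤ ∧ ∀ (l : Filter ℝ) (_ : l = 𝓝[>] 0 ∨ l = 𝓝[<] 0) (k : ℝ) (_ : 0 < k)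
      (γ : Eu d), faddeevRadius k γ ≤ 6 → ∀ lam : ℝ, 0 < lam →
        wNorm s (-η) lam (limitKernel l k γ fun ξ => (χ ξ : ℂ)) ≤
          C * ENNReal.ofReal (faddeevRadius k γ ^ (-2 : ℝ)) *
            ENNReal.ofReal (max 1 lam⁻¹ ^ η) := by
  have hχ := contDiff_dyadicCutoff_ofReal h 0
  have hχs := hasCompactSupport_dyadicCutoff_ofReal h 0
  have hφ := contDiff_dyadicCutoff_ofReal h 1
  have hφs := hasCompactSupport_dyadicCutoff_ofReal h 1
  have e1 : ∀ ζ, dyadicCutoff χ φ 1 ζ = φ ζ := fun ζ => by simp [dyadicCutoff]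
  simp only [e1] at hφ hφs
  simp only [dyadicCutoff] at hχ hχs
  obtain ⟨A, hA, hmid⟩ := exists_wNorm_limitKernel_mid_le hd hχ hχs hst hα hsd hη hemb
  obtain ⟨B, hB, hnear⟩ := exists_wNorm_limitKernel_near_le hd hφ hφs (fun ζ hζ => by
    have := le_norm_of_dyadicCutoff_ne_zero h (n := 0) (ξ := ζ)
      (by rw [zero_add, e1]; exact_mod_cast hζ)
    simpa using this) hs1 hη
  have hone : ∀ lam : ℝ, 1 ≤ ENNReal.ofReal (max 1 lam⁻¹ ^ η) := fun lam => by
    rw [← ENNReal.ofReal_one]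
    exact ENNReal.ofReal_le_ofReal (Real.one_le_rpow (le_max_left _ _) hη)
  -- Adding `2B` makes the recursion homogeneous: `4N + 4B + 2B ≤ 4(N + 2B)`. The factor `36 R^{-2}`
  -- is at least `1` for `R ≤ 6` and is reproduced by the step, because `4 · 36 (2R)^{-2} = 36
  -- R^{-2}`.
  have key : ∀ J : ℕ, ∀ (l : Filter ℝ) (_ : l = 𝓝[>] 0 ∨ l = 𝓝[<] 0) (k : ℝ) (_ : 0 < k)
      (γ : Eu d), faddeevRadius k γ ≤ 6 → 3 / 32 ≤ 2 ^ J * faddeevRadius k γ →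
      ∀ lam : ℝ, 0 < lam →
        wNorm s (-η) lam (limitKernel l k γ fun ξ => (χ ξ : ℂ)) + 2 * B ≤
          ENNReal.ofReal (36 * faddeevRadius k γ ^ (-2 : ℝ)) *
            (A * ENNReal.ofReal (max 1 lam⁻¹ ^ η) + 2 * B) := by
    intro J
    have hbase : ∀ (l : Filter ℝ) (_ : l = 𝓝[>] 0 ∨ l = 𝓝[<] 0) (k : ℝ) (_ : 0 < k)
        (γ : Eu d), faddeevRadius k γ ≤ 6 → 3 / 32 ≤ faddeevRadius k γ → ∀ lam : ℝ, 0 < lam →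
        wNorm s (-η) lam (limitKernel l k γ fun ξ => (χ ξ : ℂ)) + 2 * B ≤
          ENNReal.ofReal (36 * faddeevRadius k γ ^ (-2 : ℝ)) *
            (A * ENNReal.ofReal (max 1 lam⁻¹ ^ η) + 2 * B) := by
      intro l hl k hk γ h1 h2 lam hlam
      have hR := faddeevRadius_pos hk γ
      have h3 : 1 ≤ ENNReal.ofReal (36 * faddeevRadius k γ ^ (-2 : ℝ)) := by
        rw [← ENNReal.ofReal_one]
        refine ENNReal.ofReal_le_ofReal ?_
        rw [Real.rpow_neg hR.le, ← div_eq_mul_inv, le_div_iff₀ (by positivity), Real.rpow_ofNat]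
        nlinarith
      calc _ ≤ 1 * (A * ENNReal.ofReal (max 1 lam⁻¹ ^ η) + 2 * B) := by
            rw [one_mul]
            gcongr
            exact hmid l hl k hk γ h2 h1 lam hlam
        _ ≤ _ := by gcongr
    induction J with
    | zero =>
      intro l hl k hk γ h1 h2 lam hlam
      exact hbase l hl k hk γ h1 (by simpa using h2) lam hlam
    | succ J ih =>
      intro l hl k hk γ h1 h2 lam hlam
      rcases le_or_gt (3 / 32) (faddeevRadius k γ) with h3 | h3
      -- In the remaining case `R < 3/32` the doubled radius is below `3/16`, so the annular kernel
      -- in the recursion is non-singular.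
      · exact hbase l hl k hk γ h1 h3 lam hlam
      have hR := faddeevRadius_pos hk γ
      have hc : (0 : ℝ) < 1 / 2 := by norm_num
      have hk' : 0 < k / (1 / 2) := by positivity
      have hrad := faddeevRadius_smul hc k γ
      have hstep := wNorm_limitKernel_low_step hd h hs1 hst hα hsd η l hl hk γ lam
      have h4 := ih l hl (k / (1 / 2)) hk' ((1 / 2 : ℝ)⁻¹ • γ)
        (by rw [hrad]; linarith) (by rw [hrad]; rw [pow_succ] at h2; linarith) (lam / (1 / 2))
        (by positivity)
      have h5 := hnear l hl (k / (1 / 2)) hk' ((1 / 2 : ℝ)⁻¹ • γ) (by rw [hrad]; linarith)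
        (lam / (1 / 2))
      have h6 : ENNReal.ofReal (max 1 (lam / (1 / 2))⁻¹ ^ η) ≤
          ENNReal.ofReal (max 1 lam⁻¹ ^ η) := by
        refine ENNReal.ofReal_le_ofReal (Real.rpow_le_rpow (by positivity)
          (max_le_max le_rfl (inv_anti₀ hlam ?_)) hη)
        linarith
      have h7 : (4 : ℝ≥0∞) * ENNReal.ofReal (36 * (faddeevRadius k γ / (1 / 2)) ^ (-2 : ℝ)) =
          ENNReal.ofReal (36 * faddeevRadius k γ ^ (-2 : ℝ)) := by
        rw [show (4 : ℝ≥0∞) = ENNReal.ofReal 4 by simp, ← ENNReal.ofReal_mul (by norm_num),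
          Real.rpow_neg (by positivity), Real.rpow_neg hR.le, Real.rpow_ofNat, Real.rpow_ofNat]
        congr 1
        field_simp
        norm_num
      rw [hrad] at h4
      calc _ ≤ 4 * wNorm s (-η) (lam / (1 / 2)) (limitKernel l (k / (1 / 2)) ((1 / 2 : ℝ)⁻¹ • γ)
              fun ξ => (χ ξ : ℂ)) + 4 * B + 2 * B := by
            gcongr
            exact hstep.trans (by gcongr)
        _ ≤ 4 * (wNorm s (-η) (lam / (1 / 2)) (limitKernel l (k / (1 / 2)) ((1 / 2 : ℝ)⁻¹ • γ)
              fun ξ => (χ ξ : ℂ)) + 2 * B) := by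
            rw [add_assoc, mul_add, ← add_mul, ← mul_assoc]
            gcongr
            norm_num
        _ ≤ 4 * (ENNReal.ofReal (36 * (faddeevRadius k γ / (1 / 2)) ^ (-2 : ℝ)) *
              (A * ENNReal.ofReal (max 1 lam⁻¹ ^ η) + 2 * B)) := by
            gcongr
            exact h4.trans (by gcongr)
        _ = _ := by rw [← mul_assoc, h7]
  refine ⟨36 * (A + 2 * B), ENNReal.mul_lt_top (by simp) (ENNReal.add_lt_top.2
    ⟨hA, ENNReal.mul_lt_top (by simp) hB⟩), fun l hl k hk γ hR lam hlam => ?_⟩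
  have hR0 := faddeevRadius_pos hk γ
  obtain ⟨J, hJ⟩ := pow_unbounded_of_one_lt (3 / 32 / faddeevRadius k γ) one_lt_two
  rw [div_lt_iff₀ hR0] at hJ
  calc _ ≤ _ := le_self_add.trans (key J l hl k hk γ hR hJ.le lam hlam)
    _ ≤ ENNReal.ofReal (36 * faddeevRadius k γ ^ (-2 : ℝ)) *
          (A * ENNReal.ofReal (max 1 lam⁻¹ ^ η) + 2 * B * ENNReal.ofReal (max 1 lam⁻¹ ^ η)) := by
        gcongr ENNReal.ofReal _ * (_ + ?_)
        exact le_mul_of_one_le_right zero_le (hone lam)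
    _ = _ := by
        rw [ENNReal.ofReal_mul (by norm_num), ENNReal.ofReal_ofNat]
        ring

theorem one_le_max_rpow {R η : ℝ} (hR : 0 < R) (hη : 0 ≤ η) : 1 ≤ max (R ^ η) (R ^ (-2 : ℝ)) := by
  rcases le_total 1 R with h | h
  · exact le_max_of_le_left (Real.one_le_rpow h hη)
  · exact le_max_of_le_right (Real.one_le_rpow_of_pos_of_le_one_of_nonpos hR h (by norm_num))

/-- After scaling, the ratio `R / 2^n` is at most `3/16`, at least `6`, or in between. The two
extreme regimes are bounded uniformly, and `1 ≤ λ^{-η} max(R^η, R^{-2})`; the intermediate one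
produces `R^η`, and the block of `χ` produces `R^{-2}`. -/
theorem exists_wNorm_limitKernel_dyadic_le (hd : 2 ≤ d) {χ φ : Eu d → ℝ} (h : IsDyadicPair χ φ)
    {s : ℝ≥0∞} (hs1 : 1 ≤ s) (hst : s ≠ ⊤) {α : ℝ} (hα : 0 ≤ α)
    (hsd : d / s.toReal = d - α) {η : ℝ} (hη : 0 ≤ η) (hemb : ExponentEmbedding d s η) :
    ∃ C : ℝ≥0∞, C < ⊤ ∧ ∀ (l : Filter ℝ) (_ : l = 𝓝[>] 0 ∨ l = 𝓝[<] 0) (k : ℝ) (_ : 0 < k)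
      (γ : Eu d) (lam : ℝ), 0 < lam → lam < 1 → ∀ m : ℕ,
        wNorm s (-η) lam (limitKernel l k γ fun ξ => (dyadicCutoff χ φ m ξ : ℂ)) ≤
          C * ENNReal.ofReal (lam ^ (-η) *
            max (faddeevRadius k γ ^ η) (faddeevRadius k γ ^ (-2 : ℝ))) *
            ENNReal.ofReal (2 ^ (-(((m : ℝ) - 1) * (2 - α)))) := by
  have hχ := contDiff_dyadicCutoff_ofReal h 0
  have hχs := hasCompactSupport_dyadicCutoff_ofReal h 0
  have hφ := contDiff_dyadicCutoff_ofReal h 1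
  have hφs := hasCompactSupport_dyadicCutoff_ofReal h 1
  have e1 : ∀ ζ, dyadicCutoff χ φ 1 ζ = φ ζ := fun ζ => by simp [dyadicCutoff]
  have hup : ∀ ζ, (φ ζ : ℂ) ≠ 0 → ‖ζ‖ ≤ 8 / 3 := fun ζ hζ => by
    have := norm_le_of_dyadicCutoff_ne_zero h (m := 1) (ξ := ζ) (by rw [e1]; exact_mod_cast hζ)
    linarith
  have hlow : ∀ ζ, (φ ζ : ℂ) ≠ 0 → 3 / 4 ≤ ‖ζ‖ := fun ζ hζ => by
    have := le_norm_of_dyadicCutoff_ne_zero h (n := 0) (ξ := ζ)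
      (by rw [zero_add, e1]; exact_mod_cast hζ)
    simpa using this
  have hupχ : ∀ ζ, (χ ζ : ℂ) ≠ 0 → ‖ζ‖ ≤ 8 / 3 := fun ζ hζ => by
    have := norm_le_of_dyadicCutoff_ne_zero h (m := 0) (ξ := ζ)
      (by simp only [dyadicCutoff]; exact_mod_cast hζ)
    simp only [pow_zero] at this
    linarith
  simp only [e1] at hφ hφs
  simp only [dyadicCutoff] at hχ hχs
  obtain ⟨C₁, hC₁, h₁⟩ := exists_wNorm_limitKernel_near_le hd hφ hφs hlow hs1 hη
  obtain ⟨C₂, hC₂, h₂⟩ := exists_wNorm_limitKernel_mid_le hd hφ hφs hst hα hsd hη hemb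
  obtain ⟨C₃, hC₃, h₃⟩ := exists_wNorm_limitKernel_far_le hd hφ hφs hup hs1 hη
  obtain ⟨C₄, hC₄, h₄⟩ := exists_wNorm_limitKernel_far_le hd hχ hχs hupχ hs1 hη
  obtain ⟨C₅, hC₅, h₅⟩ := exists_wNorm_limitKernel_low_le hd h hs1 hst hα hsd hη hemb
  set C : ℝ≥0∞ := C₁ + C₂ * ENNReal.ofReal ((32 / 3) ^ η) + C₃ with hC
  -- The block of `χ` has dyadic index `-1`, so its target factor is `2^{2-α}`; the constant is
  -- divided by it in advance.
  set D : ℝ≥0∞ := (C₄ + C₅) * ENNReal.ofReal (2 ^ (α - 2)) with hD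
  refine ⟨C + D, ?_, fun l hl k hk γ lam hlam hlam1 m => ?_⟩
  · simp [hC, hD, ENNReal.add_lt_top, ENNReal.mul_lt_top, hC₁, hC₂, hC₃, hC₄, hC₅]
  have hR := faddeevRadius_pos hk γ
  have hmax := one_le_max_rpow hR hη
  have hlamη : 1 ≤ lam ^ (-η) :=
    Real.one_le_rpow_of_pos_of_le_one_of_nonpos hlam hlam1.le (by linarith)
  have hlam' : lam⁻¹ ^ η = lam ^ (-η) := by rw [Real.rpow_neg hlam.le, Real.inv_rpow hlam.le]
  obtain ⟨R, hRe⟩ : ∃ R, R = faddeevRadius k γ := ⟨_, rfl⟩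
  rw [← hRe] at hR hmax ⊢
  obtain ⟨G, hG⟩ : ∃ G, G = lam ^ (-η) * max (R ^ η) (R ^ (-2 : ℝ)) := ⟨_, rfl⟩
  rw [← hG]
  have hG1 : 1 ≤ ENNReal.ofReal G := by
    rw [← ENNReal.ofReal_one, hG]
    exact ENNReal.ofReal_le_ofReal (one_le_mul_of_one_le_of_one_le hlamη hmax)
  rcases m with _ | n
  · have hb : wNorm s (-η) lam (limitKernel l k γ fun ξ => (dyadicCutoff χ φ 0 ξ : ℂ)) ≤
        (C₄ + C₅) * ENNReal.ofReal G := by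
      simp only [dyadicCutoff]
      rcases le_total 6 R with h6 | h6
      · refine (h₄ l hl k hk γ (hRe ▸ h6) lam).trans ?_
        calc C₄ ≤ C₄ + C₅ := le_self_add
          _ ≤ _ := le_mul_of_one_le_right zero_le hG1
      · refine (h₅ l hl k hk γ (hRe ▸ h6) lam hlam).trans ?_
        rw [← hRe, mul_assoc, ← ENNReal.ofReal_mul (by positivity),
          max_eq_right ((one_le_inv₀ hlam).2 hlam1.le), hlam', mul_comm (R ^ (-2 : ℝ)), hG]
        gcongr
        · exact le_add_self
        · exact le_max_right _ _
    refine hb.trans ?_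
    have h2 : ENNReal.ofReal (2 ^ (α - 2)) *
        ENNReal.ofReal (2 ^ (-((((0 : ℕ) : ℝ) - 1) * (2 - α)))) = 1 := by
      rw [← ofReal_two_rpow_mul_neg (α - 2)]
      congr 3
      push_cast; ring
    calc (C₄ + C₅) * ENNReal.ofReal G = D * ENNReal.ofReal G *
          ENNReal.ofReal (2 ^ (-((((0 : ℕ) : ℝ) - 1) * (2 - α)))) := by
          rw [hD, mul_right_comm, mul_assoc _ _ (ENNReal.ofReal (2 ^ (-_))), mul_right_comm, h2,
            mul_one]
      _ ≤ _ := by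
          gcongr
          exact le_add_self
  · have hc : (0 : ℝ) < 2 ^ n := by positivity
    have hc1 : (1 : ℝ) ≤ 2 ^ n := one_le_pow₀ one_le_two
    have e2 : (fun ξ => (dyadicCutoff χ φ (n + 1) ξ : ℂ)) =
        fun ξ => (φ (((2 : ℝ) ^ n)⁻¹ • ξ) : ℂ) := by
      ext ξ
      simp only [dyadicCutoff]
      rw [Real.rpow_neg two_pos.le, Real.rpow_natCast]
    rw [e2, wNorm_limitKernel_comp_smul hd hk γ hl hφ hφs hc hst hsd (-η) lam]
    have e3 : ((2 : ℝ) ^ n) ^ (α - 2) = 2 ^ (-((((n + 1 : ℕ) : ℝ) - 1) * (2 - α))) := by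
      rw [← Real.rpow_natCast, ← Real.rpow_mul two_pos.le]
      congr 1
      push_cast; ring
    rw [e3, mul_comm]
    gcongr
    have hk' : 0 < k / 2 ^ n := by positivity
    have hrad : faddeevRadius (k / 2 ^ n) (((2 : ℝ) ^ n)⁻¹ • γ) = R / 2 ^ n := by
      rw [faddeevRadius_smul hc, hRe]
    have hCle : C ≤ C + D := le_self_add
    rcases le_total (R / 2 ^ n) (3 / 16) with hn | hn
    · refine (h₁ l hl _ hk' _ (hrad ▸ hn) _).trans ?_
      calc C₁ ≤ C := by rw [hC, add_assoc]; exact le_self_add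
        _ ≤ C + D := hCle
        _ ≤ _ := le_mul_of_one_le_right zero_le hG1
    rcases le_total 6 (R / 2 ^ n) with hf | hf
    · refine (h₃ l hl _ hk' _ (hrad ▸ hf) _).trans ?_
      calc C₃ ≤ C := le_add_self
        _ ≤ C + D := hCle
        _ ≤ _ := le_mul_of_one_le_right zero_le hG1
    · refine (h₂ l hl _ hk' (((2 : ℝ) ^ n)⁻¹ • γ) (by rw [hrad]; linarith) (by rw [hrad]; exact hf)
        (lam / 2 ^ n) (by positivity)).trans ?_
      -- In this regime `2^n ≤ (16/3) R`, so the cost `(2^n/λ)^η` of changing the weight is at most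
      -- a multiple of `(R/λ)^η`.
      have h7 : max 1 (lam / 2 ^ n)⁻¹ ^ η ≤ (32 / 3) ^ η * G := by
        rw [inv_div, max_eq_right ((one_le_div hlam).2 (hlam1.le.trans hc1))]
        rw [le_div_iff₀ hc] at hn
        calc (2 ^ n / lam) ^ η ≤ (32 / 3 * (lam⁻¹ * R)) ^ η := by
              refine Real.rpow_le_rpow (by positivity) ?_ hη
              rw [div_eq_mul_inv, mul_comm, mul_left_comm]
              gcongr
              linarith
          _ = (32 / 3) ^ η * (lam ^ (-η) * R ^ η) := by
              rw [Real.mul_rpow (by norm_num) (by positivity), Real.mul_rpow (by positivity) hR.le,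
                hlam']
          _ ≤ _ := by
              rw [hG]
              gcongr
              exact le_max_left _ _
      calc _ ≤ C₂ * (ENNReal.ofReal ((32 / 3) ^ η) * ENNReal.ofReal G) := by
            rw [← ENNReal.ofReal_mul (by positivity)]
            gcongr
        _ ≤ C * ENNReal.ofReal G := by
            rw [← mul_assoc]
            gcongr
            rw [hC, add_right_comm]
            exact le_add_self
        _ ≤ _ := by gcongr

/-! ### Extension to weighted Besov spaces -/

theorem young_exponents {x : ℝ} {p₁ p₂ : ℝ≥0∞} (hp₁ : 1 ≤ p₁) (hp₂ : 1 ≤ p₂)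
    (hp : (p₂⁻¹).toReal - (p₁⁻¹).toReal = x) (hx : x ≤ 1) :
    ((ENNReal.ofReal (1 - x))⁻¹)⁻¹ + p₂⁻¹ = 1 + p₁⁻¹ := by
  have h1 : p₁⁻¹ ≠ ⊤ := ENNReal.inv_ne_top.2 (zero_lt_one.trans_le hp₁).ne'
  have h2 : p₂⁻¹ ≠ ⊤ := ENNReal.inv_ne_top.2 (zero_lt_one.trans_le hp₂).ne'
  rw [inv_inv, ← ENNReal.ofReal_toReal h1, ← ENNReal.ofReal_toReal h2,
    ← ENNReal.ofReal_add (by linarith) ENNReal.toReal_nonneg, ← ENNReal.ofReal_one,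
    ← ENNReal.ofReal_add zero_le_one ENNReal.toReal_nonneg]
  congr 1
  linarith

/-- Only finiteness for a fixed `lam` is needed here, to make the convolutions with all kernels of
the family meaningful; the quantitative bounds enter separately. -/
theorem ExponentEmbedding.wNorm_lt_top {K : (Eu d → ℂ) → Eu d → ℂ} {Ψ b : Eu d → ℂ}
    (hK : KernelFamily K Ψ b) {s : ℝ≥0∞} {η : ℝ} (hη : 0 ≤ η) (h : ExponentEmbedding d s η)
    {lam : ℝ} (hlam : 0 < lam) {ψ : Eu d → ℂ} (hψ : ContDiff ℝ ∞ ψ) (hs : HasCompactSupport ψ) :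
    wNorm s (-η) lam (K ψ) < ⊤ := by
  obtain ⟨a, ha, A, hA, hb⟩ := h
  refine (wNorm_neg_le_mul (lam' := 1) hη (le_max_left 1 lam⁻¹) ?_ _).trans_lt
    (ENNReal.mul_lt_top (by simp) ((hb _ (hK.aestronglyMeasurable ψ hψ hs)).trans_lt
      (ENNReal.mul_lt_top hA (hK.wNorm_lt_top ψ hψ hs a ha))))
  rw [abs_one, abs_of_pos hlam]
  have : lam⁻¹ * lam ≤ max 1 lam⁻¹ * lam := by gcongr; exact le_max_right _ _
  rwa [inv_mul_cancel₀ hlam.ne'] at this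

/-- The dual form of the weighted Young inequality bounds every block of the image by the kernel
norm times the neighbouring blocks of `f`; the gain `2^{-nσ}` becomes the difference in regularity.
Linearity holds because the blocks of any element of the space can be convolved with all the
kernels. -/
theorem exists_besov_extension {χ φ : Eu d → ℝ} (hχφ : IsDyadicPair χ φ)
    {K : (Eu d → ℂ) → Eu d → ℂ} {Ψ b : Eu d → ℂ} (hK : KernelFamily K Ψ b) {N : ℕ}
    (hN : ∀ ξ, Ψ ξ ≠ 0 → ‖ξ‖ < 3 / 4 * 2 ^ N) {s p₁ p₂ q : ℝ≥0∞} (hs1 : 1 ≤ s) (hp₁ : 1 ≤ p₁)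
    (hp₂ : 1 ≤ p₂) (hq : 1 ≤ q) (hspr : s⁻¹ + p₂⁻¹ = 1 + p₁⁻¹) (r σ : ℝ) {η : ℝ} (hη : 0 ≤ η)
    (hemb : ExponentEmbedding d s η) {lam : ℝ} (hlam : 0 < lam) (hlam1 : lam < 1) {c : ℝ≥0∞}
    (hc : ∀ m : ℕ, wNorm s (-η) lam (K fun ξ => (dyadicCutoff χ φ m ξ : ℂ)) ≤
      c * ENNReal.ofReal (2 ^ (-(((m : ℝ) - 1) * σ)))) :
    ∃ T : 𝓢'(Eu d, ℂ) →ₗ.[ℂ] 𝓢'(Eu d, ℂ),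
      (∀ f, f ∈ T.domain ↔ besovNorm χ φ (r - σ) p₂ q η lam f < ⊤) ∧
      (∀ f : T.domain, T f = faddeevFun χ φ K Ψ b N f) ∧
      ∀ f : T.domain, besovNorm χ φ r p₁ q (-η) lam (T f) ≤
        ENNReal.ofReal (Real.sqrt 2 ^ η) * c * ENNReal.ofReal (2 ^ |r - σ|) * 4 *
          besovNorm χ φ (r - σ) p₂ q η lam (f : 𝓢'(Eu d, ℂ)) := by
  have hlam' : |lam| ≤ 1 := by rw [abs_of_pos hlam]; exact hlam1.le
  have hblock : ∀ {f : 𝓢'(Eu d, ℂ)} {g : ℕ → Eu d → ℂ},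
      (∀ i, IsRepresentedBy (dyadicBlock χ φ i f) (g i) ∧ wNorm p₂ η lam (g i) < ⊤) →
        BlockData χ φ K f g := fun hg =>
    { rep := fun i => (hg i).1
      tempered := fun i => TemperedFun.of_wNorm hp₂ hlam' (hg i).1.1 (hg i).2
      pair := fun i ψ hψ hψs => convPair_of_wNorm (hK.aestronglyMeasurable ψ hψ hψs) (hg i).1.1
        hs1 hp₂ hp₁ hspr hη hlam' (hemb.wNorm_lt_top hK hη hlam hψ hψs) (hg i).2 }
  have hdat : ∀ f ∈ besovSpace χ φ (r - σ) p₂ q hp₂ hq η lam, ∃ g : ℕ → Eu d → ℂ,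
      BlockData χ φ K f g := by
    intro f hf
    obtain ⟨g, hg⟩ := exists_blocks hq hf
    exact ⟨g, hblock hg⟩
  refine ⟨linearOn (besovSpace χ φ (r - σ) p₂ q hp₂ hq η lam) (faddeevFun χ φ K Ψ b N)
    (fun f hf g hg => ?_) (fun c f hf => ?_), fun f => Iff.rfl, fun f => rfl, fun f => ?_⟩
  · obtain ⟨_, h⟩ := hdat f hf
    obtain ⟨_, h'⟩ := hdat g hg
    exact faddeevFun_add hK h h'
  · obtain ⟨_, h⟩ := hdat f hf
    exact faddeevFun_smul hK h c
  · obtain ⟨g, hg⟩ := exists_blocks hq f.2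
    refine besovNorm_le_of_blocks r σ hq _ fun m => ?_
    have hrep := isRepresentedBy_dyadicBlock_faddeevFun hK hχφ hN (hblock hg) m
    refine (le_of_eq (hrep.weightedLpNorm_eq p₁ (-η) lam)).trans ?_
    have hsum : ∑ i ∈ nbr m, weightedLpNorm p₂ (bracketWeight η lam) (dyadicBlock χ φ i f) =
        ∑ i ∈ nbr m, wNorm p₂ η lam (g i) :=
      Finset.sum_congr rfl fun i _ => (hg i).1.weightedLpNorm_eq _ _ _
    rw [hsum]
    calc _ ≤ _ := wNorm_conv_dual_le (hK.aestronglyMeasurable _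
          (contDiff_dyadicCutoff_ofReal hχφ m) (hasCompactSupport_dyadicCutoff_ofReal hχφ m))
          (Finset.aestronglyMeasurable_fun_sum _ fun i _ => (hg i).1.1) hs1 hp₂ hspr hη lam
      _ ≤ ENNReal.ofReal (Real.sqrt 2 ^ η) * ((c * ENNReal.ofReal (2 ^ (-(((m : ℝ) - 1) * σ)))) *
          ∑ i ∈ nbr m, wNorm p₂ η lam (g i)) := by
        gcongr
        · exact hc m
        · exact wNorm_sum_le hp₂ η lam (nbr m) (g := g) fun i => (hg i).1.1
      _ = _ := by ring

end Faddeev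

end

/-! ### Assembly of the theorem -/

theorem theorem4p2 (d : ℕ) (hd : 2 ≤ d)
    (χ φ : EuclideanSpace ℝ (Fin d) → ℝ) (hχφ : IsDyadicPair χ φ)
    (α r η : ℝ) (p₁ p₂ q : ℝ≥0∞)
    (hα₀ : 0 ≤ α) (hα : α < (d : ℝ) / 2)
    (hp₁ : 1 ≤ p₁) (hp₂ : 1 ≤ p₂) (hq : 1 ≤ q)
    (hp : (p₂⁻¹).toReal - (p₁⁻¹).toReal = α / d)
    (hη : ((d : ℝ) + 1) / 2 - α < η) :
    ∃ C : ℝ, 0 < C ∧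
      ∀ l : Filter ℝ, (l = 𝓝[>] 0 ∨ l = 𝓝[<] 0) →
      ∀ k : ℝ, 0 < k → ∀ γ : EuclideanSpace ℝ (Fin d),
      ∃ H : 𝓢'(EuclideanSpace ℝ (Fin d), ℂ) →ₗ.[ℂ] 𝓢'(EuclideanSpace ℝ (Fin d), ℂ),
        IsFaddeevOperator χ φ l k γ H ∧
        ∀ lam : ℝ, 0 < lam → lam < 1 →
        ∃ T : 𝓢'(EuclideanSpace ℝ (Fin d), ℂ) →ₗ.[ℂ] 𝓢'(EuclideanSpace ℝ (Fin d), ℂ),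
          (∀ f, f ∈ T.domain ↔ besovNorm χ φ (r - 2 + α) p₂ q η lam f < (⊤ : ℝ≥0∞)) ∧
          (∀ (f : T.domain) (f' : H.domain),
            (f : 𝓢'(EuclideanSpace ℝ (Fin d), ℂ)) = (f' : 𝓢'(EuclideanSpace ℝ (Fin d), ℂ)) →
              T f = H f') ∧
          ∀ f : T.domain,
            besovNorm χ φ r p₁ q (-η) lam (T f) ≤
              ENNReal.ofReal (C * (lam ^ (-η) *
                max (faddeevRadius k γ ^ η) (faddeevRadius k γ ^ (-2 : ℝ)))) *
              besovNorm χ φ (r - 2 + α) p₂ q η lam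
                (f : 𝓢'(EuclideanSpace ℝ (Fin d), ℂ)) := by
  have hd0 : (0 : ℝ) < d := by positivity
  have hη0 : 0 ≤ η := by linarith
  have h1 : α / d < 1 / 2 := by rw [div_lt_iff₀ hd0]; linarith
  have h2 : 0 ≤ α / d := by positivity
  have hemb := Faddeev.exponentEmbedding hd hα₀ hα hη
  have hspr := Faddeev.young_exponents hp₁ hp₂ hp (by linarith)
  have hsd : d / ((ENNReal.ofReal (1 - α / d))⁻¹).toReal = d - α := by
    rw [ENNReal.toReal_inv, ENNReal.toReal_ofReal (by linarith)]
    field_simp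
  have hs1 : 1 ≤ (ENNReal.ofReal (1 - α / d))⁻¹ := by
    rw [ENNReal.one_le_inv, ← ENNReal.ofReal_one]
    exact ENNReal.ofReal_le_ofReal (by linarith)
  have hst : (ENNReal.ofReal (1 - α / d))⁻¹ ≠ ⊤ :=
    ENNReal.inv_ne_top.2 (ENNReal.ofReal_pos.2 (by linarith)).ne'
  obtain ⟨s, hs⟩ : ∃ s, s = (ENNReal.ofReal (1 - α / d))⁻¹ := ⟨_, rfl⟩
  rw [← hs] at hemb hspr hsd hs1 hst
  obtain ⟨C, hC, hb⟩ := Faddeev.exists_wNorm_limitKernel_dyadic_le hd hχφ hs1 hst hα₀ hsd hη0 hemb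
  obtain ⟨D, hD⟩ : ∃ D : ℝ≥0∞,
      D = ENNReal.ofReal (Real.sqrt 2 ^ η) * C * ENNReal.ofReal (2 ^ |r - (2 - α)|) * 4 := ⟨_, rfl⟩
  have hDt : D ≠ ⊤ := by
    rw [hD]
    exact (ENNReal.mul_lt_top (ENNReal.mul_lt_top (ENNReal.mul_lt_top (by simp) hC) (by simp))
      (by simp)).ne
  -- The summand `1` only ensures that the constant is positive.
  refine ⟨D.toReal + 1, by positivity, fun l hl k hk γ => ?_⟩
  obtain ⟨Ψ, N, hΨ, hΨs, hΨ1, hN⟩ := Faddeev.exists_lowCutoff (d := d) (2 * faddeevRadius k γ)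
  obtain ⟨H, hH, hHf⟩ := Faddeev.exists_isFaddeevOperator hd hχφ hk γ hl hΨ hΨs hΨ1 hN
  refine ⟨H, hH, fun lam hlam hlam1 => ?_⟩
  obtain ⟨T, hT, hTf, hTb⟩ := Faddeev.exists_besov_extension hχφ
    (Faddeev.kernelFamily_limitKernel hd hk γ hl hΨ hΨs hΨ1) hN hs1 hp₁ hp₂ hq hspr r (2 - α) hη0
    hemb hlam hlam1 (hb l hl k hk γ lam hlam hlam1)
  have hr : r - 2 + α = r - (2 - α) := by ring
  rw [hr]
  refine ⟨T, hT, fun f f' hff' => ?_, fun f => (hTb f).trans ?_⟩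
  -- Both operators are restrictions of `faddeevFun` with the same cut-off `Ψ` and the same `N`.
  · rw [hTf, hHf, hff']
  · gcongr ?_ * _
    have hDle : D ≤ ENNReal.ofReal (D.toReal + 1) := by
      rw [← ENNReal.ofReal_toReal hDt, ENNReal.toReal_ofReal ENNReal.toReal_nonneg]
      exact ENNReal.ofReal_le_ofReal (by linarith)
    refine le_trans (le_of_eq ?_) ((mul_le_mul' hDle le_rfl).trans
      (ENNReal.ofReal_mul (by positivity)).ge)
    rw [hD]
    ring
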